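/- **Theorem 2.1.** Let $\mathcal C\subset\mathbb C$ be a finite disjoint union of oriented piecewise $C^1$ curves without self-intersections, possibly extending to infinity. Let $S$ be an open set in a real normed space (the parameters), and let $\vec f(\lambda;s),\vec g(\lambda;s)\in\mathbb C^r$ be defined for $\lambda$ in an open neighbourhood of $\mathcal C$ and $s\in S$, jointly $C^1$ in $(\lambda,s)$, analytic in $\lambda$, and such that $\vec f^{\,T}(\lambda;s)\,\vec g(\lambda;s)=0$ for $\lambda\in\mathcal C$. Consider the integrable kernel $$K(\lambda,\mu)=\frac{\vec f^{\,T}(\lambda)\,\vec g(\mu)}{\lambda-\mu}\quad(\lambda\neq\mu),\qquad K(\lambda,\lambda)=\vec f^{\,\prime T}(\lambda)\,\vec g(\lambda),$$ where $'$ is the derivative in $\lambda$, the operator $(K\varphi)(\lambda)=\int_{\mathcal C}K(\lambda,\mu)\varphi(\mu)\,d\mu$ on $L^2(\mathcal C)$, and its Fredholm determinant $$\det(\mathrm{Id}-K)=\sum_{k\ge 0}\frac{(-1)^k}{k!}\int_{\mathcal C^k}\det\big[K(\lambda_i,\lambda_j)\big]_{i,j=1}^k\,d\lambda_1\cdots d\lambda_k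 .$$ Let $\partial$ be a vector field on $S$ and let $s\in S$. Assume that there is $a\in L^2(\mathcal C,|d\lambda|)$ such that, for all parameters in a neighbourhood of $s$ and with $\partial$ the derivative in the fixed direction given by the vector field at $s$, the norms of $\vec f,\vec g,\partial\vec f,\partial\vec g$ at $\lambda\in\mathcal C$ are at most $a(\lambda)$, and $|K(\lambda,\mu)|,|\partial K(\lambda,\mu)|\le a(\lambda)a(\mu)$ for $\lambda,\mu\in\mathcal C$ (if $\mathcal C$ is bounded this holds with $a$ constant). Suppose that at $s$ the Riemann–Hilbert problem with jump $M=\mathbf 1-2\pi i\,\vec f\,\vec g^{\,T}$ has a solution $\Gamma$: $\Gamma$ is an $r\times r$ matrix function, analytic on $\mathbb C\setminus\mathcal C$, with boundary values $\Gamma_\pm$ from the left ($+$) and from the right ($-$) of $\mathcal C$ satisfying $\Gamma_+=\Gamma_-M$ away from corners and endpoints, with $\Gamma(\lambda)=\mathbf 1+\mathcal O(\lambda^{-1})$ as $\lambda\to\infty$, and $\Gamma(\lambda)=\mathcal O(\log|\lambda-p|)$ as $\lambda\to p$ for every corner or endpoint $p$ of $\mathcal C$. Put $$\omega_M(\partial)=\int_{\mathcal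 C}\mathrm{Tr}\big(\Gamma_-^{-1}\Gamma_-'\,\partial M\,M^{-1}\big)\frac{d\lambda}{2\pi i},$$ $$H(M)=-\int_{\mathcal C}\Big(\partial\vec f^{\,\prime T}\vec g+\vec f^{\,\prime T}\partial\vec g\Big)d\lambda-2\pi i\int_{\mathcal C}\big(\vec g^{\,T}\vec f^{\,\prime}\big)\big(\partial\vec g^{\,T}\vec f\big)\,d\lambda ,$$ and assume that the integral defining $\omega_M(\partial)$ and the second integral in $H(M)$ converge absolutely. Then, at $s$, $\det(\mathrm{Id}-K)\neq0$, $\det(\mathrm{Id}-K)$ is differentiable in the direction $\partial$, and $$\omega_M(\partial)=\partial\ln\det(\mathrm{Id}-K)-H(M),$$ where $\partial\ln\det(\mathrm{Id}-K)=\partial\det(\mathrm{Id}-K)/\det(\mathrm{Id}-K)$. -/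

import Mathlib

open MeasureTheory Filter Topology Matrix

noncomputable section

/-- A finite disjoint union of oriented, piecewise `C¹` curves in the complex plane without
self-intersections.  The `j`-th component is `t ↦ γ j t`, `t ∈ dom j`, where `dom j` is a closed
interval: it is a closed curve (if it takes the same value at the two ends of a compact interval),
an arc, or a curve that goes to infinity in one or both directions. -/
structure Contour where
  /-- number of components -/
  n : ℕ
  /-- parameter interval of each component -/
  dom : Fin n → Set ℝ
  /-- parametrization of each component -/
  γ : Fin n → ℝ → ℂ
  /-- parameters of possible corners -/
  corner : Fin n → Set ℝ
  dom_closed : ∀ j, IsClosed (dom j)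
  dom_ordConnected : ∀ j, (dom j).OrdConnected
  dom_nontrivial : ∀ j, (dom j).Nontrivial
  corner_finite : ∀ j a b, (corner j ∩ Set.Icc a b).Finite
  continuousOn : ∀ j, ContinuousOn (γ j) (dom j)
  contDiffAt : ∀ j, ∀ t ∈ interior (dom j) \ corner j, ContDiffAt ℝ 1 (γ j) t
  deriv_ne_zero : ∀ j, ∀ t ∈ interior (dom j) \ corner j, deriv (γ j) t ≠ 0
  deriv_right : ∀ j, ∀ t ∈ dom j, ∃ d : ℂ, d ≠ 0 ∧
    Tendsto (deriv (γ j)) (𝓝[interior (dom j) ∩ Set.Ioi t] t) (𝓝 d)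
  deriv_left : ∀ j, ∀ t ∈ dom j, ∃ d : ℂ, d ≠ 0 ∧
    Tendsto (deriv (γ j)) (𝓝[interior (dom j) ∩ Set.Iio t] t) (𝓝 d)
  /-- two distinct parameters give the same point only if they are the two ends of `dom j` -/
  simple : ∀ j, ∀ t ∈ dom j, ∀ u ∈ dom j, t < u → γ j t = γ j u → dom j = Set.Icc t u
  /-- an unbounded component goes to infinity -/
  proper : ∀ j, Tendsto (γ j) (cocompact ℝ ⊓ 𝓟 (dom j)) (cocompact ℂ)
  disjoint : ∀ j k, j ≠ k → Disjoint (γ j '' dom j) (γ k '' dom k)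

namespace Contour

/-- The set of points of the contour. -/
def carrier (C : Contour) : Set ℂ := ⋃ j, C.γ j '' C.dom j

/-- The parameters of the regular points: neither a corner nor an end of a parameter interval. -/
def regular (C : Contour) (j : Fin C.n) : Set ℝ := interior (C.dom j) \ C.corner j

/-- The point of the contour with parameter `x = (j, t)`. -/
def pt (C : Contour) (x : Fin C.n × ℝ) : ℂ := C.γ x.1 x.2

/-- The velocity `γ_j'(t)`, so that `dλ = vel x dt`. -/
def vel (C : Contour) (x : Fin C.n × ℝ) : ℂ := deriv (C.γ x.1) x.2

/-- The measure `dt` on the parameter space `{(j, t) | t ∈ dom j}`. -/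
def paramMeasure (C : Contour) : Measure (Fin C.n × ℝ) :=
  ((Measure.count : Measure (Fin C.n)).prod (volume : Measure ℝ)).restrict
    {x | x.2 ∈ C.dom x.1}

/-- The arc-length measure `|dλ|`, in the parameter. -/
def arcMeasure (C : Contour) : Measure (Fin C.n × ℝ) :=
  C.paramMeasure.withDensity fun x => ‖C.vel x‖ₑ

/-- The contour integral `∫_C φ dλ`, with `φ` a function of the parameter. -/
def integral (C : Contour) (φ : Fin C.n × ℝ → ℂ) : ℂ :=
  ∫ x, φ x * C.vel x ∂C.paramMeasure

/-- Absolute convergence of `∫_C φ dλ`. -/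
def IntegrableOn (C : Contour) (φ : Fin C.n × ℝ → ℂ) : Prop :=
  Integrable (fun x => φ x * C.vel x) C.paramMeasure

/-- `z` tends to the regular point with parameter `x` from the left of the contour.  Near that
point the contour is a graph over its tangent, and the points on its left are those of the form
`γ_j(t) + ε i γ_j'(t₀)` with `ε > 0`. -/
def leftNhds (C : Contour) (x : Fin C.n × ℝ) : Filter ℂ :=
  map (fun p : ℝ × ℝ => C.γ x.1 p.1 + (p.2 : ℂ) * (Complex.I * C.vel x)) (𝓝 x.2 ×ˢ 𝓝[>] 0)

/-- `z` tends to the regular point with parameter `x` from the right of the contour. -/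
def rightNhds (C : Contour) (x : Fin C.n × ℝ) : Filter ℂ :=
  map (fun p : ℝ × ℝ => C.γ x.1 p.1 - (p.2 : ℂ) * (Complex.I * C.vel x)) (𝓝 x.2 ×ˢ 𝓝[>] 0)

end Contour

/-- `Γ` solves the Riemann–Hilbert problem with jump matrix `M` on `C`:
it is analytic off `C`, has boundary values `Γ₊` (from the left) and `Γ₋` (from the right) at the
regular points, which satisfy `Γ₊ = Γ₋ M`, is `1 + O(1/z)` at infinity, and grows at most
logarithmically at the corners and endpoints. -/
structure IsRHSolution (C : Contour) {r : ℕ} (M : ℂ → Matrix (Fin r) (Fin r) ℂ)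
    (Γ : ℂ → Matrix (Fin r) (Fin r) ℂ) : Prop where
  analytic : ∀ i k, DifferentiableOn ℂ (fun z => Γ z i k) C.carrierᶜ
  jump : ∀ j, ∀ t ∈ C.regular j, ∃ P Q : Matrix (Fin r) (Fin r) ℂ,
    Tendsto Γ (C.leftNhds (j, t)) (𝓝 P) ∧ Tendsto Γ (C.rightNhds (j, t)) (𝓝 Q) ∧
      P = Q * M (C.γ j t)
  infinity : ∀ i k, (fun z => Γ z i k - (1 : Matrix (Fin r) (Fin r) ℂ) i k)
    =O[cocompact ℂ ⊓ 𝓟 C.carrierᶜ] fun z => z⁻¹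
  exceptional : ∀ j, ∀ t ∈ C.dom j \ C.regular j, ∀ i k,
    (fun z => Γ z i k) =O[𝓝[C.carrierᶜ] (C.γ j t)] fun z => Real.log ‖z - C.γ j t‖

/-- The boundary value `Φ₋` from the right at the point with parameter `x`. -/
def minusValue (C : Contour) {r : ℕ} (Φ : ℂ → Matrix (Fin r) (Fin r) ℂ) (x : Fin C.n × ℝ) :
    Matrix (Fin r) (Fin r) ℂ :=
  limUnder (C.rightNhds x) Φ

/-- The entrywise derivative `Φ'` with respect to the spectral variable. -/
def matrixDeriv {r : ℕ} (Φ : ℂ → Matrix (Fin r) (Fin r) ℂ) (z : ℂ) : Matrix (Fin r) (Fin r) ℂ :=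
  Matrix.of fun i k => deriv (fun w => Φ w i k) z

/-- The entrywise derivative `∂M` at the parameter value `s` in the direction `v`. -/
def matrixParamDeriv {E : Type*} [NormedAddCommGroup E] [NormedSpace ℝ E] {r : ℕ}
    (M : E → ℂ → Matrix (Fin r) (Fin r) ℂ) (s v : E) (l : ℂ) : Matrix (Fin r) (Fin r) ℂ :=
  Matrix.of fun i k => lineDeriv ℝ (fun s' => M s' l i k) s v

/-- The integrand `Tr(Γ₋⁻¹ Γ₋' ∂M M⁻¹) / (2πi)` of the Malgrange form. -/
def malgrangeIntegrand {E : Type*} [NormedAddCommGroup E] [NormedSpace ℝ E] (C : Contour) {r : ℕ}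
    (M : E → ℂ → Matrix (Fin r) (Fin r) ℂ) (Γ : ℂ → Matrix (Fin r) (Fin r) ℂ) (s v : E)
    (x : Fin C.n × ℝ) : ℂ :=
  ((minusValue C Γ x)⁻¹ * minusValue C (matrixDeriv Γ) x *
    (matrixParamDeriv M s v (C.pt x) * (M s (C.pt x))⁻¹)).trace / (2 * Real.pi * Complex.I)

/-- The Malgrange form `ω_M(∂)`, with `∂` the derivative in the direction `v` at `s`. -/
def malgrangeForm {E : Type*} [NormedAddCommGroup E] [NormedSpace ℝ E] (C : Contour) {r : ℕ}
    (M : E → ℂ → Matrix (Fin r) (Fin r) ℂ) (Γ : ℂ → Matrix (Fin r) (Fin r) ℂ) (s v : E) : ℂ :=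
  C.integral (malgrangeIntegrand C M Γ s v)

/-- The jump matrix `1 - 2πi f gᵀ`. -/
def integrableJump {r : ℕ} (f g : ℂ → Fin r → ℂ) (l : ℂ) : Matrix (Fin r) (Fin r) ℂ :=
  1 - (2 * Real.pi * Complex.I) • Matrix.vecMulVec (f l) (g l)

open Classical in
/-- The kernel `K(l, m) = fᵀ(l) g(m) / (l - m)`, with its limit `f'ᵀ(l) g(l)` on the diagonal. -/
def integrableKernel {r : ℕ} (f g : ℂ → Fin r → ℂ) (l m : ℂ) : ℂ :=
  if l = m then deriv f l ⬝ᵥ g l else (f l ⬝ᵥ g m) / (l - m)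

/-- The Fredholm determinant
`det(Id - K) = ∑ₖ (-1)ᵏ / k! ∫_{Cᵏ} det[K(λᵢ, λⱼ)] dλ₁ ⋯ dλₖ` of the integral operator
`(K φ)(λ) = ∫_C K(λ, μ) φ(μ) dμ`. -/
def fredholmDet (C : Contour) (K : ℂ → ℂ → ℂ) : ℂ :=
  ∑' k : ℕ, ((-1) ^ k / (k.factorial : ℂ)) *
    ∫ x : Fin k → Fin C.n × ℝ,
      (Matrix.of fun i j => K (C.pt (x i)) (C.pt (x j))).det * ∏ i, C.vel (x i)
      ∂(Measure.pi fun _ => C.paramMeasure)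

section Data

variable {E : Type*} [NormedAddCommGroup E] [NormedSpace ℝ E]

/-- Integrand of `H₁(M)`, i.e. `-(∂f'ᵀ g + f'ᵀ ∂g)`. -/
def correctionIntegrand₁ {r : ℕ} (f g : E → ℂ → Fin r → ℂ) (s v : E) (l : ℂ) : ℂ :=
  -(lineDeriv ℝ (fun s' => deriv (f s') l) s v ⬝ᵥ g s l +
    deriv (f s) l ⬝ᵥ lineDeriv ℝ (fun s' => g s' l) s v)

/-- Integrand of `H₂(M)`, i.e. `2πi (gᵀ f') (∂gᵀ f)`. -/
def correctionIntegrand₂ {r : ℕ} (f g : E → ℂ → Fin r → ℂ) (s v : E) (l : ℂ) : ℂ :=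
  2 * Real.pi * Complex.I *
    ((g s l ⬝ᵥ deriv (f s) l) * (lineDeriv ℝ (fun s' => g s' l) s v ⬝ᵥ f s l))

/-- `H(M) = H₁(M) - H₂(M)`. -/
def correction (C : Contour) {r : ℕ} (f g : E → ℂ → Fin r → ℂ) (s v : E) : ℂ :=
  C.integral (fun x => correctionIntegrand₁ f g s v (C.pt x)) -
    C.integral (fun x => correctionIntegrand₂ f g s v (C.pt x))

/-- Decay along the contour, locally uniform in the parameters: `f`, `g`, `∂f`, `∂g` are bounded on
`C` by one function `a ∈ L²(C, |dλ|)`, and `K(l, m)`, `∂K(l, m)` by `a(l) a(m)`, for all parameters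
near `s`.  This makes the Fredholm series converge and differentiable in the direction `v`.  If
the contour is bounded, a constant `a` will do for any `f`, `g` that are `C¹` in all variables and
analytic in the spectral one. -/
def IsDominatedNear (C : Contour) {r : ℕ} (f g : E → ℂ → Fin r → ℂ) (s v : E) : Prop :=
  ∃ a : ℂ → ℝ, MemLp (fun x => a (C.pt x)) 2 C.arcMeasure ∧
    ∀ᶠ s' in 𝓝 s, ∀ l ∈ C.carrier,
      (‖f s' l‖ ≤ a l ∧ ‖g s' l‖ ≤ a l ∧
        ‖lineDeriv ℝ (fun q => f q l) s' v‖ ≤ a l ∧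
        ‖lineDeriv ℝ (fun q => g q l) s' v‖ ≤ a l) ∧
      ∀ m ∈ C.carrier,
        ‖integrableKernel (f s') (g s') l m‖ ≤ a l * a m ∧
        ‖lineDeriv ℝ (fun q => integrableKernel (f q) (g q) l m) s' v‖ ≤ a l * a m

end Data

end

/-! Write R for the resolvent kernel, (Id - K)⁻¹ = Id + R. Jacobi's formula gives ∂ ln det(Id - K) =
-(∫ ∂K(λ,λ) dλ + ∬ ∂K(λ,μ) R(μ,λ) dμ dλ). The single integral is minus the first part of H(M), so
the theorem amounts to evaluating the double integral as the second part of H(M) minus ω_M(∂). This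
is possible because R is again an integrable kernel, built from the solution Γ.

Determinant. If φ = Kφ, then φ continues analytically to a neighbourhood of the contour, and by
Plemelj's formula the row vector ∫ φ gᵀ/(z - μ) dμ has the same jump M as Γ. Multiplied by Γ⁻¹ it
has no jump, and Liouville's theorem makes it vanish, hence φ = 0. The Fredholm alternative
`Fredholm.det_ne_zero` then gives det(Id - K) ≠ 0.

Dressing. Solving φ = fᵢ + Kφ, the same argument (`IsSolution.transform_eq`) shows that F = Γf
continues analytically across the contour and that Γ is 1 plus the Cauchy transform of F gᵀ. The
pair (g, -f) with Γ⁻ᵀ gives G = Γ⁻ᵀ g. Partial fractions and uniqueness yield R(λ,μ) = F(λ)ᵀG(μ)/(λ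
- μ), which is `IsDressedPair.resolvent_eq`.

Trace formula. The kernel ∂K is the integrable kernel of the doubled vectors (∂f, f) and (g, ∂g).
For m(z,w) = -(f(z)ᵀ∂g(w)) F(w)ᵀG(z)/(w - z), consider the transforms ∫ m(z,μ)/(z - μ) dμ and ∫
m(λ,w)/(λ - w) dλ. They are expressed by Γ', by (Γ⁻ᵀ)' and by the inner integral of ∂K against R.
The left boundary value of the second minus the right boundary value of the first is the Malgrange
density, minus the density of the second part of H(M), plus that inner integral
(`IsDressedPair.exists_boundary_values`). It remains to see that this difference has integral zero
(`TwoPointKernel.integral_eq_zero`). Moving λ to λ - n in the first transform and μ to μ + n in the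
second produces the same denominator λ - μ - n, so by Fubini the two integrals against a cutoff χ
differ only by the commutator ∬ (χ(λ) - χ(μ)) m(λ,μ)/(λ - μ), which is harmless for Lipschitz χ.
Cutoffs that remove shrinking discs about corners and endpoints have commutators with an integrable
majorant independent of the radius, and the cutoff at scale T contributes O(1/T).

Analysis at the contour. A function holomorphic off the contour with equal boundary values extends
across regular points by a Morera argument in straightening charts. At corners, endpoints and
infinity Cauchy transforms of L¹ densities have no good pointwise bounds; their area integrals over
discs do, and through the mean value property these suffice for removable singularities and for
Liouville's theorem. -/

noncomputable section
open Metric Complex Set Real Finset MeasureTheory.Measure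
set_option linter.unusedSectionVars false

/-! ### Hadamard's inequality -/

namespace Fredholm

/-- Hadamard's bound `k^(k/2)` for a determinant with entries in the unit disc. -/
def hadamardBound (k : ℕ) : ℝ := √((k : ℝ) ^ k)

lemma hadamardBound_nonneg (k : ℕ) : 0 ≤ hadamardBound k := sqrt_nonneg _

open scoped ComplexOrder in
-- |det A|² is the product of the eigenvalues of A Aᴴ, whose sum tr(A Aᴴ) = Σ|aᵢⱼ|² is at most k².
-- By the inequality of the means the product is at most (k²/k)^k = k^k.
lemma norm_det_le_of_norm_entry_le_one {k : ℕ} (A : Matrix (Fin k) (Fin k) ℂ)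
    (hA : ∀ i j, ‖A i j‖ ≤ 1) : ‖A.det‖ ≤ hadamardBound k := by
  rcases Nat.eq_zero_or_pos k with rfl | hk
  · simp [hadamardBound]
  have hP := posSemidef_self_mul_conjTranspose A; have hH := hP.isHermitian
  set l := hH.eigenvalues with hl; have hl0 : ∀ i, 0 ≤ l i := fun i => hP.eigenvalues_nonneg i
  have hdet : ‖A.det‖ ^ 2 = ∏ i, l i := by
    have h1 := hH.det_eq_prod_eigenvalues; rw [det_mul, det_conjTranspose] at h1
    have h2 : (‖A.det‖ ^ 2 : ℂ) = ∏ i, ((l i : ℝ) : ℂ) := by rw [← mul_conj']; exact h1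
    exact_mod_cast h2
  have htr : ∑ i, l i ≤ (k : ℝ) * k := by
    have h1 : (A * Aᴴ).trace = ∑ i, ((hH.eigenvalues i : ℝ) : ℂ) := hH.trace_eq_sum_eigenvalues
    have h2 : (∑ i, hH.eigenvalues i : ℝ) = ∑ i, ∑ j, ‖A i j‖ ^ 2 := by
      have h3 : (A * Aᴴ).trace = ∑ i, ∑ j, ((‖A i j‖ : ℂ) ^ 2) := by
        simp only [trace, Matrix.diag, Matrix.mul_apply, conjTranspose_apply]; simp [mul_conj']
      rw [h3] at h1; exact_mod_cast h1.symm
    rw [hl, h2]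
    calc ∑ i, ∑ j, ‖A i j‖ ^ 2 ≤ ∑ _i : Fin k, ∑ _j : Fin k, (1 : ℝ) :=
          sum_le_sum fun i _ => sum_le_sum fun j _ => pow_le_one₀ (norm_nonneg _) (hA i j)
      _ = k * k := by simp
  have hk' : (0 : ℝ) < k := by exact_mod_cast hk
  have hamgm := geom_mean_le_arith_mean Finset.univ (fun _ : Fin k => (1 : ℝ)) l
    (fun _ _ => zero_le_one) (by simpa using hk) (fun i _ => hl0 i)
  simp at hamgm
  have h4 : (∏ i, l i) ≤ (k : ℝ) ^ k := by
    have h5 : (∏ i, l i) ^ ((k : ℝ)⁻¹) ≤ k := hamgm.trans ((div_le_iff₀ hk').2 htr)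
    grind [pow_le_pow_left₀, rpow_nonneg, prod_nonneg, rpow_inv_natCast_pow]
  refine le_sqrt_of_sq_le ?_; rw [hdet]; exact h4

/-- Hadamard's inequality for a matrix dominated by a matrix of rank one. -/
lemma norm_det_le_of_norm_entry_le {k : ℕ} (A : Matrix (Fin k) (Fin k) ℂ) (α β : Fin k → ℝ)
    (hα : ∀ i, 0 ≤ α i) (hβ : ∀ i, 0 ≤ β i) (hA : ∀ i j, ‖A i j‖ ≤ α i * β j) :
    ‖A.det‖ ≤ hadamardBound k * ∏ i, (α i * β i) := by
  -- Where the weight αᵢβⱼ is zero, the quotient is zero by convention and the entry of A is zero by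
  -- the bound, so A = diag(α) V diag(β) holds in every case.
  set V : Matrix (Fin k) (Fin k) ℂ := of fun i j => A i j / (α i * β j : ℝ) with hV
  have hV1 : ∀ i j, ‖V i j‖ ≤ 1 := by
    intro i j; simp only [hV, of_apply, norm_div, norm_real]
    refine div_le_one_of_le₀ ?_ (norm_nonneg _); grind [norm_of_nonneg, mul_nonneg]
  have hAV : A = of fun i j => (α i : ℂ) * (of (fun i j => (β j : ℂ) * V i j)) i j := by
    ext i j; simp [hV]; by_cases h : α i * β j = 0
    · grind [norm_le_zero_iff]
    · have : A i j = ((α i * β j : ℝ) : ℂ) * (A i j / ((α i * β j : ℝ) : ℂ)) :=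
        (mul_div_cancel₀ _ (by exact_mod_cast h)).symm
      conv_lhs => rw [this]
      push_cast; ring
  rw [hAV, det_mul_column, det_mul_row, norm_mul, norm_mul, norm_prod, norm_prod, prod_mul_distrib]
  simp [norm_of_nonneg (hα _), norm_of_nonneg (hβ _)]; have hp : 0 ≤ (∏ i, α i) * ∏ i, β i :=
    mul_nonneg (prod_nonneg fun i _ => hα i) (prod_nonneg fun i _ => hβ i)
  calc (∏ i, α i) * ((∏ i, β i) * ‖V.det‖) = ((∏ i, α i) * ∏ i, β i) * ‖V.det‖ := by ring
    _ ≤ ((∏ i, α i) * ∏ i, β i) * hadamardBound k :=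
        mul_le_mul_of_nonneg_left (norm_det_le_of_norm_entry_le_one V hV1) hp
    _ = _ := by ring

/-- The majorant of the Fredholm series. -/
def seriesBound (m : ℝ) (k : ℕ) : ℝ := hadamardBound (k + 1) * m ^ k / k.factorial

lemma seriesBound_nonneg {m : ℝ} (hm : 0 ≤ m) (k : ℕ) : 0 ≤ seriesBound m k := by
  have := hadamardBound_nonneg (k + 1); unfold seriesBound; positivity

/-- The minors of order k are determinants of size k + 1; this lets coefficients and minors share
one majorant. -/
lemma hadamardBound_mono_succ (k : ℕ) : hadamardBound k ≤ hadamardBound (k + 1) := by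
  refine sqrt_le_sqrt ?_; have h : (k ^ k : ℕ) ≤ (k + 1) ^ (k + 1) :=
    (Nat.pow_le_pow_left (Nat.le_succ k) k).trans (Nat.pow_le_pow_right (Nat.succ_pos k)
      (Nat.le_succ k))
  exact_mod_cast h

/-- The factor 2^k leaves room for binomial weights. Since (k+1)^(k+1) ≤ e^(k+1) (k+1)!, the square
of a term is at most t q with t from an exponential series and q = (1/4)^k, and x² ≤ t q implies x ≤
t + q. -/
lemma summable_two_pow_mul_seriesBound {m : ℝ} (hm : 0 ≤ m) :
    Summable fun k => 2 ^ k * seriesBound m k := by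
  -- Here 32 = 4 · 2 · 4: the square of 2^k, the estimate (k+1)! ≤ 2^k k!, and the compensation of
  -- the split-off factor (1/4)^k.
  set e := Real.exp 1; have key : ∀ k : ℕ, 2 ^ k * seriesBound m k ≤
      e * ((32 * e * m ^ 2) ^ k / k.factorial) + (1 / 4) ^ k := by
    intro k; have hf : (0 : ℝ) < k.factorial := by positivity
    have h1 : ((k + 1 : ℕ) : ℝ) ^ (k + 1) ≤ e ^ (k + 1) * (k + 1).factorial := by
      have := pow_div_factorial_le_exp ((k + 1 : ℕ) : ℝ) (by positivity) (k + 1)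
      rw [div_le_iff₀ (by positivity)] at this
      aesop
    have h2 : ((k + 1).factorial : ℝ) ≤ 2 ^ k * k.factorial := by
      rw [Nat.factorial_succ]; push_cast; refine mul_le_mul_of_nonneg_right ?_ hf.le
      exact_mod_cast Nat.lt_two_pow_self
    set t := e * ((32 * e * m ^ 2) ^ k / k.factorial) with ht; have ht0 : 0 ≤ t := by positivity
    have hsq : (2 ^ k * seriesBound m k) ^ 2 ≤ t * (1 / 4) ^ k := by
      have hs : hadamardBound (k + 1) ^ 2 = ((k + 1 : ℕ) : ℝ) ^ (k + 1) := sq_sqrt (by positivity)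
      have : (2 ^ k * seriesBound m k) ^ 2
          = 4 ^ k * (((k + 1 : ℕ) : ℝ) ^ (k + 1)) * (m ^ 2) ^ k / (k.factorial : ℝ) ^ 2 := by
        unfold seriesBound
        rw [mul_pow, div_pow, mul_pow, hs, ← pow_mul, ← pow_mul m k 2, ← pow_mul m 2 k,
          mul_comm k 2, pow_mul 2 2 k]
        ring
      rw [this]
      calc 4 ^ k * (((k + 1 : ℕ) : ℝ) ^ (k + 1)) * (m ^ 2) ^ k / (k.factorial : ℝ) ^ 2
          ≤ 4 ^ k * (e ^ (k + 1) * (2 ^ k * k.factorial)) * (m ^ 2) ^ k / (k.factorial : ℝ) ^ 2 := by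
            gcongr; exact h1.trans (by gcongr)
        _ = t * (1 / 4) ^ k := by
            rw [ht]
            have : (32 * e * m ^ 2) ^ k = 4 ^ k * 2 ^ k * 4 ^ k * e ^ k * (m ^ 2) ^ k := by
              rw [← mul_pow, ← mul_pow, ← mul_pow, ← mul_pow]; norm_num
            grind [inv_pow]
    have hq : (0 : ℝ) ≤ (1 / 4) ^ k := by positivity
    nlinarith
  refine Summable.of_nonneg_of_le (fun k => mul_nonneg (by positivity) (seriesBound_nonneg hm k))
    key ?_
  exact ((summable_pow_div_factorial _).mul_left _).add
    (summable_geometric_of_lt_one (by norm_num) (by norm_num))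

/-! ### Fredholm coefficients and minors -/

variable {X : Type*} [MeasurableSpace X]

/-- The `k`-th term of the Fredholm series of `det(1 - K)`. -/
def coeff (μ : Measure X) (K : X → X → ℂ) (k : ℕ) : ℂ := ((-1) ^ k / (k.factorial : ℂ)) *
    ∫ x : Fin k → X, (of fun i j => K (x i) (x j)).det ∂(Measure.pi fun _ => μ)

/-- The bordered matrix with rows `L x, K z1, …, K z_k` and columns `y, z1, …, z_k`. -/
def bordered (L K : X → X → ℂ) {k : ℕ} (x y : X) (z : Fin k → X) :
    Matrix (Fin (k + 1)) (Fin (k + 1)) ℂ :=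
  of fun i j => (Fin.cons (L x) (fun a => K (z a)) : Fin (k + 1) → X → ℂ) i
    ((Fin.cons y z : Fin (k + 1) → X) j)

/-- The `k`-th term of the series of the first Fredholm minor, with the first row taken from
`L`. -/
def minor (μ : Measure X) (L K : X → X → ℂ) (k : ℕ) (x y : X) : ℂ :=
  ((-1) ^ k / (k.factorial : ℂ)) * ∫ z : Fin k → X, (bordered L K x y z).det
    ∂(Measure.pi fun _ => μ)

/-- The kernel is measurable and bounded by `α(x) β(y)`. -/
structure IsDominated (α β : X → ℝ) (K : X → X → ℂ) : Prop where
  measurable : Measurable (Function.uncurry K)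
  bound : ∀ x y, ‖K x y‖ ≤ α x * β y

/-- A pair of weights with integrable product. -/
structure IsWeight (μ : Measure X) (α β : X → ℝ) : Prop where
  left_measurable : Measurable α
  right_measurable : Measurable β
  left_nonneg : ∀ x, 0 ≤ α x
  right_nonneg : ∀ x, 0 ≤ β x
  integrable : Integrable (fun x => α x * β x) μ

/-- The expansions along row i of one matrix and along row 0 of the other have the same minors, and
their signs differ by (-1)^i. -/
lemma det_insertNth_row {k : ℕ} {κ : Type*} (i : Fin (k + 1)) (r : κ) (R : Fin k → κ)
    (c : Fin (k + 1) → κ → ℂ) :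
    (of fun a b => c b ((i.insertNth r R : Fin (k + 1) → κ) a)).det =
      (-1) ^ (i : ℕ) * (of fun a b => c b ((Fin.cons r R : Fin (k + 1) → κ) a)).det := by
  rw [det_succ_row _ i, det_succ_row_zero, mul_sum]; refine Finset.sum_congr rfl fun j _ => ?_; simp
  have : (of fun a b => c b ((i.insertNth r R : Fin (k + 1) → κ) a)).submatrix i.succAbove
      j.succAbove = (of fun a b => c b ((Fin.cons r R : Fin (k + 1) → κ) a)).submatrix
      Fin.succ j.succAbove := by
    ext a b; simp
  grind

/-- Row and column are moved together, so the two signs cancel. -/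
lemma det_insertNth {k : ℕ} {κ ι : Type*} (i : Fin (k + 1)) (r : κ) (R : Fin k → κ) (c : ι)
    (C : Fin k → ι) (e : κ → ι → ℂ) :
    (of fun a b => e ((i.insertNth r R : Fin (k + 1) → κ) a)
      ((i.insertNth c C : Fin (k + 1) → ι) b)).det =
    (of fun a b => e ((Fin.cons r R : Fin (k + 1) → κ) a)
      ((Fin.cons c C : Fin (k + 1) → ι) b)).det := by
  rw [det_insertNth_row i r R (fun b x => e x ((i.insertNth c C : Fin (k + 1) → ι) b)),
    ← det_transpose]
  have := det_insertNth_row i c C (fun b x => e ((Fin.cons r R : Fin (k + 1) → κ) b) x)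
  have h2 : (of fun a b => e ((Fin.cons r R : Fin (k + 1) → κ) a)
      ((i.insertNth c C : Fin (k + 1) → ι) b))ᵀ = of fun a b =>
      e ((Fin.cons r R : Fin (k + 1) → κ) b) ((i.insertNth c C : Fin (k + 1) → ι) a) := by
    rfl
  have h3 : (of fun a b => e ((Fin.cons r R : Fin (k + 1) → κ) a)
      ((Fin.cons c C : Fin (k + 1) → ι) b))ᵀ = of fun a b =>
      e ((Fin.cons r R : Fin (k + 1) → κ) b) ((Fin.cons c C : Fin (k + 1) → ι) a) := by
    rfl
  rw [h2, this, ← h3, det_transpose, ← mul_assoc, ← pow_add]; simp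

section
variable {μ : Measure X} [SigmaFinite μ] {α β : X → ℝ} {L K : X → X → ℂ}

lemma measurePreserving_insertNth {k : ℕ} (i : Fin (k + 1)) :
    MeasurePreserving (fun p : X × (Fin k → X) => (i.insertNth p.1 p.2 : Fin (k + 1) → X))
      (μ.prod (Measure.pi fun _ => μ)) (Measure.pi fun _ => μ) :=
  (measurePreserving_piFinSuccAbove (fun _ : Fin (k + 1) => μ) i).symm

lemma integral_insertNth {k : ℕ} (i : Fin (k + 1)) (G : (Fin (k + 1) → X) → ℂ) :
    ∫ z, G z ∂(Measure.pi fun _ => μ) =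
      ∫ p : X × (Fin k → X), G (i.insertNth p.1 p.2) ∂(μ.prod (Measure.pi fun _ => μ)) := by
  have := (measurePreserving_piFinSuccAbove (fun _ : Fin (k + 1) => μ) i).symm.integral_comp'
    (g := G)
  rw [← this]; rfl

lemma integrable_insertNth {k : ℕ} (i : Fin (k + 1)) {G : (Fin (k + 1) → X) → ℂ}
    (hG : Integrable G (Measure.pi fun _ => μ)) :
    Integrable (fun p : X × (Fin k → X) => G (i.insertNth p.1 p.2))
      (μ.prod (Measure.pi fun _ => μ)) :=
  (measurePreserving_insertNth i).integrable_comp_of_integrable hG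

lemma IsWeight.integrable_prod (hw : IsWeight μ α β) (k : ℕ) :
    Integrable (fun z : Fin k → X => ∏ i, (α (z i) * β (z i))) (Measure.pi fun _ => μ) :=
  Integrable.fintype_prod fun _ => hw.integrable

lemma IsWeight.integral_prod (hw : IsWeight μ α β) (k : ℕ) :
    ∫ z : Fin k → X, ∏ i, (α (z i) * β (z i)) ∂(Measure.pi fun _ => μ) =
      (∫ x, α x * β x ∂μ) ^ k := by
  have := integral_fintype_prod_eq_pow (μ := μ) (ι := Fin k) (fun x => α x * β x); simpa using this

lemma IsWeight.mass_nonneg (hw : IsWeight μ α β) : 0 ≤ ∫ x, α x * β x ∂μ :=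
  integral_nonneg fun x => mul_nonneg (hw.left_nonneg x) (hw.right_nonneg x)

lemma IsDominated.measurable_det (hK : IsDominated α β K) (k : ℕ) :
    Measurable fun z : Fin k → X => (of fun i j => K (z i) (z j)).det := by
  have := hK.measurable; simp [det_apply]; fun_prop

lemma norm_det_le (hw : IsWeight μ α β) (hK : IsDominated α β K) {k : ℕ} (z : Fin k → X) :
    ‖(of fun i j => K (z i) (z j)).det‖ ≤ hadamardBound k * ∏ i, (α (z i) * β (z i)) :=
  norm_det_le_of_norm_entry_le _ (fun i => α (z i)) (fun i => β (z i))
    (fun _ => hw.left_nonneg _) (fun _ => hw.right_nonneg _) fun _ _ => hK.bound _ _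

lemma norm_det_bordered_le (hw : IsWeight μ α β) (hL : IsDominated α β L)
    (hK : IsDominated α β K) {k : ℕ} (x y : X) (z : Fin k → X) :
    ‖(bordered L K x y z).det‖ ≤
      hadamardBound (k + 1) * (α x * β y * ∏ i, (α (z i) * β (z i))) := by
  have := norm_det_le_of_norm_entry_le (bordered L K x y z)
    (fun i => α ((Fin.cons x z : Fin (k + 1) → X) i))
    (fun i => β ((Fin.cons y z : Fin (k + 1) → X) i))
    (fun _ => hw.left_nonneg _) (fun _ => hw.right_nonneg _) (by
      intro i j; refine Fin.cases ?_ (fun a => ?_) i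
      · simpa [bordered] using hL.bound _ _
      · simpa [bordered] using hK.bound _ _)
  simpa [Fin.prod_univ_succ] using this

lemma measurable_det_bordered (hL : IsDominated α β L) (hK : IsDominated α β K) (k : ℕ) :
    Measurable fun p : (X × X) × (Fin k → X) => (bordered L K p.1.1 p.1.2 p.2).det := by
  have h1 := hL.measurable; have h2 := hK.measurable; have hentry : ∀ i j : Fin (k + 1),
      Measurable fun p : (X × X) × (Fin k → X) => bordered L K p.1.1 p.1.2 p.2 i j := by
    intro i j
    have hc : Measurable fun p : (X × X) × (Fin k → X) =>
        (Fin.cons p.1.2 p.2 : Fin (k + 1) → X) j := by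
      refine Fin.cases ?_ (fun b => ?_) j
      · simp; fun_prop
      · simp; fun_prop
    refine Fin.cases ?_ (fun a => ?_) i
    · simp [bordered]; fun_prop
    · simp [bordered]; fun_prop
  simp [det_apply]; fun_prop

lemma integrable_det (hw : IsWeight μ α β) (hK : IsDominated α β K) (k : ℕ) :
    Integrable (fun z : Fin k → X => (of fun i j => K (z i) (z j)).det) (Measure.pi fun _ => μ) :=
  ((hw.integrable_prod k).const_mul (hadamardBound k)).mono'
    (hK.measurable_det k).aestronglyMeasurable (ae_of_all _ fun z => norm_det_le hw hK z)

lemma norm_coeff_le (hw : IsWeight μ α β) (hK : IsDominated α β K) (k : ℕ) :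
    ‖coeff μ K k‖ ≤ seriesBound (∫ x, α x * β x ∂μ) k := by
  have h1 : ‖∫ x : Fin k → X, (of fun i j => K (x i) (x j)).det
      ∂(Measure.pi fun _ => μ)‖ ≤ hadamardBound k * (∫ x, α x * β x ∂μ) ^ k := by
    rw [← hw.integral_prod k, ← integral_const_mul]
    exact norm_integral_le_of_norm_le ((hw.integrable_prod k).const_mul _)
      (ae_of_all _ fun z => norm_det_le hw hK z)
  have hm := hw.mass_nonneg; unfold coeff seriesBound
  rw [norm_mul, norm_div, norm_pow, norm_neg, norm_one, one_pow, Complex.norm_natCast,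
    one_div_mul_eq_div]
  gcongr; exact h1.trans (mul_le_mul_of_nonneg_right (hadamardBound_mono_succ k) (by positivity))

lemma norm_minor_le (hw : IsWeight μ α β) (hL : IsDominated α β L) (hK : IsDominated α β K)
    (k : ℕ) (x y : X) :
    ‖minor μ L K k x y‖ ≤ α x * β y * seriesBound (∫ x, α x * β x ∂μ) k := by
  have h1 : ‖∫ z : Fin k → X, (bordered L K x y z).det ∂(Measure.pi fun _ => μ)‖ ≤
      hadamardBound (k + 1) * (α x * β y * (∫ x, α x * β x ∂μ) ^ k) := by
    rw [← hw.integral_prod k, ← integral_const_mul, ← integral_const_mul]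
    exact norm_integral_le_of_norm_le (((hw.integrable_prod k).const_mul _).const_mul _)
      (ae_of_all _ fun z => norm_det_bordered_le hw hL hK x y z)
  unfold minor seriesBound
  rw [norm_mul, norm_div, norm_pow, norm_neg, norm_one, one_pow, Complex.norm_natCast,
    one_div_mul_eq_div]
  calc _ ≤ hadamardBound (k + 1) * (α x * β y * (∫ x, α x * β x ∂μ) ^ k) / k.factorial := by
        gcongr
    _ = _ := by ring

lemma measurable_minor (hL : IsDominated α β L) (hK : IsDominated α β K) (k : ℕ) :
    Measurable fun p : X × X => minor μ L K k p.1 p.2 := by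
  exact ((measurable_det_bordered hL hK k).stronglyMeasurable.integral_prod_right').measurable.const_mul _

/-- Expansion of a Fredholm minor along its first row. -/
lemma minor_zero (x y : X) : minor μ L K 0 x y = coeff μ K 0 * L x y := by
  simp [minor, coeff, bordered]

/-- Expansion along the first row. The corner entry L x y yields the coefficient. Each of the other
k + 1 entries, once the row of its variable is moved to the top, yields the same integral of a minor
of order k with a negative sign; the number k + 1 cancels against the factorial. -/
lemma minor_succ (hw : IsWeight μ α β) (hL : IsDominated α β L) (hK : IsDominated α β K)
    (k : ℕ) (x y : X) :
    minor μ L K (k + 1) x y = coeff μ K (k + 1) * L x y + ∫ w, L x w * minor μ K K k w y ∂μ := by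
  have hexp : ∀ z : Fin (k + 1) → X, (bordered L K x y z).det =
      L x y * (of fun i j => K (z i) (z j)).det +
      ∑ j : Fin (k + 1), (-1) ^ ((j : ℕ) + 1) * (L x (z j) * (of fun a b : Fin (k + 1) => K (z a)
          ((Fin.cons y (fun i => z (j.succAbove i)) : Fin (k + 1) → X) b)).det) := by
    intro z; rw [det_succ_row_zero, Fin.sum_univ_succ]; congr 1
    · aesop
    · refine Finset.sum_congr rfl fun j _ => ?_; simp [bordered]; rw [mul_assoc]; congr 3; ext a b
      refine Fin.cases ?_ (fun b => ?_) b <;> simp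
  have hterm : ∀ (j : Fin (k + 1)) (p : X × (Fin k → X)),
      L x ((j.insertNth p.1 p.2 : Fin (k + 1) → X) j) *
        (of fun a b : Fin (k + 1) => K ((j.insertNth p.1 p.2 : Fin (k + 1) → X) a)
          ((Fin.cons y (fun i => (j.insertNth p.1 p.2 : Fin (k + 1) → X) (j.succAbove i)) :
            Fin (k + 1) → X) b)).det =
      (-1) ^ (j : ℕ) * (L x p.1 * (bordered K K p.1 y p.2).det) := by
    intro j p; simp
    rw [det_insertNth_row j p.1 p.2 (fun b u => K u ((Fin.cons y p.2 : Fin (k + 1) → X) b))]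
    have : (of fun a b => K ((Fin.cons p.1 p.2 : Fin (k + 1) → X) a)
        ((Fin.cons y p.2 : Fin (k + 1) → X) b)) = bordered K K p.1 y p.2 := by
      ext a b
      refine Fin.cases ?_ (fun a => ?_) a <;> simp [bordered]
    rw [this]; ring
  have hint : Integrable (fun p : X × (Fin k → X) => L x p.1 * (bordered K K p.1 y p.2).det)
      (μ.prod (Measure.pi fun _ => μ)) := by
    have hb := (hw.integrable.mul_prod (hw.integrable_prod k)).const_mul
      (hadamardBound (k + 1) * α x * β y)
    refine hb.mono' ?_ (ae_of_all _ fun p => ?_)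
    · refine Measurable.aestronglyMeasurable (Measurable.mul ?_ ?_)
      · exact hL.measurable.comp (measurable_const.prodMk measurable_fst)
      · exact (measurable_det_bordered hK hK k).comp
          ((measurable_fst.prodMk measurable_const).prodMk measurable_snd)
    · rw [norm_mul]
      calc _ ≤ (α x * β p.1) * (hadamardBound (k + 1) *
            (α p.1 * β y * ∏ i, (α (p.2 i) * β (p.2 i)))) :=
            mul_le_mul (hL.bound _ _) (norm_det_bordered_le hw hK hK _ _ _) (norm_nonneg _)
              (mul_nonneg (hw.left_nonneg _) (hw.right_nonneg _))
        _ = _ := by ring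
  have hint' : ∀ j : Fin (k + 1), Integrable (fun z : Fin (k + 1) → X => (-1) ^ ((j : ℕ) + 1) *
      (L x (z j) * (of fun a b : Fin (k + 1) => K (z a)
          ((Fin.cons y (fun i => z (j.succAbove i)) : Fin (k + 1) → X) b)).det))
      (Measure.pi fun _ => μ) := by
    intro j; refine Integrable.const_mul ?_ _
    have hmp := (measurePreserving_piFinSuccAbove (fun _ : Fin (k + 1) => μ) j).symm
    rw [← hmp.integrable_comp_emb (MeasurableEquiv.measurableEmbedding _)]
    refine (hint.const_mul ((-1) ^ (j : ℕ))).congr (ae_of_all _ fun p => ?_); exact (hterm j p).symm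
  have hval : ∀ j : Fin (k + 1), ∫ z : Fin (k + 1) → X, (-1) ^ ((j : ℕ) + 1) *
      (L x (z j) * (of fun a b : Fin (k + 1) => K (z a)
          ((Fin.cons y (fun i => z (j.succAbove i)) : Fin (k + 1) → X) b)).det)
      ∂(Measure.pi fun _ => μ) =
      -∫ w, L x w * (∫ z : Fin k → X, (bordered K K w y z).det ∂(Measure.pi fun _ => μ)) ∂μ := by
    intro j; rw [integral_const_mul, integral_insertNth j]; simp_rw [hterm j]
    rw [integral_const_mul, integral_prod _ hint, ← mul_assoc, ← pow_add,
      Odd.neg_one_pow (show Odd ((j : ℕ) + 1 + j) from ⟨j, by ring⟩), neg_one_mul]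
    grind [integral_const_mul]
  have hk1 : ((k : ℂ) + 1) ≠ 0 := by exact_mod_cast k.succ_ne_zero
  unfold minor; simp_rw [hexp]; rw [integral_add ((integrable_det hw hK (k + 1)).const_mul _)
    (integrable_finsetSum _ fun j _ => hint' j), integral_finsetSum _ fun j _ => hint' j,
    integral_const_mul]
  simp_rw [hval]; have hpull : ∫ w, L x w * ((-1) ^ k / (k.factorial : ℂ) *
      ∫ z : Fin k → X, (bordered K K w y z).det ∂(Measure.pi fun _ => μ)) ∂μ =
      (-1) ^ k / (k.factorial : ℂ) * ∫ w, L x w *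
      (∫ z : Fin k → X, (bordered K K w y z).det ∂(Measure.pi fun _ => μ)) ∂μ := by
    rw [← integral_const_mul]; grind
  rw [hpull, coeff, sum_const, card_univ, Fintype.card_fin, nsmul_eq_mul, Nat.factorial_succ]; grind

/-- The trace of a minor. -/
lemma integral_minor_diag (hw : IsWeight μ α β) (hK : IsDominated α β K) (k : ℕ) :
    ∫ x, minor μ K K k x x ∂μ = -((k + 1 : ℕ) : ℂ) * coeff μ K (k + 1) := by
  have hk1 : ((k : ℂ) + 1) ≠ 0 := by exact_mod_cast k.succ_ne_zero
  have hb : ∀ p : X × (Fin k → X), (of fun i j =>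
      K (((0 : Fin (k + 1)).insertNth p.1 p.2 : Fin (k + 1) → X) i)
      (((0 : Fin (k + 1)).insertNth p.1 p.2 : Fin (k + 1) → X) j)).det =
      (bordered K K p.1 p.1 p.2).det := by
    intro p; congr 1; ext a b
    refine Fin.cases ?_ (fun a => ?_) a <;> simp [bordered]
  -- For x = y the bordered determinant is the determinant with k + 1 points; only the ratio -(k +
  -- 1) of the two prefactors remains.
  unfold minor coeff; rw [integral_const_mul, integral_insertNth 0]
  have hint := integrable_insertNth (μ := μ) (0 : Fin (k + 1)) (integrable_det hw hK (k + 1))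
  simp_rw [hb] at hint ⊢; rw [integral_prod _ hint, Nat.factorial_succ]; grind

end
end Fredholm

/-! ### Weighted Fredholm series and the Fredholm alternative -/

namespace Fredholm
variable {X : Type*} [MeasurableSpace X]

/-- The Fredholm determinant of `1 - K`. -/
def det (μ : Measure X) (K : X → X → ℂ) : ℂ := ∑' k, coeff μ K k

/-- The series `∑ uₖ dₖ` formed with the Fredholm coefficients. -/
def weightedDet (μ : Measure X) (K : X → X → ℂ) (u : ℕ → ℂ) : ℂ := ∑' k, u k * coeff μ K k

/-- The series `∑ uₖ nₖ(x, y)` formed with the Fredholm minors. -/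
def weightedMinor (μ : Measure X) (L K : X → X → ℂ) (u : ℕ → ℂ) (x y : X) : ℂ :=
  ∑' k, u k * minor μ L K k x y

/-- At most geometric growth with ratio two. -/
def GeomGrowth (u : ℕ → ℂ) : Prop := ∃ c : ℝ, 0 ≤ c ∧ ∀ k, ‖u k‖ ≤ c * 2 ^ k

lemma GeomGrowth.shift {u : ℕ → ℂ} (hu : GeomGrowth u) : GeomGrowth fun k => u (k + 1) := by
  obtain ⟨c, hc, h⟩ := hu
  exact ⟨c * 2, by positivity, fun k => (h (k + 1)).trans (le_of_eq (by ring))⟩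

lemma geomGrowth_choose (j : ℕ) : GeomGrowth fun k => (k.choose j : ℂ) := by
  refine ⟨1, zero_le_one, fun k => ?_⟩; rw [Complex.norm_natCast, one_mul]
  exact_mod_cast Nat.choose_le_two_pow k j

lemma geomGrowth_one : GeomGrowth fun _ => 1 := by simpa using geomGrowth_choose 0

lemma coeff_zero (μ : Measure X) [SigmaFinite μ] (K : X → X → ℂ) : coeff μ K 0 = 1 := by
  simp [coeff, Measure.real]

variable {μ : Measure X} [SigmaFinite μ] {α β : X → ℝ} {L K : X → X → ℂ} {u : ℕ → ℂ}

/-- The constant in the bounds of the weighted series. -/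
def seriesMass (μ : Measure X) (α β : X → ℝ) : ℝ := ∑' k, 2 ^ k * seriesBound (∫ x, α x * β x ∂μ) k

lemma summable_coeff (hw : IsWeight μ α β) (hK : IsDominated α β K) (hu : GeomGrowth u) :
    Summable fun k => u k * coeff μ K k := by
  obtain ⟨c, hc, h⟩ := hu; refine Summable.of_norm_bounded
    ((summable_two_pow_mul_seriesBound hw.mass_nonneg).mul_left c) fun k => ?_
  grind [norm_mul, mul_assoc, mul_le_mul, norm_coeff_le, norm_nonneg]

lemma norm_mul_minor_le (hw : IsWeight μ α β) (hL : IsDominated α β L) (hK : IsDominated α β K)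
    {c : ℝ} (hc : 0 ≤ c) (h : ∀ k, ‖u k‖ ≤ c * 2 ^ k) (k : ℕ) (x y : X) :
    ‖u k * minor μ L K k x y‖ ≤ c * (α x * β y) * (2 ^ k * seriesBound (∫ x, α x * β x ∂μ) k) := by
  rw [norm_mul]
  calc _ ≤ (c * 2 ^ k) * (α x * β y * seriesBound (∫ x, α x * β x ∂μ) k) :=
        mul_le_mul (h k) (norm_minor_le hw hL hK k x y) (norm_nonneg _) (by positivity)
    _ = _ := by ring

lemma summable_minor (hw : IsWeight μ α β) (hL : IsDominated α β L) (hK : IsDominated α β K)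
    (hu : GeomGrowth u) (x y : X) : Summable fun k => u k * minor μ L K k x y := by
  obtain ⟨c, hc, h⟩ := hu; exact Summable.of_norm_bounded
    ((summable_two_pow_mul_seriesBound hw.mass_nonneg).mul_left _)
    fun k => norm_mul_minor_le hw hL hK hc h k x y

lemma norm_weightedMinor_le (hw : IsWeight μ α β) (hL : IsDominated α β L)
    (hK : IsDominated α β K) {c : ℝ} (hc : 0 ≤ c) (h : ∀ k, ‖u k‖ ≤ c * 2 ^ k) (x y : X) :
    ‖weightedMinor μ L K u x y‖ ≤ c * seriesMass μ α β * (α x * β y) := by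
  refine (tsum_of_norm_bounded ((summable_two_pow_mul_seriesBound hw.mass_nonneg).mul_left _).hasSum
    fun k => norm_mul_minor_le hw hL hK hc h k x y).trans (le_of_eq ?_)
  rw [tsum_mul_left, seriesMass]; ring

lemma measurable_weightedMinor (hw : IsWeight μ α β) (hL : IsDominated α β L)
    (hK : IsDominated α β K) (hu : GeomGrowth u) :
    Measurable fun p : X × X => weightedMinor μ L K u p.1 p.2 := by
  refine measurable_of_tendsto_metrizable (f := fun n (p : X × X) =>
    ∑ k ∈ Finset.range n, u k * minor μ L K k p.1 p.2) (fun n => ?_) ?_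
  · exact measurable_sum _ fun k _ => (measurable_minor hL hK k).const_mul _
  · rw [tendsto_pi_nhds]; exact fun p => (summable_minor hw hL hK hu p.1 p.2).hasSum.tendsto_sum_nat

lemma IsDominated.measurable_left (hL : IsDominated α β L) (x : X) : Measurable (L x) :=
  hL.measurable.comp measurable_prodMk_left

lemma integrable_mul_of_bound (hw : IsWeight μ α β) (hL : IsDominated α β L) {φ : X → ℂ}
    (hφ : Measurable φ) {c : ℝ} (hc : ∀ x, ‖φ x‖ ≤ c * α x) (x : X) :
    Integrable (fun w => L x w * φ w) μ := by
  refine (hw.integrable.const_mul (α x * c)).mono'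
    ((hL.measurable_left x).mul hφ).aestronglyMeasurable (ae_of_all _ fun w => ?_)
  rw [norm_mul]
  calc _ ≤ (α x * β w) * (c * α w) := mul_le_mul (hL.bound _ _) (hc w) (norm_nonneg _)
        (mul_nonneg (hw.left_nonneg _) (hw.right_nonneg _))
    _ = _ := by ring

/-- The first-row expansion of a weighted minor. -/
lemma weightedMinor_eq (hw : IsWeight μ α β) (hL : IsDominated α β L) (hK : IsDominated α β K)
    (hu : GeomGrowth u) (x y : X) :
    weightedMinor μ L K u x y = weightedDet μ K u * L x y +
      ∫ w, L x w * weightedMinor μ K K (fun k => u (k + 1)) w y ∂μ := by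
  obtain ⟨c, hc, h⟩ := hu.shift
  have hint : ∀ k, Integrable (fun w => L x w * (u (k + 1) * minor μ K K k w y)) μ := by
    intro k; refine integrable_mul_of_bound hw hL ?_
      (c := c * β y * (2 ^ k * seriesBound (∫ x, α x * β x ∂μ) k)) (fun w => ?_) x
    · exact ((measurable_minor hK hK k).comp measurable_prodMk_right).const_mul _
    · exact (norm_mul_minor_le hw hK hK hc h k w y).trans (le_of_eq (by ring))
  have hsum : HasSum (fun k => ∫ w, L x w * (u (k + 1) * minor μ K K k w y) ∂μ)
      (∫ w, ∑' k, L x w * (u (k + 1) * minor μ K K k w y) ∂μ) := by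
    refine hasSum_integral_of_summable_integral_norm hint ?_
    refine Summable.of_nonneg_of_le (fun k => integral_nonneg fun _ => norm_nonneg _) (fun k => ?_)
      ((summable_two_pow_mul_seriesBound hw.mass_nonneg).mul_left
        (α x * c * β y * ∫ x, α x * β x ∂μ))
    calc ∫ w, ‖L x w * (u (k + 1) * minor μ K K k w y)‖ ∂μ
        ≤ ∫ w, (α x * c * β y * (2 ^ k * seriesBound (∫ x, α x * β x ∂μ) k)) * (α w * β w) ∂μ := by
          refine integral_mono (hint k).norm (hw.integrable.const_mul _) fun w => ?_; rw [norm_mul]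
          calc _ ≤ (α x * β w) * (c * (α w * β y) *
                (2 ^ k * seriesBound (∫ x, α x * β x ∂μ) k)) :=
                mul_le_mul (hL.bound _ _) (norm_mul_minor_le hw hK hK hc h k w y) (norm_nonneg _)
                  (mul_nonneg (hw.left_nonneg _) (hw.right_nonneg _))
            _ = _ := by ring
      _ = _ := by rw [integral_const_mul]; ring
  have h2 := (summable_coeff hw hK hu)
  have h2' : Summable fun k => u (k + 1) * coeff μ K (k + 1) * L x y :=
    ((summable_nat_add_iff 1).2 h2).mul_right _
  unfold weightedMinor weightedDet
  rw [((summable_minor hw hL hK hu x y)).tsum_eq_zero_add, h2.tsum_eq_zero_add, minor_zero]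
  have h3 : ∀ k, u (k + 1) * minor μ L K (k + 1) x y = u (k + 1) * coeff μ K (k + 1) * L x y +
        ∫ w, L x w * (u (k + 1) * minor μ K K k w y) ∂μ := by
    grind [minor_succ, mul_add, integral_const_mul]
  simp_rw [h3]; rw [h2'.tsum_add hsum.summable, hsum.tsum_eq, tsum_mul_right]
  simp_rw [tsum_mul_left]; ring

lemma integral_weightedMinor_diag (hw : IsWeight μ α β) (hL : IsDominated α β L)
    (hK : IsDominated α β K) (hu : GeomGrowth u) :
    HasSum (fun k => u k * ∫ x, minor μ L K k x x ∂μ) (∫ x, weightedMinor μ L K u x x ∂μ) := by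
  obtain ⟨c, hc, h⟩ := hu
  have hm : ∀ k, Measurable fun x => minor μ L K k x x := fun k =>
    (measurable_minor hL hK k).comp (measurable_id.prodMk measurable_id)
  have hint : ∀ k, Integrable (fun x => u k * minor μ L K k x x) μ := fun k =>
    (hw.integrable.const_mul (c * (2 ^ k * seriesBound (∫ x, α x * β x ∂μ) k))).mono'
      ((hm k).const_mul _).aestronglyMeasurable (ae_of_all _ fun x =>
        (norm_mul_minor_le hw hL hK hc h k x x).trans (le_of_eq (by ring)))
  have := hasSum_integral_of_summable_integral_norm hint (by
    refine Summable.of_nonneg_of_le (fun k => integral_nonneg fun _ => norm_nonneg _) (fun k => ?_)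
      ((summable_two_pow_mul_seriesBound hw.mass_nonneg).mul_left (c * ∫ x, α x * β x ∂μ))
    calc _ ≤ ∫ x, (c * (2 ^ k * seriesBound (∫ x, α x * β x ∂μ) k)) * (α x * β x) ∂μ := by
          refine integral_mono (hint k).norm (hw.integrable.const_mul _) fun x => ?_
          exact (norm_mul_minor_le hw hL hK hc h k x x).trans (le_of_eq (by ring))
      _ = _ := by rw [integral_const_mul]; ring)
  simp [integral_const_mul] at this; exact this

/-- The only solution of `φ = Kφ` that is bounded by a multiple of `α` is zero. -/
def IsInjective (μ : Measure X) (α : X → ℝ) (K : X → X → ℂ) : Prop :=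
  ∀ φ : X → ℂ, Measurable φ → (∃ c : ℝ, ∀ x, ‖φ x‖ ≤ c * α x) →
    (∀ x, φ x = ∫ y, K x y * φ y ∂μ) → φ =ᵐ[μ] 0

/-- Injectivity gives vanishing almost everywhere only; inserting this into the integral equation
gives it at every point. -/
lemma weightedMinor_eq_zero (hw : IsWeight μ α β) (hK : IsDominated α β K)
    (hinj : IsInjective μ α K) (hu : GeomGrowth u) (y : X)
    (h : ∀ x, weightedMinor μ K K u x y = ∫ w, K x w * weightedMinor μ K K u w y ∂μ) (x : X) :
    weightedMinor μ K K u x y = 0 := by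
  have hmeas := (measurable_weightedMinor hw hK hK hu).comp (measurable_prodMk_right (y := y))
  obtain ⟨c, hc, hb⟩ := hu; have h0 := hinj (fun x => weightedMinor μ K K u x y) hmeas
    ⟨c * seriesMass μ α β * β y, fun x =>
      (norm_weightedMinor_le hw hK hK hc hb x y).trans (le_of_eq (by ring))⟩ h
  rw [h x]; refine integral_eq_zero_of_ae ?_; filter_upwards [h0] with w hw0
  simp only [Pi.zero_apply] at hw0 ⊢; rw [hw0, mul_zero]

/-- The Fredholm determinant does not vanish if `1 - K` is injective. -/
theorem det_ne_zero (hw : IsWeight μ α β) (hK : IsDominated α β K)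
    (hinj : IsInjective μ α K) : det μ K ≠ 0 := by
  intro hD
  have hbase : weightedDet μ K (fun k => (k.choose 0 : ℂ)) = 0 := by
    simpa [weightedDet, det] using hD
  -- The sums Σ C(k,j) dₖ are the Taylor coefficients at λ = 1 of the entire function Σ dₖ λ^k. The
  -- trace of the minor with weights C(k,j) is -(j+1) times the coefficient of index j + 1, so a
  -- vanishing minor kills the next coefficient. By Pascal's rule the row expansion of the next
  -- minor is then the homogeneous equation, and injectivity applies again.
  have key : ∀ j : ℕ, weightedDet μ K (fun k => (k.choose j : ℂ)) = 0 ∧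
      ∀ x y, weightedMinor μ K K (fun k => (k.choose j : ℂ)) x y = 0 := by
    intro j
    induction j with
    | zero =>
      refine ⟨hbase, fun x y => weightedMinor_eq_zero hw hK hinj (geomGrowth_choose 0) y
        (fun x => ?_) x⟩
      conv_lhs => rw [weightedMinor_eq hw hK hK (geomGrowth_choose 0), hbase]
      simp
    | succ j ih =>
      have h1 : weightedDet μ K (fun k => (k.choose (j + 1) : ℂ)) = 0 := by
        have h2 := (integral_weightedMinor_diag hw hK hK (geomGrowth_choose j)).tsum_eq
        simp_rw [ih.2, integral_minor_diag hw hK, integral_zero] at h2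
        have h3 := (summable_coeff hw hK (geomGrowth_choose (j + 1))).tsum_eq_zero_add
        unfold weightedDet
        have h4 : ∀ k : ℕ, (k.choose j : ℂ) * (-((k + 1 : ℕ) : ℂ) * coeff μ K (k + 1)) =
            -((j + 1 : ℕ) : ℂ) * ((((k + 1).choose (j + 1) : ℕ) : ℂ) * coeff μ K (k + 1)) := by
          intro k; have h5 : ((k + 1 : ℕ) : ℂ) * (k.choose j : ℂ) =
              (((k + 1).choose (j + 1) : ℕ) : ℂ) * ((j + 1 : ℕ) : ℂ) := by
            exact_mod_cast Nat.add_one_mul_choose_eq k j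
          grind
        simp_rw [h4, tsum_mul_left] at h2
        have h6 : (-((j + 1 : ℕ) : ℂ)) ≠ 0 := neg_ne_zero.2 (by exact_mod_cast j.succ_ne_zero)
        simp_all
      refine ⟨h1, fun x y => weightedMinor_eq_zero hw hK hinj (geomGrowth_choose (j + 1)) y
        (fun x => ?_) x⟩
      conv_lhs => rw [weightedMinor_eq hw hK hK (geomGrowth_choose (j + 1)), h1]
      rw [zero_mul, zero_add]; congr 1; ext w
      have h7 : weightedMinor μ K K (fun k => ((k + 1).choose (j + 1) : ℂ)) w y =
          weightedMinor μ K K (fun k => (k.choose j : ℂ)) w y +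
            weightedMinor μ K K (fun k => (k.choose (j + 1) : ℂ)) w y := by
        unfold weightedMinor; rw [← (summable_minor hw hK hK (geomGrowth_choose j) w y).tsum_add
          (summable_minor hw hK hK (geomGrowth_choose (j + 1)) w y)]
        congr 1; ext k; simp [Nat.choose_succ_succ']; push_cast; ring
      rw [h7, ih.2, zero_add]
  -- Re-expansion from λ = 1 to λ = 0: the double series Σ (-1)^j C(k,j) dₖ equals d₀ = 1 when
  -- summed over j first, and 0 when summed over k first.
  set F : ℕ × ℕ → ℂ := fun p => (-1) ^ p.2 * (p.1.choose p.2 : ℂ) * coeff μ K p.1 with hF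
  have hchoose0 : ∀ k j, j ∉ Finset.range (k + 1) → k.choose j = 0 := by grind
  have hFs : Summable F := by
    refine Summable.of_norm ?_; rw [summable_prod_of_nonneg fun _ => norm_nonneg _]
    have hn : ∀ k j, ‖F (k, j)‖ = (k.choose j : ℝ) * ‖coeff μ K k‖ := by simp_all
    refine ⟨fun k => summable_of_ne_finset_zero (s := Finset.range (k + 1)) fun j hj => ?_, ?_⟩
    · simp_all
    · have : ∀ k, ∑' j, ‖F (k, j)‖ = 2 ^ k * ‖coeff μ K k‖ := by
        intro k; simp_rw [hn, tsum_mul_right]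
        rw [tsum_eq_sum (s := Finset.range (k + 1)) fun j hj => by simp [hchoose0 k j hj]]
        congr 1; exact_mod_cast Nat.sum_range_choose k
      simp_rw [this]; exact Summable.of_nonneg_of_le (fun k => by positivity)
        (fun k => mul_le_mul_of_nonneg_left (norm_coeff_le hw hK k) (by positivity))
        (summable_two_pow_mul_seriesBound hw.mass_nonneg)
  have hcomm : ∑' k, ∑' j, F (k, j) = ∑' j, ∑' k, F (k, j) := (hFs.tsum_comm).symm
  have hleft : ∑' k, ∑' j, F (k, j) = 1 := by
    have h1 : ∀ k, ∑' j, F (k, j) = if k = 0 then 1 else 0 := by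
      intro k; simp [hF]
      rw [tsum_mul_right, tsum_eq_sum (s := Finset.range (k + 1)) fun j hj => by
        simp [hchoose0 k j hj]]
      have h2 : ∑ j ∈ Finset.range (k + 1), (-1 : ℂ) ^ j * (k.choose j : ℂ) =
          if k = 0 then 1 else 0 := by
        exact_mod_cast Int.alternating_sum_range_choose (n := k)
      grind [coeff_zero]
    simp_rw [h1]; simp
  have hright : ∑' j, ∑' k, F (k, j) = 0 := by
    have h1 : ∀ j, ∑' k, F (k, j) = 0 := by
      intro j; simp [hF, mul_assoc]; rw [tsum_mul_left]; have := (key j).1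
      unfold weightedDet at this; rw [this, mul_zero]
    simp_rw [h1]; simp
  grind

/-- The resolvent kernel `N(x, y) / D`. -/
def resolvent (μ : Measure X) (K : X → X → ℂ) (x y : X) : ℂ :=
  (det μ K)⁻¹ * weightedMinor μ K K (fun _ => 1) x y

lemma weightedDet_one : weightedDet μ K (fun _ => 1) = det μ K := by simp [weightedDet, det]

lemma measurable_resolvent (hw : IsWeight μ α β) (hK : IsDominated α β K) :
    Measurable fun p : X × X => resolvent μ K p.1 p.2 :=
  (measurable_weightedMinor hw hK hK geomGrowth_one).const_mul _

lemma exists_norm_resolvent_le (hw : IsWeight μ α β) (hK : IsDominated α β K) :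
    ∃ c : ℝ, 0 ≤ c ∧ ∀ x y, ‖resolvent μ K x y‖ ≤ c * (α x * β y) := by
  refine ⟨‖(det μ K)⁻¹‖ * seriesMass μ α β, ?_, fun x y => ?_⟩
  · exact mul_nonneg (norm_nonneg _) (tsum_nonneg fun k =>
      mul_nonneg (by positivity) (seriesBound_nonneg hw.mass_nonneg k))
  · rw [resolvent, norm_mul, mul_assoc]; refine mul_le_mul_of_nonneg_left ?_ (norm_nonneg _)
    have := norm_weightedMinor_le hw hK hK (u := fun _ => 1) zero_le_one
      (fun k => by simp [one_le_pow₀]) x y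
    simpa using this

/-- The resolvent equation. -/
lemma resolvent_eq (hw : IsWeight μ α β) (hK : IsDominated α β K) (hD : det μ K ≠ 0) (x y : X) :
    resolvent μ K x y = K x y + ∫ w, K x w * resolvent μ K w y ∂μ := by
  have h := weightedMinor_eq hw hK hK geomGrowth_one x y; rw [weightedDet_one] at h
  have h2 : ∀ w, K x w * resolvent μ K w y =
      (det μ K)⁻¹ * (K x w * weightedMinor μ K K (fun _ => 1) w y) := fun w => by
    rw [resolvent]; ring
  simp_rw [h2]; rw [integral_const_mul, resolvent, h]; field_simp

lemma integrable_mul_resolvent (hw : IsWeight μ α β) (hL : IsDominated α β L)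
    (hK : IsDominated α β K) :
    Integrable (fun p : X × X => L p.1 p.2 * resolvent μ K p.2 p.1) (μ.prod μ) := by
  obtain ⟨c, hc, hR⟩ := exists_norm_resolvent_le hw hK
  have hmeas : Measurable fun p : X × X => L p.1 p.2 * resolvent μ K p.2 p.1 := by
    have h3 := measurable_resolvent hw hK
    have h4 : Measurable fun p : X × X => L p.1 p.2 := hL.measurable; fun_prop
  have hb : Integrable (fun p : X × X => c * ((α p.1 * β p.1) * (α p.2 * β p.2))) (μ.prod μ) := by
    have h3 := hw.integrable.mul_prod hw.integrable; fun_prop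
  refine hb.mono' hmeas.aestronglyMeasurable (ae_of_all _ fun p => ?_); rw [norm_mul]
  calc ‖L p.1 p.2‖ * ‖resolvent μ K p.2 p.1‖
      ≤ (α p.1 * β p.2) * (c * (α p.2 * β p.1)) :=
        mul_le_mul (hL.bound _ _) (hR _ _) (norm_nonneg _)
          (mul_nonneg (hw.left_nonneg _) (hw.right_nonneg _))
    _ = _ := by ring

/-! ### Differentiation -/

lemma hasDerivAt_det {k : ℕ} {A : ℝ → Matrix (Fin k) (Fin k) ℂ} {A' : Matrix (Fin k) (Fin k) ℂ}
    {t : ℝ} (h : ∀ i j, HasDerivAt (fun t => A t i j) (A' i j) t) :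
    HasDerivAt (fun t => (A t).det) (∑ i, ((A t).updateRow i (A' i)).det) t := by
  have h1 : (fun t => (A t).det) = fun t => ∑ σ : Equiv.Perm (Fin k),
      Equiv.Perm.sign σ • ∏ i, A t i (σ i) := by
    ext t; rw [← det_transpose, det_apply]; rfl
  have h2 : ∑ i, ((A t).updateRow i (A' i)).det = ∑ σ : Equiv.Perm (Fin k),
      Equiv.Perm.sign σ • ∑ i, (∏ j ∈ Finset.univ.erase i, A t j (σ j)) • A' i (σ i) := by
    have : ∀ i, ((A t).updateRow i (A' i)).det = ∑ σ : Equiv.Perm (Fin k),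
        Equiv.Perm.sign σ • ((∏ j ∈ Finset.univ.erase i, A t j (σ j)) • A' i (σ i)) := by
      intro i; rw [← det_transpose, det_apply]; refine Finset.sum_congr rfl fun σ _ => ?_; congr 1
      rw [← mul_prod_erase _ _ (Finset.mem_univ i)]; simp_all [mul_comm, prod_congr]
    simp_rw [this]; rw [Finset.sum_comm]; simp_rw [smul_sum]
  rw [h1, h2]; refine HasDerivAt.fun_sum fun σ _ => ?_
  exact (HasDerivAt.fun_finsetProd fun i _ => h i (σ i)).const_smul (Equiv.Perm.sign σ)

variable {δ : ℝ} {Kp Lp : ℝ → X → X → ℂ}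

/-- The determinant is differentiated row by row. Moving the differentiated row and its column to
the front shows that all k + 1 rows contribute the same integral, the trace of the minor whose first
row comes from the derivative kernel. -/
lemma hasDerivAt_coeff (hw : IsWeight μ α β) (hK : ∀ t ∈ ball (0 : ℝ) δ, IsDominated α β (Kp t))
    (hL : ∀ t ∈ ball (0 : ℝ) δ, IsDominated α β (Lp t))
    (hd : ∀ t ∈ ball (0 : ℝ) δ, ∀ x y, HasDerivAt (fun t => Kp t x y) (Lp t x y) t)
    (k : ℕ) (t : ℝ) (ht : t ∈ ball (0 : ℝ) δ) :
    HasDerivAt (fun t => coeff μ (Kp t) (k + 1)) (-∫ x, minor μ (Lp t) (Kp t) k x x ∂μ) t := by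
  set F' : ℝ → (Fin (k + 1) → X) → ℂ := fun t z => ∑ i, ((of fun a b =>
    Kp t (z a) (z b)).updateRow i ((of fun a b => Lp t (z a) (z b)) i)).det with hF'
  have hupd : ∀ t ∈ ball (0 : ℝ) δ, ∀ (z : Fin (k + 1) → X) i, ‖((of fun a b =>
      Kp t (z a) (z b)).updateRow i ((of fun a b => Lp t (z a) (z b)) i)).det‖ ≤
      hadamardBound (k + 1) * ∏ i, (α (z i) * β (z i)) := by
    intro t ht z i; refine norm_det_le_of_norm_entry_le _ (fun i => α (z i)) (fun i => β (z i))
      (fun _ => hw.left_nonneg _) (fun _ => hw.right_nonneg _) fun a b => ?_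
    by_cases h : a = i
    · simp_all [IsDominated.bound]
    simp_all [IsDominated.bound]
  have hmeasU : ∀ i, Measurable fun z : Fin (k + 1) → X => ((of fun a b =>
      Kp t (z a) (z b)).updateRow i ((of fun a b => Lp t (z a) (z b)) i)).det := by
    intro i; have h1 := (hK t ht).measurable; have h2 := (hL t ht).measurable; simp [det_apply]
    refine measurable_sum _ fun σ _ => (measurable_prod _ fun a _ => ?_).const_smul _
    by_cases h : σ a = i
    · simp [updateRow_apply, h]; fun_prop
    · simp [updateRow_apply, h]; fun_prop
  have hball : ball (0 : ℝ) δ ∈ 𝓝 t := Metric.isOpen_ball.mem_nhds ht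
  have hder := (hasDerivAt_integral_of_dominated_loc_of_deriv_le
    (μ := Measure.pi fun _ : Fin (k + 1) => μ) (F := fun t (z : Fin (k + 1) → X) =>
      (of fun i j => Kp t (z i) (z j)).det) (F' := F')
    (bound := fun z => (k + 1 : ℕ) * (hadamardBound (k + 1) * ∏ i, (α (z i) * β (z i))))
    hball
    (by filter_upwards [hball] with t' ht'
        exact ((hK t' ht').measurable_det (k + 1)).aestronglyMeasurable)
    (integrable_det hw (hK t ht) (k + 1))
    (measurable_sum _ fun i _ => hmeasU i).aestronglyMeasurable
    (ae_of_all _ fun z t' ht' => by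
      refine (norm_sum_le _ _).trans ?_
      refine (sum_le_sum fun i _ => hupd t' ht' z i).trans (le_of_eq ?_); simp)
    (((hw.integrable_prod (k + 1)).const_mul _).const_mul _)
    (ae_of_all _ fun z t' ht' => hasDerivAt_det fun i j => hd t' ht' (z i) (z j))).2
  have hintU : ∀ i, Integrable (fun z : Fin (k + 1) → X => ((of fun a b =>
      Kp t (z a) (z b)).updateRow i ((of fun a b => Lp t (z a) (z b)) i)).det)
      (Measure.pi fun _ => μ) := fun i =>
    ((hw.integrable_prod (k + 1)).const_mul _).mono' (hmeasU i).aestronglyMeasurable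
      (ae_of_all _ fun z => hupd t ht z i)
  have hpt : ∀ i (p : X × (Fin k → X)), ((of fun a b =>
      Kp t ((i.insertNth p.1 p.2 : Fin (k + 1) → X) a)
        ((i.insertNth p.1 p.2 : Fin (k + 1) → X) b)).updateRow i ((of fun a b =>
        Lp t ((i.insertNth p.1 p.2 : Fin (k + 1) → X) a)
        ((i.insertNth p.1 p.2 : Fin (k + 1) → X) b)) i)).det =
      (bordered (Lp t) (Kp t) p.1 p.1 p.2).det := by
    intro i p; have := det_insertNth i (Lp t p.1) (fun a => Kp t (p.2 a)) p.1 p.2 (fun f x => f x)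
    rw [show bordered (Lp t) (Kp t) p.1 p.1 p.2 = of fun a b =>
      (Fin.cons (Lp t p.1) (fun a => Kp t (p.2 a)) : Fin (k + 1) → X → ℂ) a
        ((Fin.cons p.1 p.2 : Fin (k + 1) → X) b) from rfl, ← this]
    congr 1; ext a b; rcases Fin.eq_self_or_eq_succAbove i a with rfl | ⟨a', rfl⟩
    · simp
    simp
  have hval : ∀ i, ∫ z : Fin (k + 1) → X, ((of fun a b =>
      Kp t (z a) (z b)).updateRow i ((of fun a b => Lp t (z a) (z b)) i)).det
      ∂(Measure.pi fun _ => μ) =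
      ∫ x, ∫ z : Fin k → X, (bordered (Lp t) (Kp t) x x z).det ∂(Measure.pi fun _ => μ) ∂μ := by
    intro i; have h1 := integrable_insertNth i (hintU i); rw [integral_insertNth i]
    simp_all [integral_prod]
  have hk1 : ((k : ℂ) + 1) ≠ 0 := by exact_mod_cast k.succ_ne_zero
  unfold coeff minor
  refine (hder.const_mul ((-1 : ℂ) ^ (k + 1) / ((k + 1).factorial : ℂ))).congr_deriv ?_
  rw [integral_finsetSum _ fun i _ => hintU i, integral_const_mul]; simp_rw [hval]
  rw [sum_const, card_univ, Fintype.card_fin, nsmul_eq_mul, Nat.factorial_succ]; grind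

/-- Jacobi's formula for the Fredholm determinant along a differentiable path of kernels. -/
theorem hasDerivAt_fredholm_det (hδ : 0 < δ) (hw : IsWeight μ α β)
    (hK : ∀ t ∈ ball (0 : ℝ) δ, IsDominated α β (Kp t))
    (hL : ∀ t ∈ ball (0 : ℝ) δ, IsDominated α β (Lp t))
    (hd : ∀ t ∈ ball (0 : ℝ) δ, ∀ x y, HasDerivAt (fun t => Kp t x y) (Lp t x y) t)
    (hD : det μ (Kp 0) ≠ 0) :
    HasDerivAt (fun t => det μ (Kp t)) (-det μ (Kp 0) * ((∫ x, Lp 0 x x ∂μ) +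
      ∫ x, ∫ w, Lp 0 x w * resolvent μ (Kp 0) w x ∂μ ∂μ)) 0 := by
  have h0 : (0 : ℝ) ∈ ball (0 : ℝ) δ := mem_ball_self hδ; have hm := hw.mass_nonneg
  have hsb : Summable fun k => seriesBound (∫ x, α x * β x ∂μ) k :=
    Summable.of_nonneg_of_le (fun k => seriesBound_nonneg hm k)
      (fun k => le_mul_of_one_le_left (seriesBound_nonneg hm k)
        (one_le_pow₀ (by norm_num : (1 : ℝ) ≤ 2))) (summable_two_pow_mul_seriesBound hm)
  have hsc : ∀ t ∈ ball (0 : ℝ) δ, Summable fun k => coeff μ (Kp t) k := fun t ht => by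
    grind [summable_coeff, geomGrowth_one]
  have hder := hasDerivAt_tsum_of_isPreconnected
    (g := fun k t => coeff μ (Kp t) (k + 1)) (g' := fun k t => -∫ x, minor μ (Lp t) (Kp t) k x x ∂μ)
    (hsb.mul_left (∫ x, α x * β x ∂μ)) isOpen_ball (convex_ball (0 : ℝ) δ).isPreconnected
    (fun k t ht => hasDerivAt_coeff hw hK hL hd k t ht)
    (fun k t ht => by
      rw [norm_neg, mul_comm, ← integral_const_mul]
      refine norm_integral_le_of_norm_le (hw.integrable.const_mul _) (ae_of_all _ fun x => ?_)
      grind [norm_minor_le]) h0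
    ((summable_nat_add_iff 1).2 (hsc 0 h0)) h0
  have hsplit : (fun t => det μ (Kp t)) =ᶠ[𝓝 0] fun t => 1 + ∑' k, coeff μ (Kp t) (k + 1) := by
    filter_upwards [Metric.isOpen_ball.mem_nhds h0] with t ht; rw [det, (hsc t ht).tsum_eq_zero_add]
    simp [coeff_zero]
  refine (hder.const_add 1).congr_of_eventuallyEq hsplit |>.congr_deriv ?_
  -- The derivative of the series is minus the trace of the minor with first row from `Lp 0`; its
  -- first-row expansion turns this into an expression in the resolvent.
  have h1 := (integral_weightedMinor_diag hw (hL 0 h0) (hK 0 h0) geomGrowth_one).tsum_eq; simp at h1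
  rw [tsum_neg, h1]; have h2 : ∀ x, weightedMinor μ (Lp 0) (Kp 0) (fun _ => 1) x x =
      det μ (Kp 0) * (Lp 0 x x + ∫ w, Lp 0 x w * resolvent μ (Kp 0) w x ∂μ) := by
    intro x; rw [weightedMinor_eq hw (hL 0 h0) (hK 0 h0) geomGrowth_one, weightedDet_one, mul_add,
      ← integral_const_mul]
    congr 2; ext w; rw [resolvent]; field_simp
  simp_rw [h2]; rw [integral_const_mul, integral_add, neg_mul]
  · have hdm : Measurable fun x => Lp 0 x x :=
      (hL 0 h0).measurable.comp (measurable_id.prodMk measurable_id)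
    exact hw.integrable.mono' hdm.aestronglyMeasurable (ae_of_all _ fun x => (hL 0 h0).bound x x)
  · exact (integrable_mul_resolvent hw (hL 0 h0) (hK 0 h0)).integral_prod_left

end Fredholm

namespace Contour
variable (C : Contour)

/-! ### Topology of a contour -/

lemma isOpen_regular (j : Fin C.n) : IsOpen (C.regular j) := by
  rw [isOpen_iff_mem_nhds]; intro t ht; have h1 : (C.corner j ∩ Set.Icc (t - 1) (t + 1))ᶜ ∈ 𝓝 t :=
    (C.corner_finite j (t - 1) (t + 1)).isClosed.isOpen_compl.mem_nhds fun h => ht.2 h.1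
  have h2 : Set.Icc (t - 1) (t + 1) ∈ 𝓝 t := by simp
  filter_upwards [h1, h2, isOpen_interior.mem_nhds ht.1] with u hu1 hu2 hu3
  exact ⟨hu3, fun h => hu1 ⟨h, hu2⟩⟩

lemma regular_subset_dom (j : Fin C.n) : C.regular j ⊆ C.dom j := fun _ ht => interior_subset ht.1

lemma finite_dom_diff_interior (j : Fin C.n) : (C.dom j \ interior (C.dom j)).Finite := by
  have h : C.dom j \ interior (C.dom j) ⊆
      {t | IsLeast (C.dom j) t} ∪ {t | IsGreatest (C.dom j) t} := by
    rintro t ⟨ht, hti⟩; by_contra hcon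
    simp [IsLeast, IsGreatest, ht, mem_lowerBounds, mem_upperBounds] at hcon
    obtain ⟨⟨u, hu, hut⟩, ⟨w, hw, htw⟩⟩ := hcon
    refine hti (mem_interior_iff_mem_nhds.2 (mem_of_superset (Icc_mem_nhds hut htw) ?_))
    exact (C.dom_ordConnected j).out hu hw
  refine Finite.subset (Finite.union ?_ ?_) h
  · exact Subsingleton.finite fun a ha b hb => ha.unique hb
  · exact Subsingleton.finite fun a ha b hb => ha.unique hb

lemma finite_dom_diff_regular (j : Fin C.n) (a b : ℝ) :
    ((C.dom j \ C.regular j) ∩ Set.Icc a b).Finite := by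
  refine ((C.finite_dom_diff_interior j).union (C.corner_finite j a b)).subset ?_
  rintro t ⟨⟨h1, h2⟩, h3⟩; by_cases h : t ∈ interior (C.dom j)
  · exact Or.inr ⟨by_contra fun hc => h2 ⟨h, hc⟩, h3⟩
  grind

lemma countable_dom_diff_regular (j : Fin C.n) : (C.dom j \ C.regular j).Countable := by
  have : C.dom j \ C.regular j ⊆ ⋃ n : ℕ, (C.dom j \ C.regular j) ∩ Set.Icc (-(n : ℝ)) n := by
    intro t ht; obtain ⟨n, hn⟩ := exists_nat_ge |t|; grind [mem_iUnion]
  grind [Countable.mono, countable_iUnion, Finite.countable, finite_dom_diff_regular]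

/-- The parameters of the points in a bounded region are bounded. -/
lemma exists_Icc_of_norm_le (j : Fin C.n) (R : ℝ) :
    ∃ a b : ℝ, ∀ t ∈ C.dom j, ‖C.γ j t‖ ≤ R → t ∈ Set.Icc a b := by
  have h := C.proper j (isCompact_closedBall (0 : ℂ) R).compl_mem_cocompact
  rw [Filter.mem_map, mem_inf_principal, mem_cocompact] at h; obtain ⟨T, hT, hsub⟩ := h
  obtain ⟨ρ, hρ⟩ := hT.isBounded.subset_closedBall 0; refine ⟨-ρ, ρ, fun t ht hn => ?_⟩
  by_contra hcon; have : t ∈ Tᶜ := fun htT => hcon (by grind [norm_eq_abs, mem_closedBall_zero_iff])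
  exact hsub this ht (by simpa using hn)

/-- The component is proper: near a given point of the plane only a compact interval of parameters
matters. -/
lemma isClosed_image (j : Fin C.n) {A : Set ℝ} (hA : IsClosed A) (hAd : A ⊆ C.dom j) :
    IsClosed (C.γ j '' A) := by
  refine isClosed_of_closure_subset fun z hz => ?_
  obtain ⟨a, b, hab⟩ := C.exists_Icc_of_norm_le j (‖z‖ + 1)
  have hcpt : IsCompact (C.γ j '' (A ∩ Set.Icc a b)) :=
    (isCompact_Icc.inter_left hA).image_of_continuousOn
      ((C.continuousOn j).mono fun t ht => hAd ht.1)
  have h1 : z ∈ closure (ball z 1 ∩ C.γ j '' A) :=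
    Metric.isOpen_ball.inter_closure ⟨mem_ball_self one_pos, hz⟩
  have h2 : ball z 1 ∩ C.γ j '' A ⊆ C.γ j '' (A ∩ Set.Icc a b) := by
    rintro _ ⟨hw, t, ht, rfl⟩; grind [norm_sub_norm_le, mem_ball_iff_norm]
  have h3 := hcpt.isClosed.closure_subset_iff.2 h2 h1; grind

lemma isClosed_carrier : IsClosed C.carrier :=
  isClosed_iUnion_of_finite fun j => C.isClosed_image j (C.dom_closed j) subset_rfl

lemma mem_carrier {j : Fin C.n} {t : ℝ} (ht : t ∈ C.dom j) : C.γ j t ∈ C.carrier :=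
  Set.mem_iUnion.2 ⟨j, t, ht, rfl⟩

/-- The corners and endpoints. -/
def exceptional : Set ℂ := ⋃ j, C.γ j '' (C.dom j \ C.regular j)

lemma exceptional_subset : C.exceptional ⊆ C.carrier :=
  iUnion_mono fun _ => Set.image_mono Set.sdiff_subset

lemma finite_exceptional_inter (R : ℝ) : (C.exceptional ∩ closedBall 0 R).Finite := by
  choose a b hab using fun j => C.exists_Icc_of_norm_le j R
  refine (finite_iUnion fun j => (C.finite_dom_diff_regular j (a j) (b j)).image (C.γ j)).subset ?_
  rintro z ⟨hz, hR⟩; obtain ⟨j, t, ht, rfl⟩ := Set.mem_iUnion.1 hz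
  exact Set.mem_iUnion.2 ⟨j, t, ⟨ht, hab j t ht.1 (by simpa using hR)⟩, rfl⟩

lemma countable_exceptional : C.exceptional.Countable :=
  countable_iUnion fun j => (C.countable_dom_diff_regular j).image _

/-- Near any point the exceptional points reduce to at most that point. -/
lemma eventually_notMem_exceptional (z : ℂ) : ∀ᶠ w in 𝓝[≠] z, w ∉ C.exceptional := by
  have hF : ((C.exceptional ∩ closedBall 0 (‖z‖ + 1)) \ {z}).Finite :=
    (C.finite_exceptional_inter (‖z‖ + 1)).subset Set.sdiff_subset
  have h1 : ((C.exceptional ∩ closedBall 0 (‖z‖ + 1)) \ {z})ᶜ ∈ 𝓝 z :=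
    hF.isClosed.isOpen_compl.mem_nhds fun h => h.2 rfl
  filter_upwards [self_mem_nhdsWithin, nhdsWithin_le_nhds h1,
    nhdsWithin_le_nhds (ball_mem_nhds z one_pos)] with w hw1 hw2 hw3 hw4
  refine hw2 ⟨⟨hw4, ?_⟩, hw1⟩; grind [mem_closedBall_zero_iff, mem_ball_iff_norm, norm_sub_norm_le]

lemma differentiableAt {j : Fin C.n} {t : ℝ} (ht : t ∈ C.regular j) :
    DifferentiableAt ℝ (C.γ j) t :=
  (C.contDiffAt j t ht).differentiableAt one_ne_zero

lemma hasDerivAt {j : Fin C.n} {t : ℝ} (ht : t ∈ C.regular j) :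
    HasDerivAt (C.γ j) (deriv (C.γ j) t) t := (C.differentiableAt ht).hasDerivAt

lemma continuousAt_deriv {j : Fin C.n} {t : ℝ} (ht : t ∈ C.regular j) :
    ContinuousAt (deriv (C.γ j)) t := by
  have h := (C.contDiffAt j t ht).continuousAt_fderiv one_ne_zero
  have h2 : deriv (C.γ j) = fun t => fderiv ℝ (C.γ j) t 1 := by simp
  rw [h2]; fun_prop

/-- The regular part is the image of a subset of the real line, a null set of the plane, under the
real differentiable map w ↦ γ(Re w), and differentiable maps between spaces of equal dimension
preserve null sets. The remaining points are countable. -/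
lemma volume_carrier : volume C.carrier = 0 := by
  have hsub : C.carrier ⊆ C.exceptional ∪ ⋃ j, C.γ j '' C.regular j := by
    intro z hz; obtain ⟨j, t, ht, rfl⟩ := Set.mem_iUnion.1 hz; by_cases h : t ∈ C.regular j
    · aesop
    · exact Or.inl (Set.mem_iUnion.2 ⟨j, t, ⟨ht, h⟩, rfl⟩)
  refine measure_mono_null hsub (measure_union_null (C.countable_exceptional.measure_zero _) ?_)
  refine measure_iUnion_null fun j => ?_
  have hline : volume {w : ℂ | w.im = 0} = 0 := by
    have := addHaar_submodule (volume : Measure ℂ) (LinearMap.ker imLm) (by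
      intro h; have : I ∈ LinearMap.ker imLm := h ▸ Submodule.mem_top; simp at this)
    bound
  have himg : C.γ j '' C.regular j ⊆
      (fun w : ℂ => C.γ j w.re) '' {w : ℂ | w.im = 0 ∧ w.re ∈ C.regular j} := by
    rintro _ ⟨t, ht, rfl⟩; exact ⟨t, ⟨by simp, by simpa using ht⟩, by simp⟩
  refine measure_mono_null himg (addHaar_image_eq_zero_of_differentiableOn_of_addHaar_eq_zero _
    ?_ (measure_mono_null (fun w hw => hw.1) hline))
  intro w hw; exact ((C.differentiableAt hw.2).comp w
    Complex.reCLM.differentiableAt).differentiableWithinAt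

lemma dense_compl_carrier : Dense C.carrierᶜ :=
  dense_of_ae (μ := volume) (p := fun z => z ∈ C.carrierᶜ)
    (by simpa [ae_iff] using C.volume_carrier)

lemma neBot_nhdsWithin_compl (z : ℂ) : (𝓝[C.carrierᶜ] z).NeBot :=
  mem_closure_iff_nhdsWithin_neBot.1 (C.dense_compl_carrier z)

/-! ### Straightening charts -/

/-- The map `t + iε ↦ γ(t) + ε i γ'(t0)`. -/
def straighten (j : Fin C.n) (t0 : ℝ) (w : ℂ) : ℂ :=
  C.γ j w.re + (w.im : ℂ) * (I * deriv (C.γ j) t0)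

@[simp] lemma straighten_ofReal (j : Fin C.n) (t0 t : ℝ) :
    C.straighten j t0 (t : ℂ) = C.γ j t := by simp [straighten]

/-- On the square about `t0` the map `straighten` is close to its linear part, and it meets the
contour only in the real points of the square. -/
structure IsChart (j : Fin C.n) (t0 η : ℝ) : Prop where
  pos : 0 < η
  sub : Set.Icc (t0 - η) (t0 + η) ⊆ C.regular j
  approx : ∀ s ∈ Set.Icc (t0 - η) (t0 + η), ∀ t ∈ Set.Icc (t0 - η) (t0 + η),
    ‖C.γ j t - C.γ j s - ((t - s : ℝ) : ℂ) * deriv (C.γ j) t0‖ ≤ ‖deriv (C.γ j) t0‖ / 4 * |t - s|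
  deriv_approx : ∀ t ∈ Set.Icc (t0 - η) (t0 + η),
    ‖deriv (C.γ j) t - deriv (C.γ j) t0‖ ≤ ‖deriv (C.γ j) t0‖ / 4
  sep : ∀ k, ∀ t ∈ C.dom k, ∀ w : ℂ, |w.re - t0| ≤ η → |w.im| ≤ η →
    C.γ k t = C.straighten j t0 w → k = j ∧ w = t

variable {C} {j : Fin C.n} {t0 η : ℝ}

/-- In the imaginary direction `straighten` is exactly linear, so the whole error comes from γ at
the real parts. -/
lemma straighten_sub_le (happ : ∀ s ∈ Set.Icc (t0 - η) (t0 + η), ∀ t ∈ Set.Icc (t0 - η) (t0 + η),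
      ‖C.γ j t - C.γ j s - ((t - s : ℝ) : ℂ) * deriv (C.γ j) t0‖ ≤
      ‖deriv (C.γ j) t0‖ / 4 * |t - s|) {w w' : ℂ}
    (hw : w.re ∈ Set.Icc (t0 - η) (t0 + η)) (hw' : w'.re ∈ Set.Icc (t0 - η) (t0 + η)) :
    ‖C.straighten j t0 w - C.straighten j t0 w' - (w - w') * deriv (C.γ j) t0‖ ≤
      ‖deriv (C.γ j) t0‖ / 4 * ‖w - w'‖ := by
  have h1 : C.straighten j t0 w - C.straighten j t0 w' - (w - w') * deriv (C.γ j) t0 =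
      C.γ j w.re - C.γ j w'.re - ((w.re - w'.re : ℝ) : ℂ) * deriv (C.γ j) t0 := by
    unfold straighten; push_cast; grind [re_add_im]
  rw [h1]; refine (happ _ hw' _ hw).trans ?_; gcongr; simpa using abs_re_le_norm (w - w')

lemma norm_le_straighten_sub
    (happ : ∀ s ∈ Set.Icc (t0 - η) (t0 + η), ∀ t ∈ Set.Icc (t0 - η) (t0 + η),
      ‖C.γ j t - C.γ j s - ((t - s : ℝ) : ℂ) * deriv (C.γ j) t0‖ ≤
      ‖deriv (C.γ j) t0‖ / 4 * |t - s|) {w w' : ℂ}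
    (hw : w.re ∈ Set.Icc (t0 - η) (t0 + η)) (hw' : w'.re ∈ Set.Icc (t0 - η) (t0 + η)) :
    3 / 4 * ‖deriv (C.γ j) t0‖ * ‖w - w'‖ ≤ ‖C.straighten j t0 w - C.straighten j t0 w'‖ ∧
    ‖C.straighten j t0 w - C.straighten j t0 w'‖ ≤ 5 / 4 * ‖deriv (C.γ j) t0‖ * ‖w - w'‖ := by
  have h := straighten_sub_le happ hw hw'; have h2 := norm_sub_norm_le ((w - w') * deriv (C.γ j) t0)
    (C.straighten j t0 w - C.straighten j t0 w')
  grind [norm_sub_norm_le, norm_mul, norm_sub_rev]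

lemma mem_Icc_of_abs {a b c : ℝ} (h : |a - b| ≤ c) : a ∈ Set.Icc (b - c) (b + c) := by grind

/-- Charts exist at the regular points. -/
lemma exists_isChart (ht0 : t0 ∈ C.regular j) : ∃ δ > 0, ∀ η, 0 < η → η ≤ δ → C.IsChart j t0 η := by
  set τ := deriv (C.γ j) t0 with hτ; have hτ0 : τ ≠ 0 := C.deriv_ne_zero j t0 ht0
  have hτp : 0 < ‖τ‖ := norm_pos_iff.2 hτ0
  have hstrict := ((C.contDiffAt j t0 ht0).hasStrictDerivAt one_ne_zero).hasStrictFDerivAt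
  obtain ⟨s, hs, hsapp⟩ := hstrict.approximates_deriv_on_nhds
    (c := ‖τ‖₊ / 4) (Or.inr (div_pos (nnnorm_pos.2 hτ0) (by norm_num)))
  have hder : ∀ᶠ t in 𝓝 t0, ‖deriv (C.γ j) t - τ‖ < ‖τ‖ / 4 := by
    have := (C.continuousAt_deriv ht0).tendsto; simp_all [dist_eq_norm, Metric.tendsto_nhds]
  obtain ⟨δ, hδ, hball⟩ := Metric.mem_nhds_iff.1
    (inter_mem (inter_mem hs hder) ((C.isOpen_regular j).mem_nhds ht0))
  set δ' := δ / 2 with hδ'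
  have hIcc : ∀ η ≤ δ', ∀ t ∈ Set.Icc (t0 - η) (t0 + η), t ∈ ball t0 δ := by
    grind [mem_ball_iff_norm, norm_eq_abs]
  have happ : ∀ η ≤ δ', ∀ s ∈ Set.Icc (t0 - η) (t0 + η), ∀ t ∈ Set.Icc (t0 - η) (t0 + η),
      ‖C.γ j t - C.γ j s - ((t - s : ℝ) : ℂ) * τ‖ ≤ ‖τ‖ / 4 * |t - s| := by
    intro η hη s hs t ht
    have := hsapp t (hball (hIcc η hη t ht)).1.1 s (hball (hIcc η hη s hs)).1.1; bound
  -- The part of the contour outside the arc about `t0`. It is closed and misses γ(t0), so a disc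
  -- about γ(t0) meets the contour only in the arc; this gives the separation property.
  set A : Set ℂ := ⋃ k, C.γ k '' (C.dom k \ {t | k = j ∧ t ∈ Set.Ioo (t0 - δ') (t0 + δ')}) with hA
  have hAclosed : IsClosed A := by
    refine isClosed_iUnion_of_finite fun k => C.isClosed_image k ?_ Set.sdiff_subset
    refine (C.dom_closed k).sdiff ?_; by_cases h : k = j
    · simpa [h] using! (isOpen_Ioo : IsOpen (Set.Ioo (t0 - δ') (t0 + δ')))
    · simp [h]
  have hnot : C.γ j t0 ∉ A := by
    intro h; obtain ⟨k, t, ⟨ht, ht'⟩, htγ⟩ := Set.mem_iUnion.1 h; by_cases hkj : k = j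
    · subst hkj; have hne : t ≠ t0 := by grind
      -- Two parameters with the same point are the two ends of the interval, while `t0` is
      -- interior.
      have hint := ht0.1; rcases lt_or_gt_of_ne hne with hlt | hlt
      · have := C.simple k t ht t0 (C.regular_subset_dom k ht0) hlt htγ; grind [interior_Icc]
      · have := C.simple k t0 (C.regular_subset_dom k ht0) t ht hlt htγ.symm; grind [interior_Icc]
    · exact Set.disjoint_left.1 (C.disjoint k j hkj) ⟨t, ht, htγ⟩
        ⟨t0, C.regular_subset_dom j ht0, rfl⟩
  obtain ⟨ρ, hρ, hρA⟩ := Metric.mem_nhds_iff.1 (hAclosed.isOpen_compl.mem_nhds hnot)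
  refine ⟨min δ' (ρ / (4 * ‖τ‖)), lt_min (by positivity) (by positivity), fun η hη hηle => ?_⟩
  have hη1 : η ≤ δ' := by grind
  have hη2 : η * (4 * ‖τ‖) ≤ ρ := (le_div_iff₀ (by positivity)).1 (hηle.trans (min_le_right _ _))
  refine ⟨hη, fun t ht => (hball (hIcc η hη1 t ht)).2, happ η hη1,
    fun t ht => (hball (hIcc η hη1 t ht)).1.2.le, ?_⟩
  intro k t ht w hw1 hw2 hγ; have hwI := mem_Icc_of_abs (hw1.trans hη1)
  have h0I : ((t0 : ℂ)).re ∈ Set.Icc (t0 - δ') (t0 + δ') := by simp; grind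
  have hb := (norm_le_straighten_sub (happ δ' le_rfl) hwI h0I).2
  have hwn : ‖w - t0‖ ≤ 2 * η := by
    have := norm_le_abs_re_add_abs_im (w - t0); simp at this; linarith
  have hlt : ‖C.γ k t - C.γ j t0‖ < ρ := by rw [straighten_ofReal, ← hγ] at hb; nlinarith
  have hnA : C.γ k t ∉ A := hρA (by rwa [mem_ball_iff_norm])
  have hkt : k = j ∧ t ∈ Set.Ioo (t0 - δ') (t0 + δ') := by grind [mem_iUnion]
  obtain ⟨rfl, htI⟩ := hkt; refine ⟨rfl, ?_⟩
  have h3 := (norm_le_straighten_sub (happ δ' le_rfl) hwI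
    (show ((t : ℂ)).re ∈ Set.Icc (t0 - δ') (t0 + δ') from Set.Ioo_subset_Icc_self htI)).1
  rw [straighten_ofReal, hγ, sub_self, norm_zero] at h3
  have h4 : ‖w - t‖ ≤ 0 := by
    by_contra hc; have : 0 < 3 / 4 * ‖τ‖ * ‖w - t‖ := by bound
    linarith
  exact sub_eq_zero.1 (norm_le_zero_iff.1 h4)

namespace IsChart

lemma regular_center (h : C.IsChart j t0 η) : t0 ∈ C.regular j :=
  h.sub ⟨by linarith [h.pos], by linarith [h.pos]⟩

lemma deriv_ne (h : C.IsChart j t0 η) : deriv (C.γ j) t0 ≠ 0 :=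
  C.deriv_ne_zero j t0 h.regular_center

lemma norm_deriv_pos (h : C.IsChart j t0 η) : 0 < ‖deriv (C.γ j) t0‖ := norm_pos_iff.2 h.deriv_ne

lemma lower (h : C.IsChart j t0 η) {w w' : ℂ} (hw : |w.re - t0| ≤ η) (hw' : |w'.re - t0| ≤ η) :
    3 / 4 * ‖deriv (C.γ j) t0‖ * ‖w - w'‖ ≤ ‖C.straighten j t0 w - C.straighten j t0 w'‖ :=
  (norm_le_straighten_sub h.approx (mem_Icc_of_abs hw) (mem_Icc_of_abs hw')).1

lemma upper (h : C.IsChart j t0 η) {w w' : ℂ} (hw : |w.re - t0| ≤ η) (hw' : |w'.re - t0| ≤ η) :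
    ‖C.straighten j t0 w - C.straighten j t0 w'‖ ≤ 5 / 4 * ‖deriv (C.γ j) t0‖ * ‖w - w'‖ :=
  (norm_le_straighten_sub h.approx (mem_Icc_of_abs hw) (mem_Icc_of_abs hw')).2

lemma injOn (h : C.IsChart j t0 η) {w w' : ℂ} (hw : |w.re - t0| ≤ η) (hw' : |w'.re - t0| ≤ η)
    (heq : C.straighten j t0 w = C.straighten j t0 w') : w = w' := by
  have h1 := h.lower hw hw'; rw [heq, sub_self, norm_zero] at h1; have h2 := h.norm_deriv_pos
  by_contra hne; have : 0 < ‖w - w'‖ := norm_pos_iff.2 (sub_ne_zero.2 hne)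
  have : 0 < 3 / 4 * ‖deriv (C.γ j) t0‖ * ‖w - w'‖ := by positivity
  linarith

/-- The chart is a local homeomorphism. -/
lemma map_nhds (h : C.IsChart j t0 η) {w : ℂ} (hw : |w.re - t0| < η) :
    map (C.straighten j t0) (𝓝 w) = 𝓝 (C.straighten j t0 w) := by
  set τ := deriv (C.γ j) t0; have hτ : τ ≠ 0 := h.deriv_ne; set S : Set ℂ := {w | |w.re - t0| < η}
  have hS : IsOpen S := isOpen_lt (by fun_prop) continuous_const
  -- After division by γ'(t0) the chart is within 1/4 of the identity in the Lipschitz sense, and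
  -- the quantitative open mapping theorem applies.
  have happ : ApproximatesLinearOn (fun w => C.straighten j t0 w * τ⁻¹)
      ((ContinuousLinearEquiv.refl ℂ ℂ : ℂ ≃L[ℂ] ℂ) : ℂ →L[ℂ] ℂ) S (1 / 4) := by
    intro x hx y hy
    have h1 := straighten_sub_le h.approx (mem_Icc_of_abs (le_of_lt hx)) (mem_Icc_of_abs (le_of_lt hy))
    have h2 : C.straighten j t0 x * τ⁻¹ - C.straighten j t0 y * τ⁻¹ - (x - y) =
        (C.straighten j t0 x - C.straighten j t0 y - (x - y) * τ) * τ⁻¹ := by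
      field_simp
    simp; rw [h2, norm_mul, norm_inv]; have hτp := h.norm_deriv_pos
    rw [← div_eq_mul_inv, div_le_iff₀ hτp]; grind [le_of_eq]
  have h3 := happ.map_nhds_eq (ContinuousLinearEquiv.refl ℂ ℂ).toNonlinearRightInverse
    (hS.mem_nhds hw) (Or.inr (by
      have : ((ContinuousLinearEquiv.refl ℂ ℂ).toNonlinearRightInverse).nnnorm = 1 := by
        change ‖((ContinuousLinearEquiv.refl ℂ ℂ).symm : ℂ →L[ℂ] ℂ)‖₊ = 1; simp
      rw [this]; linarith))
  have h4 : C.straighten j t0 = (fun z => z * τ) ∘ fun w => C.straighten j t0 w * τ⁻¹ := by grind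
  conv_lhs => rw [h4, ← Filter.map_map, h3]
  have h5 := (Homeomorph.mulRight₀ τ hτ).map_nhds_eq (C.straighten j t0 w * τ⁻¹); simp at h5; grind

lemma continuousAt (h : C.IsChart j t0 η) {w : ℂ} (hw : |w.re - t0| < η) :
    ContinuousAt (C.straighten j t0) w := (h.map_nhds hw).le

lemma mem_carrier_iff (h : C.IsChart j t0 η) {w : ℂ} (hw : |w.re - t0| ≤ η) (hw' : |w.im| ≤ η) :
    C.straighten j t0 w ∈ C.carrier ↔ w.im = 0 := by
  constructor
  · intro hmem; obtain ⟨k, t, ht, hγ⟩ := Set.mem_iUnion.1 hmem; rw [(h.sep k t ht w hw hw' hγ).2]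
    simp
  · intro him; have : w = (w.re : ℂ) := Complex.ext rfl (by simpa using him)
    rw [this, straighten_ofReal]
    exact C.mem_carrier (C.regular_subset_dom j (h.sub (mem_Icc_of_abs hw)))

/-- If the images under two overlapping charts agree, then the points lie on the same side. -/
lemma side (h : C.IsChart j t0 η) {t η' : ℝ} (ht : t ∈ Set.Icc (t0 - η) (t0 + η)) {u w : ℂ}
    (hu : |u.re - t0| ≤ η) (hw : |w.re - t0| ≤ η)
    (heq : C.straighten j t0 u = C.straighten j t w) {σ : ℝ} (hσ : σ ^ 2 = 1)
    (hpos : 0 < σ * u.im) : 0 < σ * w.im := by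
  set τ := deriv (C.γ j) t0 with hτ; have hτ0 : τ ≠ 0 := h.deriv_ne
  have hτp : 0 < ‖τ‖ := h.norm_deriv_pos
  have h1 := h.approx _ (mem_Icc_of_abs hw) _ (mem_Icc_of_abs hu); have h2 := h.deriv_approx t ht
  -- In units of γ'(t0), `e` is the error of the secant and `e'` the deviation of the normal
  -- direction. The real part of the equation bounds |Re u - Re w| by |Im w|/3; then the errors in
  -- the imaginary part add up to less than |Im w|, too little to reverse the sign.
  set e := (C.γ j u.re - C.γ j w.re - ((u.re - w.re : ℝ) : ℂ) * τ) / τ with he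
  set e' := ((deriv (C.γ j) t - τ) / τ) * I with he'
  have hen : ‖e‖ ≤ |u.re - w.re| / 4 := by rw [he, norm_div, div_le_iff₀ hτp]; linarith
  have hen' : ‖e'‖ ≤ 1 / 4 := by
    rw [he', norm_mul, norm_I, mul_one, norm_div, div_le_iff₀ hτp]; linarith
  have hkey : ((u.re - w.re : ℝ) : ℂ) + e + u.im * I = w.im * I + w.im * e' := by
    unfold straighten at heq; grind
  have hre := congrArg re hkey; have him := congrArg im hkey; simp at hre him
  have r1 := abs_re_le_norm e; have r2 := abs_im_le_norm e; have r3 := abs_re_le_norm e'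
  have r4 := abs_im_le_norm e'; by_contra hcon; have hσabs : |σ| = 1 := by grind
  have hX : |u.re - w.re| ≤ |w.im| / 4 + |u.re - w.re| / 4 := by
    have : u.re - w.re = w.im * e'.re - e.re := by linarith
    calc |u.re - w.re| = |w.im * e'.re - e.re| := by rw [← this]
      _ ≤ |w.im * e'.re| + |e.re| := abs_sub _ _
      _ ≤ |w.im| * (1 / 4) + |u.re - w.re| / 4 := by rw [abs_mul]; bound
      _ = _ := by ring
  have hwabs : σ * w.im = -|w.im| := by grind
  have h5 : σ * u.im = σ * w.im + σ * (w.im * e'.im) - σ * e.im := by grind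
  have h6 : |σ * (w.im * e'.im)| ≤ |w.im| * (1 / 4) := by
    rw [abs_mul, hσabs, one_mul, abs_mul]; bound
  have h7 : |σ * e.im| ≤ |u.re - w.re| / 4 := by grind
  grind

end IsChart

/-- The sign σ = ±1 selects the side, so that one argument serves both. -/
lemma nhdsWithin_side {σ : ℝ} (hσ : σ ^ 2 = 1) (t : ℝ) : 𝓝[{w : ℂ | 0 < σ * w.im}] (t : ℂ) =
    map (fun p : ℝ × ℝ => (p.1 : ℂ) + σ * p.2 * I) (𝓝 t ×ˢ 𝓝[>] 0) := by
  have hσ0 : σ ≠ 0 := by grind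
  have h3 : 𝓝 t ×ˢ 𝓝[>] (0 : ℝ) = 𝓝[{p : ℝ × ℝ | 0 < p.2}] (t, 0) := by
    rw [← nhdsWithin_univ, ← nhdsWithin_prod_eq]; congr 1; ext p; simp
  set φ : ℝ × ℝ ≃ₜ ℂ := ((Homeomorph.refl ℝ).prodCongr (Homeomorph.mulLeft₀ σ hσ0)).trans
    Complex.equivRealProdCLM.symm.toHomeomorph
  have hφ : ⇑φ = fun p => (p.1 : ℂ) + σ * p.2 * I := by ext p; simp [φ, equivRealProdCLM_symm_apply]
  rw [h3, ← hφ, φ.isInducing.map_nhdsWithin_eq]; congr 1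
  · simp [hφ]
  · ext w; constructor
    · intro hw; refine ⟨(w.re, σ * w.im), hw, ?_⟩
      rw [hφ]; apply Complex.ext <;> simp; grind
    rintro ⟨p, hp, rfl⟩; simpa [hφ, ← mul_assoc, ← sq, hσ] using hp

lemma leftNhds_eq (j : Fin C.n) (t : ℝ) :
    C.leftNhds (j, t) = map (C.straighten j t) (𝓝[{w | 0 < w.im}] (t : ℂ)) := by
  have h := nhdsWithin_side (σ := 1) (by norm_num) t
  simp only [one_mul] at h; rw [h, Filter.map_map, leftNhds]; congr 1; ext p; simp [straighten, vel]

lemma rightNhds_eq (j : Fin C.n) (t : ℝ) :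
    C.rightNhds (j, t) = map (C.straighten j t) (𝓝[{w | w.im < 0}] (t : ℂ)) := by
  have h := nhdsWithin_side (σ := -1) (by norm_num) t
  simp only [neg_mul, one_mul, neg_pos] at h
  rw [h, Filter.map_map, rightNhds]; congr 1; ext p; simp [straighten, vel, sub_eq_add_neg]

namespace IsChart

/-- The one-sided filter at the parameter t is defined with the normal at t. By `IsChart.side` a
single chart centred at `t0` may be used for all nearby t. -/
lemma tendsto_side (h : C.IsChart j t0 η) {t : ℝ} (ht : |t - t0| < η) {σ : ℝ} (hσ : σ ^ 2 = 1) :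
    Tendsto (C.straighten j t0) (𝓝[{w | 0 < σ * w.im}] (t : ℂ))
      (map (C.straighten j t) (𝓝[{w | 0 < σ * w.im}] (t : ℂ))) := by
  obtain ⟨δ, hδ, hch⟩ := exists_isChart (h.sub (mem_Icc_of_abs ht.le))
  have hmap := (hch δ hδ le_rfl).map_nhds (w := t) (by simpa using hδ)
  rw [straighten_ofReal] at hmap; intro s hs
  rw [Filter.mem_map, mem_nhdsWithin_iff_exists_mem_nhds_inter] at hs; obtain ⟨V, hV, hVs⟩ := hs
  have hV2 : V ∩ {w : ℂ | |w.re - t0| < η} ∈ 𝓝 (t : ℂ) := by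
    refine inter_mem hV ((isOpen_lt (by fun_prop) continuous_const).mem_nhds ?_)
    simpa using ht
  have h1 : C.straighten j t '' (V ∩ {w : ℂ | |w.re - t0| < η}) ∈ 𝓝 (C.γ j t) := by
    rw [← hmap]; exact image_mem_map hV2
  have h2 := (h.continuousAt (w := (t : ℂ)) (by simpa using ht))
  rw [ContinuousAt, straighten_ofReal] at h2; have h3 : {w : ℂ | |w.re - t0| < η} ∈ 𝓝 (t : ℂ) :=
    by simp_all
  rw [Filter.mem_map]
  filter_upwards [nhdsWithin_le_nhds (h2 h1), nhdsWithin_le_nhds h3, self_mem_nhdsWithin]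
    with u hu1 hu2 hu3
  obtain ⟨w, ⟨hwV, hw2⟩, hwu⟩ := hu1; rw [Set.mem_preimage, ← hwu]; refine hVs ⟨hwV, ?_⟩
  exact h.side (η' := δ) (mem_Icc_of_abs ht.le) (le_of_lt hu2) (le_of_lt hw2) hwu.symm hσ hu3

lemma tendsto_left (h : C.IsChart j t0 η) {t : ℝ} (ht : |t - t0| < η) :
    Tendsto (C.straighten j t0) (𝓝[{w | 0 < w.im}] (t : ℂ)) (C.leftNhds (j, t)) := by
  have := h.tendsto_side ht (σ := 1) (by norm_num)
  simp at this; rwa [leftNhds_eq]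

lemma tendsto_right (h : C.IsChart j t0 η) {t : ℝ} (ht : |t - t0| < η) :
    Tendsto (C.straighten j t0) (𝓝[{w | w.im < 0}] (t : ℂ)) (C.rightNhds (j, t)) := by
  have := h.tendsto_side ht (σ := -1) (by norm_num)
  simp at this; rwa [rightNhds_eq]

end IsChart

end Contour

/-! ### Local integrability of negative powers -/

lemma locallyIntegrable_abs_rpow (c : ℝ) :
    LocallyIntegrable (fun t : ℝ => |t - c| ^ (-(1 / 2) : ℝ)) volume := by
  have h0 : LocallyIntegrable (fun t : ℝ => |t| ^ (-(1 / 2) : ℝ)) volume := by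
    refine locallyIntegrable_of_norm_le_rpow (C := 1) (α := 1 / 2) (by simp) (by norm_num)
      (ae_of_all _ fun t => ?_)
      (by exact ((continuous_abs.measurable).pow_const _).aestronglyMeasurable)
    rw [one_mul, norm_of_nonneg (by positivity), norm_eq_abs]
  intro x; obtain ⟨U, hU, hint⟩ := h0 (x - c)
  refine ⟨(fun t => t - c) ⁻¹' U, (by fun_prop : Continuous fun t : ℝ => t - c).continuousAt hU, ?_⟩
  exact ((measurePreserving_sub_right volume c).integrableOn_comp_preimage
    (MeasurableEquiv.subRight c).measurableEmbedding).2 hint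

lemma locallyIntegrable_inv_norm (c : ℂ) : LocallyIntegrable (fun z : ℂ => ‖z - c‖⁻¹) volume := by
  have h0 : LocallyIntegrable (fun z : ℂ => ‖z‖⁻¹) volume := by
    refine locallyIntegrable_of_norm_le_rpow (C := 1) (α := 1) (by simp)
      (by simp) (ae_of_all _ fun t => ?_) (by fun_prop)
    simp [rpow_neg_one]
  intro x; obtain ⟨U, hU, hint⟩ := h0 (x - c)
  refine ⟨(fun t => t - c) ⁻¹' U, (by fun_prop : Continuous fun t : ℂ => t - c).continuousAt hU, ?_⟩
  exact ((measurePreserving_sub_right volume c).integrableOn_comp_preimage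
    (MeasurableEquiv.subRight c).measurableEmbedding).2 hint

/-! ### Measure and measurability on the parameter space -/

namespace Contour
variable (C : Contour)

/-- The parameters: a component and a real number. -/
abbrev Param := Fin C.n × ℝ

/-- The measure `dt` on the parameter space. -/
postfix:max "ᵐ" => Contour.paramMeasure

instance : SigmaFinite Cᵐ := by unfold paramMeasure; infer_instance

/-- The parameter space `{(j, t) | t ∈ dom j}`. -/
def params : Set C.Param := {x | x.2 ∈ C.dom x.1}

lemma measurableSet_fiberwise (A : Fin C.n → Set ℝ) (hA : ∀ j, MeasurableSet (A j)) :
    MeasurableSet {x : C.Param | x.2 ∈ A x.1} := by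
  have : {x : C.Param | x.2 ∈ A x.1} = ⋃ j, ({j} : Set (Fin C.n)) ×ˢ A j := by ext ⟨j, t⟩; simp
  simp_all [MeasurableSet.iUnion, MeasurableSet.prod]

lemma measurableSet_params : MeasurableSet C.params :=
  C.measurableSet_fiberwise C.dom fun j => (C.dom_closed j).measurableSet

lemma paramMeasure_eq : Cᵐ =
    ((count : Measure (Fin C.n)).prod (volume : Measure ℝ)).restrict C.params := rfl

lemma ae_mem_params : ∀ᵐ x ∂Cᵐ, x ∈ C.params := ae_restrict_mem C.measurableSet_params

/-- The regular parameters. -/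
def regularParams : Set C.Param := {x | x.2 ∈ C.regular x.1}

lemma regularParams_subset : C.regularParams ⊆ C.params := fun x hx => C.regular_subset_dom x.1 hx

lemma ae_regular : ∀ᵐ x ∂Cᵐ, x ∈ C.regularParams := by
  have hcount : (C.params \ C.regularParams).Countable := by
    have : C.params \ C.regularParams ⊆ ⋃ j, Prod.mk j '' (C.dom j \ C.regular j) := by
      rintro ⟨j, t⟩ ⟨h1, h2⟩; aesop
    exact (countable_iUnion fun j => (C.countable_dom_diff_regular j).image _).mono this
  have h0 : Cᵐ (C.params \ C.regularParams) = 0 := by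
    refine le_antisymm ((restrict_apply_le _ _).trans (le_of_eq ?_)) zero_le
    exact hcount.measure_zero _
  filter_upwards [C.ae_mem_params, measure_eq_zero_iff_ae_notMem.1 h0] with x hx hx2; grind

lemma measurable_vel : Measurable C.vel :=
  measurable_from_prod_countable_right fun j => measurable_deriv (C.γ j)

lemma vel_ne_zero {x : C.Param} (hx : x ∈ C.regularParams) : C.vel x ≠ 0 :=
  C.deriv_ne_zero x.1 x.2 hx

lemma continuousOn_pt : ContinuousOn C.pt C.params := by
  intro x hx; obtain ⟨j, t⟩ := x; have h := C.continuousOn j t hx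
  have h1 : 𝓝[C.params] (j, t) ≤ map (Prod.mk j) (𝓝[C.dom j] t) := by
    intro s hs; rw [Filter.mem_map, mem_nhdsWithin] at hs; obtain ⟨u, hu, htu, hsub⟩ := hs
    rw [mem_nhdsWithin]; refine ⟨{j} ×ˢ u, (isOpen_discrete _).prod hu, ⟨rfl, htu⟩, ?_⟩
    rintro ⟨k, w⟩ ⟨⟨hk, hw⟩, hd⟩; aesop
  have h2 : Tendsto C.pt (map (Prod.mk j) (𝓝[C.dom j] t)) (𝓝 (C.pt (j, t))) := by bound
  exact h2.mono_left h1

lemma aemeasurable_pt : AEMeasurable C.pt Cᵐ :=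
  C.continuousOn_pt.aemeasurable C.measurableSet_params

lemma pt_mem_carrier {x : C.Param} (hx : x ∈ C.params) : C.pt x ∈ C.carrier := C.mem_carrier hx

/-- A function continuous on the contour is measurable in the parameter on measurable sets of
parameters. -/
lemma measurable_indicator_comp_pt {F : Type*} [TopologicalSpace F] [Zero F] [MeasurableSpace F]
    [BorelSpace F] {h : ℂ → F} (hh : ContinuousOn h C.carrier) {A : Set C.Param}
    (hA : MeasurableSet A) (hAp : A ⊆ C.params) :
    Measurable (A.indicator fun x => h (C.pt x)) := by
  classical
  refine ContinuousOn.measurable_piecewise ?_ continuousOn_const hA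
  exact hh.comp (C.continuousOn_pt.mono hAp) fun x hx => C.pt_mem_carrier (hAp hx)

lemma aemeasurable_comp_pt {F : Type*} [TopologicalSpace F] [MeasurableSpace F]
    [BorelSpace F] {h : ℂ → F} (hh : ContinuousOn h C.carrier) :
    AEMeasurable (fun x => h (C.pt x)) Cᵐ :=
  ContinuousOn.aemeasurable (hh.comp C.continuousOn_pt fun x hx => C.pt_mem_carrier hx)
    C.measurableSet_params

lemma restrict_arc (j : Fin C.n) {I : Set ℝ} (hI : MeasurableSet I) (hsub : I ⊆ C.dom j) :
    Cᵐ.restrict ({j} ×ˢ I) = (volume.restrict I).map (Prod.mk j) := by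
  rw [paramMeasure_eq, restrict_restrict ((measurableSet_singleton j).prod hI), Set.inter_eq_left.2]
  · rw [← prod_restrict, restrict_singleton, count_singleton, one_smul, dirac_prod]
  · rintro ⟨k, t⟩ ⟨hk, ht⟩; aesop

lemma setIntegral_arc {F : Type*} [NormedAddCommGroup F] [NormedSpace ℝ F] (j : Fin C.n)
    {I : Set ℝ} (hI : MeasurableSet I) (hsub : I ⊆ C.dom j) (φ : C.Param → F) :
    ∫ x in {j} ×ˢ I, φ x ∂Cᵐ = ∫ t in I, φ (j, t) := by
  rw [C.restrict_arc j hI hsub, (measurableEmbedding_prodMk_left j).integral_map]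

lemma integrableOn_arc_iff {F : Type*} [NormedAddCommGroup F] (j : Fin C.n)
    {I : Set ℝ} (hI : MeasurableSet I) (hsub : I ⊆ C.dom j) {φ : C.Param → F} :
    MeasureTheory.IntegrableOn φ ({j} ×ˢ I) Cᵐ ↔
      MeasureTheory.IntegrableOn (fun t => φ (j, t)) I := by
  rw [MeasureTheory.IntegrableOn, C.restrict_arc j hI hsub,
    (measurableEmbedding_prodMk_left j).integrable_map_iff]
  rfl

/-! ### Speed and distance along the contour -/

lemma eventually_lower_bound {f : ℝ → ℂ} {d : ℂ} (hd : d ≠ 0) {t0 : ℝ} {s : Set ℝ}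
    (hs : t0 ∉ s) (h : HasDerivWithinAt f d s t0) :
    ∀ᶠ t in 𝓝[s] t0, ‖d‖ / 2 * |t - t0| ≤ ‖f t - f t0‖ := by
  rw [hasDerivWithinAt_iff_tendsto_slope' hs] at h; have hlt : ‖d‖ / 2 < ‖d‖ := by simp_all
  filter_upwards [h.norm.eventually (lt_mem_nhds hlt), self_mem_nhdsWithin] with t ht hts
  rw [slope_def_module, norm_smul, norm_inv, norm_eq_abs, inv_mul_eq_div,
    lt_div_iff₀ (abs_pos.2 (by grind))] at ht
  exact ht.le

/-- Near a parameter value the speed is bounded, and the distance is at least comparable with the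
parameter distance. -/
lemma exists_local_bound (j : Fin C.n) {t0 : ℝ} (ht0 : t0 ∈ C.dom j) :
    ∃ M c : ℝ, 0 < c ∧ ∀ᶠ t in 𝓝 t0, t ∈ C.regular j → t ≠ t0 →
      ‖deriv (C.γ j) t‖ ≤ M ∧ c * |t - t0| ≤ ‖C.γ j t - C.γ j t0‖ := by
  obtain ⟨d1, hd₁, hlim1⟩ := C.deriv_right j t0 ht0
  obtain ⟨d2, hd2, hlim2⟩ := C.deriv_left j t0 ht0; have hF := C.corner_finite j (t0 - 1) (t0 + 1)
  have hcorner : ∀ᶠ t in 𝓝[≠] t0, t ∉ C.corner j := by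
    have h1 : ((C.corner j ∩ Set.Icc (t0 - 1) (t0 + 1)) \ {t0})ᶜ ∈ 𝓝 t0 :=
      (hF.subset Set.sdiff_subset).isClosed.isOpen_compl.mem_nhds fun h => h.2 rfl
    filter_upwards [nhdsWithin_le_nhds h1, self_mem_nhdsWithin,
      nhdsWithin_le_nhds (Icc_mem_nhds (show t0 - 1 < t0 by linarith)
        (show t0 < t0 + 1 by linarith))] with t h2 h3 h4 h5
    grind
  have hint : ∀ b ∈ C.dom j, ∀ a ∈ C.dom j, Set.Ioo a b ⊆ interior (C.dom j) :=
    fun b hb a ha => interior_maximal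
      (Set.Ioo_subset_Icc_self.trans ((C.dom_ordConnected j).out ha hb)) isOpen_Ioo
  have right : ∀ᶠ t in 𝓝[>] t0, t ∈ C.regular j →
      ‖deriv (C.γ j) t‖ ≤ ‖d1‖ + 1 ∧ ‖d1‖ / 2 * |t - t0| ≤ ‖C.γ j t - C.γ j t0‖ := by
    by_cases hex : ∃ b ∈ C.dom j, t0 < b
    · obtain ⟨b, hb, hlt⟩ := hex; have hIoo : Set.Ioo t0 b ∈ 𝓝[>] t0 := Ioo_mem_nhdsGT hlt
      have hreg : ∀ᶠ t in 𝓝[>] t0, t ∈ C.regular j := by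
        filter_upwards [hIoo, nhdsWithin_mono _ (fun t (ht : t0 < t) => ht.ne') hcorner]
          with t h1 h2
        exact ⟨hint b hb t0 ht0 h1, h2⟩
      have hlim : Tendsto (deriv (C.γ j)) (𝓝[>] t0) (𝓝 d1) := by
        refine hlim1.mono_left ?_; refine le_inf inf_le_left (le_principal_iff.2 ?_)
        filter_upwards [hreg, self_mem_nhdsWithin] with t h1 h2; exact ⟨h1.1, h2⟩
      -- A one-sided limit of the derivative is a one-sided derivative; being non-zero, it keeps the
      -- distance comparable with the parameter difference even at corners and endpoints.
      have hder : HasDerivWithinAt (C.γ j) d1 (Set.Ici t0) t0 := by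
        refine hasDerivWithinAt_Ici_of_tendsto_deriv (s := C.regular j ∩ Set.Ioi t0)
          (fun t ht => (C.differentiableAt ht.1).differentiableWithinAt)
          ((C.continuousOn j t0 ht0).mono fun t ht => C.regular_subset_dom j ht.1)
          (inter_mem hreg self_mem_nhdsWithin) hlim
      filter_upwards [hlim.norm.eventually (gt_mem_nhds (show ‖d1‖ < ‖d1‖ + 1 by linarith)),
        eventually_lower_bound hd₁ (by simp) (hder.mono Set.Ioi_subset_Ici_self)]
        with t h1 h2 _
      exact ⟨h1.le, h2⟩
    · push Not at hex; filter_upwards [self_mem_nhdsWithin] with t ht htr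
      grind [regular_subset_dom]
  have left : ∀ᶠ t in 𝓝[<] t0, t ∈ C.regular j →
      ‖deriv (C.γ j) t‖ ≤ ‖d2‖ + 1 ∧ ‖d2‖ / 2 * |t - t0| ≤ ‖C.γ j t - C.γ j t0‖ := by
    by_cases hex : ∃ b ∈ C.dom j, b < t0
    · obtain ⟨b, hb, hlt⟩ := hex; have hIoo : Set.Ioo b t0 ∈ 𝓝[<] t0 := Ioo_mem_nhdsLT hlt
      have hreg : ∀ᶠ t in 𝓝[<] t0, t ∈ C.regular j := by
        filter_upwards [hIoo, nhdsWithin_mono _ (fun t (ht : t < t0) => ht.ne) hcorner] with t h1 h2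
        exact ⟨hint t0 ht0 b hb h1, h2⟩
      have hlim : Tendsto (deriv (C.γ j)) (𝓝[<] t0) (𝓝 d2) := by
        refine hlim2.mono_left ?_; refine le_inf inf_le_left (le_principal_iff.2 ?_)
        filter_upwards [hreg, self_mem_nhdsWithin] with t h1 h2; exact ⟨h1.1, h2⟩
      have hder : HasDerivWithinAt (C.γ j) d2 (Set.Iic t0) t0 := by
        refine hasDerivWithinAt_Iic_of_tendsto_deriv (s := C.regular j ∩ Set.Iio t0)
          (fun t ht => (C.differentiableAt ht.1).differentiableWithinAt)
          ((C.continuousOn j t0 ht0).mono fun t ht => C.regular_subset_dom j ht.1)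
          (inter_mem hreg self_mem_nhdsWithin) hlim
      filter_upwards [hlim.norm.eventually (gt_mem_nhds (show ‖d2‖ < ‖d2‖ + 1 by linarith)),
        eventually_lower_bound hd2 (by simp) (hder.mono Set.Iio_subset_Iic_self)]
        with t h1 h2 _
      exact ⟨h1.le, h2⟩
    · push Not at hex; filter_upwards [self_mem_nhdsWithin] with t ht htr
      grind [regular_subset_dom]
  refine ⟨max (‖d1‖ + 1) (‖d2‖ + 1), min (‖d1‖ / 2) (‖d2‖ / 2),
    lt_min (by simpa using hd₁) (by simpa using hd2), ?_⟩
  rw [eventually_nhdsWithin_iff] at right left; filter_upwards [right, left] with t h1 h2 htr hne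
  rcases lt_or_gt_of_ne hne with hlt | hlt
  · obtain ⟨h3, h4⟩ := h2 hlt htr; refine ⟨h3.trans (le_max_right _ _), le_trans ?_ h4⟩; bound
  · obtain ⟨h3, h4⟩ := h1 hlt htr; refine ⟨h3.trans (le_max_left _ _), le_trans ?_ h4⟩; bound

/-- By compactness the question is local. Where γ(t0) = p, the distance is at least c|t - t0| and |t
- t0|^(-1/2) is integrable; elsewhere the distance to p is bounded below. The speed is locally
bounded in either case. -/
lemma integrableOn_speed_mul_rpow (j : Fin C.n) (p : ℂ) (a b : ℝ) : MeasureTheory.IntegrableOn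
      (fun t => ‖deriv (C.γ j) t‖ * ‖C.γ j t - p‖ ^ (-(1 / 2) : ℝ))
      (C.dom j ∩ Set.Icc a b) := by
  have hmeas : AEStronglyMeasurable
      (fun t => ‖deriv (C.γ j) t‖ * ‖C.γ j t - p‖ ^ (-(1 / 2) : ℝ)) (volume.restrict (C.dom j)) := by
    have h1 := (C.continuousOn j).aemeasurable (μ := volume) (C.dom_closed j).measurableSet
    have : AEMeasurable (fun t => ‖deriv (C.γ j) t‖ * ‖C.γ j t - p‖ ^ (-(1 / 2) : ℝ))
        (volume.restrict (C.dom j)) :=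
      (measurable_deriv (C.γ j)).norm.aemeasurable.mul ((h1.sub_const p).norm.pow_const _)
    exact this.aestronglyMeasurable
  have hregae : ∀ᵐ t ∂(volume.restrict (C.dom j)), t ∈ C.regular j := by
    rw [ae_restrict_iff' (C.dom_closed j).measurableSet]
    have h0 : volume (C.dom j \ C.regular j) = 0 := (C.countable_dom_diff_regular j).measure_zero _
    grind [measure_eq_zero_iff_ae_notMem]
  have key : MeasureTheory.IntegrableOn
      (fun t => ‖deriv (C.γ j) t‖ * ‖C.γ j t - p‖ ^ (-(1 / 2) : ℝ))
      ((C.dom j ∩ Set.Icc a b) ∩ C.dom j) := by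
    refine (isCompact_Icc.inter_left (C.dom_closed j)).induction_on
      (p := fun S => MeasureTheory.IntegrableOn
        (fun t => ‖deriv (C.γ j) t‖ * ‖C.γ j t - p‖ ^ (-(1 / 2) : ℝ)) (S ∩ C.dom j)) ?_ ?_ ?_ ?_
    · simp
    · grind [IntegrableOn.mono_set]
    · grind [Set.union_inter_distrib_right, IntegrableOn.union]
    · rintro t0 ⟨ht0, -⟩; obtain ⟨M, c, hc, hev⟩ := C.exists_local_bound j ht0
      obtain ⟨B, hB0, hB⟩ : ∃ B : ℝ, 0 ≤ B ∧ ∀ᶠ t in 𝓝[C.dom j] t0, t ∈ C.regular j → t ≠ t0 →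
          ‖C.γ j t - p‖ ^ (-(1 / 2) : ℝ) ≤ B + c ^ (-(1 / 2) : ℝ) * |t - t0| ^ (-(1 / 2) : ℝ) := by
        by_cases hp : C.γ j t0 = p
        · refine ⟨0, le_rfl, ?_⟩; filter_upwards [nhdsWithin_le_nhds hev] with t h1 h2 h3
          obtain ⟨-, h4⟩ := h1 h2 h3; rw [zero_add, ← mul_rpow hc.le (abs_nonneg _), ← hp]
          grind [rpow_le_rpow_of_nonpos, mul_pos]
        · have hpos : 0 < ‖C.γ j t0 - p‖ := norm_pos_iff.2 (sub_ne_zero.2 hp)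
          refine ⟨(‖C.γ j t0 - p‖ / 2) ^ (-(1 / 2) : ℝ), by positivity, ?_⟩
          have h1 : Tendsto (fun t => ‖C.γ j t - p‖) (𝓝[C.dom j] t0) (𝓝 ‖C.γ j t0 - p‖) :=
            ((C.continuousOn j t0 ht0).sub_const p).norm
          filter_upwards [h1.eventually (lt_mem_nhds (half_lt_self hpos))] with t h2 _ _
          have h3 := rpow_le_rpow_of_nonpos (half_pos hpos) h2.le
            (show (-(1 / 2) : ℝ) ≤ 0 by norm_num)
          have : 0 ≤ c ^ (-(1 / 2) : ℝ) * |t - t0| ^ (-(1 / 2) : ℝ) := by positivity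
          linarith
      obtain ⟨U, hU, hint⟩ := locallyIntegrable_abs_rpow t0 t0
      have hset : {t | (t ∈ C.regular j → t ≠ t0 →
          ‖deriv (C.γ j) t‖ ≤ M ∧ c * |t - t0| ≤ ‖C.γ j t - C.γ j t0‖) ∧
          (t ∈ C.regular j → t ≠ t0 → ‖C.γ j t - p‖ ^ (-(1 / 2) : ℝ) ≤
            B + c ^ (-(1 / 2) : ℝ) * |t - t0| ^ (-(1 / 2) : ℝ))} ∈ 𝓝[C.dom j] t0 := by
        filter_upwards [nhdsWithin_le_nhds hev, hB] with t h1 h2; exact ⟨h1, h2⟩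
      obtain ⟨ε, hε, hball⟩ := Metric.mem_nhdsWithin_iff.1 (inter_mem hset (nhdsWithin_le_nhds hU))
      refine ⟨Metric.ball t0 ε, nhdsWithin_le_nhds (Metric.ball_mem_nhds _ hε), ?_⟩
      have hbd : MeasureTheory.IntegrableOn (fun t => M * (B + c ^ (-(1 / 2) : ℝ) *
          |t - t0| ^ (-(1 / 2) : ℝ))) (Metric.ball t0 ε ∩ C.dom j) := by
        refine Integrable.const_mul (Integrable.add ?_ (Integrable.const_mul ?_ _)) _
        · refine integrableOn_const ?_
          exact ((measure_mono Set.inter_subset_left).trans_lt measure_ball_lt_top).ne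
        · exact hint.mono_set fun t ht => (hball ht).2
      refine Integrable.mono' hbd (hmeas.mono_measure (Measure.restrict_mono
        Set.inter_subset_right le_rfl)) ?_
      have h1 := ae_mono (restrict_mono (μ := volume)
        (Set.inter_subset_right : ball t0 ε ∩ C.dom j ⊆ C.dom j) le_rfl) hregae
      filter_upwards [h1, ae_restrict_of_ae (ae_ne volume t0), ae_restrict_mem
        (Metric.isOpen_ball.measurableSet.inter (C.dom_closed j).measurableSet)] with t h3 h4 h5
      have h6 := (hball h5).1; rw [norm_of_nonneg (by positivity)]
      exact mul_le_mul (h6.1 h3 h4).1 (h6.2 h3 h4) (by positivity)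
        ((norm_nonneg _).trans (h6.1 h3 h4).1)
  grind [IntegrableOn.mono_set]

/-- On bounded parts of the contour `|λ - p|^(-1/2)` is integrable. -/
lemma integrableOn_vel_mul_rpow (p : ℂ) (R : ℝ) :
    MeasureTheory.IntegrableOn (fun x => ‖C.vel x‖ * ‖C.pt x - p‖ ^ (-(1 / 2) : ℝ))
      {x | ‖C.pt x‖ ≤ R} Cᵐ := by
  choose a b hab using fun j => C.exists_Icc_of_norm_le j R; have h1 : MeasureTheory.IntegrableOn
      (fun x => ‖C.vel x‖ * ‖C.pt x - p‖ ^ (-(1 / 2) : ℝ))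
      (⋃ j, ({j} : Set (Fin C.n)) ×ˢ (C.dom j ∩ Set.Icc (a j) (b j))) Cᵐ := by
    rw [integrableOn_finite_iUnion]; intro j
    rw [C.integrableOn_arc_iff j ((C.dom_closed j).measurableSet.inter measurableSet_Icc)
      Set.inter_subset_left]
    exact C.integrableOn_speed_mul_rpow j p _ _
  refine h1.mono_set_ae ?_; filter_upwards [C.ae_mem_params] with x hx hR
  exact Set.mem_iUnion.2 ⟨x.1, rfl, hx, hab x.1 x.2 hx hR⟩

lemma nullMeasurableSet_norm_le (R : ℝ) : NullMeasurableSet {x | ‖C.pt x‖ ≤ R} Cᵐ :=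
  nullMeasurableSet_le C.aemeasurable_pt.norm aemeasurable_const

/-- Bounded parts of the contour have finite length. -/
lemma integrableOn_norm_vel (R : ℝ) :
    MeasureTheory.IntegrableOn (fun x => ‖C.vel x‖) {x | ‖C.pt x‖ ≤ R} Cᵐ := by
  -- The auxiliary point |R| + 1 lies outside the disc, at distance at most 2(|R| + 1) from each
  -- point of it, so the weight is bounded below there.
  have h := C.integrableOn_vel_mul_rpow ((|R| + 1 : ℝ) : ℂ) R
  refine Integrable.mono' (h.const_mul ((2 * (|R| + 1)) ^ (1 / 2 : ℝ)))
    C.measurable_vel.norm.aestronglyMeasurable ?_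
  rw [ae_restrict_iff'₀ (C.nullMeasurableSet_norm_le R)]; refine ae_of_all _ fun x hx => ?_
  rw [norm_norm]
  have hp : ‖(((|R| + 1 : ℝ)) : ℂ)‖ = |R| + 1 := by grind [norm_real, norm_of_nonneg]
  have h1 : ‖C.pt x - ((|R| + 1 : ℝ) : ℂ)‖ ≤ 2 * (|R| + 1) := by
    refine (norm_sub_le _ _).trans ?_; grind
  have h2 : 0 < ‖C.pt x - ((|R| + 1 : ℝ) : ℂ)‖ := by grind [norm_sub_rev, norm_sub_norm_le]
  have h3 := rpow_le_rpow_of_nonpos h2 h1 (show (-(1 / 2) : ℝ) ≤ 0 by norm_num)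
  have h4 : (2 * (|R| + 1)) ^ (1 / 2 : ℝ) * (2 * (|R| + 1)) ^ (-(1 / 2) : ℝ) = 1 := by
    rw [← rpow_add (by positivity)]; norm_num
  calc ‖C.vel x‖ = ‖C.vel x‖ * ((2 * (|R| + 1)) ^ (1 / 2 : ℝ) *
        (2 * (|R| + 1)) ^ (-(1 / 2) : ℝ)) := by rw [h4, mul_one]
    _ ≤ ‖C.vel x‖ * ((2 * (|R| + 1)) ^ (1 / 2 : ℝ) *
        ‖C.pt x - ((|R| + 1 : ℝ) : ℂ)‖ ^ (-(1 / 2) : ℝ)) := by gcongr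
    _ = _ := by ring

end Contour

/-! ### Area integrals of `1 / |z - w|` -/

lemma volume_real_ball (c : ℂ) {R : ℝ} (hR : 0 ≤ R) : volume.real (ball c R) = π * R ^ 2 := by
  rw [Measure.real, Complex.volume_ball]; simp [ENNReal.toReal_ofReal hR, mul_comm]

lemma integrableOn_inv_norm_ball (c w : ℂ) (R : ℝ) :
    IntegrableOn (fun z : ℂ => ‖z - w‖⁻¹) (ball c R) :=
  ((locallyIntegrable_inv_norm w).integrableOn_isCompact (isCompact_closedBall c R)).mono_set
    ball_subset_closedBall

/-- The area integral of `1/|z|` over the disc of radius one. -/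
def discPotential : ℝ := ∫ z in ball (0 : ℂ) 1, ‖z‖⁻¹

lemma discPotential_nonneg : 0 ≤ discPotential := integral_nonneg fun _ => by positivity

lemma integral_inv_norm_ball_center (w : ℂ) {R : ℝ} (hR : 0 < R) :
    ∫ z in ball w R, ‖z - w‖⁻¹ = discPotential * R := by
  have h1 : ∫ z in ball w R, ‖z - w‖⁻¹ = ∫ z in ball (0 : ℂ) R, ‖z‖⁻¹ := by
    have := (measurePreserving_sub_right (volume : Measure ℂ) w).setIntegral_preimage_emb
      (MeasurableEquiv.subRight w).measurableEmbedding (fun z : ℂ => ‖z‖⁻¹) (ball 0 R)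
    rw [← this]; congr 2; ext z; simp [dist_eq_norm]
  have h2 := setIntegral_comp_smul_of_pos (volume : Measure ℂ) (fun z : ℂ => ‖z‖⁻¹) (ball 0 1) hR
  rw [_root_.smul_ball hR.ne', smul_zero, mul_one, norm_of_nonneg hR.le, finrank_real_complex] at h2
  rw [h1, discPotential]
  have h3 : ∀ z : ℂ, ‖R • z‖⁻¹ = R⁻¹ * ‖z‖⁻¹ := by grind [norm_smul, norm_of_nonneg]
  simp_rw [h3] at h2; rw [integral_const_mul, smul_eq_mul] at h2; grind

/-- `∫_{B(c, R)} dA / |z - w| ≤ const · R`. -/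
lemma integral_inv_norm_ball_le (c w : ℂ) {R : ℝ} (hR : 0 < R) :
    ∫ z in ball c R, ‖z - w‖⁻¹ ≤ (discPotential + π) * R := by
  -- Points of the disc at distance at least R from w contribute at most R⁻¹ times the area πR²; the
  -- others lie in the disc about w.
  have hpt : ∀ z : ℂ, ‖z - w‖⁻¹ ≤ (ball w R).indicator (fun z => ‖z - w‖⁻¹) z + R⁻¹ := by
    intro z; by_cases hz : z ∈ ball w R
    · rw [indicator_of_mem hz]; bound
    grind [indicator_of_notMem, zero_add, inv_anti₀, mem_ball_iff_norm]
  have hi : Integrable ((ball w R).indicator fun z : ℂ => ‖z - w‖⁻¹) :=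
    (integrable_indicator_iff Metric.isOpen_ball.measurableSet).2 (integrableOn_inv_norm_ball w w R)
  have hconst : IntegrableOn (fun _ : ℂ => R⁻¹) (ball c R) :=
    integrableOn_const measure_ball_lt_top.ne
  calc ∫ z in ball c R, ‖z - w‖⁻¹
      ≤ ∫ z in ball c R, ((ball w R).indicator (fun z => ‖z - w‖⁻¹) z + R⁻¹) :=
        integral_mono (integrableOn_inv_norm_ball c w R) (hi.integrableOn.add hconst) hpt
    _ = (∫ z in ball c R, (ball w R).indicator (fun z => ‖z - w‖⁻¹) z) + π * R := by
        rw [integral_add hi.integrableOn hconst, setIntegral_const, volume_real_ball c hR.le,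
          smul_eq_mul]
        grind
    _ ≤ discPotential * R + π * R := by
        gcongr; rw [← integral_inv_norm_ball_center w hR,
          ← integral_indicator (μ := volume) (s := ball w R) Metric.isOpen_ball.measurableSet]
        exact setIntegral_le_integral hi (ae_of_all _ fun z =>
          indicator_nonneg (fun z _ => by positivity) z)
    _ = _ := by ring

/-- `∫_{B(c, R)} dA / |z - w| ≤ const · R^(3/2) |w - c|^(-1/2)`. -/
lemma integral_inv_norm_ball_le_rpow (c w : ℂ) (hwc : w ≠ c) {R : ℝ} (hR : 0 < R) :
    ∫ z in ball c R, ‖z - w‖⁻¹ ≤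
      2 * (discPotential + 2 * π) * (R ^ (3 / 2 : ℝ) * ‖w - c‖ ^ (-(1 / 2) : ℝ)) := by
  have hd : 0 < ‖w - c‖ := norm_pos_iff.2 (sub_ne_zero.2 hwc); have hdp := discPotential_nonneg
  have hpi := pi_pos
  have hRR : R ^ (3 / 2 : ℝ) = R * R ^ (1 / 2 : ℝ) := by
    rw [show (3 / 2 : ℝ) = 1 + 1 / 2 by norm_num, rpow_add hR, rpow_one]
  -- An interpolation between the bound by R, used when w is within 2R of the centre, and the bound
  -- by R²/|w - c|, used otherwise.
  by_cases hcase : ‖w - c‖ ≤ 2 * R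
  · refine (integral_inv_norm_ball_le c w hR).trans ?_
    have h1 : 1 ≤ 2 * (R ^ (1 / 2 : ℝ) * ‖w - c‖ ^ (-(1 / 2) : ℝ)) := by
      have h2 : (2 * R) ^ (-(1 / 2) : ℝ) ≤ ‖w - c‖ ^ (-(1 / 2) : ℝ) :=
        rpow_le_rpow_of_nonpos hd hcase (by norm_num)
      have h3 : R ^ (1 / 2 : ℝ) * (2 * R) ^ (-(1 / 2) : ℝ) = (2 : ℝ) ^ (-(1 / 2) : ℝ) := by
        rw [mul_rpow (by norm_num) hR.le, mul_left_comm, ← rpow_add hR]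
        norm_num
      have h4 : (1 / 2 : ℝ) ≤ (2 : ℝ) ^ (-(1 / 2) : ℝ) := by
        have := rpow_le_rpow_of_exponent_le (show (1 : ℝ) ≤ 2 by norm_num)
          (show (-1 : ℝ) ≤ -(1 / 2) by norm_num)
        linarith
      have h5 : R ^ (1 / 2 : ℝ) * (2 * R) ^ (-(1 / 2) : ℝ) ≤
          R ^ (1 / 2 : ℝ) * ‖w - c‖ ^ (-(1 / 2) : ℝ) := by gcongr
      linarith
    rw [hRR]
    calc (discPotential + π) * R
        ≤ (discPotential + 2 * π) * R * 1 := by nlinarith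
      _ ≤ (discPotential + 2 * π) * R *
          (2 * (R ^ (1 / 2 : ℝ) * ‖w - c‖ ^ (-(1 / 2) : ℝ))) := by gcongr
      _ = _ := by ring
  · have hbd : ∀ z ∈ ball c R, ‖z - w‖⁻¹ ≤ 2 * ‖w - c‖⁻¹ := by
      intro z hz; rw [mem_ball_iff_norm] at hz
      have h1 : ‖w - c‖ / 2 ≤ ‖z - w‖ := by
        grind [norm_sub_norm_le, norm_sub_rev, sub_sub_sub_cancel_right]
      calc ‖z - w‖⁻¹ ≤ (‖w - c‖ / 2)⁻¹ := inv_anti₀ (by positivity) h1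
        _ = _ := by ring
    have h2 : ∫ z in ball c R, ‖z - w‖⁻¹ ≤ ∫ z in ball c R, 2 * ‖w - c‖⁻¹ :=
      setIntegral_mono_on (integrableOn_inv_norm_ball c w R)
        (integrableOn_const measure_ball_lt_top.ne) Metric.isOpen_ball.measurableSet hbd
    rw [setIntegral_const, volume_real_ball c hR.le, smul_eq_mul] at h2; refine h2.trans ?_
    rw [hRR]
    have h3 : ‖w - c‖⁻¹ = ‖w - c‖ ^ (-(1 / 2) : ℝ) * ‖w - c‖ ^ (-(1 / 2) : ℝ) := by
      rw [← rpow_add hd, ← rpow_neg_one]; norm_num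
    have h4 : ‖w - c‖ ^ (-(1 / 2) : ℝ) ≤ R ^ (-(1 / 2) : ℝ) :=
      rpow_le_rpow_of_nonpos hR (by linarith) (by norm_num)
    have h5 : R ^ (1 / 2 : ℝ) * R ^ (-(1 / 2) : ℝ) = 1 := by rw [← rpow_add hR]; norm_num
    have h6 : R = R ^ (1 / 2 : ℝ) * R ^ (1 / 2 : ℝ) := by rw [← rpow_add hR]; norm_num
    have h7 : R * ‖w - c‖ ^ (-(1 / 2) : ℝ) ≤ R ^ (1 / 2 : ℝ) := by
      calc R * ‖w - c‖ ^ (-(1 / 2) : ℝ) ≤ R * R ^ (-(1 / 2) : ℝ) := by gcongr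
        _ = R ^ (1 / 2 : ℝ) * (R ^ (1 / 2 : ℝ) * R ^ (-(1 / 2) : ℝ)) := by grind
        _ = _ := by rw [h5, mul_one]
    rw [h3]
    calc π * R ^ 2 * (2 * (‖w - c‖ ^ (-(1 / 2) : ℝ) * ‖w - c‖ ^ (-(1 / 2) : ℝ)))
        = 2 * π * R * (R * ‖w - c‖ ^ (-(1 / 2) : ℝ)) * ‖w - c‖ ^ (-(1 / 2) : ℝ) := by ring
      _ ≤ 2 * π * R * R ^ (1 / 2 : ℝ) * ‖w - c‖ ^ (-(1 / 2) : ℝ) := by gcongr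
      _ ≤ (2 * (discPotential + 2 * π)) * R * R ^ (1 / 2 : ℝ) *
          ‖w - c‖ ^ (-(1 / 2) : ℝ) := by gcongr; linarith
      _ = _ := by ring

/-! ### Removing a contour across which a function is continuous -/

namespace Contour
variable {C : Contour} {j : Fin C.n} {t0 η : ℝ}

/-- The square of half-side `ρ` about a real point. -/
def square (t0 ρ : ℝ) : Set ℂ := {w | |w.re - t0| < ρ ∧ |w.im| < ρ}

lemma isOpen_square (t0 ρ : ℝ) : IsOpen (square t0 ρ) :=
  (isOpen_lt (f := fun w : ℂ => |w.re - t0|) (by fun_prop) continuous_const).inter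
    (isOpen_lt (f := fun w : ℂ => |w.im|) (by fun_prop) continuous_const)

lemma ofReal_mem_square {t0 ρ t : ℝ} (h : |t - t0| < ρ) : (t : ℂ) ∈ square t0 ρ := by
  refine ⟨by simpa using h, ?_⟩
  simpa using (abs_nonneg _).trans_lt h

lemma square_mem_nhds {t0 ρ : ℝ} (h : 0 < ρ) : square t0 ρ ∈ 𝓝 (t0 : ℂ) :=
  (isOpen_square t0 ρ).mem_nhds (ofReal_mem_square (by simpa using h))

lemma exists_square_subset {t0 : ℝ} {A : Set ℂ} (hA : A ∈ 𝓝 (t0 : ℂ)) :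
    ∃ δ > 0, ∀ ρ ≤ δ, square t0 ρ ⊆ A := by
  obtain ⟨δ, hδ, hsub⟩ := Metric.mem_nhds_iff.1 hA
  refine ⟨δ / 2, by positivity, fun ρ hρ w hw => hsub ?_⟩
  rw [mem_ball_iff_norm]; have h1 := norm_le_abs_re_add_abs_im (w - t0); simp at h1
  have := hw.1; have := hw.2; linarith

/-- Truncation of a complex number to a closed square. -/
def clampSquare (t0 ρ : ℝ) (w : ℂ) : ℂ := ⟨max (t0 - ρ) (min w.re (t0 + ρ)), max (-ρ) (min w.im ρ)⟩

lemma continuous_clampSquare (t0 ρ : ℝ) : Continuous (clampSquare t0 ρ) := by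
  have : clampSquare t0 ρ = fun w : ℂ => ((max (t0 - ρ) (min w.re (t0 + ρ)) : ℝ) : ℂ) +
      ((max (-ρ) (min w.im ρ) : ℝ) : ℂ) * I := by
    ext w; exact (mk_eq_add_mul_I _ _)
  rw [this]; fun_prop

lemma clampSquare_mem {t0 ρ ρ' : ℝ} (h0 : 0 < ρ) (h : ρ < ρ') (w : ℂ) :
    clampSquare t0 ρ w ∈ square t0 ρ' := by
  refine ⟨abs_lt.2 ⟨?_, ?_⟩, abs_lt.2 ⟨?_, ?_⟩⟩
  · have := le_max_left (t0 - ρ) (min w.re (t0 + ρ))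
    change -ρ' < max (t0 - ρ) (min w.re (t0 + ρ)) - t0; linarith
  · have := max_le (show t0 - ρ ≤ t0 + ρ by linarith) (min_le_right w.re (t0 + ρ))
    change max (t0 - ρ) (min w.re (t0 + ρ)) - t0 < ρ'; linarith
  · have := le_max_left (-ρ) (min w.im ρ); change -ρ' < max (-ρ) (min w.im ρ); linarith
  · have := max_le (show -ρ ≤ ρ by linarith) (min_le_right w.im ρ)
    change max (-ρ) (min w.im ρ) < ρ'; linarith

lemma clampSquare_eq {t0 ρ : ℝ} {w : ℂ} (h1 : |w.re - t0| ≤ ρ) (h2 : |w.im| ≤ ρ) :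
    clampSquare t0 ρ w = w := by
  refine Complex.ext ?_ ?_
  · change max (t0 - ρ) (min w.re (t0 + ρ)) = w.re; grind
  · change max (-ρ) (min w.im ρ) = w.im; grind

lemma mem_square_of_uIcc {t0 ρ t t' ε : ℝ} (ht : |t - t0| < ρ) (ht' : |t' - t0| < ρ)
    (hε : |ε| < ρ) {u : ℝ} (hu : u ∈ Set.uIcc t t') : ((u : ℂ) + ε * I) ∈ square t0 ρ := by
  have : |u - t0| < ρ := by grind [Set.mem_uIcc]
  exact ⟨by simpa using this, by simpa using hε⟩

lemma straighten_add (j : Fin C.n) (t0 u ε : ℝ) : C.straighten j t0 ((u : ℂ) + ε * I) =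
    C.γ j u + ε * (I * deriv (C.γ j) t0) := by
  simp [straighten]

namespace IsChart

/-- The derivative of the integral of a holomorphic function along a translate of an arc. -/
lemma hasDerivAt_integral_translate (h : C.IsChart j t0 η) {ρ : ℝ} (hρ : ρ ≤ η) {φ : ℂ → ℂ}
    {V : Set ℂ} (hV : IsOpen V) (hφ : DifferentiableOn ℂ φ V)
    (hsub : ∀ w ∈ square t0 ρ, w.im ≠ 0 → C.straighten j t0 w ∈ V)
    {t t' ε : ℝ} (ht : |t - t0| < ρ) (ht' : |t' - t0| < ρ) (hε : |ε| < ρ) (hε0 : ε ≠ 0) :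
    HasDerivAt (fun e : ℝ => ∫ u in t..t', φ (C.straighten j t0 (u + e * I)) * deriv (C.γ j) u)
      ((I * deriv (C.γ j) t0) * (φ (C.straighten j t0 (t' + ε * I)) -
        φ (C.straighten j t0 (t + ε * I)))) ε := by
  set τ := I * deriv (C.γ j) t0 with hτ; set Θ := C.straighten j t0 with hΘ
  have hφ' : ContinuousOn (deriv φ) V := (hφ.deriv hV).continuousOn
  have hcontΘ : ∀ w ∈ square t0 ρ, ContinuousAt Θ w := fun w hw => h.continuousAt (hw.1.trans_le hρ)
  obtain ⟨r, hr, hball⟩ : ∃ r > 0, ∀ e ∈ closedBall ε r, |e| < ρ ∧ e ≠ 0 := by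
    have h1 : {e : ℝ | |e| < ρ ∧ e ≠ 0} ∈ 𝓝 ε :=
      ((isOpen_lt continuous_abs continuous_const).inter isOpen_ne).mem_nhds ⟨hε, hε0⟩
    grind [HasBasis.mem_iff, nhds_basis_closedBall]
  have hmemV : ∀ e ∈ closedBall ε r, ∀ u ∈ Set.uIcc t t',
      Θ ((u : ℂ) + e * I) ∈ V := fun e he u hu =>
    hsub _ (mem_square_of_uIcc ht ht' (hball e he).1 hu) (by simp_all)
  have hreg : ∀ u ∈ Set.uIcc t t', u ∈ C.regular j := fun u hu => by
    have := (mem_square_of_uIcc ht ht' ((abs_nonneg _).trans_lt ht |> fun h => by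
      simpa using h : |(0 : ℝ)| < ρ) hu).1
    exact h.sub (mem_Icc_of_abs (by simpa using (this.trans_le hρ).le))
  have hγ' : ContinuousOn (deriv (C.γ j)) (Set.uIcc t t') := fun u hu =>
    (C.continuousAt_deriv (hreg u hu)).continuousWithinAt
  have hcΘ2 : ContinuousOn (fun p : ℝ × ℝ => Θ ((p.2 : ℂ) + p.1 * I))
      (closedBall ε r ×ˢ Set.uIcc t t') := by
    intro p hp; refine ContinuousAt.continuousWithinAt ?_
    exact ContinuousAt.comp (f := fun p : ℝ × ℝ => ((p.2 : ℂ) + p.1 * I))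
      (hcontΘ _ (mem_square_of_uIcc ht ht' (hball _ hp.1).1 hp.2))
      (by fun_prop : Continuous fun p : ℝ × ℝ => ((p.2 : ℂ) + p.1 * I)).continuousAt
  have hcslice : ∀ e ∈ closedBall ε r,
      ContinuousOn (fun u : ℝ => Θ ((u : ℂ) + e * I)) (Set.uIcc t t') := fun e he =>
    hcΘ2.comp (f := fun u : ℝ => (e, u)) (by fun_prop) fun u hu => ⟨he, hu⟩
  have hcF' : ContinuousOn (fun p : ℝ × ℝ => deriv φ (Θ ((p.2 : ℂ) + p.1 * I)) * τ *
      deriv (C.γ j) p.2) (closedBall ε r ×ˢ Set.uIcc t t') := by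
    refine ((hφ'.comp hcΘ2 fun p hp => hmemV _ hp.1 _ hp.2).mul continuousOn_const).mul ?_
    exact hγ'.comp continuousOn_snd fun p hp => hp.2
  obtain ⟨M, hM⟩ := ((isCompact_closedBall ε r).prod isCompact_uIcc).exists_bound_of_continuousOn
    hcF'
  have hεb : ε ∈ closedBall ε r := mem_closedBall_self hr.le
  have hcF'ε : ContinuousOn (fun u : ℝ => deriv φ (Θ ((u : ℂ) + ε * I)) * τ *
      deriv (C.γ j) u) (Set.uIcc t t') :=
    hcF'.comp (f := fun u : ℝ => (ε, u)) (by fun_prop) fun u hu => ⟨hεb, hu⟩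
  have hcF : ∀ e ∈ closedBall ε r,
      ContinuousOn (fun u : ℝ => φ (Θ ((u : ℂ) + e * I)) * deriv (C.γ j) u)
        (Set.uIcc t t') := fun e he =>
    (hφ.continuousOn.comp (hcslice e he) fun u hu => hmemV e he u hu).mul hγ'
  have key := (intervalIntegral.hasDerivAt_integral_of_dominated_loc_of_deriv_le
    (μ := volume) (a := t) (b := t') (bound := fun _ => M)
    (F := fun (e : ℝ) (u : ℝ) => φ (Θ ((u : ℂ) + e * I)) * deriv (C.γ j) u)
    (F' := fun (e : ℝ) (u : ℝ) => deriv φ (Θ ((u : ℂ) + e * I)) * τ * deriv (C.γ j) u)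
    (closedBall_mem_nhds ε hr) ?_ (hcF ε hεb).intervalIntegrable
    ?_ ?_ intervalIntegrable_const ?_).2
  -- Differentiation in the height gives φ'(Θ) τ γ'(u). Since ∂Θ/∂u = γ'(u), this has the primitive
  -- τ φ(Θ) in u, and only the values at the two ends survive.
  · refine key.congr_deriv ?_; have h2 : ∀ u ∈ Set.uIcc t t', HasDerivAt
        (fun u : ℝ => τ * φ (Θ ((u : ℂ) + ε * I)))
        (deriv φ (Θ ((u : ℂ) + ε * I)) * τ * deriv (C.γ j) u) u := by
      intro u hu
      have h3 : HasDerivAt (fun u : ℝ => Θ ((u : ℂ) + ε * I)) (deriv (C.γ j) u) u := by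
        simp only [hΘ, straighten_add]; exact (C.hasDerivAt (hreg u hu)).add_const _
      have h4 := ((hφ.differentiableAt (hV.mem_nhds (hmemV ε hεb u hu))).hasDerivAt.comp u h3)
      refine (h4.const_mul τ).congr_deriv (by ring)
    rw [intervalIntegral.integral_eq_sub_of_hasDerivAt h2 hcF'ε.intervalIntegrable]; ring
  · filter_upwards [closedBall_mem_nhds ε hr] with e he
    exact ((hcF e he).mono uIoc_subset_uIcc).aestronglyMeasurable measurableSet_uIoc
  · exact (hcF'ε.mono uIoc_subset_uIcc).aestronglyMeasurable measurableSet_uIoc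
  · exact ae_of_all _ fun u hu e he => hM (e, u) ⟨he, uIoc_subset_uIcc hu⟩
  · refine ae_of_all _ fun u hu e he => ?_
    have h3 : HasDerivAt (fun e : ℝ => Θ ((u : ℂ) + e * I)) τ e := by
      simp [hΘ, straighten_add]
      have := ((hasDerivAt_id e).ofReal_comp.mul_const τ).const_add (C.γ j u); simpa using this
    have h4 := ((hφ.differentiableAt (hV.mem_nhds
      (hmemV e he u (uIoc_subset_uIcc hu)))).hasDerivAt.comp e h3)
    exact h4.mul_const _


/-- Cauchy's theorem on a curved box, for a function that is continuous across the contour. -/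
lemma integral_box (h : C.IsChart j t0 η) {ρ : ℝ} (hρ : ρ ≤ η) {φ κ : ℂ → ℂ}
    {V : Set ℂ} (hV : IsOpen V) (hφ : DifferentiableOn ℂ φ V)
    (hsub : ∀ w ∈ square t0 ρ, w.im ≠ 0 → C.straighten j t0 w ∈ V)
    (hκ : Continuous κ) (hκφ : ∀ w ∈ square t0 ρ, w.im ≠ 0 → κ w = φ (C.straighten j t0 w))
    {γ' : ℝ → ℂ} (hγ' : Continuous γ') (hγ'' : ∀ u, |u - t0| < ρ → γ' u = deriv (C.γ j) u)
    {t t' ε : ℝ} (ht : |t - t0| < ρ) (ht' : |t' - t0| < ρ) (hε : |ε| < ρ) :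
    (∫ u in t..t', κ (u + ε * I) * γ' u) - ∫ u in t..t', κ u * γ' u =
      (I * deriv (C.γ j) t0) * ((∫ v in (0 : ℝ)..ε, κ (t' + v * I)) -
        ∫ v in (0 : ℝ)..ε, κ (t + v * I)) := by
  set τ := I * deriv (C.γ j) t0 with hτ
  have hA : Continuous fun e : ℝ => ∫ u in t..t', κ (u + e * I) * γ' u := by fun_prop
  have hv : ∀ t : ℝ, Continuous fun v : ℝ => κ (t + v * I) := fun t => by fun_prop
  -- The derivative in the height is known off height 0 only. As the integral is continuous in the
  -- height, the fundamental theorem of calculus tolerates this single exception; here the contour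
  -- is crossed.
  have key := integral_eq_of_hasDerivAt_off_countable
    (fun e : ℝ => ∫ u in t..t', κ (u + e * I) * γ' u)
    (fun e : ℝ => τ * (κ (t' + e * I) - κ (t + e * I))) (a := 0) (b := ε)
    (countable_singleton (0 : ℝ)) hA.continuousOn ?_ (by
      exact Continuous.intervalIntegrable (by fun_prop) _ _)
  · simp_all [Continuous.intervalIntegrable]
  · rintro e ⟨he, he0⟩; have he' : |e| < ρ := by grind
    have he0' : e ≠ 0 := he0
    have hm : ∀ u : ℝ, |u - t0| < ρ → ∀ e : ℝ, |e| < ρ → (u + e * I : ℂ) ∈ square t0 ρ :=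
      fun u hu e he => ⟨by simpa using hu, by simpa using he⟩
    rw [hκφ _ (hm t ht e he') (by simpa using he0'), hκφ _ (hm t' ht' e he') (by simpa using he0')]
    refine (h.hasDerivAt_integral_translate hρ hV hφ hsub ht ht' he' he0').congr_of_eventuallyEq ?_
    have h2 : {e : ℝ | |e| < ρ ∧ e ≠ 0} ∈ 𝓝 e :=
      ((isOpen_lt continuous_abs continuous_const).inter isOpen_ne).mem_nhds ⟨he', he0'⟩
    filter_upwards [h2] with e he; refine intervalIntegral.integral_congr fun u hu => ?_
    have h3 := mem_square_of_uIcc ht ht' he.1 hu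
    rw [hκφ _ h3 (by simpa using he.2), hγ'' u (by simpa using h3.1)]

/-- A primitive of a function that is continuous across the contour. -/
lemma isLittleO_primitive (h : C.IsChart j t0 η) {ρ : ℝ} (hρ : ρ ≤ η) {φ κ : ℂ → ℂ}
    {V : Set ℂ} (hV : IsOpen V) (hφ : DifferentiableOn ℂ φ V)
    (hsub : ∀ w ∈ square t0 ρ, w.im ≠ 0 → C.straighten j t0 w ∈ V)
    (hκ : Continuous κ) (hκφ : ∀ w ∈ square t0 ρ, w.im ≠ 0 → κ w = φ (C.straighten j t0 w))
    {γ' : ℝ → ℂ} (hγ' : Continuous γ') (hγ'' : ∀ u, |u - t0| < ρ → γ' u = deriv (C.γ j) u)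
    {Q : ℂ → ℂ} (hQ : ∀ w, Q w = (∫ u in t0..w.re, κ u * γ' u) +
      (I * deriv (C.γ j) t0) * ∫ v in (0 : ℝ)..w.im, κ (w.re + v * I))
    {w0 : ℂ} (hw₀ : w0 ∈ square t0 ρ) :
    (fun w => Q w - Q w0 - κ w0 * (C.straighten j t0 w - C.straighten j t0 w0)) =o[𝓝 w0]
      fun w => C.straighten j t0 w - C.straighten j t0 w0 := by
  set τ := I * deriv (C.γ j) t0 with hτ; have hd := h.norm_deriv_pos
  have hτn : ‖τ‖ = ‖deriv (C.γ j) t0‖ := by simp [hτ]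
  rw [Asymptotics.isLittleO_iff]; intro c hc; obtain ⟨r, hr, hball⟩ := Metric.continuousAt_iff.1
    (hκ.continuousAt (x := w0)) (c / 3) (by positivity)
  have hsq : square t0 ρ ∩ ball w0 (r / 2) ∈ 𝓝 w0 :=
    inter_mem ((isOpen_square _ _).mem_nhds hw₀) (ball_mem_nhds _ (by positivity))
  filter_upwards [hsq] with w hw; obtain ⟨hws, hwb⟩ := hw; rw [mem_ball_iff_norm] at hwb
  have hci : ∀ a b : ℝ, IntervalIntegrable (fun u : ℝ => κ u * γ' u) volume a b := fun a b =>
    Continuous.intervalIntegrable (by fun_prop) _ _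
  have hcv : ∀ t a b : ℝ, IntervalIntegrable (fun v : ℝ => κ (t + v * I)) volume a b :=
    fun t a b => Continuous.intervalIntegrable (by fun_prop) _ _
  have hcu : ∀ e a b : ℝ, IntervalIntegrable (fun u : ℝ => κ (u + e * I) * γ' u)
      volume a b := fun t a b => Continuous.intervalIntegrable (by fun_prop) _ _
  have hbox := h.integral_box hρ hV hφ hsub hκ hκφ hγ' hγ'' hw₀.1 hws.1 hw₀.2
  have hγint : ∫ u in w0.re..w.re, γ' u = C.γ j w.re - C.γ j w0.re := by
    refine intervalIntegral.integral_eq_sub_of_hasDerivAt (fun u hu => ?_)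
      (hγ'.intervalIntegrable _ _)
    have hu' : |u - t0| < ρ := by
      have := (mem_square_of_uIcc hw₀.1 hws.1 hw₀.2 hu).1; simpa using this
    rw [hγ'' u hu']; exact C.hasDerivAt (h.sub (mem_Icc_of_abs (hu'.le.trans hρ)))
  -- The box identity lifts the horizontal segment from height 0 to the height of `w0`, so the
  -- increment of Q is an integral over an L-shaped path from `w0` to w, on which κ is close to
  -- κ(w0).
  have e1 : Q w - Q w0 = (∫ u in w0.re..w.re, κ (u + w0.im * I) * γ' u) +
      τ * ∫ v in w0.im..w.im, κ (w.re + v * I) := by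
    rw [hQ, hQ, ← intervalIntegral.integral_add_adjacent_intervals (hci t0 w0.re)
      (hci w0.re w.re), ← intervalIntegral.integral_add_adjacent_intervals (hcv w.re 0 w0.im)
      (hcv w.re w0.im w.im)]
    grind
  have e2 : Q w - Q w0 - κ w0 * (C.straighten j t0 w - C.straighten j t0 w0) =
      (∫ u in w0.re..w.re, (κ (u + w0.im * I) - κ w0) * γ' u) +
      τ * ∫ v in w0.im..w.im, (κ (w.re + v * I) - κ w0) := by
    rw [e1]; simp [sub_mul]
    have hcc : IntervalIntegrable (fun u => κ w0 * γ' u) volume w0.re w.re :=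
      (continuous_const.mul hγ').intervalIntegrable _ _
    rw [intervalIntegral.integral_sub (hcu _ _ _) hcc, intervalIntegral.integral_const_mul,
      hγint, intervalIntegral.integral_sub (hcv _ _ _) intervalIntegrable_const,
      intervalIntegral.integral_const]
    simp [straighten, ← hτ]; push_cast; ring
  have hsmall : ∀ u v : ℝ, u ∈ uIoc w0.re w.re ∨ u = w.re ∨ u = w0.re →
      v ∈ uIoc w0.im w.im ∨ v = w0.im →
      ‖κ (u + v * I) - κ w0‖ ≤ c / 3 := by
    intro u v hu hv; have h1 : |u - w0.re| ≤ |w.re - w0.re| := by grind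
    have h2 : |v - w0.im| ≤ |w.im - w0.im| := by grind
    have h3 := abs_re_le_norm (w - w0); have h4 := abs_im_le_norm (w - w0); rw [sub_re] at h3
    rw [sub_im] at h4; have h5 := norm_le_abs_re_add_abs_im (u + v * I - w0); simp at h5
    grind [dist_eq_norm]
  have hM : ∀ u ∈ uIoc w0.re w.re, ‖γ' u‖ ≤ 5 / 4 * ‖deriv (C.γ j) t0‖ := by
    intro u hu
    have hu' : |u - t0| < ρ := by
      have := (mem_square_of_uIcc hw₀.1 hws.1 hw₀.2 (uIoc_subset_uIcc hu)).1; simpa using this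
    rw [hγ'' u hu']; have h1 := h.deriv_approx u (mem_Icc_of_abs (hu'.le.trans hρ))
    have h2 := norm_le_norm_add_norm_sub' (deriv (C.γ j) u) (deriv (C.γ j) t0); linarith
  have b1 : ‖∫ u in w0.re..w.re, (κ (u + w0.im * I) - κ w0) * γ' u‖ ≤
      c / 3 * (5 / 4 * ‖deriv (C.γ j) t0‖) * |w.re - w0.re| := by
    refine intervalIntegral.norm_integral_le_of_norm_le_const fun u hu => ?_; rw [norm_mul]; bound
  have b2 : ‖∫ v in w0.im..w.im, (κ (w.re + v * I) - κ w0)‖ ≤ c / 3 * |w.im - w0.im| :=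
    intervalIntegral.norm_integral_le_of_norm_le_const fun v hv =>
      hsmall w.re v (Or.inr (Or.inl rfl)) (Or.inl hv)
  have h3 := abs_re_le_norm (w - w0); have h4 := abs_im_le_norm (w - w0); rw [sub_re] at h3
  rw [sub_im] at h4; have hlow := h.lower (hws.1.le.trans hρ) (hw₀.1.le.trans hρ); rw [e2]
  refine (norm_add_le _ _).trans ?_; rw [norm_mul, hτn]
  have c1 : c / 3 * (5 / 4 * ‖deriv (C.γ j) t0‖) * |w.re - w0.re| ≤
      c / 3 * (5 / 4 * ‖deriv (C.γ j) t0‖) * ‖w - w0‖ := by gcongr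
  have c2 : ‖deriv (C.γ j) t0‖ * ‖∫ v in w0.im..w.im, (κ (w.re + v * I) - κ w0)‖ ≤
      ‖deriv (C.γ j) t0‖ * (c / 3 * ‖w - w0‖) := by
    grind [mul_le_mul_of_nonneg_left, LE.le.trans]
  have c3 : c * (3 / 4 * ‖deriv (C.γ j) t0‖ * ‖w - w0‖) ≤
      c * ‖C.straighten j t0 w - C.straighten j t0 w0‖ := by gcongr
  linarith

end IsChart

/-- A function that is holomorphic off the contour and has the same limits from both sides near a
regular point has a holomorphic extension across that point. -/
theorem exists_holomorphic_extension (ht0 : t0 ∈ C.regular j) {V : Set ℂ} (hV : IsOpen V)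
    (hmem : C.γ j t0 ∈ V) {φ : ℂ → ℂ} (hφ : DifferentiableOn ℂ φ (V \ C.carrier))
    (hlim : ∀ᶠ t : ℝ in 𝓝 t0, ∃ l,
      Tendsto (φ ∘ C.straighten j t0) (𝓝[{w | 0 < w.im}] (t : ℂ)) (𝓝 l) ∧
      Tendsto (φ ∘ C.straighten j t0) (𝓝[{w | w.im < 0}] (t : ℂ)) (𝓝 l)) :
    ∃ (W : Set ℂ) (H : ℂ → ℂ), IsOpen W ∧ C.γ j t0 ∈ W ∧ W ⊆ V ∧ DifferentiableOn ℂ H W ∧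
      EqOn φ H (W \ C.carrier) := by
  obtain ⟨η, hη, hchart⟩ := exists_isChart ht0; have hch := hchart η hη le_rfl
  have hVn : C.straighten j t0 ⁻¹' V ∈ 𝓝 (t0 : ℂ) := by
    refine (hch.continuousAt (w := (t0 : ℂ)) (by simpa using hη)) ?_
    grind [straighten_ofReal, IsOpen.mem_nhds]
  obtain ⟨δ1, hδ1, hsq1⟩ := exists_square_subset hVn
  obtain ⟨δ2, hδ2, hlim⟩ := Metric.eventually_nhds_iff.1 hlim
  obtain ⟨ρ', hρ', hρη, hρ1, hρ2⟩ : ∃ ρ' > 0, ρ' ≤ η ∧ ρ' ≤ δ1 ∧ ρ' ≤ δ2 :=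
    ⟨min η (min δ1 δ2), by positivity, min_le_left _ _,
      (min_le_right _ _).trans (min_le_left _ _), (min_le_right _ _).trans (min_le_right _ _)⟩
  set Θ := C.straighten j t0 with hΘ
  have hVC : IsOpen (V \ C.carrier) := hV.sdiff C.isClosed_carrier
  have hoff : ∀ w ∈ square t0 ρ', w.im ≠ 0 → Θ w ∈ V \ C.carrier := fun w hw him =>
    ⟨hsq1 _ hρ1 hw, fun hc => him
      ((hch.mem_carrier_iff (hw.1.le.trans hρη) (hw.2.le.trans hρη)).1 hc)⟩
  -- the continuous extension
  set A : Set ℂ := {w | w.im ≠ 0}; set k := extendFrom A (φ ∘ Θ)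
  have hlimk : ∀ w ∈ square t0 ρ', ∃ y, Tendsto (φ ∘ Θ) (𝓝[A] w) (𝓝 y) := by
    intro w hw; by_cases him : w.im = 0
    · have hwre : w = (w.re : ℂ) := Complex.ext rfl (by simpa using him)
      obtain ⟨l, hl, hr⟩ := hlim (y := w.re) (by exact hw.1.trans_le hρ2)
      refine ⟨l, ?_⟩; have hA : A = {w | 0 < w.im} ∪ {w | w.im < 0} := by ext w; grind
      grind [nhdsWithin_union, Tendsto.sup]
    · have h1 := (hφ.differentiableAt (hVC.mem_nhds (hoff w hw him))).continuousAt
      exact ⟨_, (h1.comp (hch.continuousAt (hw.1.trans_le hρη))).mono_left nhdsWithin_le_nhds⟩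
  have hAcl : ∀ w : ℂ, w ∈ closure A := by
    have : Dense A := by
      have h1 : A = (fun w : ℂ => imCLM w) ⁻¹' {0}ᶜ := rfl
      exact (dense_compl_singleton (0 : ℝ)).preimage (isOpenMap_im)
    exact fun w => this w
  have hkcont : ContinuousOn k (square t0 ρ') := continuousOn_extendFrom (fun w _ => hAcl w) hlimk
  have hkeq : ∀ w ∈ square t0 ρ', w.im ≠ 0 → k w = φ (Θ w) := by
    intro w hw him; have h1 := (hφ.differentiableAt (hVC.mem_nhds (hoff w hw him))).continuousAt
    exact extendFrom_eq (hAcl w)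
      ((h1.comp (hch.continuousAt (hw.1.trans_le hρη))).mono_left nhdsWithin_le_nhds)
  -- truncation to a smaller square
  set ρ := ρ' / 2 with hρdef; have hρ : 0 < ρ := by positivity
  have hρρ' : ρ < ρ' := half_lt_self hρ'
  have hsqsub : square t0 ρ ⊆ square t0 ρ' := fun w hw => ⟨hw.1.trans hρρ', hw.2.trans hρρ'⟩
  set κ : ℂ → ℂ := fun w => k (clampSquare t0 ρ w)
  have hκ : Continuous κ := hkcont.comp_continuous (continuous_clampSquare t0 ρ)
    fun w => clampSquare_mem hρ hρρ' w
  have hκφ : ∀ w ∈ square t0 ρ, w.im ≠ 0 → κ w = φ (Θ w) := fun w hw him => by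
    simp [κ]; rw [clampSquare_eq hw.1.le hw.2.le, hkeq w (hsqsub hw) him]
  set γ' : ℝ → ℂ := fun u => deriv (C.γ j) (max (t0 - ρ) (min u (t0 + ρ)))
  have hγ' : Continuous γ' := by
    rw [continuous_iff_continuousAt]; intro u
    have h1 : max (t0 - ρ) (min u (t0 + ρ)) ∈ C.regular j := by
      refine hch.sub ⟨?_, ?_⟩
      · grind
      grind
    exact ContinuousAt.comp (f := fun u => max (t0 - ρ) (min u (t0 + ρ)))
      (C.continuousAt_deriv h1) (by fun_prop)
  set Q : ℂ → ℂ := fun w => (∫ u in t0..w.re, κ u * γ' u) +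
      (I * deriv (C.γ j) t0) * ∫ v in (0 : ℝ)..w.im, κ (w.re + v * I) with hQ
  have hinj : InjOn Θ (square t0 ρ) := fun w hw w' hw' he =>
    hch.injOn ((hsqsub hw).1.le.trans hρη) ((hsqsub hw').1.le.trans hρη) he
  -- Morera's argument: Q read in the plane is a holomorphic primitive, and its derivative is the
  -- required extension.
  set P : ℂ → ℂ := fun z => Q (Function.invFunOn Θ (square t0 ρ) z) with hP
  have hPΘ : ∀ w ∈ square t0 ρ, P (Θ w) = Q w := fun w hw => by
    simp [hP]; rw [hinj (Function.invFunOn_mem ⟨w, hw, rfl⟩) hw (Function.invFunOn_eq ⟨w, hw, rfl⟩)]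
  have hder : ∀ w ∈ square t0 ρ, HasDerivAt P (κ w) (Θ w) := by
    intro w hw; have h1 := hch.isLittleO_primitive (ρ := ρ) (hρρ'.le.trans hρη) hVC hφ
      (fun w hw => hoff w (hsqsub hw)) hκ hκφ hγ' (by grind) (Q := Q) (fun w => rfl) hw
    rw [hasDerivAt_iff_isLittleO, ← hch.map_nhds ((hsqsub hw).1.trans_le hρη),
      Asymptotics.isLittleO_map]
    refine h1.congr' ?_ (EventuallyEq.refl _ _)
    filter_upwards [(isOpen_square t0 ρ).mem_nhds hw] with w' hw'; grind [smul_eq_mul]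
  have hWopen : IsOpen (Θ '' square t0 ρ) := by
    rw [isOpen_iff_mem_nhds]; rintro _ ⟨w, hw, rfl⟩
    rw [hΘ, ← hch.map_nhds ((hsqsub hw).1.trans_le hρη)]
    exact image_mem_map ((isOpen_square t0 ρ).mem_nhds hw)
  have hPd : DifferentiableOn ℂ P (Θ '' square t0 ρ) := by
    rintro _ ⟨w, hw, rfl⟩; exact (hder w hw).differentiableAt.differentiableWithinAt
  refine ⟨Θ '' square t0 ρ, deriv P, hWopen, ⟨t0, ofReal_mem_square (by simpa using hρ), ?_⟩, ?_,
    hPd.deriv hWopen, ?_⟩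
  · rw [hΘ, straighten_ofReal]
  · rintro _ ⟨w, hw, rfl⟩; grind
  · rintro _ ⟨⟨w, hw, rfl⟩, hc⟩; have him : w.im ≠ 0 := fun him => hc
      ((hch.mem_carrier_iff ((hsqsub hw).1.le.trans hρη) ((hsqsub hw).2.le.trans hρη)).2 him)
    rw [(hder w hw).deriv, hκφ w hw him]

end Contour

/-! ### The mean value property for discs -/

/-- In polar coordinates the area integral becomes an integral of circle averages, each equal to the
value at the centre. -/
lemma integral_ball_of_differentiableOn {H : ℂ → ℂ} {c : ℂ} {ρ : ℝ} (hρ : 0 < ρ)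
    (hc : ContinuousOn H (closedBall c ρ)) (hd : DifferentiableOn ℂ H (ball c ρ)) :
    ∫ z in ball c ρ, H z = (π * ρ ^ 2 : ℝ) * H c := by
  have h1 : ∫ z in ball c ρ, H z = ∫ z, (ball (0 : ℂ) ρ).indicator (fun z => H (z + c)) z := by
    rw [← integral_indicator Metric.isOpen_ball.measurableSet, ← integral_add_right_eq_self _ c]
    refine integral_congr_ae (ae_of_all _ fun z => ?_); by_cases hz : z ∈ ball (0 : ℂ) ρ
    · simp_all
    simp_all
  have hmap : ∀ p ∈ Set.Icc (0 : ℝ) ρ ×ˢ (Set.univ : Set ℝ),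
      circleMap c p.1 p.2 ∈ closedBall c ρ := fun p hp => by
    grind [mem_closedBall_iff_norm, circleMap_sub_center, norm_circleMap_zero]
  have hcont : ContinuousOn (fun p : ℝ × ℝ => p.1 • H (circleMap c p.1 p.2))
      (Set.Icc 0 ρ ×ˢ Set.Icc (-π) π) := by
    refine continuousOn_fst.smul (hc.comp (f := fun p : ℝ × ℝ => circleMap c p.1 p.2) ?_
      fun p hp => hmap p ⟨hp.1, trivial⟩)
    fun_prop
  have hint : IntegrableOn (fun p : ℝ × ℝ => p.1 • H (circleMap c p.1 p.2))
      (Set.Ioo 0 ρ ×ˢ Set.Ioo (-π) π) :=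
    (hcont.integrableOn_compact (isCompact_Icc.prod isCompact_Icc)).mono_set
      (Set.prod_mono Set.Ioo_subset_Icc_self Set.Ioo_subset_Icc_self)
  rw [h1, ← Complex.integral_comp_polarCoord_symm]
  have h2 : ∀ p ∈ polarCoord.target, p.1 • (ball (0 : ℂ) ρ).indicator
      (fun z => H (z + c)) (Complex.polarCoord.symm p) =
      (Set.Ioo 0 ρ ×ˢ Set.Ioo (-π) π).indicator
        (fun p : ℝ × ℝ => p.1 • H (circleMap c p.1 p.2)) p := by
    rintro ⟨r, θ⟩ hp; obtain ⟨hr, hθ⟩ := hp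
    have h3 : Complex.polarCoord.symm (r, θ) + c = circleMap c r θ := by
      rw [Complex.polarCoord_symm_apply, circleMap, exp_mul_I]; push_cast; ring
    grind [indicator_of_mem, mem_ball_zero_iff, norm_polarCoord_symm, indicator_of_notMem, smul_zero]
  rw [setIntegral_congr_fun polarCoord.open_target.measurableSet h2,
    setIntegral_indicator (measurableSet_Ioo.prod measurableSet_Ioo),
    Set.inter_eq_right.2 (by rw [polarCoord_target]; grind),
    volume_eq_prod, setIntegral_prod _ hint]
  have h4 : ∀ r ∈ Set.Ioo 0 ρ, ∫ θ in Set.Ioo (-π) π, r • H (circleMap c r θ) =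
      r • ((2 * π : ℝ) * H c) := by
    intro r hr; rw [integral_smul]; congr 1
    have h5 : DiffContOnCl ℂ H (ball c |r|) := by
      grind [DifferentiableOn.diffContOnCl, closure_ball, DifferentiableOn.mono, closedBall_subset_ball]
    have h6 := h5.circleAverage; rw [circleAverage_def] at h6
    have h7 : Function.Periodic (fun θ => H (circleMap c r θ)) (2 * π) :=
      (periodic_circleMap c r).comp H
    have h8 := h7.intervalIntegral_add_eq (-π) 0
    rw [← integral_Ioc_eq_integral_Ioo, ← intervalIntegral.integral_of_le (by linarith [pi_pos])]
    rw [show -π + 2 * π = π by ring, zero_add] at h8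
    rw [h8, ← h6]; simp [mul_assoc]
  rw [setIntegral_congr_fun measurableSet_Ioo h4, integral_smul_const,
    ← integral_Ioc_eq_integral_Ioo, ← intervalIntegral.integral_of_le hρ.le, integral_id,
    real_smul]
  push_cast; ring

/-- The value at the centre of a disc is at most the mean of the modulus. -/
lemma norm_le_integral_ball {H : ℂ → ℂ} {c : ℂ} {ρ : ℝ} (hρ : 0 < ρ)
    (hc : ContinuousOn H (closedBall c ρ)) (hd : DifferentiableOn ℂ H (ball c ρ)) :
    π * ρ ^ 2 * ‖H c‖ ≤ ∫ z in ball c ρ, ‖H z‖ := by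
  have h1 := norm_integral_le_integral_norm (μ := volume.restrict (ball c ρ)) H
  rw [integral_ball_of_differentiableOn hρ hc hd, norm_mul, norm_real,
    norm_of_nonneg (by positivity)] at h1
  exact h1

/-! ### Removable singularities and Liouville's theorem off a contour -/

namespace Contour
variable {C : Contour}

lemma ae_notMem_carrier : ∀ᵐ z : ℂ, z ∉ C.carrier :=
  measure_eq_zero_iff_ae_notMem.1 C.volume_carrier

lemma ball_integral_congr {h H : ℂ → ℂ} {A : Set ℂ} (hA : MeasurableSet A)
    (he : ∀ z ∈ A, z ∉ C.carrier → h z = H z) : ∫ z in A, ‖h z‖ = ∫ z in A, ‖H z‖ := by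
  refine setIntegral_congr_ae hA ?_; filter_upwards [C.ae_notMem_carrier] with z hz hzA
  rw [he z hzA hz]

/-- A holomorphic function off the contour with the same limits from both sides at the regular
points, and not too large near the exceptional points, has an entire extension. -/
theorem exists_entire_extension {h : ℂ → ℂ} (hd : DifferentiableOn ℂ h C.carrierᶜ)
    (hreg : ∀ j, ∀ t ∈ C.regular j, ∃ l, Tendsto h (C.leftNhds (j, t)) (𝓝 l) ∧
      Tendsto h (C.rightNhds (j, t)) (𝓝 l))
    (hexc : ∀ p ∈ C.exceptional, ∃ B : ℝ, ∀ᶠ z in 𝓝[≠] p,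
      ∫ w in ball z (‖z - p‖ / 2), ‖h w‖ ≤ B * ‖z - p‖ ^ (5 / 4 : ℝ)) :
    ∃ H : ℂ → ℂ, Differentiable ℂ H ∧ EqOn h H C.carrierᶜ := by
  -- Since the complement of the contour is dense, the limit from off the contour agrees with every
  -- local continuous extension; the local extensions need not be glued.
  set H₁ : ℂ → ℂ := fun z => limUnder (𝓝[C.carrierᶜ] z) h with hH1
  have hlocal : ∀ z, z ∉ C.exceptional → ∃ (W : Set ℂ) (G : ℂ → ℂ), IsOpen W ∧ z ∈ W ∧
      DifferentiableOn ℂ G W ∧ EqOn h G (W \ C.carrier) := by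
    intro z hz; by_cases hzC : z ∈ C.carrier
    · obtain ⟨j, t, ht, rfl⟩ := Set.mem_iUnion.1 hzC
      have htr : t ∈ C.regular j := by
        by_contra hnot; exact hz (Set.mem_iUnion.2 ⟨j, t, ⟨ht, hnot⟩, rfl⟩)
      obtain ⟨W, G, h1, h2, h3, h4, h5⟩ := exists_holomorphic_extension htr isOpen_univ trivial
        (hd.mono (by simp)) (by
          obtain ⟨η, hη, hch⟩ := exists_isChart htr
          filter_upwards [(C.isOpen_regular j).mem_nhds htr, ball_mem_nhds t hη] with u hu h'
          obtain ⟨l, h₁, h₂⟩ := hreg j u hu; exact ⟨l, h₁.comp ((hch η hη le_rfl).tendsto_left h'),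
            h₂.comp ((hch η hη le_rfl).tendsto_right h')⟩)
      grind
    · exact ⟨C.carrierᶜ, h, C.isClosed_carrier.isOpen_compl, hzC, hd, fun _ _ => rfl⟩
  have hlim : ∀ {W : Set ℂ} {G : ℂ → ℂ}, IsOpen W → DifferentiableOn ℂ G W →
      EqOn h G (W \ C.carrier) → EqOn H₁ G W := by
    intro W G hW hG he z hz; have := C.neBot_nhdsWithin_compl z; refine Tendsto.limUnder_eq ?_
    have h1 : Tendsto G (𝓝[C.carrierᶜ] z) (𝓝 (G z)) :=
      (hG.differentiableAt (hW.mem_nhds hz)).continuousAt.tendsto.mono_left nhdsWithin_le_nhds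
    refine h1.congr' ?_
    filter_upwards [nhdsWithin_le_nhds (hW.mem_nhds hz), self_mem_nhdsWithin] with w hw hwC
    exact (he ⟨hw, hwC⟩).symm
  have hH1d : ∀ z, z ∉ C.exceptional → DifferentiableAt ℂ H₁ z := by
    intro z hz; obtain ⟨W, G, h1, h2, h3, h4⟩ := hlocal z hz
    refine (h3.differentiableAt (h1.mem_nhds h2)).congr_of_eventuallyEq ?_
    filter_upwards [h1.mem_nhds h2] with w hw using hlim h1 h3 h4 hw
  have hH1h : EqOn h H₁ C.carrierᶜ := fun z hz =>
    (hlim C.isClosed_carrier.isOpen_compl hd (fun _ _ => rfl) hz).symm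
  classical
  -- An exceptional point is isolated among the exceptional points. There the value is the limit
  -- over a punctured neighbourhood, on which `H₁` is holomorphic.
  set H : ℂ → ℂ := fun z => if z ∈ C.exceptional then limUnder (𝓝[≠] z) H₁ else H₁ z with hH
  refine ⟨H, fun p => ?_, fun z hz => ?_⟩; swap
  · grind [exceptional_subset]
  obtain ⟨r, hr, hball⟩ := Metric.mem_nhdsWithin_iff.1 (C.eventually_notMem_exceptional p)
  have hballE : ∀ z ∈ ball p r, z ≠ p → z ∉ C.exceptional := fun z hz hne => hball ⟨hz, hne⟩
  by_cases hp : p ∈ C.exceptional; swap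
  · refine (hH1d p hp).congr_of_eventuallyEq ?_; filter_upwards [ball_mem_nhds p hr] with z hz
    grind
  have hHup : ∀ z ∈ ball p r, H z = Function.update H₁ p (limUnder (𝓝[≠] p) H₁) z := by grind
  have hd1 : DifferentiableOn ℂ H₁ (ball p r \ {p}) := fun z hz =>
    (hH1d z (hballE z hz.1 hz.2)).differentiableWithinAt
  have hup := differentiableOn_update_limUnder_of_isLittleO (ball_mem_nhds p hr) hd1 ?_
  · refine (hup.differentiableAt (ball_mem_nhds p hr)).congr_of_eventuallyEq ?_
    filter_upwards [ball_mem_nhds p hr] with z hz using hHup z hz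
  obtain ⟨B, hB⟩ := hexc p hp
  -- The mean value property on the disc of radius |z - p|/2 divides |z - p|^(5/4) by an area of
  -- order |z - p|². The exponent -3/4 is above -1, so the singularity is removable.
  have hbound : ∀ᶠ z in 𝓝[≠] p, ‖H₁ z‖ ≤ 4 / π * |B| * ‖z - p‖ ^ (-(3 / 4) : ℝ) := by
    filter_upwards [hB, nhdsWithin_le_nhds (ball_mem_nhds p (half_pos hr)),
      self_mem_nhdsWithin] with z hzB hz hzp
    rw [mem_ball_iff_norm] at hz; have hd0 : 0 < ‖z - p‖ := norm_pos_iff.2 (sub_ne_zero.2 hzp)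
    have hsub : closedBall z (‖z - p‖ / 2) ⊆ ball p r \ {p} := by
      intro w hw; rw [mem_closedBall_iff_norm] at hw; constructor
      · rw [mem_ball_iff_norm]; have := norm_sub_le_norm_sub_add_norm_sub w z p; linarith
      grind [norm_sub_rev]
    have h1 := norm_le_integral_ball (H := H₁) (c := z) (ρ := ‖z - p‖ / 2) (by positivity)
      (hd1.continuousOn.mono hsub) (hd1.mono (Metric.ball_subset_closedBall.trans hsub))
    rw [← C.ball_integral_congr (h := h) Metric.isOpen_ball.measurableSet
      fun w _ hw => hH1h hw] at h1
    have h2 : ‖z - p‖ ^ (5 / 4 : ℝ) = ‖z - p‖ ^ (-(3 / 4) : ℝ) * ‖z - p‖ ^ 2 := by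
      rw [← rpow_natCast, ← rpow_add hd0]; norm_num
    have h3 := h1.trans hzB; rw [h2] at h3; have h4 : π / 4 * ‖z - p‖ ^ 2 * ‖H₁ z‖ ≤
        |B| * ‖z - p‖ ^ (-(3 / 4) : ℝ) * ‖z - p‖ ^ 2 := by
      refine le_trans (le_of_eq (by ring)) (h3.trans ?_)
      rw [← mul_assoc]; bound
    have h5 : π / 4 * ‖H₁ z‖ ≤ |B| * ‖z - p‖ ^ (-(3 / 4) : ℝ) := by
      have : 0 < ‖z - p‖ ^ 2 := by positivity
      nlinarith
    calc ‖H₁ z‖ = 4 / π * (π / 4 * ‖H₁ z‖) := by field_simp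
      _ ≤ 4 / π * (|B| * ‖z - p‖ ^ (-(3 / 4) : ℝ)) := by gcongr
      _ = _ := by ring
  have ht0 : Tendsto (fun z => ‖z - p‖) (𝓝[≠] p) (𝓝[>] 0) := by
    refine tendsto_nhdsWithin_iff.2 ⟨?_, ?_⟩
    · have : ContinuousAt (fun z : ℂ => ‖z - p‖) p := by fun_prop
      have h := this.tendsto; simp at h; exact h.mono_left nhdsWithin_le_nhds
    · filter_upwards [self_mem_nhdsWithin] with z hz; exact norm_pos_iff.2 (sub_ne_zero.2 hz)
  have hlo : (fun z => ‖z - p‖ ^ (-(3 / 4) : ℝ)) =o[𝓝[≠] p] fun z => (z - p)⁻¹ := by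
    rw [← Asymptotics.isLittleO_norm_right]; rw [Asymptotics.isLittleO_iff_tendsto' (by simp)]
    have h1 : Tendsto (fun x : ℝ => x ^ (1 / 4 : ℝ)) (𝓝[>] 0) (𝓝 0) := by
      have := (continuousAt_rpow_const 0 (1 / 4 : ℝ) (Or.inr (by norm_num))).tendsto
      grind [Tendsto.mono_left, zero_rpow, nhdsWithin_le_nhds]
    refine (h1.comp ht0).congr' ?_; filter_upwards [self_mem_nhdsWithin] with z hz
    have hd0 : 0 < ‖z - p‖ := norm_pos_iff.2 (sub_ne_zero.2 hz); rw [norm_inv, div_inv_eq_mul]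
    conv_rhs => rw [← rpow_one ‖z - p‖, ← rpow_mul hd0.le, ← rpow_add hd0]
    norm_num
  refine Asymptotics.IsLittleO.sub ?_ ?_
  · exact (Asymptotics.IsBigO.of_bound (4 / π * |B|) (by
      filter_upwards [hbound] with z hz; refine hz.trans (le_of_eq ?_)
      rw [norm_of_nonneg (by positivity)])).trans_isLittleO hlo
  · rw [Asymptotics.isLittleO_const_left]; right
    have : (norm ∘ fun z => (z - p)⁻¹) = (fun x : ℝ => x⁻¹) ∘ fun z => ‖z - p‖ := by ext z; simp
    grind [Tendsto.comp, tendsto_inv_nhdsGT_zero]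

/-- Under the assumptions of `exists_entire_extension`, a function that tends to zero at infinity
is zero. -/
theorem eq_zero_of_tendsto {h H : ℂ → ℂ} (hH : Differentiable ℂ H) (he : EqOn h H C.carrierᶜ)
    (hlim : Tendsto h (cocompact ℂ ⊓ 𝓟 C.carrierᶜ) (𝓝 0)) : EqOn h 0 C.carrierᶜ := by
  have h1 : Tendsto H (cocompact ℂ) (𝓝 0) := by
    rw [Metric.tendsto_nhds]; intro ε hε
    have h2 := (Metric.tendsto_nhds.1 hlim) (ε / 2) (by positivity)
    rw [eventually_inf_principal, eventually_iff, mem_cocompact_iff_closedBall_compl_subset 0] at h2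
    obtain ⟨r, hr⟩ := h2; rw [eventually_iff, mem_cocompact_iff_closedBall_compl_subset 0]
    refine ⟨r, fun z hz => ?_⟩; have h3 : (closedBall (0 : ℂ) r)ᶜ ∈ 𝓝 z :=
      Metric.isClosed_closedBall.isOpen_compl.mem_nhds hz
    have := C.neBot_nhdsWithin_compl z
    have h4 : dist (H z) 0 ≤ ε / 2 := by
      refine le_of_tendsto (f := fun w => dist (H w) 0) (x := 𝓝[C.carrierᶜ] z)
        ((hH.continuous.dist continuous_const).continuousAt.tendsto.mono_left nhdsWithin_le_nhds) ?_
      filter_upwards [nhdsWithin_le_nhds h3, self_mem_nhdsWithin] with w hw hwC; grind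
    grind
  intro z hz; rw [he hz]; exact hH.apply_eq_of_tendsto_cocompact z h1

/-- Under the assumptions of `exists_entire_extension`, a function whose means over large discs
tend to zero is zero. -/
theorem eq_zero_of_tendsto_integral {h H : ℂ → ℂ} (hH : Differentiable ℂ H)
    (he : EqOn h H C.carrierᶜ)
    (hlim : ∀ z, Tendsto (fun R : ℝ => (R ^ 2)⁻¹ * ∫ w in ball z R, ‖h w‖) atTop (𝓝 0)) :
    EqOn h 0 C.carrierᶜ := by
  intro z hz; rw [he hz]
  have h1 : ∀ᶠ R : ℝ in atTop, π * ‖H z‖ ≤ (R ^ 2)⁻¹ * ∫ w in ball z R, ‖h w‖ := by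
    filter_upwards [eventually_gt_atTop 0] with R hR
    rw [C.ball_integral_congr Metric.isOpen_ball.measurableSet fun w _ hw => he hw]
    have := norm_le_integral_ball (H := H) (c := z) hR hH.continuous.continuousOn
      hH.differentiableOn
    rw [inv_mul_eq_div, le_div_iff₀ (by positivity)]
    linarith
  have h2 := ge_of_tendsto (hlim z) h1; have h3 := pi_pos; have h4 : ‖H z‖ ≤ 0 := by nlinarith
  simpa using h4

end Contour

/-! ### Cauchy transforms on a contour -/

namespace Contour
variable {C : Contour}

/-- The Cauchy transform `∫ w(x) / (z - pt x) dx`. -/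
def cauchyTransform (C : Contour) (w : C.Param → ℂ) (z : ℂ) : ℂ := ∫ x, w x / (z - C.pt x) ∂Cᵐ

lemma aestronglyMeasurable_sub_pt (z : ℂ) : AEStronglyMeasurable (fun x => z - C.pt x) Cᵐ :=
  (C.aemeasurable_pt.const_sub z).aestronglyMeasurable

/-- The Cauchy transform is holomorphic off the support of the density. -/
lemma hasDerivAt_cauchyTransform {w : C.Param → ℂ} (hw : Integrable w Cᵐ)
    {z0 : ℂ} {r : ℝ} (hr : 0 < r)
    (h0 : ∀ᵐ x ∂Cᵐ, ‖C.pt x - z0‖ < r → w x = 0) :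
    Integrable (fun x => -(w x / (z0 - C.pt x) ^ 2)) Cᵐ ∧
    HasDerivAt (C.cauchyTransform w) (∫ x, -(w x / (z0 - C.pt x) ^ 2) ∂Cᵐ) z0 := by
  have hsep : ∀ z ∈ ball z0 (r / 2), ∀ x, r ≤ ‖C.pt x - z0‖ → r / 2 ≤ ‖z - C.pt x‖ := by
    intro z hz x hx; rw [mem_ball_iff_norm] at hz
    have h1 := norm_sub_le_norm_sub_add_norm_sub (C.pt x) z z0; grind [norm_sub_rev]
  have hmeas1 : ∀ z, AEStronglyMeasurable (fun x => w x / (z - C.pt x)) Cᵐ := fun z =>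
    (hw.aestronglyMeasurable.aemeasurable.div
      (C.aestronglyMeasurable_sub_pt z).aemeasurable).aestronglyMeasurable
  have hmeas2 : AEStronglyMeasurable (fun x => -(w x / (z0 - C.pt x) ^ 2)) Cᵐ :=
    (hw.aestronglyMeasurable.aemeasurable.div
      ((C.aestronglyMeasurable_sub_pt z0).aemeasurable.pow_const 2)).neg.aestronglyMeasurable
  refine hasDerivAt_integral_of_dominated_loc_of_deriv_le (s := ball z0 (r / 2))
    (bound := fun x => ‖w x‖ * (2 / r) ^ 2)
    (F' := fun z x => -(w x / (z - C.pt x) ^ 2)) (ball_mem_nhds _ (by positivity))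
    (Eventually.of_forall hmeas1) ?_ hmeas2 ?_ (hw.norm.mul_const _) ?_
  · refine (hw.norm.mul_const (2 / r)).mono' (hmeas1 z0) ?_; filter_upwards [h0] with x hx
    by_cases hxr : ‖C.pt x - z0‖ < r
    · simp [hx hxr]
    · have h1 := hsep z0 (mem_ball_self (by positivity)) x (not_lt.1 hxr)
      rw [norm_div, div_eq_mul_inv]; rw [← inv_div]; bound
  · filter_upwards [h0] with x hx z hz; by_cases hxr : ‖C.pt x - z0‖ < r
    · simp [hx hxr]
    · rw [norm_neg, norm_div, div_eq_mul_inv, norm_pow, ← inv_pow]; rw [← inv_div]; bound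
  · filter_upwards [h0] with x hx z hz; by_cases hxr : ‖C.pt x - z0‖ < r
    · simp_all [hasDerivAt_const]
    · have h1 := hsep z hz x (not_lt.1 hxr)
      have hne : z - C.pt x ≠ 0 := norm_pos_iff.1 ((half_pos hr).trans_le h1)
      have h2 := (((hasDerivAt_id z).sub_const (C.pt x)).inv hne).const_mul (w x); simp at h2
      grind [HasDerivAt.congr_of_eventuallyEq]

lemma exists_ball_off_carrier {z : ℂ} (hz : z ∉ C.carrier) :
    ∃ r > 0, ∀ᵐ x ∂Cᵐ, r ≤ ‖C.pt x - z‖ := by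
  obtain ⟨r, hr, hball⟩ := Metric.isOpen_iff.1 C.isClosed_carrier.isOpen_compl z hz
  refine ⟨r, hr, ?_⟩; filter_upwards [C.ae_mem_params] with x hx; by_contra! hlt
  exact hball (mem_ball_iff_norm.2 hlt) (C.pt_mem_carrier hx)

lemma hasDerivAt_cauchyTransform_off {w : C.Param → ℂ} (hw : Integrable w Cᵐ)
    {z : ℂ} (hz : z ∉ C.carrier) :
    Integrable (fun x => -(w x / (z - C.pt x) ^ 2)) Cᵐ ∧
    HasDerivAt (C.cauchyTransform w) (∫ x, -(w x / (z - C.pt x) ^ 2) ∂Cᵐ) z := by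
  grind [exists_ball_off_carrier, hasDerivAt_cauchyTransform, Eventually.mono]

lemma differentiableOn_cauchyTransform {w : C.Param → ℂ} (hw : Integrable w Cᵐ) :
    DifferentiableOn ℂ (C.cauchyTransform w) C.carrierᶜ := fun z hz =>
  (C.hasDerivAt_cauchyTransform_off hw hz).2.differentiableAt.differentiableWithinAt

lemma integrable_div_sub_pt {w : C.Param → ℂ} (hw : Integrable w Cᵐ)
    {z : ℂ} (hz : z ∉ C.carrier) : Integrable (fun x => w x / (z - C.pt x)) Cᵐ := by
  obtain ⟨r, hr, h⟩ := C.exists_ball_off_carrier hz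
  refine (hw.norm.mul_const r⁻¹).mono' (hw.aestronglyMeasurable.aemeasurable.div
      (C.aestronglyMeasurable_sub_pt z).aemeasurable).aestronglyMeasurable ?_
  filter_upwards [h] with x hx; rw [norm_div, div_eq_mul_inv, norm_sub_rev]; gcongr

/-- A point has at most two parameters on each component, because coincidences occur only at the two
ends. -/
lemma ae_pt_ne (p : ℂ) : ∀ᵐ x ∂Cᵐ, C.pt x ≠ p := by
  have hcount : (C.pt ⁻¹' {p} ∩ C.params).Countable := by
    have hsub : ∀ j, ({t | C.γ j t = p} ∩ C.dom j).Finite := by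
      intro j; by_cases hex : ∃ t ∈ C.dom j, C.γ j t = p
      · obtain ⟨t, ht, htp⟩ := hex; by_cases hex2 : ∃ u ∈ C.dom j, u ≠ t ∧ C.γ j u = p
        · obtain ⟨u, hu, hut, hup⟩ := hex2; rcases lt_or_gt_of_ne hut with hlt | hlt
          · have hI := C.simple j u hu t ht hlt (by rw [htp, hup])
            refine Finite.subset (Set.toFinite {u, t}) ?_; rintro s ⟨hsp, hs⟩; by_contra hns
            rw [hI] at hs
            have h2 := C.simple j s (by rw [hI]; exact hs) t ht (by grind) (by rw [htp]; exact hsp)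
            grind
          · have hI := C.simple j t ht u hu hlt (by rw [htp, hup])
            refine Finite.subset (Set.toFinite {t, u}) ?_; rintro s ⟨hsp, hs⟩; by_contra hns
            rw [hI] at hs
            have h2 := C.simple j s (by rw [hI]; exact hs) u hu (by grind) (by rw [hup]; exact hsp)
            grind
        · refine Finite.subset (finite_singleton t) ?_; grind
      · refine Finite.subset finite_empty ?_; grind
    refine (countable_iUnion fun j => ((hsub j).image (Prod.mk j)).countable).mono ?_
    rintro ⟨j, t⟩ ⟨h1, h2⟩; aesop
  have h0 : Cᵐ (C.pt ⁻¹' {p} ∩ C.params) = 0 :=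
    le_antisymm ((restrict_apply_le _ _).trans (le_of_eq (hcount.measure_zero _))) zero_le
  filter_upwards [C.ae_mem_params, measure_eq_zero_iff_ae_notMem.1 h0] with x hx hx2 hxp
  exact hx2 ⟨hxp, hx⟩

/-! ### Area integrals of Cauchy transforms -/

/-- Fubini moves the area integral onto 1/|z - λ| with λ on the contour, where it is explicitly
bounded. This replaces pointwise bounds, which an integrable density does not provide near the
contour. -/
lemma integral_norm_cauchyTransform_le {w : C.Param → ℂ} (hw : Integrable w Cᵐ)
    (c : ℂ) (R : ℝ) {b : C.Param → ℝ}
    (hb : ∀ᵐ x ∂Cᵐ, ∫ z in ball c R, ‖z - C.pt x‖⁻¹ ≤ b x)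
    (hwb : Integrable (fun x => ‖w x‖ * b x) Cᵐ) :
    MeasureTheory.IntegrableOn (C.cauchyTransform w) (Metric.ball c R) ∧
    ∫ z in ball c R, ‖C.cauchyTransform w z‖ ≤ ∫ x, ‖w x‖ * b x ∂Cᵐ := by
  set ν := (volume : Measure ℂ).restrict (ball c R) with hν
  have hmeas : AEStronglyMeasurable (fun p : C.Param × ℂ => w p.1 / (p.2 - C.pt p.1))
      (Cᵐ.prod ν) := by
    have h1 : AEMeasurable (fun p : C.Param × ℂ => w p.1) (Cᵐ.prod ν) := by fun_prop
    exact (h1.div (measurable_snd.aemeasurable.sub C.aemeasurable_pt.comp_fst)).aestronglyMeasurable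
  have hslice : ∀ x, Integrable (fun z => w x / (z - C.pt x)) ν := by
    intro x; refine ((integrableOn_inv_norm_ball c (C.pt x) R).const_mul ‖w x‖).mono' ?_ ?_
    · exact Measurable.aestronglyMeasurable (by fun_prop)
    · exact ae_of_all _ fun z => by aesop
  have hnorm : ∀ x, ∫ z, ‖w x / (z - C.pt x)‖ ∂ν = ‖w x‖ * ∫ z in ball c R, ‖z - C.pt x‖⁻¹ := by
    intro x; rw [← integral_const_mul]; aesop
  have hle : ∀ᵐ x ∂Cᵐ, ∫ z, ‖w x / (z - C.pt x)‖ ∂ν ≤ ‖w x‖ * b x := by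
    filter_upwards [hb] with x hx; rw [hnorm]; gcongr
  have hint : Integrable (fun p : C.Param × ℂ => w p.1 / (p.2 - C.pt p.1)) (Cᵐ.prod ν) := by
    rw [integrable_prod_iff hmeas]
    refine ⟨ae_of_all _ hslice, hwb.mono' hmeas.norm.integral_prod_right' ?_⟩
    filter_upwards [hle] with x hx; rwa [norm_of_nonneg (integral_nonneg fun z => norm_nonneg _)]
  refine ⟨hint.integral_prod_right, ?_⟩
  calc ∫ z, ‖C.cauchyTransform w z‖ ∂ν
      ≤ ∫ z, ∫ x, ‖w x / (z - C.pt x)‖ ∂Cᵐ ∂ν := by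
        refine integral_mono_ae hint.integral_prod_right.norm hint.norm.integral_prod_right
          (ae_of_all _ fun z => ?_)
        exact norm_integral_le_integral_norm _
    _ = ∫ x, ∫ z, ‖w x / (z - C.pt x)‖ ∂ν ∂Cᵐ :=
        (integral_integral_swap (f := fun x z => ‖w x / (z - C.pt x)‖) hint.norm).symm
    _ ≤ _ := integral_mono_ae hint.norm.integral_prod_left hwb hle

/-- The mean of a Cauchy transform over a disc is at most of the order of the inverse radius. -/
lemma integral_norm_cauchyTransform_ball_le {w : C.Param → ℂ}
    (hw : Integrable w Cᵐ) : ∃ B : ℝ, 0 ≤ B ∧ ∀ (c : ℂ) (R : ℝ), 0 < R →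
      MeasureTheory.IntegrableOn (C.cauchyTransform w) (Metric.ball c R) ∧
      ∫ z in ball c R, ‖C.cauchyTransform w z‖ ≤ B * R := by
  refine ⟨(∫ x, ‖w x‖ ∂Cᵐ) * (discPotential + π), ?_, fun c R hR => ?_⟩
  · have := discPotential_nonneg; positivity
  · have h := C.integral_norm_cauchyTransform_le hw c R (b := fun _ => (discPotential + π) * R)
      (ae_of_all _ fun x => integral_inv_norm_ball_le c (C.pt x) hR) (hw.norm.mul_const _)
    grind [integral_mul_const, mul_assoc]

/-- Means of the Cauchy transform near a point at which the density is bounded. -/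
lemma integral_norm_cauchyTransform_center_le {w : C.Param → ℂ}
    (hw : Integrable w Cᵐ) (p : ℂ) {B r : ℝ} (hr : 0 < r)
    (hbd : ∀ᵐ x ∂Cᵐ, ‖C.pt x - p‖ < r → ‖w x‖ ≤ B * ‖C.vel x‖) :
    ∃ B' : ℝ, 0 ≤ B' ∧ ∀ R : ℝ, 0 < R →
      MeasureTheory.IntegrableOn (C.cauchyTransform w) (Metric.ball p R) ∧
      ∫ z in ball p R, ‖C.cauchyTransform w z‖ ≤ B' * R ^ (3 / 2 : ℝ) := by
  have hind : Integrable ({x | ‖C.pt x‖ ≤ ‖p‖ + r}.indicator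
      fun x => ‖C.vel x‖ * ‖C.pt x - p‖ ^ (-(1 / 2) : ℝ)) Cᵐ :=
    (C.integrableOn_vel_mul_rpow p (‖p‖ + r)).integrable_indicator₀ (C.nullMeasurableSet_norm_le _)
  -- Within distance r of p the density is at most a multiple of the speed, and the weight is
  -- integrable against arc length there; farther away the weight is at most r^(-1/2).
  have hwb : Integrable (fun x => ‖w x‖ * ‖C.pt x - p‖ ^ (-(1 / 2) : ℝ)) Cᵐ := by
    refine ((hind.const_mul |B|).add (hw.norm.mul_const (r ^ (-(1 / 2) : ℝ)))).mono' ?_ ?_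
    · exact (hw.aestronglyMeasurable.norm.aemeasurable.mul
        ((C.aemeasurable_pt.sub_const p).norm.pow_const _)).aestronglyMeasurable
    · filter_upwards [hbd] with x hx; rw [norm_of_nonneg (by positivity)]
      simp; by_cases hxr : ‖C.pt x - p‖ < r
      · have hmem : x ∈ {x | ‖C.pt x‖ ≤ ‖p‖ + r} := by
          have := norm_le_norm_add_norm_sub' (C.pt x) p; grind
        rw [indicator_of_mem hmem]; have h1 : 0 ≤ ‖w x‖ * r ^ (-(1 / 2) : ℝ) := by positivity
        have h2 : ‖w x‖ * ‖C.pt x - p‖ ^ (-(1 / 2) : ℝ) ≤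
            |B| * (‖C.vel x‖ * ‖C.pt x - p‖ ^ (-(1 / 2) : ℝ)) := by
          rw [← mul_assoc]; gcongr; exact (hx hxr).trans (by bound)
        linarith
      · have h1 : ‖w x‖ * ‖C.pt x - p‖ ^ (-(1 / 2) : ℝ) ≤ ‖w x‖ * r ^ (-(1 / 2) : ℝ) := by
          grind [mul_le_mul_of_nonneg_left, rpow_le_rpow_of_nonpos]
        have h2 : 0 ≤ |B| * {x | ‖C.pt x‖ ≤ ‖p‖ + r}.indicator
            (fun x => ‖C.vel x‖ * ‖C.pt x - p‖ ^ (-(1 / 2) : ℝ)) x :=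
          mul_nonneg (abs_nonneg _) (indicator_nonneg (fun x _ => by positivity) _)
        linarith
  set c0 := 2 * (discPotential + 2 * π) with hc₀
  have hc0' : 0 ≤ c0 := by have := discPotential_nonneg; positivity
  refine ⟨c0 * ∫ x, ‖w x‖ * ‖C.pt x - p‖ ^ (-(1 / 2) : ℝ) ∂Cᵐ,
    mul_nonneg hc0' (integral_nonneg fun x => by positivity), fun R hR => ?_⟩
  have h := C.integral_norm_cauchyTransform_le hw p R
    (b := fun x => c0 * (R ^ (3 / 2 : ℝ) * ‖C.pt x - p‖ ^ (-(1 / 2) : ℝ)))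
    (by filter_upwards [C.ae_pt_ne p] with x hx; grind [integral_inv_norm_ball_le_rpow])
    ((hwb.const_mul (c0 * R ^ (3 / 2 : ℝ))).congr (ae_of_all _ fun x => by ring))
  rw [← integral_const_mul, ← integral_mul_const]; grind

end Contour

/-! ### The jump of a Cauchy transform -/

lemma log_neg_of_im_neg {A : ℂ} (hA : A.im < 0) : Complex.log (-A) = Complex.log A + π * I := by
  rw [Complex.log, Complex.log, norm_neg, arg_neg_eq_arg_add_pi_of_im_neg hA]; push_cast; ring

lemma log_neg_of_im_pos {A : ℂ} (hA : 0 < A.im) : Complex.log (-A) = Complex.log A - π * I := by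
  rw [Complex.log, Complex.log, norm_neg, arg_neg_eq_arg_sub_pi_of_im_pos hA]; push_cast; ring

namespace Contour
variable {C : Contour} {j : Fin C.n} {t0 η : ℝ}

namespace IsChart

/-- The quotient of `Θ(w) - γ(u)` by `± iγ'(t0)`, as a perturbation of the case of a line. -/
lemma exists_quotient_eq (h : C.IsChart j t0 η) {w : ℂ} {u : ℝ} (hw : |w.re - t0| ≤ η)
    (hu : |u - t0| ≤ η) {σ : ℝ} (hσ : σ ^ 2 = 1) :
    ∃ e : ℂ, ‖e‖ ≤ |w.re - u| / 4 ∧ (C.straighten j t0 w - C.γ j u) / (σ * (I * deriv (C.γ j) t0)) =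
        ((σ * w.im : ℝ) : ℂ) - ((σ * (w.re - u) : ℝ) : ℂ) * I + e := by
  have hτ := h.deriv_ne; have hσ1 : |σ| = 1 := by grind
  have hσ0 : (σ : ℂ) ≠ 0 := by aesop
  have hσ2 : (σ : ℂ) * σ = 1 := by aesop
  refine ⟨(C.γ j w.re - C.γ j u - ((w.re - u : ℝ) : ℂ) * deriv (C.γ j) t0) /
    (σ * (I * deriv (C.γ j) t0)), ?_, ?_⟩
  · rw [norm_div, norm_mul, norm_mul, norm_I, one_mul, norm_real, norm_eq_abs,
      hσ1, one_mul, div_le_iff₀ h.norm_deriv_pos]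
    grind [approx]
  · rw [div_eq_iff (mul_ne_zero hσ0 (mul_ne_zero I_ne_zero hτ)), add_mul, div_mul_cancel₀ _
      (mul_ne_zero hσ0 (mul_ne_zero I_ne_zero hτ))]
    simp [straighten]; grind [I_mul_I]

/-- Dividing by σiγ'(t0) makes the points of side σ look positive: along the whole arc the quotient
avoids the negative real axis, so the principal logarithm is a primitive. -/
lemma quotient_mem_slitPlane (h : C.IsChart j t0 η) {w : ℂ} {u : ℝ} (hw : |w.re - t0| ≤ η)
    (hu : |u - t0| ≤ η) {σ : ℝ} (hσ : σ ^ 2 = 1) (hpos : 0 < σ * w.im ∨ w.re ≠ u) :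
    (C.straighten j t0 w - C.γ j u) / (σ * (I * deriv (C.γ j) t0)) ∈ slitPlane := by
  obtain ⟨e, he, heq⟩ := h.exists_quotient_eq hw hu hσ; rw [heq, mem_slitPlane_iff]
  have him := abs_im_le_norm e; have hσ1 : |σ| = 1 := by grind
  by_cases hd : w.re = u
  · simp_all
  · right; intro h0; simp at h0; grind

/-- The Cauchy transform of `1` on an arc. -/
lemma integral_inv_sub (h : C.IsChart j t0 η) {w : ℂ} (hw : |w.re - t0| ≤ η)
    {σ : ℝ} (hσ : σ ^ 2 = 1) (hpos : 0 < σ * w.im) :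
    ∫ t in (t0 - η)..(t0 + η), deriv (C.γ j) t / (C.straighten j t0 w - C.γ j t) =
      Complex.log ((C.straighten j t0 w - C.γ j (t0 - η)) / (σ * (I * deriv (C.γ j) t0))) -
      Complex.log ((C.straighten j t0 w - C.γ j (t0 + η)) / (σ * (I * deriv (C.γ j) t0))) := by
  set z := C.straighten j t0 w; set τ := (σ * (I * deriv (C.γ j) t0)) with hτ; have hη := h.pos
  have hIcc : Set.uIcc (t0 - η) (t0 + η) = Set.Icc (t0 - η) (t0 + η) := Set.uIcc_of_le (by linarith)
  have habs : ∀ t ∈ Set.Icc (t0 - η) (t0 + η), |t - t0| ≤ η := by grind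
  have hslit : ∀ t ∈ Set.Icc (t0 - η) (t0 + η), (z - C.γ j t) / τ ∈ slitPlane := fun t ht =>
    h.quotient_mem_slitPlane hw (habs t ht) hσ (Or.inl hpos)
  have hne : ∀ t ∈ Set.Icc (t0 - η) (t0 + η), z - C.γ j t ≠ 0 := fun t ht h0 => by
    have := hslit t ht; simp_all
  have hτ0 : τ ≠ 0 := by
    intro h0; have := hslit t0 ⟨by linarith, by linarith⟩
    simp_all
  have hder : ∀ t ∈ Set.uIcc (t0 - η) (t0 + η), HasDerivAt
      (fun t => -Complex.log ((z - C.γ j t) / τ)) (deriv (C.γ j) t / (z - C.γ j t)) t := by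
    intro t ht; rw [hIcc] at ht
    have h1 := (((C.hasDerivAt (h.sub ht)).const_sub z).div_const τ).clog_real (hslit t ht)
    refine h1.neg.congr_deriv ?_; grind
  have hcont : ContinuousOn (fun t => deriv (C.γ j) t / (z - C.γ j t))
      (Set.uIcc (t0 - η) (t0 + η)) := by
    rw [hIcc]
    refine ContinuousOn.div (fun t ht => (C.continuousAt_deriv (h.sub ht)).continuousWithinAt)
      (fun t ht => ?_) hne
    exact (continuousAt_const.sub (C.hasDerivAt (h.sub ht)).continuousAt).continuousWithinAt
  rw [intervalIntegral.integral_eq_sub_of_hasDerivAt hder hcont.intervalIntegrable]; ring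

end IsChart

/-- The Cauchy integral over an arc of a holomorphic density: the part without a jump. -/
lemma tendsto_integral_slope (h : C.IsChart j t0 η) {Q : ℂ → ℂ} {L r : ℝ}
    (hr : 0 < r) (harc : ∀ t ∈ Set.Icc (t0 - η) (t0 + η), C.γ j t ∈ ball (C.γ j t0) r)
    (hQc : ContinuousOn Q (ball (C.γ j t0) r))
    (hlip : ∀ z ∈ ball (C.γ j t0) r, ∀ z' ∈ ball (C.γ j t0) r, ‖Q z - Q z'‖ ≤ L * ‖z - z'‖) :
    Tendsto (fun z => ∫ t in (t0 - η)..(t0 + η),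
        (Q (C.γ j t) - Q z) / (z - C.γ j t) * deriv (C.γ j) t) (𝓝 (C.γ j t0))
      (𝓝 (∫ t in (t0 - η)..(t0 + η),
        (Q (C.γ j t) - Q (C.γ j t0)) / (C.γ j t0 - C.γ j t) * deriv (C.γ j) t)) := by
  have hη := h.pos; have hle : t0 - η ≤ t0 + η := by linarith
  have habs : ∀ t ∈ Set.Icc (t0 - η) (t0 + η), |t - t0| ≤ η := by grind
  have hball := ball_mem_nhds (C.γ j t0) hr
  have hγc : ContinuousOn (C.γ j) (Set.Ioc (t0 - η) (t0 + η)) := fun t ht =>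
    (C.hasDerivAt (h.sub (Set.Ioc_subset_Icc_self ht))).continuousAt.continuousWithinAt
  refine intervalIntegral.tendsto_integral_filter_of_dominated_convergence
    (fun _ => |L| * (5 / 4 * ‖deriv (C.γ j) t0‖)) ?_ ?_ intervalIntegrable_const ?_
  · filter_upwards [hball] with z hz; rw [uIoc_of_le hle]
    have h1 : AEMeasurable (fun t => Q (C.γ j t)) (volume.restrict (Set.Ioc (t0 - η) (t0 + η))) :=
      ContinuousOn.aemeasurable (hQc.comp hγc fun t ht => harc t (Set.Ioc_subset_Icc_self ht))
        measurableSet_Ioc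
    have h2 : AEMeasurable (C.γ j) (volume.restrict (Set.Ioc (t0 - η) (t0 + η))) :=
      hγc.aemeasurable measurableSet_Ioc
    exact (((h1.sub_const _).div (h2.const_sub z)).mul
      (measurable_deriv _).aemeasurable).aestronglyMeasurable
  · filter_upwards [hball] with z hz; refine ae_of_all _ fun t ht => ?_; rw [uIoc_of_le hle] at ht
    have ht' := Set.Ioc_subset_Icc_self ht; rw [norm_mul, norm_div]; have h1 := h.deriv_approx t ht'
    have h2 := norm_le_norm_add_norm_sub' (deriv (C.γ j) t) (deriv (C.γ j) t0)
    -- The Lipschitz constant of Q bounds the difference quotient uniformly in z, also at coincident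
    -- points, where division by zero gives zero.
    have h3 : ‖Q (C.γ j t) - Q z‖ / ‖z - C.γ j t‖ ≤ |L| := by
      refine div_le_of_le_mul₀ (norm_nonneg _) (abs_nonneg _) ?_
      refine (hlip _ (harc t ht') z hz).trans ?_; rw [norm_sub_rev]; bound
    gcongr; linarith
  · have hne : ∀ᵐ t : ℝ, t ≠ t0 := by simp [ae_iff, measure_singleton]
    filter_upwards [hne] with t htne ht; rw [uIoc_of_le hle] at ht
    have hne' : C.γ j t0 - C.γ j t ≠ 0 := by
      intro h0; have h1 := h.injOn (w := (t0 : ℂ)) (w' := (t : ℂ)) (by simpa using hη.le)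
        (by simpa using habs t (Set.Ioc_subset_Icc_self ht)) (by grind [straighten_ofReal])
      exact htne (ofReal_injective h1).symm
    have hQ0 : ContinuousAt Q (C.γ j t0) := hQc.continuousAt hball
    exact (((continuousAt_const.sub hQ0).div (continuousAt_id.sub continuousAt_const)
      hne').mul continuousAt_const).tendsto

/-- **The Plemelj formula** for a density which is holomorphic near a regular point. -/
theorem exists_jump_cauchyTransform {w : C.Param → ℂ} (hw : Integrable w Cᵐ)
    (ht0 : t0 ∈ C.regular j) {V : Set ℂ} (hV : IsOpen V) (hmem : C.γ j t0 ∈ V) {Q : ℂ → ℂ}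
    (hQ : DifferentiableOn ℂ Q V)
    (hwQ : ∀ᵐ x ∂Cᵐ, C.pt x ∈ V → w x = Q (C.pt x) * C.vel x) :
    ∃ L R : ℂ, Tendsto (C.cauchyTransform w) (C.leftNhds (j, t0)) (𝓝 L) ∧
      Tendsto (C.cauchyTransform w) (C.rightNhds (j, t0)) (𝓝 R) ∧
      L - R = -(2 * π * I) * Q (C.γ j t0) := by
  obtain ⟨r, hr, hrV⟩ := Metric.nhds_basis_closedBall.mem_iff.1 (hV.mem_nhds hmem)
  obtain ⟨M, hM⟩ := (isCompact_closedBall (C.γ j t0) r).exists_bound_of_continuousOn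
    ((hQ.deriv hV).continuousOn.mono hrV)
  have hlip : ∀ z ∈ ball (C.γ j t0) r, ∀ z' ∈ ball (C.γ j t0) r,
      ‖Q z - Q z'‖ ≤ M * ‖z - z'‖ := fun z hz z' hz' =>
    (convex_ball (C.γ j t0) r).norm_image_sub_le_of_norm_deriv_le
      (fun u hu => hQ.differentiableAt (hV.mem_nhds (hrV (ball_subset_closedBall hu))))
      (fun u hu => hM u (ball_subset_closedBall hu)) hz' hz
  obtain ⟨δ1, hδ1, hchart⟩ := exists_isChart ht0
  obtain ⟨δ2, hδ2, harc⟩ := Metric.continuousAt_iff.1 (C.hasDerivAt ht0).continuousAt r hr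
  set η := min δ1 (δ2 / 2) with hηdef; have hη : 0 < η := by positivity
  have h := hchart η hη (min_le_left _ _)
  have habs : ∀ t ∈ Set.Icc (t0 - η) (t0 + η), |t - t0| ≤ η := by grind
  have harc' : ∀ t ∈ Set.Icc (t0 - η) (t0 + η), C.γ j t ∈ ball (C.γ j t0) r := by
    intro t ht; refine harc ?_; rw [Real.dist_eq]; grind
  have hQc : ContinuousOn Q (ball (C.γ j t0) r) :=
    hQ.continuousOn.mono (Metric.ball_subset_closedBall.trans hrV)
  set A : Set C.Param := {j} ×ˢ Set.Ioc (t0 - η) (t0 + η) with hA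
  have hAm : MeasurableSet A := (measurableSet_singleton j).prod measurableSet_Ioc
  have hsubdom : Set.Ioc (t0 - η) (t0 + η) ⊆ C.dom j := fun t ht =>
    C.regular_subset_dom j (h.sub (Set.Ioc_subset_Icc_self ht))
  -- the part far from the point
  obtain ⟨r', hr', hball⟩ := Metric.mem_nhds_iff.1
    (show C.straighten j t0 '' square t0 η ∈ 𝓝 (C.γ j t0) by
      rw [← straighten_ofReal, ← h.map_nhds (by simpa using hη)]
      exact image_mem_map (square_mem_nhds hη))
  have hfar0 : ∀ᵐ x ∂Cᵐ, ‖C.pt x - C.γ j t0‖ < r' → Aᶜ.indicator w x = 0 := by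
    filter_upwards [C.ae_mem_params] with x hx hlt
    obtain ⟨u, hu, hux⟩ := hball (mem_ball_iff_norm.2 hlt)
    obtain ⟨h1, h2⟩ := h.sep x.1 x.2 hx u hu.1.le hu.2.le hux.symm; have h3 := abs_lt.1 hu.1
    grind [ofReal_re, indicator_of_notMem]
  have hfar : ContinuousAt (C.cauchyTransform (Aᶜ.indicator w)) (C.γ j t0) :=
    (C.hasDerivAt_cauchyTransform (hw.indicator hAm.compl) hr' hfar0).2.continuousAt
  -- the decomposition off the contour
  have hdec : ∀ z, z ∉ C.carrier → C.cauchyTransform w z = C.cauchyTransform (Aᶜ.indicator w) z +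
      (∫ t in (t0 - η)..(t0 + η), (Q (C.γ j t) - Q z) / (z - C.γ j t) * deriv (C.γ j) t) +
      Q z * ∫ t in (t0 - η)..(t0 + η), deriv (C.γ j) t / (z - C.γ j t) := by
    intro z hz; have h1 : C.cauchyTransform w z = C.cauchyTransform (Aᶜ.indicator w) z +
        ∫ x in A, w x / (z - C.pt x) ∂Cᵐ := by
      have hI := C.integrable_div_sub_pt hw hz; unfold cauchyTransform
      rw [← integral_add_compl hAm hI, add_comm, ← integral_indicator hAm.compl]
      grind [indicator_of_mem, indicator_of_notMem]
    have h2 : ∫ x in A, w x / (z - C.pt x) ∂Cᵐ =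
        ∫ x in A, Q (C.pt x) * C.vel x / (z - C.pt x) ∂Cᵐ := by
      refine setIntegral_congr_ae hAm ?_; filter_upwards [hwQ] with x hx hxA
      obtain ⟨rfl, hx2⟩ := hxA
      rw [hx (hrV (ball_subset_closedBall (harc' _ (Set.Ioc_subset_Icc_self hx2))))]
    have hle : t0 - η ≤ t0 + η := by linarith
    have hγc : ContinuousOn (C.γ j) (Set.uIcc (t0 - η) (t0 + η)) := fun t ht => by
      rw [Set.uIcc_of_le hle] at ht; exact (C.hasDerivAt (h.sub ht)).continuousAt.continuousWithinAt
    have hγ'c : ContinuousOn (deriv (C.γ j)) (Set.uIcc (t0 - η) (t0 + η)) := fun t ht => by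
      rw [Set.uIcc_of_le hle] at ht; exact (C.continuousAt_deriv (h.sub ht)).continuousWithinAt
    have hQγc : ContinuousOn (fun t => Q (C.γ j t)) (Set.uIcc (t0 - η) (t0 + η)) :=
      hQc.comp hγc fun t ht => harc' t (by rwa [Set.uIcc_of_le hle] at ht)
    have hne : ∀ t ∈ Set.uIcc (t0 - η) (t0 + η), z - C.γ j t ≠ 0 := fun t ht h0 => by
      rw [Set.uIcc_of_le hle] at ht
      exact hz (by rw [sub_eq_zero.1 h0]; exact C.mem_carrier (C.regular_subset_dom j (h.sub ht)))
    have i1 : IntervalIntegrable (fun t => (Q (C.γ j t) - Q z) / (z - C.γ j t) * deriv (C.γ j) t)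
        volume (t0 - η) (t0 + η) :=
      (((hQγc.sub continuousOn_const).div (continuousOn_const.sub hγc) hne).mul
        hγ'c).intervalIntegrable
    have i2 : IntervalIntegrable (fun t => Q z * (deriv (C.γ j) t / (z - C.γ j t)))
        volume (t0 - η) (t0 + η) :=
      (continuousOn_const.mul (hγ'c.div (continuousOn_const.sub hγc) hne)).intervalIntegrable
    rw [h1, h2, C.setIntegral_arc j measurableSet_Ioc hsubdom,
      ← intervalIntegral.integral_of_le hle, add_assoc, ← intervalIntegral.integral_const_mul,
      ← intervalIntegral.integral_add i1 i2]
    congr 1; refine intervalIntegral.integral_congr fun t ht => ?_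
    change Q (C.γ j t) * deriv (C.γ j) t / (z - C.γ j t) = _; grind
  have hT := C.tendsto_integral_slope h hr harc' hQc hlip; set T := ∫ t in (t0 - η)..(t0 + η),
        (Q (C.γ j t) - Q (C.γ j t0)) / (C.γ j t0 - C.γ j t) * deriv (C.γ j) t with hTdef
  set a : ℝ → ℝ → ℂ := fun σ u => (C.γ j t0 - C.γ j u) / (σ * (I * deriv (C.γ j) t0)) with ha
  have hside : ∀ σ : ℝ, σ ^ 2 = 1 → Tendsto (C.cauchyTransform w ∘ C.straighten j t0)
      (𝓝[{w | 0 < σ * w.im}] (t0 : ℂ)) (𝓝 (C.cauchyTransform (Aᶜ.indicator w) (C.γ j t0) + T +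
        Q (C.γ j t0) * (Complex.log (a σ (t0 - η)) - Complex.log (a σ (t0 + η))))) := by
    intro σ hσ
    have hΘ : Tendsto (C.straighten j t0) (𝓝[{w | 0 < σ * w.im}] (t0 : ℂ)) (𝓝 (C.γ j t0)) := by
      have := (h.continuousAt (w := (t0 : ℂ)) (by simpa using hη)).tendsto
      grind [Tendsto.mono_left, straighten_ofReal, nhdsWithin_le_nhds]
    have hlog : ∀ u, u ≠ t0 → |u - t0| ≤ η → Tendsto (fun w => Complex.log
        ((C.straighten j t0 w - C.γ j u) / (σ * (I * deriv (C.γ j) t0))))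
        (𝓝[{w | 0 < σ * w.im}] (t0 : ℂ)) (𝓝 (Complex.log (a σ u))) := by
      intro u hu hu'
      have hs := h.quotient_mem_slitPlane (w := (t0 : ℂ)) (u := u) (by simpa using hη.le) hu' hσ
        (Or.inr (by simpa using hu.symm))
      rw [straighten_ofReal] at hs; exact ((hΘ.sub_const _).div_const _).clog hs
    have hQ0 : Tendsto Q (𝓝 (C.γ j t0)) (𝓝 (Q (C.γ j t0))) :=
      (hQc.continuousAt (ball_mem_nhds _ hr)).tendsto
    refine (((hfar.tendsto.comp hΘ).add (hT.comp hΘ)).add ((hQ0.comp hΘ).mul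
      ((hlog (t0 - η) (by linarith) (by grind)).sub
      (hlog (t0 + η) (by linarith) (by grind))))).congr' ?_
    filter_upwards [nhdsWithin_le_nhds (square_mem_nhds hη), self_mem_nhdsWithin] with u hu hpos
    have huim : u.im ≠ 0 := by grind
    have hz : C.straighten j t0 u ∉ C.carrier := fun hc =>
      huim ((h.mem_carrier_iff hu.1.le hu.2.le).1 hc)
    simp; rw [hdec _ hz, h.integral_inv_sub hu.1.le hσ hpos]
  have hleft := hside 1 (by norm_num)
  have hright := hside (-1) (by norm_num)
  simp at hleft; simp at hright; refine ⟨_, _, by rw [leftNhds_eq]; bound,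
    by rw [rightNhds_eq]; bound, ?_⟩
  -- The logarithms for the two sides have opposite arguments. The initial point of the arc gives an
  -- argument in the lower and the end point one in the upper half-plane, so the branches shift by
  -- +πi and -πi and their difference is 2πi.
  · have hneg : ∀ u, a (-1) u = -a 1 u := fun u => by simp [ha, div_neg]
    have him : ∀ u, |u - t0| ≤ η → |(a 1 u).im + (t0 - u)| ≤ |t0 - u| / 4 := by
      intro u hu
      obtain ⟨e, he, heq⟩ := h.exists_quotient_eq (w := (t0 : ℂ)) (u := u) (by simpa using hη.le) hu
        (σ := 1) (by norm_num)
      rw [straighten_ofReal] at heq; simp only [ha]; rw [heq]; simp at he ⊢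
      have := abs_im_le_norm e; grind
    have h1 : (a 1 (t0 - η)).im < 0 := by grind [abs_le, abs_of_pos]
    have h2 : 0 < (a 1 (t0 + η)).im := by grind [abs_le, abs_of_pos]
    grind [log_neg_of_im_neg, log_neg_of_im_pos]

end Contour

/-! ### Riemann–Hilbert problems -/

namespace Contour
variable {C : Contour}

lemma leftNhds_le {j : Fin C.n} {t : ℝ} (ht : t ∈ C.regular j) :
    C.leftNhds (j, t) ≤ 𝓝[C.carrierᶜ] (C.γ j t) := by
  obtain ⟨η, hη, hch⟩ := exists_isChart ht; have h := hch η hη le_rfl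
  rw [leftNhds_eq, nhdsWithin, ← straighten_ofReal]
  refine le_inf ((Filter.map_mono nhdsWithin_le_nhds).trans (h.continuousAt (by simpa using hη))) ?_
  rw [le_principal_iff, Filter.mem_map]
  filter_upwards [nhdsWithin_le_nhds (square_mem_nhds hη), self_mem_nhdsWithin] with w hw hpos hc
  exact (ne_of_gt hpos) ((h.mem_carrier_iff hw.1.le hw.2.le).1 hc)

lemma rightNhds_le {j : Fin C.n} {t : ℝ} (ht : t ∈ C.regular j) :
    C.rightNhds (j, t) ≤ 𝓝[C.carrierᶜ] (C.γ j t) := by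
  obtain ⟨η, hη, hch⟩ := exists_isChart ht; have h := hch η hη le_rfl
  rw [rightNhds_eq, nhdsWithin, ← straighten_ofReal]
  refine le_inf ((Filter.map_mono nhdsWithin_le_nhds).trans (h.continuousAt (by simpa using hη))) ?_
  rw [le_principal_iff, Filter.mem_map]
  filter_upwards [nhdsWithin_le_nhds (square_mem_nhds hη), self_mem_nhdsWithin] with w hw hneg hc
  exact (ne_of_lt hneg) ((h.mem_carrier_iff hw.1.le hw.2.le).1 hc)

instance (x : C.Param) : (C.leftNhds x).NeBot := by unfold leftNhds; infer_instance

instance (x : C.Param) : (C.rightNhds x).NeBot := by unfold rightNhds; infer_instance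

/-- Growth slower than any negative power at the exceptional points. -/
def Mild (C : Contour) (u : ℂ → ℂ) : Prop := ∀ p ∈ C.exceptional, ∀ ε : ℝ, 0 < ε →
    u =O[𝓝[C.carrierᶜ] p] fun z => ‖z - p‖ ^ (-ε)

lemma eventually_norm_sub_pos {p : ℂ} (hp : p ∈ C.exceptional) :
    ∀ᶠ z in 𝓝[C.carrierᶜ] p, 0 < ‖z - p‖ := by
  filter_upwards [self_mem_nhdsWithin] with z hz; grind [norm_pos_iff, exceptional_subset]

lemma Mild.const (c : ℂ) : C.Mild fun _ => c := by
  intro p hp ε hε; refine Asymptotics.IsBigO.of_bound ‖c‖ ?_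
  filter_upwards [C.eventually_norm_sub_pos hp,
    nhdsWithin_le_nhds (ball_mem_nhds p one_pos)] with z hz hz1
  grind [norm_of_nonneg, le_mul_of_one_le_right, one_le_rpow_of_pos_of_le_one_of_nonpos, mem_ball_iff_norm]

lemma Mild.add {u v : ℂ → ℂ} (hu : C.Mild u) (hv : C.Mild v) : C.Mild fun z => u z + v z :=
  fun p hp ε hε => (hu p hp ε hε).add (hv p hp ε hε)

lemma Mild.mul {u v : ℂ → ℂ} (hu : C.Mild u) (hv : C.Mild v) : C.Mild fun z => u z * v z := by
  intro p hp ε hε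
  refine ((hu p hp (ε / 2) (by positivity)).mul (hv p hp (ε / 2) (by positivity))).congr'
    EventuallyEq.rfl ?_
  filter_upwards [C.eventually_norm_sub_pos hp] with z hz; rw [← rpow_add hz]; ring

lemma Mild.sum {ι : Type*} (s : Finset ι) {u : ι → ℂ → ℂ} (hu : ∀ i ∈ s, C.Mild (u i)) :
    C.Mild fun z => ∑ i ∈ s, u i z := fun p hp ε hε => by
  have := Asymptotics.IsBigO.sum fun i hi => hu i hi p hp ε hε; simpa only [sum_fn] using this

lemma Mild.prod {ι : Type*} (s : Finset ι) {u : ι → ℂ → ℂ} (hu : ∀ i ∈ s, C.Mild (u i)) :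
    C.Mild fun z => ∏ i ∈ s, u i z := by
  classical
  induction s using Finset.induction_on with
  | empty => simpa using Mild.const 1
  | insert i s hi ih =>
    simp_all [Mild.mul]

/-- Means over small discs of a mild factor times a function with controlled means. -/
lemma exists_integral_ball_le (p : ℂ) {h : ℂ → ℂ} {u : ℂ → ℝ} {c B' : ℝ} (hc : 0 ≤ c) (hB' : 0 ≤ B')
    (hb : ∀ᶠ w in 𝓝[C.carrierᶜ] p, ‖h w‖ ≤ c * ‖w - p‖ ^ (-(1 / 4) : ℝ) * (1 + u w))
    (hu0 : ∀ w, 0 ≤ u w) (hu : ∀ R : ℝ, 0 < R → MeasureTheory.IntegrableOn u (Metric.ball p R) ∧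
      ∫ w in ball p R, u w ≤ B' * R ^ (3 / 2 : ℝ)) :
    ∃ B : ℝ, ∀ᶠ z in 𝓝[≠] p,
      ∫ w in Metric.ball z (‖z - p‖ / 2), ‖h w‖ ≤ B * ‖z - p‖ ^ (5 / 4 : ℝ) := by
  rw [eventually_nhdsWithin_iff, Metric.eventually_nhds_iff] at hb; obtain ⟨ρ, hρ, hb⟩ := hb
  -- With d = |z - p|, the distance to p on the disc B(z, d/2) is at least d/2, and the disc lies in
  -- B(p, 2d). The exponents combine as 3/2 - 1/4 = 5/4; the constant 1 contributes an area of order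
  -- d² ≤ d^(3/2), as d < 1.
  refine ⟨c * (1 / 2) ^ (-(1 / 4) : ℝ) * (π + B' * 2 ^ (3 / 2 : ℝ)), ?_⟩; have hpi := pi_pos
  have hm : 0 < min (ρ / 2) 1 := by positivity
  filter_upwards [nhdsWithin_le_nhds (ball_mem_nhds p hm), self_mem_nhdsWithin] with z hz hzp
  rw [mem_ball_iff_norm] at hz; set d := ‖z - p‖ with hd
  have hd0 : 0 < d := norm_pos_iff.2 (sub_ne_zero.2 hzp); have hd1 : d < 1 := by grind
  have hdρ : d < ρ / 2 := by grind
  have hsub : ball z (d / 2) ⊆ ball p (2 * d) := by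
    intro w hw; rw [mem_ball_iff_norm] at hw ⊢; have := norm_sub_le_norm_sub_add_norm_sub w z p
    linarith
  obtain ⟨hui, hule⟩ := hu (2 * d) (by positivity)
  have hui' := hui.mono_set hsub; have h1 : ∫ w in ball z (d / 2), ‖h w‖ ≤
      ∫ w in ball z (d / 2), c * (d / 2) ^ (-(1 / 4) : ℝ) * (1 + u w) := by
    refine integral_mono_of_nonneg (ae_of_all _ fun w => norm_nonneg _) ?_ ?_
    · exact ((integrableOn_const (by simp [Complex.volume_ball, ENNReal.mul_eq_top])).add hui').const_mul _
    · have hae := ae_restrict_of_ae (s := ball z (d / 2)) C.ae_notMem_carrier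
      filter_upwards [hae, ae_restrict_mem Metric.isOpen_ball.measurableSet] with w hwC hw
      rw [mem_ball_iff_norm] at hw; have e1 := norm_sub_le_norm_sub_add_norm_sub w z p
      have e2 := norm_sub_le_norm_sub_add_norm_sub z w p; rw [norm_sub_rev z w] at e2
      refine (hb (y := w) (by rw [dist_eq_norm]; linarith) hwC).trans ?_
      have := hu0 w; have e3 : ‖w - p‖ ^ (-(1 / 4) : ℝ) ≤ (d / 2) ^ (-(1 / 4) : ℝ) :=
        rpow_le_rpow_of_nonpos (by positivity) (by linarith) (by norm_num)
      gcongr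
  refine h1.trans ?_
  have hone : Integrable (fun _ : ℂ => (1 : ℝ)) (volume.restrict (ball z (d / 2))) :=
    integrableOn_const (by simp [Complex.volume_ball, ENNReal.mul_eq_top])
  rw [integral_const_mul, integral_add hone hui', setIntegral_const,
    volume_real_ball z (by positivity : 0 ≤ d / 2), smul_eq_mul, mul_one]
  have h2 : ∫ w in ball z (d / 2), u w ≤ B' * (2 * d) ^ (3 / 2 : ℝ) :=
    (setIntegral_mono_set hui (ae_of_all _ hu0) hsub.eventuallyLE).trans hule
  have h3 : π * (d / 2) ^ 2 ≤ π * d ^ (3 / 2 : ℝ) := by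
    have : d ^ (2 : ℝ) ≤ d ^ (3 / 2 : ℝ) := rpow_le_rpow_of_exponent_ge hd0 hd1.le (by norm_num)
    rw [rpow_two] at this; nlinarith
  rw [mul_rpow (by norm_num) hd0.le] at h2
  have h4 : (d / 2) ^ (-(1 / 4) : ℝ) = (1 / 2) ^ (-(1 / 4) : ℝ) * d ^ (-(1 / 4) : ℝ) := by
    grind [mul_rpow]
  have h5 : d ^ (-(1 / 4) : ℝ) * d ^ (3 / 2 : ℝ) = d ^ (5 / 4 : ℝ) := by
    rw [← rpow_add hd0]; norm_num
  calc c * (d / 2) ^ (-(1 / 4) : ℝ) * (π * (d / 2) ^ 2 + ∫ w in ball z (d / 2), u w)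
      ≤ c * (d / 2) ^ (-(1 / 4) : ℝ) * (π * d ^ (3 / 2 : ℝ) +
        B' * (2 ^ (3 / 2 : ℝ) * d ^ (3 / 2 : ℝ))) := by gcongr
    _ = c * (1 / 2) ^ (-(1 / 4) : ℝ) * (π + B' * 2 ^ (3 / 2 : ℝ)) *
        (d ^ (-(1 / 4) : ℝ) * d ^ (3 / 2 : ℝ)) := by rw [h4]; ring
    _ = _ := by rw [h5]

lemma Mild.exists_integral_ball_le {h : ℂ → ℂ} (hh : C.Mild h) {p : ℂ} (hp : p ∈ C.exceptional) :
    ∃ B : ℝ, ∀ᶠ z in 𝓝[≠] p, ∫ w in ball z (‖z - p‖ / 2), ‖h w‖ ≤ B * ‖z - p‖ ^ (5 / 4 : ℝ) := by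
  obtain ⟨c, hc, hb⟩ := (hh p hp (1 / 4) (by norm_num)).exists_nonneg
  refine C.exists_integral_ball_le p (u := 0) hc le_rfl ?_ (fun _ => le_rfl) fun R hR => ?_
  · filter_upwards [hb.bound] with w hw; rw [norm_of_nonneg (by positivity)] at hw
    simpa using hw
  · simp [MeasureTheory.IntegrableOn]

end Contour

/-- A weaker form of `IsRHSolution`, which passes to the inverse. -/
structure IsWeakRHSolution (C : Contour) {r : ℕ} (M : ℂ → Matrix (Fin r) (Fin r) ℂ)
    (Γ : ℂ → Matrix (Fin r) (Fin r) ℂ) : Prop where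
  analytic : ∀ i k, DifferentiableOn ℂ (fun z => Γ z i k) C.carrierᶜ
  jump : ∀ j, ∀ t ∈ C.regular j, ∃ P Q : Matrix (Fin r) (Fin r) ℂ,
    Tendsto Γ (C.leftNhds (j, t)) (𝓝 P) ∧ Tendsto Γ (C.rightNhds (j, t)) (𝓝 Q) ∧ P = Q * M (C.γ j t)
  infinity : Tendsto Γ (cocompact ℂ ⊓ 𝓟 C.carrierᶜ) (𝓝 1)
  mild : ∀ i k, C.Mild fun z => Γ z i k

section
variable {C : Contour} {r : ℕ}

lemma IsRHSolution.weak {M Γ : ℂ → Matrix (Fin r) (Fin r) ℂ} (h : IsRHSolution C M Γ) :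
    IsWeakRHSolution C M Γ where
  analytic := h.analytic
  jump := h.jump
  infinity := by
    refine tendsto_pi_nhds.2 fun i => tendsto_pi_nhds.2 fun k => ?_
    have h1 : Tendsto (fun z : ℂ => z⁻¹) (cocompact ℂ ⊓ 𝓟 C.carrierᶜ) (𝓝 0) :=
      (tendsto_inv₀_cobounded (α := ℂ)).mono_left
        (inf_le_left.trans Metric.cobounded_eq_cocompact.ge)
    have h2 := ((h.infinity i k).trans_tendsto h1).add_const ((1 : Matrix (Fin r) (Fin r) ℂ) i k)
    simpa using h2
  mild := by
    intro i k p hp ε hε; obtain ⟨j, t, ht, rfl⟩ := Set.mem_iUnion.1 hp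
    refine (h.exceptional j t ht i k).trans ?_
    have h2 : Tendsto (fun z => ‖z - C.γ j t‖) (𝓝[C.carrierᶜ] (C.γ j t)) (𝓝[>] 0) := by
      refine tendsto_nhdsWithin_iff.2 ⟨?_, C.eventually_norm_sub_pos hp⟩
      have : ContinuousAt (fun z : ℂ => ‖z - C.γ j t‖) (C.γ j t) := by fun_prop
      have h := this.tendsto; simp at h; exact h.mono_left nhdsWithin_le_nhds
    exact ((isLittleO_log_rpow_nhdsGT_zero (r := -ε) (by linarith)).isBigO).comp_tendsto h2

namespace IsWeakRHSolution
variable {M Γ : ℂ → Matrix (Fin r) (Fin r) ℂ}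

lemma differentiableOn_det_of_entries {n : ℕ} {A : ℂ → Matrix (Fin n) (Fin n) ℂ} {s : Set ℂ}
    (hA : ∀ i k, DifferentiableOn ℂ (fun z => A z i k) s) :
    DifferentiableOn ℂ (fun z => (A z).det) s := by
  simp [det_apply]; fun_prop

lemma mild_det_of_entries {n : ℕ} {A : ℂ → Matrix (Fin n) (Fin n) ℂ}
    (hA : ∀ i k, C.Mild fun z => A z i k) : C.Mild fun z => (A z).det := by
  simp [det_apply']
  exact Contour.Mild.sum _ fun σ _ =>
    (Contour.Mild.const _).mul (Contour.Mild.prod _ fun i _ => hA _ _)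

/-- The function det Γ - 1 has no jump because det M = 1, is mild at the exceptional points and
tends to zero at infinity, so Liouville's theorem applies. -/
lemma det_eq_one (h : IsWeakRHSolution C M Γ) (hM : ∀ z ∈ C.carrier, (M z).det = 1) :
    ∀ z ∉ C.carrier, (Γ z).det = 1 := by
  have hcont : Continuous fun A : Matrix (Fin r) (Fin r) ℂ => A.det - 1 := by fun_prop
  have hreg : ∀ j, ∀ t ∈ C.regular j, ∃ l,
      Tendsto (fun z => (Γ z).det - 1) (C.leftNhds (j, t)) (𝓝 l) ∧
      Tendsto (fun z => (Γ z).det - 1) (C.rightNhds (j, t)) (𝓝 l) := by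
    intro j t ht; obtain ⟨P, Q, hP, hQ, hPQ⟩ := h.jump j t ht
    refine ⟨P.det - 1, (hcont.tendsto P).comp hP, ?_⟩
    rw [hPQ, det_mul, hM _ (C.mem_carrier (C.regular_subset_dom j ht)), mul_one]
    exact (hcont.tendsto Q).comp hQ
  have hmild : C.Mild fun z => (Γ z).det - 1 := by
    simp [sub_eq_add_neg]; exact (mild_det_of_entries h.mild).add (Contour.Mild.const _)
  obtain ⟨H, hH, he⟩ := C.exists_entire_extension
    ((differentiableOn_det_of_entries h.analytic).sub_const 1) hreg
    fun p hp => hmild.exists_integral_ball_le hp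
  have h1 : Tendsto (fun z => (Γ z).det - 1) (cocompact ℂ ⊓ 𝓟 C.carrierᶜ) (𝓝 0) := by
    have := (hcont.tendsto 1).comp h.infinity; aesop
  intro z hz; exact sub_eq_zero.1 (C.eq_zero_of_tendsto hH he h1 hz)

/-- The transposed adjugate solves the problem whose jump is the transposed adjugate. -/
lemma adjugate_transpose (h : IsWeakRHSolution C M Γ) :
    IsWeakRHSolution C (fun z => (M z).adjugateᵀ) fun z => (Γ z).adjugateᵀ := by
  have hcont : Continuous fun A : Matrix (Fin r) (Fin r) ℂ => A.adjugateᵀ := by fun_prop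
  -- Entries of the adjugate are determinants with one row replaced by a basis vector, so holomorphy
  -- and mildness pass to them from the entries of Γ.
  have hentry : ∀ (i k : Fin r) (z : ℂ), (Γ z).adjugateᵀ i k =
      (of fun a b => if a = i then (if b = k then (1 : ℂ) else 0) else Γ z a b).det := by
    intro i k z; rw [transpose_apply, adjugate_apply]; congr 1; aesop
  refine ⟨fun i k => ?_, fun j t ht => ?_, ?_, fun i k => ?_⟩
  · simp only [hentry]; refine differentiableOn_det_of_entries fun a b => ?_; by_cases ha : a = i
    · simp [ha]
    · simpa [ha] using h.analytic a b
  · obtain ⟨P, Q, hP, hQ, hPQ⟩ := h.jump j t ht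
    refine ⟨P.adjugateᵀ, Q.adjugateᵀ, (hcont.tendsto P).comp hP, (hcont.tendsto Q).comp hQ, ?_⟩
    simp_all [adjugate_mul_distrib]
  · have := (hcont.tendsto 1).comp h.infinity; aesop
  · simp only [hentry]; refine mild_det_of_entries fun a b => ?_; by_cases ha : a = i
    · simpa [ha] using Contour.Mild.const _
    · simpa [ha] using h.mild a b

end IsWeakRHSolution

/-! ### The jump matrix of an integrable kernel -/

lemma det_integrableJump {f g : ℂ → Fin r → ℂ} {l : ℂ} (h : f l ⬝ᵥ g l = 0) :
    (integrableJump f g l).det = 1 := by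
  have h1 : integrableJump f g l = 1 + replicateCol Unit (-(2 * π * I) • f l) *
      replicateRow Unit (g l) := by
    rw [integrableJump, sub_eq_add_neg]; ext i k
    simp [vecMulVec_apply, Matrix.mul_apply, mul_assoc]
  simp_all [det_one_add_replicateCol_mul_replicateRow, dotProduct_comm]

/-- The rank-one matrix f gᵀ has square zero, because gᵀf = 0; inversion therefore only changes its
sign. -/
lemma integrableJump_mul {f g : ℂ → Fin r → ℂ} {l : ℂ} (h : f l ⬝ᵥ g l = 0) :
    integrableJump f g l * integrableJump f (-g) l = 1 := by
  have h1 : g l ⬝ᵥ f l = 0 := by rw [dotProduct_comm, h]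
  have h2 : vecMulVec (f l) (g l) * vecMulVec (f l) (g l) = 0 := by
    ext i k; rw [Matrix.mul_apply, Matrix.zero_apply]
    calc ∑ a, f l i * g l a * (f l a * g l k) = f l i * (∑ a, g l a * f l a) * g l k := by
          rw [mul_sum, sum_mul]; grind
      _ = f l i * (g l ⬝ᵥ f l) * g l k := rfl
      _ = 0 := by rw [h1]; ring
  simp only [integrableJump, sub_mul, mul_sub, Matrix.one_mul, Matrix.mul_one, smul_mul_assoc,
    mul_smul_comm, Pi.neg_apply, vecMulVec_neg, mul_neg, smul_neg, h2, smul_zero]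
  simp

lemma adjugate_integrableJump {f g : ℂ → Fin r → ℂ} {l : ℂ} (h : f l ⬝ᵥ g l = 0) :
    (integrableJump f g l).adjugate = integrableJump f (-g) l := by
  grind [adjugate_mul, integrableJump_mul, one_smul, det_integrableJump]

lemma transpose_integrableJump (f g : ℂ → Fin r → ℂ) (l : ℂ) :
    (integrableJump f (-g) l)ᵀ = integrableJump g (-f) l := by
  simp [integrableJump]

/-- The transposed adjugate of the solution for `(f, g)` is the solution for `(g, -f)`. -/
lemma IsWeakRHSolution.swap {f g : ℂ → Fin r → ℂ} {Γ : ℂ → Matrix (Fin r) (Fin r) ℂ}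
    (h : IsWeakRHSolution C (integrableJump f g) Γ) (hfg : ∀ l ∈ C.carrier, f l ⬝ᵥ g l = 0) :
    IsWeakRHSolution C (integrableJump g (-f)) fun z => (Γ z).adjugateᵀ := by
  have h1 := h.adjugate_transpose; refine ⟨h1.analytic, fun j t ht => ?_, h1.infinity, h1.mild⟩
  grind [IsWeakRHSolution.jump, adjugate_integrableJump, Contour.mem_carrier, Contour.regular_subset_dom, transpose_integrableJump]

end

lemma norm_dotProduct_le {r : ℕ} (u v : Fin r → ℂ) : ‖u ⬝ᵥ v‖ ≤ r * ‖u‖ * ‖v‖ := by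
  refine (norm_sum_le _ _).trans ?_
  calc ∑ i, ‖u i * v i‖ ≤ ∑ i : Fin r, ‖u‖ * ‖v‖ := by
        refine sum_le_sum fun i _ => ?_; simp [mul_le_mul, norm_le_pi_norm]
    _ = _ := by simp [mul_assoc]

lemma DifferentiableOn.dotProduct {r : ℕ} {u v : ℂ → Fin r → ℂ} {s : Set ℂ}
    (hu : DifferentiableOn ℂ u s) (hv : DifferentiableOn ℂ v s) :
    DifferentiableOn ℂ (fun z => u z ⬝ᵥ v z) s :=
  DifferentiableOn.fun_sum fun i _ => (differentiableOn_pi.1 hu i).mul (differentiableOn_pi.1 hv i)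

lemma ContinuousAt.dotProduct {X : Type*} [TopologicalSpace X] {r : ℕ} {u v : X → Fin r → ℂ} {x : X}
    (hu : ContinuousAt u x) (hv : ContinuousAt v x) : ContinuousAt (fun x => u x ⬝ᵥ v x) x :=
  tendsto_finsetSum _ fun i _ => (continuousAt_pi.1 hu i).mul (continuousAt_pi.1 hv i)

/-- An integral depending holomorphically on a parameter is holomorphic. -/
lemma differentiableAt_integral_of_bound {X : Type*} [MeasurableSpace X] {μ : Measure X}
    {F : ℂ → X → ℂ} {z0 : ℂ} {ρ : ℝ} (hρ : 0 < ρ) {bound : X → ℝ}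
    (hmeas : ∀ z ∈ ball z0 ρ, AEStronglyMeasurable (F z) μ)
    (hd : ∀ᵐ x ∂μ, DifferentiableOn ℂ (fun z => F z x) (ball z0 ρ))
    (hb : ∀ᵐ x ∂μ, ∀ z ∈ ball z0 ρ, ‖F z x‖ ≤ bound x) (hbi : Integrable bound μ) :
    DifferentiableAt ℂ (fun z => ∫ x, F z x ∂μ) z0 := by
  have hz₀ : z0 ∈ ball z0 ρ := mem_ball_self hρ
  -- A sequence of increments inside the disc: the derivative is measurable as the limit of the
  -- difference quotients along it.
  set h : ℕ → ℂ := fun n => ((ρ / (n + 2) : ℝ) : ℂ) with hh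
  have hpos : ∀ n : ℕ, 0 < ρ / ((n : ℝ) + 2) := fun n => by positivity
  have hlim : Tendsto h atTop (𝓝[≠] 0) := by
    refine tendsto_nhdsWithin_iff.2 ⟨?_, Eventually.of_forall fun n => ?_⟩
    · have h1 : Tendsto (fun n : ℕ => ρ / ((n : ℝ) + 2)) atTop (𝓝 0) := tendsto_const_nhds.div_atTop
          (tendsto_atTop_add_const_right _ _ tendsto_natCast_atTop_atTop)
      have := (Complex.continuous_ofReal.tendsto 0).comp h1; bound
    · simp only [hh, mem_compl_iff, mem_singleton_iff, ofReal_eq_zero]; exact (hpos n).ne'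
  have hmemh : ∀ n, z0 + h n ∈ ball z0 ρ := fun n => by
    rw [mem_ball_iff_norm, add_sub_cancel_left, norm_real, norm_of_nonneg (hpos n).le,
      div_lt_iff₀ (by positivity)]
    nlinarith
  have hF' : AEStronglyMeasurable (fun x => deriv (fun z => F z x) z0) μ := by
    refine aestronglyMeasurable_of_tendsto_ae atTop
      (f := fun n x => (h n)⁻¹ • (F (z0 + h n) x - F z0 x))
      (fun n => by exact ((hmeas _ (hmemh n)).sub (hmeas _ hz₀)).const_smul ((h n)⁻¹)) ?_
    filter_upwards [hd] with x hx
    exact ((hx.differentiableAt (ball_mem_nhds z0 hρ)).hasDerivAt).tendsto_slope_zero.comp hlim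
  refine (hasDerivAt_integral_of_dominated_loc_of_deriv_le (s := ball z0 (ρ / 2))
    (bound := fun x => bound x / (ρ / 4)) (F' := fun z x => deriv (fun z => F z x) z)
    (ball_mem_nhds _ (by positivity)) ?_ ?_ hF' ?_ (hbi.div_const _) ?_).2.differentiableAt
  · filter_upwards [ball_mem_nhds z0 hρ] with z hz using hmeas z hz
  · grind [Integrable.mono', Eventually.mono]
  · filter_upwards [hd, hb] with x hx hxb z hz
    grind [closedBall_subset_ball', dist_eq_norm, mem_ball_iff_norm, norm_deriv_le_of_forall_mem_sphere_norm_le, DifferentiableOn.diffContOnCl, closure_ball, DifferentiableOn.mono, sphere_subset_closedBall]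
  · filter_upwards [hd] with x hx z hz
    have hz' : z ∈ ball z0 ρ := ball_subset_ball (by linarith) hz
    exact (hx.differentiableAt (Metric.isOpen_ball.mem_nhds hz')).hasDerivAt

/-! ### Integrable kernels -/

section Kernel
variable {r : ℕ} {f g : ℂ → Fin r → ℂ} {U : Set ℂ}

/-- The kernel is at most `a(λ) a(μ)` on `X0`. -/
abbrev KernelBound (C : Contour) (f g : ℂ → Fin r → ℂ) (X0 : Set C.Param) (a : C.Param → ℝ) :=
  ∀ x ∈ X0, ∀ y ∈ X0, ‖integrableKernel f g (C.pt x) (C.pt y)‖ ≤ a x * a y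

lemma integrableKernel_of_ne {l m : ℂ} (h : l ≠ m) :
    integrableKernel f g l m = (f l ⬝ᵥ g m) / (l - m) := by
  rw [integrableKernel, if_neg h]

lemma integrableKernel_self (l : ℂ) : integrableKernel f g l l = deriv f l ⬝ᵥ g l := by
  rw [integrableKernel, if_pos rfl]

/-- The kernel is the divided difference of z ↦ fᵀ(z)g(m) at m, where this function vanishes by
orthogonality; the singularity on the diagonal is removable. -/
lemma differentiableOn_integrableKernel (hU : IsOpen U) (hf : DifferentiableOn ℂ f U) {m : ℂ}
    (hm : m ∈ U) (horth : f m ⬝ᵥ g m = 0) :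
    DifferentiableOn ℂ (fun z => integrableKernel f g z m) U := by
  have hd : DifferentiableOn ℂ (fun z => f z ⬝ᵥ g m) U := hf.dotProduct (differentiableOn_const _)
  refine ((differentiableOn_dslope (hU.mem_nhds hm)).2 hd).congr fun z hz => ?_
  by_cases hzm : z = m
  · subst hzm
    have h1 : HasDerivAt (fun w => f w ⬝ᵥ g z) (deriv f z ⬝ᵥ g z) z := by
      have hfz := hasDerivAt_pi.1 (hf.differentiableAt (hU.mem_nhds hz)).hasDerivAt
      exact HasDerivAt.fun_sum fun i _ => (hfz i).mul_const _
    rw [dslope_same, integrableKernel_self, h1.deriv]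
  grind [dslope_of_ne, integrableKernel_of_ne, slope_def_field]

/-- The kernel is bounded by `g`, uniformly for the first variable in a compact set. -/
lemma exists_norm_integrableKernel_le (hU : IsOpen U) (hf : DifferentiableOn ℂ f U) {A : Set ℂ}
    (hA : IsCompact A) (hAU : A ⊆ U) :
    ∃ M : ℝ, 0 ≤ M ∧ ∀ m ∈ U, f m ⬝ᵥ g m = 0 → ∀ z ∈ A, ‖integrableKernel f g z m‖ ≤ M * ‖g m‖ := by
  obtain ⟨δ, hδ, hδU⟩ := hA.exists_cthickening_subset_open hU hAU
  obtain ⟨B, hB⟩ := (hA.cthickening (r := δ)).exists_bound_of_continuousOn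
    (hf.continuousOn.mono hδU)
  refine ⟨r * |B| / (δ / 3), by positivity, fun m hm horth z hz => ?_⟩
  have hball : closedBall z δ ⊆ cthickening δ A := closedBall_subset_cthickening hz δ
  have hfar : ∀ u ∈ closedBall z δ, δ / 3 ≤ ‖u - m‖ →
      ‖integrableKernel f g u m‖ ≤ r * |B| / (δ / 3) * ‖g m‖ := by
    intro u hu hd; rw [integrableKernel_of_ne (by grind [norm_zero]), norm_div, div_mul_eq_mul_div]
    refine div_le_div₀ (by positivity) ?_ (by positivity) hd
    refine (norm_dotProduct_le _ _).trans ?_; gcongr; grind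
  -- If m is close to z, the maximum principle passes to the circle of radius δ about z, whose
  -- points are at distance at least δ - 2δ/3 = δ/3 from m.
  by_cases hzm : 2 * (δ / 3) ≤ ‖z - m‖
  · grind [mem_closedBall_self]
  · have hdc : DiffContOnCl ℂ (fun u => integrableKernel f g u m) (ball z δ) := by
      refine DifferentiableOn.diffContOnCl ?_; rw [closure_ball z hδ.ne']
      exact (differentiableOn_integrableKernel hU hf hm horth).mono (hball.trans hδU)
    refine norm_le_of_forall_mem_frontier_norm_le isBounded_ball hdc
      (fun u hu => ?_) (subset_closure (mem_ball_self hδ))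
    rw [frontier_ball z hδ.ne', mem_sphere_iff_norm] at hu
    refine hfar u (by rw [mem_closedBall_iff_norm, hu]) ?_
    have := norm_sub_le_norm_sub_add_norm_sub u m z; grind [norm_sub_rev]

/-- Exchanging the two vectors transposes the kernel. -/
lemma integrableKernel_swap (hU : IsOpen U) (hf : DifferentiableOn ℂ f U)
    (hg : DifferentiableOn ℂ g U) (horth : ∀ z ∈ U, f z ⬝ᵥ g z = 0) {l m : ℂ} (hl : l ∈ U) :
    integrableKernel g (-f) l m = integrableKernel f g m l := by
  by_cases hlm : l = m
  · subst hlm; have hfz := hasDerivAt_pi.1 (hf.differentiableAt (hU.mem_nhds hl)).hasDerivAt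
    have hgz := hasDerivAt_pi.1 (hg.differentiableAt (hU.mem_nhds hl)).hasDerivAt
    have h1 : HasDerivAt (fun w => f w ⬝ᵥ g w) (deriv f l ⬝ᵥ g l + f l ⬝ᵥ deriv g l) l := by
      simp [dotProduct]; rw [← sum_add_distrib]
      exact HasDerivAt.fun_sum fun i _ => (hfz i).mul (hgz i)
    -- On the diagonal the symmetry f'ᵀg = -fᵀg' comes from differentiating fᵀg = 0, which requires
    -- orthogonality in a full neighbourhood.
    have h2 : HasDerivAt (fun w => f w ⬝ᵥ g w) 0 l := by
      refine (hasDerivAt_const l (0 : ℂ)).congr_of_eventuallyEq ?_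
      filter_upwards [hU.mem_nhds hl] with w hw using horth w hw
    grind [HasDerivAt.unique, integrableKernel_self, Pi.neg_apply, dotProduct_neg, dotProduct_comm]
  grind [integrableKernel_of_ne, Pi.neg_apply, dotProduct_neg, dotProduct_comm]

end Kernel

namespace Contour
variable {C : Contour}

/-- A variant of Liouville's theorem: at infinity the function is small up to an error with
controlled area integrals. -/
theorem eq_zero_of_bound {h H : ℂ → ℂ} (hH : Differentiable ℂ H) (he : EqOn h H C.carrierᶜ)
    {u : ℂ → ℝ} {B : ℝ} (hu : ∀ (c : ℂ) (R : ℝ), 0 < R →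
      MeasureTheory.IntegrableOn u (Metric.ball c R) ∧ ∫ z in Metric.ball c R, u z ≤ B * R)
    (hu0 : ∀ z, 0 ≤ u z)
    (hb : ∀ ε > 0, ∀ᶠ z in cocompact ℂ ⊓ 𝓟 C.carrierᶜ, ‖h z‖ ≤ u z + ε) :
    EqOn h 0 C.carrierᶜ := by
  refine C.eq_zero_of_tendsto_integral hH he fun c => ?_; rw [Metric.tendsto_nhds]; intro ε hε
  have h1 := hb (ε / (4 * π)) (by positivity)
  rw [eventually_inf_principal, eventually_iff, mem_cocompact_iff_closedBall_compl_subset 0] at h1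
  obtain ⟨R1, hR1⟩ := h1; set A := ∫ z in closedBall (0 : ℂ) R1, ‖H z‖ with hA
  have hHi : ∀ s : Set ℂ, Bornology.IsBounded s → MeasureTheory.IntegrableOn (fun z => ‖H z‖) s := fun s hs =>
    ((hH.continuous.norm.locallyIntegrable).integrableOn_isCompact hs.isCompact_closure).mono_set
      subset_closure
  -- A fixed disc contributes a constant, the majorant u contributes O(R), and the error at most
  -- (ε/4)R². After division by R² only the last one survives.
  have hbound : ∀ R : ℝ, 0 < R → ∫ w in ball c R, ‖h w‖ ≤ A + (B * R + ε / 4 * R ^ 2) := by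
    intro R hR; obtain ⟨hui, hule⟩ := hu c R hR
    rw [C.ball_integral_congr Metric.isOpen_ball.measurableSet fun w _ hw => he hw]
    have hone : Integrable (fun _ : ℂ => ε / (4 * π)) (volume.restrict (ball c R)) :=
      integrableOn_const (by simp [Complex.volume_ball, ENNReal.mul_eq_top])
    have hind : Integrable ((closedBall (0 : ℂ) R1).indicator fun z => ‖H z‖)
        (volume.restrict (ball c R)) :=
      ((hHi _ isBounded_closedBall).integrable_indicator measurableSet_closedBall).integrableOn
    have hadd : Integrable (fun w => u w + ε / (4 * π)) (volume.restrict (ball c R)) := hui.add hone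
    have h2 : ∫ w in ball c R, ‖H w‖ ≤ ∫ w in ball c R,
        ((closedBall (0 : ℂ) R1).indicator (fun z => ‖H z‖) w + (u w + ε / (4 * π))) := by
      refine integral_mono_ae (hHi _ isBounded_ball) (hind.add hadd) ?_
      filter_upwards [ae_restrict_of_ae C.ae_notMem_carrier] with w hw
      by_cases hwR : w ∈ closedBall (0 : ℂ) R1
      · rw [indicator_of_mem hwR]; bound
      · rw [indicator_of_notMem hwR, zero_add, ← he hw]; exact hR1 hwR hw
    refine h2.trans ?_; rw [integral_add hind hadd, integral_add hui hone, setIntegral_const,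
      volume_real_ball c hR.le, smul_eq_mul]
    have h3 : ∫ w in ball c R, (closedBall (0 : ℂ) R1).indicator (fun z => ‖H z‖) w ≤ A := by
      rw [setIntegral_indicator measurableSet_closedBall]
      exact setIntegral_mono_set (hHi _ isBounded_closedBall)
        (ae_of_all _ fun z => norm_nonneg _) Set.inter_subset_right.eventuallyLE
    have h4 : π * R ^ 2 * (ε / (4 * π)) = ε / 4 * R ^ 2 := by field_simp
    linarith
  have hlim : Tendsto (fun R : ℝ => (R ^ 2)⁻¹ * A + B * R⁻¹ + ε / 4) atTop (𝓝 (0 * A + B * 0 + ε / 4)) := by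
    refine ((Tendsto.mul_const _ ?_).add (tendsto_inv_atTop_zero.const_mul B)).add_const _
    exact tendsto_inv_atTop_zero.comp (tendsto_pow_atTop (by norm_num))
  filter_upwards [eventually_gt_atTop 0, hlim.eventually (gt_mem_nhds (show
    0 * A + B * 0 + ε / 4 < ε by linarith))] with R hR hlt
  rw [Real.dist_eq, sub_zero, abs_of_nonneg (by positivity)]
  refine lt_of_le_of_lt ?_ hlt
  calc (R ^ 2)⁻¹ * ∫ w in ball c R, ‖h w‖
      ≤ (R ^ 2)⁻¹ * (A + (B * R + ε / 4 * R ^ 2)) := by bound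
    _ = _ := by field_simp; ring

end Contour

/-! ### The integral operator with an integrable kernel -/

/-- Two vectors that define an integrable kernel, with a square integrable bound `a` for them on a
set `X0` of regular parameters of full measure. -/
structure IntegrableData (C : Contour) {r : ℕ} (U : Set ℂ) (f g : ℂ → Fin r → ℂ)
    (X0 : Set C.Param) (a : C.Param → ℝ) : Prop where
  isOpen : IsOpen U
  carrier_subset : C.carrier ⊆ U
  diff_left : DifferentiableOn ℂ f U
  diff_right : DifferentiableOn ℂ g U
  orth : ∀ z ∈ U, f z ⬝ᵥ g z = 0
  measurableSet : MeasurableSet X0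
  regular : X0 ⊆ C.regularParams
  ae_mem : ∀ᵐ x ∂Cᵐ, x ∈ X0
  weight_measurable : Measurable a
  weight_nonneg : ∀ x, 0 ≤ a x
  weight_integrable : Integrable (fun x => a x * (a x * ‖C.vel x‖)) Cᵐ
  left_le : ∀ x ∈ X0, ‖f (C.pt x)‖ ≤ a x
  right_le : ∀ x ∈ X0, ‖g (C.pt x)‖ ≤ a x

/-- The kernel in the parameters, including the factor `dμ/dy`. -/
def paramKernel (C : Contour) {r : ℕ} (f g : ℂ → Fin r → ℂ) (X0 : Set C.Param)
    (x y : C.Param) : ℂ :=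
  X0.indicator (fun x => X0.indicator
    (fun y => integrableKernel f g (C.pt x) (C.pt y) * C.vel y) y) x

lemma measurable_dotProduct {X : Type*} [MeasurableSpace X] {r : ℕ} {u v : X → Fin r → ℂ}
    (hu : Measurable u) (hv : Measurable v) : Measurable fun x => u x ⬝ᵥ v x :=
  measurable_sum _ fun i _ => ((measurable_pi_iff.1 hu i).mul (measurable_pi_iff.1 hv i))

/-- A solution of `φ = cᵀf + Kφ`. -/
structure IsSolution (C : Contour) {r : ℕ} (f g : ℂ → Fin r → ℂ)
    (X0 : Set C.Param) (a : C.Param → ℝ) (c : Fin r → ℂ) (φ : C.Param → ℂ) :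
    Prop where
  measurable : Measurable φ
  bound : ∃ B : ℝ, 0 ≤ B ∧ ∀ x ∈ X0, ‖φ x‖ ≤ B * a x
  eq : ∀ x ∈ X0, φ x = c ⬝ᵥ f (C.pt x) + ∫ y, paramKernel C f g X0 x y * φ y ∂Cᵐ

/-- The right-hand side of `φ = cᵀf + Kφ` as a function on the plane. -/
def solutionExtension (C : Contour) {r : ℕ} (f g : ℂ → Fin r → ℂ) (c : Fin r → ℂ)
    (φ : C.Param → ℂ) (z : ℂ) : ℂ :=
  c ⬝ᵥ f z + ∫ y, integrableKernel f g z (C.pt y) * C.vel y * φ y ∂Cᵐ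

/-- The density `φ g_k dμ/dy`. -/
def solutionDensity (C : Contour) {r : ℕ} (g : ℂ → Fin r → ℂ) (φ : C.Param → ℂ) (k : Fin r)
    (y : C.Param) : ℂ := φ y * g (C.pt y) k * C.vel y

/-- The row vector `cᵀ + ∫ φ gᵀ / (z - μ) dμ`. -/
def solutionTransform (C : Contour) {r : ℕ} (g : ℂ → Fin r → ℂ) (c : Fin r → ℂ)
    (φ : C.Param → ℂ) (z : ℂ) (k : Fin r) : ℂ :=
  c k + C.cauchyTransform (solutionDensity C g φ k) z

namespace IntegrableData
variable {C : Contour} {r : ℕ} {U : Set ℂ} {f g : ℂ → Fin r → ℂ} {X0 : Set C.Param}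
  {a : C.Param → ℝ}

lemma mem_U (D : IntegrableData C U f g X0 a) {x : C.Param} (hx : x ∈ X0) : C.pt x ∈ U :=
  D.carrier_subset (C.pt_mem_carrier (C.regularParams_subset (D.regular hx)))

lemma swap (D : IntegrableData C U f g X0 a) : IntegrableData C U g (-f) X0 a where
  isOpen := D.isOpen
  carrier_subset := D.carrier_subset
  diff_left := D.diff_right
  diff_right := D.diff_left.neg
  orth z hz := by grind [Pi.neg_apply, dotProduct_neg, dotProduct_comm, orth]
  measurableSet := D.measurableSet
  regular := D.regular
  ae_mem := D.ae_mem
  weight_measurable := D.weight_measurable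
  weight_nonneg := D.weight_nonneg
  weight_integrable := D.weight_integrable
  left_le := D.right_le
  right_le x hx := by grind [Pi.neg_apply, norm_neg, left_le]

/-- The speed is put into the right weight only, as the kernel carries the velocity of its second
variable; the integral of the product of the weights is then that of a² over arc length. -/
lemma isWeight (D : IntegrableData C U f g X0 a) :
    Fredholm.IsWeight Cᵐ (X0.indicator a) (X0.indicator fun y => a y * ‖C.vel y‖) where
  left_measurable := D.weight_measurable.indicator D.measurableSet
  right_measurable := (D.weight_measurable.mul C.measurable_vel.norm).indicator D.measurableSet
  left_nonneg := indicator_nonneg fun x _ => D.weight_nonneg x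
  right_nonneg := indicator_nonneg fun x _ => mul_nonneg (D.weight_nonneg x) (norm_nonneg _)
  integrable := by
    refine (D.weight_integrable.indicator D.measurableSet).congr (ae_of_all _ fun x => ?_)
    by_cases hx : x ∈ X0 <;> simp [hx]

lemma measurable_paramKernel (D : IntegrableData C U f g X0 a) :
    Measurable (Function.uncurry (paramKernel C f g X0)) := by
  classical
  have hsub := D.regular.trans C.regularParams_subset
  have hfc := D.diff_left.continuousOn.mono D.carrier_subset
  have hgc := D.diff_right.continuousOn.mono D.carrier_subset
  have hdc := (D.diff_left.deriv D.isOpen).continuousOn.mono D.carrier_subset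
  have hp := C.measurable_indicator_comp_pt (h := id) continuousOn_id D.measurableSet hsub
  have hf' := C.measurable_indicator_comp_pt hfc D.measurableSet hsub
  have hg' := C.measurable_indicator_comp_pt hgc D.measurableSet hsub
  have hd' := C.measurable_indicator_comp_pt hdc D.measurableSet hsub
  set p := X0.indicator fun x => id (C.pt x) with hpdef
  have hE : Measurable fun q : C.Param × C.Param =>
      (if p q.1 = p q.2 then X0.indicator (fun x => deriv f (C.pt x)) q.1 ⬝ᵥ
        X0.indicator (fun x => g (C.pt x)) q.2 else
        (X0.indicator (fun x => f (C.pt x)) q.1 ⬝ᵥ X0.indicator (fun x => g (C.pt x)) q.2) /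
          (p q.1 - p q.2)) * C.vel q.2 := by
    refine Measurable.mul (Measurable.ite
      (measurableSet_eq_fun (hp.comp measurable_fst) (hp.comp measurable_snd)) ?_ ?_)
      (C.measurable_vel.comp measurable_snd)
    · fun_prop
    fun_prop
  convert hE using 1; ext ⟨x, y⟩; simp [paramKernel]; by_cases hx : x ∈ X0
  · by_cases hy : y ∈ X0
    · grind [indicator_of_mem, integrableKernel_self, integrableKernel_of_ne]
    simp_all
  · simp [indicator_of_notMem hx]

lemma isDominated (D : IntegrableData C U f g X0 a) (hK : KernelBound C f g X0 a) :
    Fredholm.IsDominated (X0.indicator a) (X0.indicator fun y => a y * ‖C.vel y‖)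
      (paramKernel C f g X0) where
  measurable := D.measurable_paramKernel
  bound x y := by
    unfold paramKernel; by_cases hx : x ∈ X0
    · by_cases hy : y ∈ X0
      · simp [indicator_of_mem hx, indicator_of_mem hy, ← mul_assoc]; bound
      · simp [hx, hy]
    · simp [hx]

lemma aestronglyMeasurable_right (D : IntegrableData C U f g X0 a) :
    AEMeasurable (fun y => g (C.pt y)) Cᵐ :=
  C.aemeasurable_comp_pt (D.diff_right.continuousOn.mono D.carrier_subset)

lemma integrable_density (D : IntegrableData C U f g X0 a) {φ : C.Param → ℂ}
    (hφ : Measurable φ) {B : ℝ} (hB : ∀ x ∈ X0, ‖φ x‖ ≤ B * a x) (k : Fin r) :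
    Integrable (solutionDensity C g φ k) Cᵐ := by
  refine (D.weight_integrable.const_mul B).mono' ?_ ?_
  · exact ((hφ.aemeasurable.mul (aemeasurable_pi_iff.1 D.aestronglyMeasurable_right k)).mul
      C.measurable_vel.aemeasurable).aestronglyMeasurable
  · filter_upwards [D.ae_mem] with x hx; rw [solutionDensity, norm_mul, norm_mul]
    have h2 : ‖g (C.pt x) k‖ ≤ a x := (norm_le_pi_norm _ k).trans (D.right_le x hx)
    have h3 := hB x hx
    calc ‖φ x‖ * ‖g (C.pt x) k‖ * ‖C.vel x‖ ≤ (B * a x) * a x * ‖C.vel x‖ := by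
          have := (norm_nonneg _).trans h3; gcongr
      _ = _ := by ring

/-- The integrand of `solutionExtension`, locally uniformly in `z`. -/
lemma norm_integrand_le (D : IntegrableData C U f g X0 a) {φ : C.Param → ℂ}
    {B : ℝ} (hB0 : 0 ≤ B) (hB : ∀ x ∈ X0, ‖φ x‖ ≤ B * a x) {A : Set ℂ} (hA : IsCompact A)
    (hAU : A ⊆ U) : ∃ M : ℝ, 0 ≤ M ∧ ∀ z ∈ A, ∀ y ∈ X0,
      ‖integrableKernel f g z (C.pt y) * C.vel y * φ y‖ ≤ M * (a y * (a y * ‖C.vel y‖)) := by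
  obtain ⟨M, hM0, hM⟩ := exists_norm_integrableKernel_le (g := g) D.isOpen D.diff_left hA hAU
  refine ⟨M * B, by positivity, fun z hz y hy => ?_⟩
  have h2 := D.right_le y hy; have h3 := D.weight_nonneg y; rw [norm_mul, norm_mul]
  calc _ ≤ M * a y * ‖C.vel y‖ * (B * a y) := by
        gcongr
        · exact (hM _ (D.mem_U hy) (D.orth _ (D.mem_U hy)) z hz).trans (by gcongr)
        · exact hB y hy
    _ = _ := by ring

lemma aestronglyMeasurable_integrand (D : IntegrableData C U f g X0 a) {φ : C.Param → ℂ}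
    (hφ : Measurable φ) (z : ℂ) : AEStronglyMeasurable
      (fun y => integrableKernel f g z (C.pt y) * C.vel y * φ y) Cᵐ := by
  have h1 : AEMeasurable (fun y => (f z ⬝ᵥ g (C.pt y)) / (z - C.pt y) * C.vel y * φ y) Cᵐ := by
    refine ((AEMeasurable.div ?_ (C.aemeasurable_pt.const_sub z)).mul
      C.measurable_vel.aemeasurable).mul hφ.aemeasurable
    exact aemeasurable_fun_sum _ fun i _ =>
      (aemeasurable_pi_iff.1 D.aestronglyMeasurable_right i).const_mul _
  refine h1.aestronglyMeasurable.congr ?_; filter_upwards [C.ae_pt_ne z] with y hy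
  rw [integrableKernel_of_ne (Ne.symm hy)]

lemma differentiableOn_extension (D : IntegrableData C U f g X0 a) {φ : C.Param → ℂ}
    (hφ : Measurable φ) {B : ℝ} (hB0 : 0 ≤ B) (hB : ∀ x ∈ X0, ‖φ x‖ ≤ B * a x) (c : Fin r → ℂ) :
    DifferentiableOn ℂ (solutionExtension C f g c φ) U := by
  refine ((differentiableOn_const c).dotProduct D.diff_left).add fun z hz => ?_
  obtain ⟨ρ, hρ, hsub⟩ := Metric.nhds_basis_closedBall.mem_iff.1 (D.isOpen.mem_nhds hz)
  obtain ⟨M, hM0, hM⟩ := D.norm_integrand_le hB0 hB (isCompact_closedBall z ρ) hsub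
  refine (differentiableAt_integral_of_bound hρ
    (fun w hw => D.aestronglyMeasurable_integrand hφ w) ?_ ?_
    (D.weight_integrable.const_mul M)).differentiableWithinAt
  · filter_upwards [D.ae_mem] with y hy
    exact (((differentiableOn_integrableKernel D.isOpen D.diff_left (D.mem_U hy)
      (D.orth _ (D.mem_U hy))).mono (Metric.ball_subset_closedBall.trans hsub)).mul_const _).mul_const _
  · filter_upwards [D.ae_mem] with y hy w hw; exact hM w (ball_subset_closedBall hw) y hy

/-- Off the contour the kernel is f(z)ᵀ times g(μ)/(z - μ), and f(z) can be taken out of the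
integral. -/
lemma extension_eq_off (D : IntegrableData C U f g X0 a) {φ : C.Param → ℂ}
    (hφ : Measurable φ) {B : ℝ} (hB : ∀ x ∈ X0, ‖φ x‖ ≤ B * a x) (c : Fin r → ℂ) {z : ℂ}
    (hz : z ∉ C.carrier) :
    solutionExtension C f g c φ z = f z ⬝ᵥ solutionTransform C g c φ z := by
  have h1 : ∫ y, integrableKernel f g z (C.pt y) * C.vel y * φ y ∂Cᵐ =
      ∑ k, f z k * C.cauchyTransform (solutionDensity C g φ k) z := by
    have hi : ∀ k, Integrable (fun y => f z k * (solutionDensity C g φ k y / (z - C.pt y)))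
        Cᵐ := fun k =>
      (C.integrable_div_sub_pt (D.integrable_density hφ hB k) hz).const_mul _
    simp [Contour.cauchyTransform, ← integral_const_mul]
    rw [← integral_finsetSum _ fun k _ => hi k]; refine integral_congr_ae ?_
    filter_upwards [C.ae_pt_ne z] with y hy
    rw [integrableKernel_of_ne (Ne.symm hy), dotProduct, sum_div, sum_mul, sum_mul]
    refine Finset.sum_congr rfl fun k _ => ?_; simp [solutionDensity]; ring
  rw [solutionExtension, h1, dotProduct_comm, dotProduct, dotProduct, ← sum_add_distrib]
  simp [solutionTransform]; ring

end IntegrableData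

namespace IsSolution
variable {C : Contour} {r : ℕ} {U : Set ℂ} {f g : ℂ → Fin r → ℂ} {X0 : Set C.Param}
  {a : C.Param → ℝ} {c : Fin r → ℂ} {φ : C.Param → ℂ}

lemma eq_extension (hφ : IsSolution C f g X0 a c φ) (D : IntegrableData C U f g X0 a)
    {x : C.Param} (hx : x ∈ X0) : φ x = solutionExtension C f g c φ (C.pt x) := by
  rw [hφ.eq x hx, solutionExtension]; congr 1; refine integral_congr_ae ?_
  filter_upwards [D.ae_mem] with y hy; rw [paramKernel, indicator_of_mem hx, indicator_of_mem hy]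

lemma integrable_density (hφ : IsSolution C f g X0 a c φ) (D : IntegrableData C U f g X0 a)
    (k : Fin r) : Integrable (solutionDensity C g φ k) Cᵐ := by
  obtain ⟨B, hB0, hB⟩ := hφ.bound; exact D.integrable_density hφ.measurable hB k

lemma differentiableOn_extension (hφ : IsSolution C f g X0 a c φ)
    (D : IntegrableData C U f g X0 a) :
    DifferentiableOn ℂ (solutionExtension C f g c φ) U := by
  grind [bound, IntegrableData.differentiableOn_extension, measurable]

lemma extension_eq_off (hφ : IsSolution C f g X0 a c φ) (D : IntegrableData C U f g X0 a) {z : ℂ}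
    (hz : z ∉ C.carrier) :
    solutionExtension C f g c φ z = f z ⬝ᵥ solutionTransform C g c φ z := by
  obtain ⟨B, hB0, hB⟩ := hφ.bound; exact D.extension_eq_off hφ.measurable hB c hz

/-- The density is bounded near every point. -/
lemma exists_density_le (hφ : IsSolution C f g X0 a c φ) (D : IntegrableData C U f g X0 a)
    (p : ℂ) : ∃ B : ℝ, 0 ≤ B ∧ ∀ k, ∀ᵐ x ∂Cᵐ, ‖C.pt x - p‖ < 1 →
      ‖solutionDensity C g φ k x‖ ≤ B * ‖C.vel x‖ := by
  -- The solution agrees on `X0` with a function holomorphic near the contour, so it is bounded on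
  -- compact pieces, corners and endpoints included.
  have hA : IsCompact (C.carrier ∩ closedBall p 1) :=
    (isCompact_closedBall p 1).inter_left C.isClosed_carrier
  have hAU : C.carrier ∩ closedBall p 1 ⊆ U := Set.inter_subset_left.trans D.carrier_subset
  obtain ⟨B1, hB1⟩ := hA.exists_bound_of_continuousOn
    ((hφ.differentiableOn_extension D).continuousOn.mono hAU)
  obtain ⟨B2, hB2⟩ := hA.exists_bound_of_continuousOn (D.diff_right.continuousOn.mono hAU)
  refine ⟨|B1| * |B2|, by positivity, fun k => ?_⟩
  filter_upwards [D.ae_mem] with x hx hxp; have hmem : C.pt x ∈ C.carrier ∩ closedBall p 1 :=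
    ⟨C.pt_mem_carrier (C.regularParams_subset (D.regular hx)), mem_closedBall_iff_norm.2 hxp.le⟩
  rw [solutionDensity, norm_mul, norm_mul, hφ.eq_extension D hx]; gcongr
  · grind
  · exact ((norm_le_pi_norm _ k).trans (hB2 _ hmem)).trans (le_abs_self _)

/-- The boundary values of the transform of a solution. -/
lemma jump_transform (hφ : IsSolution C f g X0 a c φ) (D : IntegrableData C U f g X0 a)
    {j : Fin C.n} {t : ℝ} (ht : t ∈ C.regular j) : ∃ P Q : Fin r → ℂ,
      Tendsto (solutionTransform C g c φ) (C.leftNhds (j, t)) (𝓝 P) ∧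
      Tendsto (solutionTransform C g c φ) (C.rightNhds (j, t)) (𝓝 Q) ∧
      P = Q ᵥ* integrableJump f g (C.γ j t) := by
  set Φ := solutionExtension C f g c φ
  have hmem : C.γ j t ∈ U := D.carrier_subset (C.mem_carrier (C.regular_subset_dom j ht))
  have hΦ := hφ.differentiableOn_extension D
  have hj := fun k => C.exists_jump_cauchyTransform (hφ.integrable_density D k) ht D.isOpen hmem
    (Q := fun z => Φ z * g z k) (hΦ.mul (differentiableOn_pi.1 D.diff_right k)) (by
      filter_upwards [D.ae_mem] with x hx _; rw [solutionDensity, hφ.eq_extension D hx])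
  choose L R hL hR hLR using hj
  have hQ : Tendsto (solutionTransform C g c φ) (C.rightNhds (j, t)) (𝓝 fun k => c k + R k) :=
    tendsto_pi_nhds.2 fun k => (hR k).const_add (c k)
  have hf0 : ContinuousAt f (C.γ j t) := (D.diff_left.differentiableAt (D.isOpen.mem_nhds hmem)).continuousAt
  have hΦ0 : ContinuousAt Φ (C.γ j t) := (hΦ.differentiableAt (D.isOpen.mem_nhds hmem)).continuousAt
  have hle := C.rightNhds_le ht
  -- Plemelj's formula gives the jump -2πi Φ gᵀ. Continuity of Φ expresses it through the right
  -- boundary value Q as fᵀQ, so the additive jump becomes multiplication by 1 - 2πi f gᵀ.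
  have hval : Φ (C.γ j t) = f (C.γ j t) ⬝ᵥ fun k => c k + R k := by
    have h2 : Tendsto (fun z => f z ⬝ᵥ solutionTransform C g c φ z) (C.rightNhds (j, t))
        (𝓝 (f (C.γ j t) ⬝ᵥ fun k => c k + R k)) :=
      tendsto_finsetSum _ fun i _ => ((tendsto_pi_nhds.1
        (hf0.tendsto.mono_left (hle.trans nhdsWithin_le_nhds)) i).mul (tendsto_pi_nhds.1 hQ i))
    refine tendsto_nhds_unique (hΦ0.tendsto.mono_left (hle.trans nhdsWithin_le_nhds)) (h2.congr' ?_)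
    filter_upwards [hle self_mem_nhdsWithin] with z hz; exact (hφ.extension_eq_off D hz).symm
  refine ⟨fun k => c k + L k, fun k => c k + R k,
    tendsto_pi_nhds.2 fun k => (hL k).const_add (c k), hQ, ?_⟩
  ext k; have h1 := hLR k; rw [hval] at h1; rw [integrableJump, vecMul_sub, vecMul_one, vecMul_smul,
    vecMul_vecMulVec]
  simp; grind [dotProduct_comm]

end IsSolution

lemma setIntegral_sum_norm_le {ι X : Type*} [Fintype ι] [MeasurableSpace X] {μ : Measure X}
    {s : Set X} {F : ι → X → ℂ} {b : ι → ℝ} (hF : ∀ i, IntegrableOn (F i) s μ ∧ ∫ x in s, ‖F i x‖ ∂μ ≤ b i) :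
    IntegrableOn (fun x => ∑ i, ‖F i x‖) s μ ∧ ∫ x in s, ∑ i, ‖F i x‖ ∂μ ≤ ∑ i, b i := by
  refine ⟨integrable_finsetSum _ fun i _ => (hF i).1.norm, ?_⟩
  rw [integral_finsetSum _ fun i _ => (hF i).1.norm]; exact sum_le_sum fun i _ => (hF i).2

lemma tendsto_vecMul_adjugate {r : ℕ} {l : Filter ℂ} {ψ : ℂ → Fin r → ℂ}
    {Γ : ℂ → Matrix (Fin r) (Fin r) ℂ} {P : Fin r → ℂ} {Q : Matrix (Fin r) (Fin r) ℂ}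
    (hψ : Tendsto ψ l (𝓝 P)) (hΓ : Tendsto Γ l (𝓝 Q)) (k : Fin r) (c : ℂ) :
    Tendsto (fun z => (ψ z ᵥ* (Γ z).adjugate) k - c) l (𝓝 ((P ᵥ* Q.adjugate) k - c)) := by
  have h1 : Continuous fun A : Matrix (Fin r) (Fin r) ℂ => A.adjugate := by fun_prop
  refine Tendsto.sub_const ?_ c; simp [vecMul, dotProduct]
  exact tendsto_finsetSum _ fun i _ => (tendsto_pi_nhds.1 hψ i).mul
    (tendsto_pi_nhds.1 (tendsto_pi_nhds.1 ((h1.tendsto Q).comp hΓ) i) k)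

namespace IsSolution
variable {C : Contour} {r : ℕ} {U : Set ℂ} {f g : ℂ → Fin r → ℂ} {X0 : Set C.Param}
  {a : C.Param → ℝ} {c : Fin r → ℂ} {φ : C.Param → ℂ}
  {Γ : ℂ → Matrix (Fin r) (Fin r) ℂ}

lemma norm_vecMul_sub_le (hφ : IsSolution C f g X0 a c φ) (A : Matrix (Fin r) (Fin r) ℂ) (k : Fin r)
    (z : ℂ) {b : ℝ} (hb : ∀ i, ‖A i k‖ ≤ b) :
    ‖(solutionTransform C g c φ z ᵥ* A) k - c k‖ ≤ ‖(c ᵥ* A) k - c k‖ +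
      b * ∑ i, ‖C.cauchyTransform (solutionDensity C g φ i) z‖ := by
  have h1 : (solutionTransform C g c φ z ᵥ* A) k - c k = ((c ᵥ* A) k - c k) +
      ∑ i, C.cauchyTransform (solutionDensity C g φ i) z * A i k := by
    simp [vecMul, dotProduct, solutionTransform, add_mul, sum_add_distrib]; ring
  rw [h1, mul_sum]; refine (norm_add_le _ _).trans (add_le_add le_rfl ((norm_sum_le _ _).trans
    (sum_le_sum fun i _ => ?_)))
  rw [norm_mul, mul_comm]; gcongr; exact hb i

/-- The transform and Γ have the same right factor M as jump; it cancels in the product with the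
adjugate of Γ, since M times its adjugate is det M = 1. -/
lemma jump_transform_mul_adjugate (hφ : IsSolution C f g X0 a c φ)
    (D : IntegrableData C U f g X0 a) (hΓ : IsWeakRHSolution C (integrableJump f g) Γ)
    {j : Fin C.n} {t : ℝ} (ht : t ∈ C.regular j) (k : Fin r) : ∃ l : ℂ,
      Tendsto (fun z => (solutionTransform C g c φ z ᵥ* (Γ z).adjugate) k - c k)
        (C.leftNhds (j, t)) (𝓝 l) ∧
      Tendsto (fun z => (solutionTransform C g c φ z ᵥ* (Γ z).adjugate) k - c k)
        (C.rightNhds (j, t)) (𝓝 l) := by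
  obtain ⟨P, Q, hP, hQ, hPQ⟩ := hφ.jump_transform D ht
  obtain ⟨P', Q', hP', hQ', hPQ'⟩ := hΓ.jump j t ht
  have hM : (integrableJump f g (C.γ j t)).det = 1 :=
    det_integrableJump (D.orth _ (D.carrier_subset (C.mem_carrier (C.regular_subset_dom j ht))))
  refine ⟨(Q ᵥ* Q'.adjugate) k - c k, ?_, tendsto_vecMul_adjugate hQ hQ' k (c k)⟩
  have h2 := tendsto_vecMul_adjugate hP hP' k (c k)
  have h3 : P ᵥ* P'.adjugate = Q ᵥ* Q'.adjugate := by
    grind [adjugate_mul_distrib, vecMul_vecMul, mul_adjugate, one_smul]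
  simp_all

/-- Near an exceptional point the adjugate is mild, and the Cauchy transforms have area integrals of
order R^(3/2), because the densities are bounded by the speed there. -/
lemma exists_integral_ball_le (hφ : IsSolution C f g X0 a c φ)
    (D : IntegrableData C U f g X0 a) (hΓ : IsWeakRHSolution C (integrableJump f g) Γ) (k : Fin r)
    {p : ℂ} (hp : p ∈ C.exceptional) : ∃ B : ℝ, ∀ᶠ z in 𝓝[≠] p, ∫ w in ball z (‖z - p‖ / 2),
        ‖(solutionTransform C g c φ w ᵥ* (Γ w).adjugate) k - c k‖ ≤ B * ‖z - p‖ ^ (5 / 4 : ℝ) := by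
  have hA : ∀ i, C.Mild fun z => (Γ z).adjugate i k := fun i =>
    (hΓ.swap fun l hl => D.orth l (D.carrier_subset hl)).mild k i
  obtain ⟨B0, hB₀, hd⟩ := hφ.exists_density_le D p
  have hc := fun i => C.integral_norm_cauchyTransform_center_le (hφ.integrable_density D i) p
    one_pos (hd i)
  choose B' hB' hcB using hc; have hmild : C.Mild fun z => (c ᵥ* (Γ z).adjugate) k + -c k :=
    (Contour.Mild.sum _ fun i _ => (Contour.Mild.const _).mul (hA i)).add (Contour.Mild.const _)
  obtain ⟨κ1, hκ1, hb1⟩ := (hmild p hp (1 / 4) (by norm_num)).exists_nonneg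
  choose κ hκ hb using (fun i => (hA i p hp (1 / 4) (by norm_num)).exists_nonneg)
  refine C.exists_integral_ball_le p (c := κ1 + ∑ i, κ i) (B' := ∑ i, B' i)
    (u := fun z => ∑ i, ‖C.cauchyTransform (solutionDensity C g φ i) z‖)
    (add_nonneg hκ1 (sum_nonneg fun i _ => hκ i)) (sum_nonneg fun i _ => hB' i) ?_
    (fun w => sum_nonneg fun i _ => norm_nonneg _) fun R hR => ?_
  · filter_upwards [hb1.bound, eventually_all.2 fun i => (hb i).bound] with w h1 h2
    set d := ‖w - p‖ ^ (-(1 / 4) : ℝ) with hdd; have hd0 : 0 ≤ d := by positivity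
    rw [norm_of_nonneg hd0, ← sub_eq_add_neg] at h1; simp only [norm_of_nonneg hd0] at h2
    have hS : 0 ≤ ∑ i, κ i := sum_nonneg fun i _ => hκ i
    refine (hφ.norm_vecMul_sub_le _ k w (b := (∑ i, κ i) * d) fun i => (h2 i).trans ?_).trans ?_
    · gcongr; simp_all [single_le_sum]
    · set u := ∑ i, ‖C.cauchyTransform (solutionDensity C g φ i) w‖
      have h3 : 0 ≤ κ1 * d * u := by positivity
      have h4 : 0 ≤ (∑ i, κ i) * d := by positivity
      linarith
  · have h := setIntegral_sum_norm_le fun i => hcB i R hR; rwa [← sum_mul] at h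

/-- The transform of a solution is expressed by the solution of the Riemann–Hilbert problem. -/
theorem transform_eq (hφ : IsSolution C f g X0 a c φ)
    (D : IntegrableData C U f g X0 a) (hΓ : IsWeakRHSolution C (integrableJump f g) Γ)
    {z : ℂ} (hz : z ∉ C.carrier) : solutionTransform C g c φ z = c ᵥ* Γ z := by
  have hM : ∀ l ∈ C.carrier, (integrableJump f g l).det = 1 := fun l hl =>
    det_integrableJump (D.orth _ (D.carrier_subset hl))
  have key : ∀ k, EqOn (fun z => (solutionTransform C g c φ z ᵥ* (Γ z).adjugate) k - c k) 0
      C.carrierᶜ := by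
    -- The row vector ψΓ⁻¹ - c extends to an entire function and is small in the mean at infinity,
    -- so it vanishes and ψ = cᵀΓ.
    intro k; have hd : DifferentiableOn ℂ
        (fun z => (solutionTransform C g c φ z ᵥ* (Γ z).adjugate) k - c k) C.carrierᶜ := by
      have h1 : ∀ i, DifferentiableOn ℂ (fun z => solutionTransform C g c φ z i) C.carrierᶜ :=
        fun i => (differentiableOn_const _).add
          (C.differentiableOn_cauchyTransform (hφ.integrable_density D i))
      have h2 : ∀ i, DifferentiableOn ℂ (fun z => (Γ z).adjugate i k) C.carrierᶜ :=
        fun i => (hΓ.swap fun l hl => D.orth l (D.carrier_subset hl)).analytic k i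
      simp [vecMul, dotProduct]; fun_prop
    obtain ⟨H, hH, he⟩ := C.exists_entire_extension hd
      (fun j t ht => hφ.jump_transform_mul_adjugate D hΓ ht k)
      fun p hp => hφ.exists_integral_ball_le D hΓ k hp
    have hball := fun i => C.integral_norm_cauchyTransform_ball_le (hφ.integrable_density D i)
    choose B hB hBi using hball; refine C.eq_zero_of_bound hH he (B := 2 * ∑ i, B i)
      (u := fun z => 2 * ∑ i, ‖C.cauchyTransform (solutionDensity C g φ i) z‖) ?_
      (fun z => mul_nonneg zero_le_two (sum_nonneg fun i _ => norm_nonneg _)) ?_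
    · intro q R hR; obtain ⟨h1, h2⟩ := setIntegral_sum_norm_le fun i => hBi i q R hR
      rw [← sum_mul] at h2; refine ⟨h1.const_mul 2, ?_⟩; simp_all [integral_const_mul, mul_assoc]
    · intro ε hε
      have hlim : Tendsto (fun z => (Γ z).adjugate) (cocompact ℂ ⊓ 𝓟 C.carrierᶜ) (𝓝 1) := by
        have h1 : Continuous fun A : Matrix (Fin r) (Fin r) ℂ => A.adjugate := by fun_prop
        have h2 := (h1.tendsto 1).comp hΓ.infinity; rwa [adjugate_one] at h2
      have h3 : Tendsto (fun z => (c ᵥ* (Γ z).adjugate) k - c k) (cocompact ℂ ⊓ 𝓟 C.carrierᶜ)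
          (𝓝 0) := by
        have h1 : Continuous fun A : Matrix (Fin r) (Fin r) ℂ => (c ᵥ* A) k - c k := by fun_prop
        simpa [Function.comp_def] using ((h1.tendsto 1).comp hlim)
      have h4 : ∀ i, ∀ᶠ z in cocompact ℂ ⊓ 𝓟 C.carrierᶜ, ‖(Γ z).adjugate i k‖ ≤ 2 := by
        intro i; have h5 := (tendsto_pi_nhds.1 (tendsto_pi_nhds.1 hlim i) k).norm
        have h6 : ‖(1 : Matrix (Fin r) (Fin r) ℂ) i k‖ < 2 := by
          rw [Matrix.one_apply]
          split_ifs <;> simp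
        filter_upwards [h5.eventually_lt_const h6] with z h using h.le
      filter_upwards [eventually_all.2 h4, (Metric.tendsto_nhds.1 h3) ε hε] with z h7 h8
      rw [dist_zero_right] at h8; have := hφ.norm_vecMul_sub_le _ k z h7; linarith
  have h1 : solutionTransform C g c φ z ᵥ* (Γ z).adjugate = c := by
    ext k; exact sub_eq_zero.1 (key k hz)
  grind [vecMul_vecMul, adjugate_mul, IsWeakRHSolution.det_eq_one, one_smul, vecMul_one]

end IsSolution

/-- Continuous functions on a neighbourhood of the contour that agree off it are equal. -/
lemma Contour.eqOn_of_eqOn_off {C : Contour} {U : Set ℂ} (hU : IsOpen U) {h₁ h₂ : ℂ → ℂ}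
    (h1 : ContinuousOn h₁ U) (h2 : ContinuousOn h₂ U) (he : ∀ z ∈ U, z ∉ C.carrier → h₁ z = h₂ z) :
    EqOn h₁ h₂ U := by
  refine EqOn.of_subset_closure (s := U ∩ C.carrierᶜ) (fun z hz => he z hz.1 hz.2) h1 h2
    Set.inter_subset_left ?_
  exact C.dense_compl_carrier.open_subset_closure_inter hU

namespace IntegrableData
variable {C : Contour} {r : ℕ} {U : Set ℂ} {f g : ℂ → Fin r → ℂ} {X0 : Set C.Param}
  {a : C.Param → ℝ} {Γ : ℂ → Matrix (Fin r) (Fin r) ℂ}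

/-- The solution as an analytic function. -/
lemma extension_eq (D : IntegrableData C U f g X0 a)
    (hΓ : IsWeakRHSolution C (integrableJump f g) Γ) {c : Fin r → ℂ} {φ : C.Param → ℂ}
    (hφ : IsSolution C f g X0 a c φ) {z : ℂ} (hz : z ∉ C.carrier) :
    solutionExtension C f g c φ z = c ⬝ᵥ (Γ z *ᵥ f z) := by
  rw [hφ.extension_eq_off D hz, hφ.transform_eq D hΓ hz, dotProduct_comm, dotProduct_mulVec]

/-- With c = 0 the transform is 0 · Γ = 0 off the contour; so is the extension, and by continuity
the solution itself. -/
lemma eq_zero_of_solution (D : IntegrableData C U f g X0 a)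
    (hΓ : IsWeakRHSolution C (integrableJump f g) Γ) {φ : C.Param → ℂ}
    (hφ : IsSolution C f g X0 a 0 φ) {x : C.Param} (hx : x ∈ X0) : φ x = 0 := by
  rw [hφ.eq_extension D hx]
  refine Contour.eqOn_of_eqOn_off (C := C) D.isOpen (hφ.differentiableOn_extension D).continuousOn
    (continuousOn_const (c := (0 : ℂ))) (fun z _ hz => ?_) (D.mem_U hx)
  grind [extension_eq, zero_dotProduct]

lemma isSolution_of_bound (D : IntegrableData C U f g X0 a) {φ : C.Param → ℂ}
    (hm : Measurable φ) {B : ℝ} (hB : ∀ x, ‖φ x‖ ≤ B * X0.indicator a x) (c : Fin r → ℂ)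
    (he : ∀ x ∈ X0, φ x = c ⬝ᵥ f (C.pt x) + ∫ y, paramKernel C f g X0 x y * φ y ∂Cᵐ) :
    IsSolution C f g X0 a c φ where
  measurable := hm
  bound := by
    refine ⟨|B|, abs_nonneg _, fun x hx => (hB x).trans ?_⟩; rw [indicator_of_mem hx]
    exact mul_le_mul_of_nonneg_right (le_abs_self B) (D.weight_nonneg x)
  eq := he

lemma isInjective (D : IntegrableData C U f g X0 a)
    (hΓ : IsWeakRHSolution C (integrableJump f g) Γ) :
    Fredholm.IsInjective Cᵐ (X0.indicator a) (paramKernel C f g X0) := by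
  rintro φ hφ ⟨B, hB⟩ he
  have hs := D.isSolution_of_bound hφ hB 0 fun x _ => by rw [zero_dotProduct, zero_add, ← he x]
  filter_upwards [D.ae_mem] with x hx; exact D.eq_zero_of_solution hΓ hs hx

end IntegrableData

/-! ### The inhomogeneous Fredholm equation -/

namespace Fredholm
variable {X : Type*} [MeasurableSpace X] {μ : Measure X} [SigmaFinite μ] {α β : X → ℝ}
  {K : X → X → ℂ}

/-- Solution of the inhomogeneous equation by means of the resolvent. -/
lemma exists_solution (hw : IsWeight μ α β) (hK : IsDominated α β K) (hD : det μ K ≠ 0)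
    {φ0 : X → ℂ} (hφ0 : Measurable φ0) {c : ℝ} (hc : ∀ x, ‖φ0 x‖ ≤ c * α x) :
    ∃ φ : X → ℂ, Measurable φ ∧ (∃ c', ∀ x, ‖φ x‖ ≤ c' * α x) ∧
      ∀ x, φ x = φ0 x + ∫ y, K x y * φ y ∂μ := by
  obtain ⟨B, hB0, hB⟩ := exists_norm_resolvent_le hw hK; have hRm := measurable_resolvent hw hK
  set R := resolvent μ K with hR; have hα := hw.left_nonneg; have hβ := hw.right_nonneg
  have hprod : Measurable fun p : X × X => R p.1 p.2 * φ0 p.2 := by fun_prop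
  have hbd : ∀ x y, ‖R x y * φ0 y‖ ≤ B * c * α x * (α y * β y) := fun x y => by
    rw [norm_mul]
    calc _ ≤ (B * (α x * β y)) * (c * α y) :=
          mul_le_mul (hB x y) (hc y) (norm_nonneg _) (mul_nonneg hB0 (mul_nonneg (hα x) (hβ y)))
      _ = _ := by ring
  have hm : Measurable fun x => ∫ y, R x y * φ0 y ∂μ :=
    (hprod.stronglyMeasurable.integral_prod_right (ν := μ)).measurable
  have hbR : ∀ x, ‖∫ y, R x y * φ0 y ∂μ‖ ≤ (B * c * ∫ y, α y * β y ∂μ) * α x := fun x => by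
    refine (norm_integral_le_of_norm_le (hw.integrable.const_mul _) (ae_of_all _ (hbd x))).trans
      (le_of_eq ?_)
    rw [integral_const_mul]; ring
  refine ⟨fun x => φ0 x + ∫ y, R x y * φ0 y ∂μ, hφ0.add hm,
    ⟨c + B * c * ∫ y, α y * β y ∂μ, fun x => ?_⟩, fun x => ?_⟩
  · grind [norm_add_le]
  · have hI1 := integrable_mul_of_bound hw hK hφ0 hc x
    have hI2 := integrable_mul_of_bound hw hK hm hbR x
    have h1 : ∀ y, R x y * φ0 y = K x y * φ0 y + ∫ w, K x w * R w y * φ0 y ∂μ := fun y => by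
      grind [resolvent_eq, add_mul, integral_mul_const]
    have hdbl : Integrable (fun p : X × X => K x p.2 * R p.2 p.1 * φ0 p.1) (μ.prod μ) := by
      refine ((hw.integrable.mul_prod hw.integrable).const_mul (B * c * α x)).mono' ?_ ?_
      · exact ((((hK.measurable_left x).comp measurable_snd).mul
          (hRm.comp (measurable_snd.prodMk measurable_fst))).mul
          (hφ0.comp measurable_fst)).aestronglyMeasurable
      · refine ae_of_all _ fun p => ?_; rw [mul_assoc, norm_mul]
        calc _ ≤ (α x * β p.2) * (B * c * α p.2 * (α p.1 * β p.1)) :=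
              mul_le_mul (hK.bound _ _) (hbd _ _) (norm_nonneg _) (mul_nonneg (hα _) (hβ _))
          _ = _ := by ring
    have h2 : ∫ y, ∫ w, K x w * R w y * φ0 y ∂μ ∂μ = ∫ w, K x w * ∫ y, R w y * φ0 y ∂μ ∂μ := by
      rw [integral_integral_swap (f := fun y w => K x w * R w y * φ0 y) hdbl]
      simp [mul_assoc, integral_const_mul]
    simp_rw [h1]; rw [integral_add hI1 hdbl.integral_prod_left, h2, ← integral_add hI1 hI2]
    simp_rw [mul_add]

end Fredholm

/-! ### The dressed vectors and the resolvent -/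

/-- The analytic continuation `F` of `Γf` across the contour. -/
structure IsDressing (C : Contour) {r : ℕ} (U : Set ℂ) (f g : ℂ → Fin r → ℂ)
    (X0 : Set C.Param) (a : C.Param → ℝ) (Γ : ℂ → Matrix (Fin r) (Fin r) ℂ)
    (F : ℂ → Fin r → ℂ) (B : ℝ) : Prop where
  nonneg : 0 ≤ B
  differentiableOn : DifferentiableOn ℂ F U
  eq_off : ∀ z ∉ C.carrier, F z = Γ z *ᵥ f z
  bound : ∀ x ∈ X0, ‖F (C.pt x)‖ ≤ B * a x
  integrable : ∀ i k, Integrable (fun x => F (C.pt x) i * g (C.pt x) k * C.vel x) Cᵐ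
  cauchy : ∀ z ∉ C.carrier, ∀ i k, Γ z i k = (1 : Matrix (Fin r) (Fin r) ℂ) i k +
    C.cauchyTransform (fun x => F (C.pt x) i * g (C.pt x) k * C.vel x) z

namespace IntegrableData
variable {C : Contour} {r : ℕ} {U : Set ℂ} {f g : ℂ → Fin r → ℂ} {X0 : Set C.Param}
  {a : C.Param → ℝ} {Γ : ℂ → Matrix (Fin r) (Fin r) ℂ}

lemma exists_isSolution (D : IntegrableData C U f g X0 a)
    (hΓ : IsWeakRHSolution C (integrableJump f g) Γ)
    (hK : KernelBound C f g X0 a) (i : Fin r) :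
    ∃ φ, IsSolution C f g X0 a (Pi.single i 1) φ := by
  have hdom := D.isDominated hK; have hD := Fredholm.det_ne_zero D.isWeight hdom (D.isInjective hΓ)
  have hm := C.measurable_indicator_comp_pt
    ((differentiableOn_pi.1 D.diff_left i).continuousOn.mono D.carrier_subset) D.measurableSet
    (D.regular.trans C.regularParams_subset)
  obtain ⟨φ, hφ, ⟨B, hB⟩, he⟩ := Fredholm.exists_solution D.isWeight hdom hD hm (c := 1) (by
    intro x; rw [one_mul]; by_cases hx : x ∈ X0
    · simp [indicator_of_mem hx]; exact (norm_le_pi_norm _ i).trans (D.left_le x hx)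
    · simp [hx])
  refine ⟨φ, D.isSolution_of_bound hφ hB _ fun x hx => ?_⟩
  grind [indicator_of_mem, single_one_dotProduct]

/-- The i-th component of F is the extension of the solution of φ = fᵢ + Kφ. Taking c as the i-th
basis vector in `IsSolution.transform_eq` represents row i of Γ by the Cauchy transform of Fᵢ gᵀ. -/
lemma exists_isDressing (D : IntegrableData C U f g X0 a)
    (hΓ : IsWeakRHSolution C (integrableJump f g) Γ)
    (hK : KernelBound C f g X0 a) :
    ∃ F B, IsDressing C U f g X0 a Γ F B := by
  choose φ hφ using D.exists_isSolution hΓ hK; choose B hB0 hB using (fun i => (hφ i).bound)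
  have hdens : ∀ i k, solutionDensity C g (φ i) k =ᵐ[Cᵐ] fun x =>
      solutionExtension C f g (Pi.single i 1) (φ i) (C.pt x) * g (C.pt x) k * C.vel x := by
    intro i k; filter_upwards [D.ae_mem] with x hx; rw [solutionDensity, (hφ i).eq_extension D hx]
  refine ⟨fun z i => solutionExtension C f g (Pi.single i 1) (φ i) z, ∑ i, B i,
    sum_nonneg fun i _ => hB0 i,
    differentiableOn_pi.2 fun i => (hφ i).differentiableOn_extension D, fun z hz => ?_,
    fun x hx => ?_, fun i k => ((hφ i).integrable_density D k).congr (hdens i k),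
    fun z hz i k => ?_⟩
  · grind [extension_eq, single_one_dotProduct]
  · have h0 : 0 ≤ ∑ i, B i := sum_nonneg fun i _ => hB0 i
    refine (pi_norm_le_iff_of_nonneg (mul_nonneg h0 (D.weight_nonneg x))).2 fun i => ?_
    rw [← (hφ i).eq_extension D hx]
    refine (hB i x hx).trans (mul_le_mul_of_nonneg_right ?_ (D.weight_nonneg x))
    simp_all [single_le_sum]
  · have h1 := congrFun ((hφ i).transform_eq D hΓ hz) k
    rw [single_one_vecMul, solutionTransform] at h1; rw [row_apply] at h1
    rw [← h1, Matrix.one_apply, Pi.single_apply]; congr 1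
    · simp [eq_comm]
    · refine integral_congr_ae ?_; filter_upwards [hdens i k] with x hx; rw [hx]

lemma swap_kernel_le (D : IntegrableData C U f g X0 a) (hK : KernelBound C f g X0 a) :
    ∀ x ∈ X0, ∀ y ∈ X0, ‖integrableKernel g (-f) (C.pt x) (C.pt y)‖ ≤ a x * a y := by
  intro x hx y hy
  rw [integrableKernel_swap D.isOpen D.diff_left D.diff_right D.orth (D.mem_U hx), mul_comm]
  exact hK y hy x hx

end IntegrableData

/-- The data of a solved problem: dressings of both vectors. -/
structure IsDressedPair (C : Contour) {r : ℕ} (U : Set ℂ) (f g : ℂ → Fin r → ℂ)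
    (X0 : Set C.Param) (a : C.Param → ℝ) (Γ : ℂ → Matrix (Fin r) (Fin r) ℂ)
    (F G : ℂ → Fin r → ℂ) (B : ℝ) : Prop where
  data : IntegrableData C U f g X0 a
  weak : IsWeakRHSolution C (integrableJump f g) Γ
  left : IsDressing C U f g X0 a Γ F B
  right : IsDressing C U g (-f) X0 a (fun z => (Γ z).adjugateᵀ) G B

lemma IsDressing.mono {C : Contour} {r : ℕ} {U : Set ℂ} {f g : ℂ → Fin r → ℂ}
    {X0 : Set C.Param} {a : C.Param → ℝ} {Γ : ℂ → Matrix (Fin r) (Fin r) ℂ}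
    {F : ℂ → Fin r → ℂ} {B B' : ℝ} (h : IsDressing C U f g X0 a Γ F B)
    (ha : ∀ x, 0 ≤ a x) (hB : B ≤ B') : IsDressing C U f g X0 a Γ F B' :=
  { h with
    nonneg := h.nonneg.trans hB
    bound := fun x hx => (h.bound x hx).trans (mul_le_mul_of_nonneg_right hB (ha x)) }

lemma IntegrableData.exists_isDressedPair {C : Contour} {r : ℕ} {U : Set ℂ} {f g : ℂ → Fin r → ℂ}
    {X0 : Set C.Param} {a : C.Param → ℝ} {Γ : ℂ → Matrix (Fin r) (Fin r) ℂ}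
    (D : IntegrableData C U f g X0 a) (hΓ : IsWeakRHSolution C (integrableJump f g) Γ)
    (hK : KernelBound C f g X0 a) :
    ∃ F G B, IsDressedPair C U f g X0 a Γ F G B := by
  obtain ⟨F, B1, hF⟩ := D.exists_isDressing hΓ hK; obtain ⟨G, B2, hG⟩ := D.swap.exists_isDressing
    (hΓ.swap fun l hl => D.orth l (D.carrier_subset hl)) (D.swap_kernel_le hK)
  exact ⟨F, G, max B1 B2, D, hΓ, hF.mono D.weight_nonneg (le_max_left _ _),
    hG.mono D.weight_nonneg (le_max_right _ _)⟩

namespace IsDressedPair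
variable {C : Contour} {r : ℕ} {U : Set ℂ} {f g : ℂ → Fin r → ℂ} {X0 : Set C.Param}
  {a : C.Param → ℝ} {Γ : ℂ → Matrix (Fin r) (Fin r) ℂ} {F G : ℂ → Fin r → ℂ} {B : ℝ}

lemma det_eq_one (h : IsDressedPair C U f g X0 a Γ F G B) {z : ℂ} (hz : z ∉ C.carrier) :
    (Γ z).det = 1 :=
  h.weak.det_eq_one (fun l hl => det_integrableJump (h.data.orth l (h.data.carrier_subset hl))) z hz

lemma transpose_mulVec (h : IsDressedPair C U f g X0 a Γ F G B) {z : ℂ} (hz : z ∉ C.carrier) :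
    (Γ z)ᵀ *ᵥ G z = g z := by
  rw [h.right.eq_off z hz, mulVec_mulVec, ← transpose_mul, adjugate_mul,
    h.det_eq_one hz, one_smul, transpose_one, one_mulVec]

/-- Off the contour FᵀG = fᵀΓᵀΓ⁻ᵀg = fᵀg = 0, and by continuity this holds on all of U. The factor 1
+ B makes the weight large enough for the original vectors as well. -/
lemma dressedData (h : IsDressedPair C U f g X0 a Γ F G B) :
    IntegrableData C U F G X0 (fun x => (1 + B) * a x) where
  isOpen := h.data.isOpen
  carrier_subset := h.data.carrier_subset
  diff_left := h.left.differentiableOn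
  diff_right := h.right.differentiableOn
  orth := by
    refine Contour.eqOn_of_eqOn_off (C := C) (h₂ := fun _ => 0) h.data.isOpen
      (h.left.differentiableOn.dotProduct h.right.differentiableOn).continuousOn
      continuousOn_const fun z hz hzC => ?_
    rw [h.left.eq_off z hzC, dotProduct_comm, dotProduct_mulVec, ← mulVec_transpose,
      h.transpose_mulVec hzC, dotProduct_comm, h.data.orth z hz]
  measurableSet := h.data.measurableSet
  regular := h.data.regular
  ae_mem := h.data.ae_mem
  weight_measurable := h.data.weight_measurable.const_mul _
  weight_nonneg x := mul_nonneg (by linarith [h.left.nonneg]) (h.data.weight_nonneg x)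
  weight_integrable := by
    refine (h.data.weight_integrable.const_mul ((1 + B) * (1 + B))).congr (ae_of_all _ fun x => ?_)
    ring
  left_le x hx := (h.left.bound x hx).trans (mul_le_mul_of_nonneg_right (by linarith)
    (h.data.weight_nonneg x))
  right_le x hx := (h.right.bound x hx).trans (mul_le_mul_of_nonneg_right (by linarith)
    (h.data.weight_nonneg x))

/-- The vector `G` is obtained from `g` by the transposed dressed kernel. -/
lemma integral_dressed (h : IsDressedPair C U f g X0 a Γ F G B) (k : Fin r) {ζ : ℂ} (hζ : ζ ∈ U) :
    ∫ y, integrableKernel F G (C.pt y) ζ * C.vel y * g (C.pt y) k ∂Cᵐ = G ζ k - g ζ k := by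
  have D := h.dressedData; have hm := C.measurable_indicator_comp_pt
    ((differentiableOn_pi.1 h.data.diff_right k).continuousOn.mono h.data.carrier_subset)
    h.data.measurableSet (h.data.regular.trans C.regularParams_subset)
  set φ := X0.indicator fun y => g (C.pt y) k with hφdef
  have hB : ∀ x ∈ X0, ‖φ x‖ ≤ 1 * ((1 + B) * a x) := fun x hx => by
    rw [hφdef, indicator_of_mem hx]
    have h1 := (norm_le_pi_norm (g (C.pt x)) k).trans (h.data.right_le x hx)
    nlinarith [mul_nonneg h.left.nonneg (h.data.weight_nonneg x)]
  -- Transposed, the integral is an extension for the pair (G, -F). It may be evaluated off the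
  -- contour, where the Cauchy transform of F gₖ is a column of Γ - 1 and ΓᵀG = g.
  have h1 : ∫ y, integrableKernel F G (C.pt y) ζ * C.vel y * g (C.pt y) k ∂Cᵐ =
      solutionExtension C G (-F) 0 φ ζ := by
    rw [solutionExtension, zero_dotProduct, zero_add]; refine integral_congr_ae ?_
    filter_upwards [h.data.ae_mem] with y hy
    rw [integrableKernel_swap D.isOpen D.diff_left D.diff_right D.orth hζ, hφdef,
      indicator_of_mem hy]
  rw [h1]; refine Contour.eqOn_of_eqOn_off (C := C) (h₂ := fun z => G z k - g z k) D.isOpen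
    (D.swap.differentiableOn_extension hm zero_le_one hB 0).continuousOn
    ((differentiableOn_pi.1 D.diff_right k).sub
      (differentiableOn_pi.1 h.data.diff_right k)).continuousOn (fun z hz hzC => ?_) hζ
  rw [D.swap.extension_eq_off hm hB 0 hzC]
  have h2 : ∀ m, solutionTransform C (-F) 0 φ z m = (1 : Matrix (Fin r) (Fin r) ℂ) m k - Γ z m k := by
    intro m
    rw [h.left.cauchy z hzC m k, solutionTransform, Pi.zero_apply, zero_add, sub_add_cancel_left,
      Contour.cauchyTransform, Contour.cauchyTransform, ← integral_neg]
    refine integral_congr_ae ?_; filter_upwards [h.data.ae_mem] with y hy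
    simp [solutionDensity, hφdef, indicator_of_mem hy]; ring
  simp only [dotProduct, h2, mul_sub, sum_sub_distrib, Matrix.one_apply]; simp; congr 1
  rw [← (congrFun (h.transpose_mulVec hzC) k)]; exact Finset.sum_congr rfl fun m _ => mul_comm _ _

lemma exists_norm_kernel_le (h : IsDressedPair C U f g X0 a Γ F G B) {μ : ℂ} (hμ : μ ∈ U) :
    ∃ M : ℝ, 0 ≤ M ∧ ∀ x ∈ X0, ‖integrableKernel F G (C.pt x) μ‖ ≤ M * a x := by
  have D := h.dressedData
  obtain ⟨M, hM0, hM⟩ := exists_norm_integrableKernel_le (g := -F) D.isOpen D.diff_right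
    (isCompact_singleton (x := μ)) (Set.singleton_subset_iff.2 hμ)
  have hB := h.left.nonneg; refine ⟨M * B, by positivity, fun x hx => ?_⟩
  have h1 := hM _ (D.mem_U hx) (D.swap.orth _ (D.mem_U hx)) μ rfl
  rw [integrableKernel_swap D.isOpen D.diff_left D.diff_right D.orth hμ, Pi.neg_apply,
    norm_neg] at h1
  refine h1.trans ?_; rw [mul_assoc]; exact mul_le_mul_of_nonneg_left (h.left.bound x hx) hM0

lemma differentiableOn_kernel (h : IsDressedPair C U f g X0 a Γ F G B) {μ : ℂ} (hμ : μ ∈ U) :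
    DifferentiableOn ℂ (fun z => integrableKernel F G z μ) U :=
  differentiableOn_integrableKernel h.data.isOpen h.left.differentiableOn hμ
    (h.dressedData.orth μ hμ)

lemma measurable_kernel (h : IsDressedPair C U f g X0 a Γ F G B) {μ : ℂ} (hμ : μ ∈ U) :
    Measurable (X0.indicator fun x => integrableKernel F G (C.pt x) μ) :=
  C.measurable_indicator_comp_pt
    ((h.differentiableOn_kernel hμ).continuousOn.mono h.data.carrier_subset)
    h.data.measurableSet (h.data.regular.trans C.regularParams_subset)

/-- The resolvent equation for the dressed kernel. -/
lemma kernel_eq (h : IsDressedPair C U f g X0 a Γ F G B) {μ z : ℂ} (hμ : μ ∈ C.carrier)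
    (hz : z ∈ U) : integrableKernel F G z μ = integrableKernel f g z μ +
      ∫ w, integrableKernel f g z (C.pt w) * C.vel w * integrableKernel F G (C.pt w) μ ∂Cᵐ := by
  have D := h.data; have hμU := D.carrier_subset hμ; have hm := h.measurable_kernel hμU
  obtain ⟨M, hM0, hM⟩ := h.exists_norm_kernel_le hμU
  set φ := X0.indicator fun y => integrableKernel F G (C.pt y) μ with hφdef
  have hB : ∀ x ∈ X0, ‖φ x‖ ≤ M * a x := by simp_all
  have h1 : ∀ z, ∫ w, integrableKernel f g z (C.pt w) * C.vel w * integrableKernel F G (C.pt w) μ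
      ∂Cᵐ = solutionExtension C f g 0 φ z := fun z => by
    rw [solutionExtension, zero_dotProduct, zero_add]; refine integral_congr_ae ?_
    filter_upwards [D.ae_mem] with y hy; simp_all
  rw [h1]; refine Contour.eqOn_of_eqOn_off (C := C) (h₁ := fun z => integrableKernel F G z μ)
    (h₂ := fun z => integrableKernel f g z μ + solutionExtension C f g 0 φ z) D.isOpen
    (h.differentiableOn_kernel hμU).continuousOn
    ((differentiableOn_integrableKernel D.isOpen D.diff_left hμU (D.orth μ hμU)).continuousOn.add
      (D.differentiableOn_extension hm hM0 hB 0).continuousOn) (fun z hz hzC => ?_) hz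
  have hzμ : z ≠ μ := by grind
  rw [D.extension_eq_off hm hB 0 hzC, integrableKernel_of_ne hzμ, integrableKernel_of_ne hzμ]
  -- Partial fractions: (z - μ)/((z - w)(w - μ)) = 1/(z - w) + 1/(w - μ). The first summand yields
  -- the Cauchy representation of Γ - 1, the second `integral_dressed`.
  have h2 : ∀ k, (z - μ) * solutionTransform C g 0 φ z k =
      (G μ k - g μ k) + ∑ m, G μ m * (Γ z m k - (1 : Matrix (Fin r) (Fin r) ℂ) m k) := by
    intro k; have hI1 := D.integrable_density hm hB k
    have hI2 : ∀ m, Integrable (fun x => G μ m * (F (C.pt x) m * g (C.pt x) k * C.vel x /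
        (z - C.pt x))) Cᵐ := fun m =>
      (C.integrable_div_sub_pt (h.left.integrable m k) hzC).const_mul _
    have h3 : ∀ m, G μ m * (Γ z m k - (1 : Matrix (Fin r) (Fin r) ℂ) m k) =
        ∫ x, G μ m * (F (C.pt x) m * g (C.pt x) k * C.vel x / (z - C.pt x)) ∂Cᵐ := by
      intro m; rw [h.left.cauchy z hzC m k, add_sub_cancel_left, integral_const_mul]; rfl
    have h4 : ∫ y, solutionDensity C g φ k y ∂Cᵐ = G μ k - g μ k := by
      rw [← h.integral_dressed k hμU]; refine integral_congr_ae ?_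
      filter_upwards [D.ae_mem] with y hy; rw [solutionDensity, hφdef, indicator_of_mem hy]; ring
    rw [Finset.sum_congr rfl fun m _ => h3 m, ← integral_finsetSum _ fun m _ => hI2 m, ← h4,
      ← integral_add hI1 (integrable_finsetSum _ fun m _ => hI2 m), solutionTransform,
      Pi.zero_apply, zero_add, Contour.cauchyTransform, ← integral_const_mul]
    refine integral_congr_ae ?_
    filter_upwards [D.ae_mem, C.ae_pt_ne μ, C.ae_pt_ne z] with y hy hyμ hyz
    have e3 : ∑ m, G μ m * (F (C.pt y) m * g (C.pt y) k * C.vel y / (z - C.pt y)) =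
        (F (C.pt y) ⬝ᵥ G μ) * (g (C.pt y) k * C.vel y / (z - C.pt y)) := by
      rw [dotProduct, sum_mul]; grind
    rw [e3, solutionDensity, hφdef, indicator_of_mem hy, integrableKernel_of_ne hyμ]; field_simp
    ring
  have h5 : (z - μ) * (f z ⬝ᵥ solutionTransform C g 0 φ z) = F z ⬝ᵥ G μ - f z ⬝ᵥ g μ := by
    have e1 : F z ⬝ᵥ G μ = ∑ k, f z k * ∑ m, G μ m * Γ z m k := by
      rw [h.left.eq_off z hzC, dotProduct_comm, dotProduct_mulVec, dotProduct_comm]; rfl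
    rw [e1, dotProduct, dotProduct, mul_sum, ← sum_sub_distrib]
    refine Finset.sum_congr rfl fun k _ => ?_; have e2 := h2 k
    simp [mul_sub, Matrix.one_apply] at e2; grind
  grind

/-- Uniqueness for the inhomogeneous equation. -/
lemma eq_of_equation (h : IsDressedPair C U f g X0 a Γ F G B) (hK : KernelBound C f g X0 a)
    {u ρ N : C.Param → ℂ} (hρm : Measurable ρ) (hNm : Measurable N) {b b' : ℝ}
    (hρb : ∀ x, ‖ρ x‖ ≤ b * X0.indicator a x) (hNb : ∀ x, ‖N x‖ ≤ b' * X0.indicator a x)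
    (hρ : ∀ x ∈ X0, ρ x = u x + ∫ w, paramKernel C f g X0 x w * ρ w ∂Cᵐ)
    (hN : ∀ x ∈ X0, N x = u x + ∫ w, paramKernel C f g X0 x w * N w ∂Cᵐ)
    {x : C.Param} (hx : x ∈ X0) : ρ x = N x := by
  have hsol : IsSolution C f g X0 a 0 fun x => ρ x - N x := by
    refine h.data.isSolution_of_bound (hρm.sub hNm) (B := b + b') (fun x => ?_) 0 fun x hx => ?_
    · rw [add_mul]; exact (norm_sub_le _ _).trans (add_le_add (hρb x) (hNb x))
    · have hI1 := Fredholm.integrable_mul_of_bound h.data.isWeight (h.data.isDominated hK) hρm hρb x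
      have hI2 := Fredholm.integrable_mul_of_bound h.data.isWeight (h.data.isDominated hK) hNm hNb x
      have e1 : ∫ w, paramKernel C f g X0 x w * (ρ w - N w) ∂Cᵐ =
          (∫ w, paramKernel C f g X0 x w * ρ w ∂Cᵐ) - ∫ w, paramKernel C f g X0 x w * N w ∂Cᵐ := by
        rw [← integral_sub hI1 hI2]; grind
      simp_all
  exact sub_eq_zero.1 (h.data.eq_zero_of_solution h.weak hsol hx)

/-- The columns of the dressed kernel. -/
lemma column_eq (h : IsDressedPair C U f g X0 a Γ F G B) (hK : KernelBound C f g X0 a)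
    {μ v : ℂ} (hμ : μ ∈ C.carrier) {ρ : C.Param → ℂ} (hρm : Measurable ρ) {b : ℝ}
    (hρb : ∀ x, ‖ρ x‖ ≤ b * X0.indicator a x)
    (hρ : ∀ x ∈ X0, ρ x = integrableKernel f g (C.pt x) μ * v +
      ∫ w, paramKernel C f g X0 x w * ρ w ∂Cᵐ)
    {x : C.Param} (hx : x ∈ X0) : ρ x = integrableKernel F G (C.pt x) μ * v := by
  have D := h.data; have hμU := D.carrier_subset hμ
  obtain ⟨M, hM0, hM⟩ := h.exists_norm_kernel_le hμU
  have hm : Measurable fun x => X0.indicator (fun x => integrableKernel F G (C.pt x) μ) x * v :=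
    (h.measurable_kernel hμU).mul_const v
  have key := h.eq_of_equation hK (u := fun x => integrableKernel f g (C.pt x) μ * v) hρm hm
    hρb (b' := M * ‖v‖) ?_ hρ ?_ hx
  · simp_all
  · intro x; by_cases hx : x ∈ X0
    · rw [indicator_of_mem hx, indicator_of_mem hx, norm_mul]
      have := mul_le_mul_of_nonneg_right (hM x hx) (norm_nonneg v); linarith
    simp_all
  · intro x hx; rw [indicator_of_mem hx, h.kernel_eq hμ (D.mem_U hx), add_mul, ← integral_mul_const]
    congr 1; refine integral_congr_ae ?_; filter_upwards [D.ae_mem] with w hw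
    simp [paramKernel, indicator_of_mem hx, indicator_of_mem hw]; ring

/-- The resolvent is the dressed kernel. -/
theorem resolvent_eq (h : IsDressedPair C U f g X0 a Γ F G B) (hK : KernelBound C f g X0 a)
    {x y : C.Param} (hx : x ∈ X0) (hy : y ∈ X0) :
    Fredholm.resolvent Cᵐ (paramKernel C f g X0) x y =
      integrableKernel F G (C.pt x) (C.pt y) * C.vel y := by
  have hw := h.data.isWeight; have hdom := h.data.isDominated hK
  obtain ⟨c, hc0, hc⟩ := Fredholm.exists_norm_resolvent_le hw hdom
  -- For fixed y the resolvent equation is the inhomogeneous equation solved by a column of the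
  -- dressed kernel, and its solution is unique.
  refine h.column_eq hK (C.pt_mem_carrier (C.regularParams_subset (h.data.regular hy)))
    ((Fredholm.measurable_resolvent hw hdom).comp measurable_prodMk_right)
    (b := c * X0.indicator (fun y => a y * ‖C.vel y‖) y) (fun x => ?_) (fun x hx => ?_) hx
  · grind
  · have h1 := Fredholm.resolvent_eq hw hdom
      (Fredholm.det_ne_zero hw hdom (h.data.isInjective h.weak)) x y
    rwa [paramKernel, indicator_of_mem hx, indicator_of_mem hy] at h1

end IsDressedPair

/-! ### Commutation of singular integrals -/

/-- A function `m` of two points such that `m(z, w) / (z - w)` is integrable on the contour in the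
principal value sense. -/
structure TwoPointKernel (C : Contour) (U : Set ℂ) (X0 : Set C.Param)
    (b : C.Param → ℝ) (m : ℂ → ℂ → ℂ) : Prop where
  isOpen : IsOpen U
  carrier_subset : C.carrier ⊆ U
  measurableSet : MeasurableSet X0
  regular : X0 ⊆ C.regularParams
  ae_mem : ∀ᵐ x ∂Cᵐ, x ∈ X0
  measurable : Measurable (Function.uncurry m)
  diff_left : ∀ w ∈ U, DifferentiableOn ℂ (fun z => m z w) U
  diff_right : ∀ z ∈ U, DifferentiableOn ℂ (m z) U
  local_bound : ∀ A, IsCompact A → A ⊆ U → ∃ M : ℝ, 0 ≤ M ∧ ∀ z ∈ A, ∀ w ∈ A, ‖m z w‖ ≤ M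
  left_bound : ∀ A, IsCompact A → A ⊆ U → ∃ M : ℝ, 0 ≤ M ∧ ∀ z ∈ A, ∀ y ∈ X0,
    ‖m z (C.pt y)‖ ≤ M * b y
  right_bound : ∀ A, IsCompact A → A ⊆ U → ∃ M : ℝ, 0 ≤ M ∧ ∀ w ∈ A, ∀ x ∈ X0,
    ‖m (C.pt x) w‖ ≤ M * b x
  bound : ∃ M : ℝ, 0 ≤ M ∧ ∀ x ∈ X0, ∀ y ∈ X0, ‖m (C.pt x) (C.pt y)‖ ≤ M * (b x * b y)
  nonneg : ∀ x, 0 ≤ b x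
  integrable : Integrable (fun x => b x * ‖C.vel x‖) Cᵐ

namespace Contour
variable {C : Contour}

/-- Small discs about a regular point, and small normal translations. -/
lemma exists_normal_translation {j : Fin C.n} {t0 : ℝ} (ht0 : t0 ∈ C.regular j) {P₁ P₂ : ℂ → Prop}
    (h₁ : ∀ᶠ z in C.rightNhds (j, t0), P₁ z) (h₂ : ∀ᶠ z in C.leftNhds (j, t0), P₂ z) {V : Set ℂ}
    (hV : V ∈ 𝓝 (C.γ j t0)) : ∃ (ν : ℂ) (ρ ε0 : ℝ), 0 < ρ ∧ 0 < ε0 ∧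
      closedBall (C.γ j t0) (2 * ρ) ⊆ V ∧
      ∀ ε, 0 < ε → ε < ε0 → 0 < ‖ε * ν‖ ∧ ‖ε * ν‖ < ρ / 8 ∧
        (∀ x ∈ C.params, C.pt x ∈ ball (C.γ j t0) ρ → P₁ (C.pt x - ε * ν) ∧ P₂ (C.pt x + ε * ν)) ∧
        ∀ x ∈ C.params, C.pt x ∈ ball (C.γ j t0) ρ → ∀ y ∈ C.params, C.pt y ∈ ball (C.γ j t0) ρ →
          ‖C.pt x - C.pt y‖ ≤ 2 * ‖C.pt x - C.pt y - ε * ν‖ ∧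
          ‖ε * ν‖ ≤ 2 * ‖C.pt x - C.pt y - ε * ν‖ := by
  obtain ⟨δ, hδ, hch⟩ := exists_isChart ht0
  have hP := (eventually_map.1 h₁).and (eventually_map.1 h₂); rw [eventually_prod_iff] at hP
  obtain ⟨p1, hp1, p2, hp2, hP⟩ := hP; obtain ⟨η1, hη₁, hb1⟩ := Metric.eventually_nhds_iff.1 hp1
  obtain ⟨ε1, hε1, hb2⟩ := mem_nhdsGT_iff_exists_Ioo_subset.1 hp2; set η := min δ (η1 / 2) with hη
  have hη0 : 0 < η := by positivity
  have hc := hch η hη0 (min_le_left _ _); set τ := deriv (C.γ j) t0; have hτ := hc.norm_deriv_pos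
  have hmap := hc.map_nhds (w := (t0 : ℂ)) (by simpa using hη0)
  rw [straighten_ofReal] at hmap
  have himg : C.straighten j t0 '' square t0 η ∈ 𝓝 (C.γ j t0) := by
    grind [image_mem_map, square_mem_nhds]
  obtain ⟨ρ, hρ, hρs⟩ := Metric.nhds_basis_closedBall.mem_iff.1 (inter_mem himg hV)
  have hnear : ∀ x ∈ C.params, C.pt x ∈ ball (C.γ j t0) (ρ / 2) →
      ∃ t, x = (j, t) ∧ |t - t0| < η := by
    rintro ⟨k, t⟩ hx hxb; obtain ⟨w, hw, hwx⟩ := (hρs (ball_subset_closedBall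
      (ball_subset_ball (by linarith) hxb))).1
    obtain ⟨rfl, hwt⟩ := hc.sep k t hx w hw.1.le hw.2.le hwx.symm; have := hw.1; bound
  -- The vector ν = iγ'(t0) points to the left, and translation by εν is a vertical shift in the
  -- chart. The factor 2 covers the chart constants 5/4 and 3/4, because both |t - u| and ε are at
  -- most |t - u - iε|.
  refine ⟨I * τ, ρ / 2, min ε1 (ρ / 16 / ‖τ‖), by positivity, lt_min hε1 (by positivity),
    fun z hz => (hρs (by grind)).2, fun ε hε hlt => ?_⟩
  have hn : ‖(ε : ℂ) * (I * τ)‖ = ε * ‖τ‖ := by grind [norm_mul, norm_I, norm_real, norm_of_nonneg]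
  have hlt2 : ε * ‖τ‖ < ρ / 16 := (lt_div_iff₀ hτ).1 (hlt.trans_le (min_le_right _ _))
  refine ⟨by rw [hn]; positivity, by linarith, ?_, ?_⟩
  · intro x hx hxb; obtain ⟨t, rfl, ht⟩ := hnear x hx hxb
    exact hP (hb1 (y := t) (by rw [Real.dist_eq]; grind)) (hb2 ⟨hε, by grind⟩)
  · intro x hx hxb y hy hyb; obtain ⟨t, rfl, ht⟩ := hnear x hx hxb
    obtain ⟨u, rfl, hu⟩ := hnear y hy hyb; have e0 : C.pt (j, t) - C.pt (j, u) - ε * (I * τ) =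
        C.straighten j t0 ((t : ℂ) + ((-ε : ℝ) : ℂ) * I) - C.straighten j t0 (u : ℂ) := by
      rw [straighten_add, straighten_ofReal]; simp [pt]; push_cast; ring
    have h1 := hc.lower (w := (t : ℂ) + ((-ε : ℝ) : ℂ) * I) (w' := (u : ℂ))
      (by simpa using ht.le) (by simpa using hu.le)
    rw [← e0] at h1
    have h2 := hc.upper (w := (t : ℂ)) (w' := (u : ℂ)) (by simpa using ht.le) (by simpa using hu.le)
    rw [straighten_ofReal, straighten_ofReal] at h2
    have h3 : ‖(t : ℂ) - u‖ ≤ ‖(t : ℂ) + ((-ε : ℝ) : ℂ) * I - u‖ := by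
      have := abs_re_le_norm ((t : ℂ) + ((-ε : ℝ) : ℂ) * I - u)
      rw [← ofReal_sub, norm_real, norm_eq_abs]; simpa using this
    have h4 : ε ≤ ‖(t : ℂ) + ((-ε : ℝ) : ℂ) * I - u‖ := by
      have := abs_im_le_norm ((t : ℂ) + ((-ε : ℝ) : ℂ) * I - u)
      simp only [sub_im, add_im, ofReal_im, mul_im,
        ofReal_re, I_im, I_re, mul_one, mul_zero, add_zero, zero_add,
        sub_zero, abs_neg] at this
      grind
    set A := ‖(t : ℂ) + ((-ε : ℝ) : ℂ) * I - u‖; simp only [pt] at h1 ⊢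
    constructor <;> nlinarith

lemma ae_prod_ne {X0 : Set C.Param} (hX : MeasurableSet X0) (hreg : X0 ⊆ C.regularParams)
    (hae : ∀ᵐ x ∂Cᵐ, x ∈ X0) :
    ∀ᵐ q ∂Cᵐ.prod Cᵐ, q.1 ∈ X0 ∧ q.2 ∈ X0 ∧ C.pt q.1 ≠ C.pt q.2 := by
  have hp := C.measurable_indicator_comp_pt (h := id) continuousOn_id hX
    (hreg.trans C.regularParams_subset)
  have h2 : ∀ᵐ q ∂Cᵐ.prod Cᵐ, q.2 ∈ X0 := Measure.quasiMeasurePreserving_snd.ae hae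
  set p := X0.indicator fun x => id (C.pt x) with hpd
  have h3 : MeasurableSet {q : C.Param × C.Param | q.1 ∈ X0 ∧ p q.1 = p q.2} :=
    (measurable_fst hX).inter (measurableSet_eq_fun (hp.comp measurable_fst) (hp.comp measurable_snd))
  have h4 : (Cᵐ.prod Cᵐ) {q : C.Param × C.Param | q.1 ∈ X0 ∧ p q.1 = p q.2} = 0 := by
    rw [measure_prod_null h3]; refine ae_of_all _ fun x => ?_; have h5 : ∀ᵐ y ∂Cᵐ, y ∉ Prod.mk x ⁻¹'
        {q : C.Param × C.Param | q.1 ∈ X0 ∧ p q.1 = p q.2} := by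
      filter_upwards [hae, C.ae_pt_ne (C.pt x)] with y hy hne hmem; aesop
    rw [ae_iff] at h5; simpa using h5.le
  have h5 : ∀ᵐ q ∂Cᵐ.prod Cᵐ, q ∉ {q : C.Param × C.Param | q.1 ∈ X0 ∧ p q.1 = p q.2} := by
    rw [ae_iff]; simpa using h4
  filter_upwards [Measure.quasiMeasurePreserving_fst.ae hae, h2, h5] with q hq1 hq2 hq3; simp_all

end Contour

/-- A holomorphic function bounded on a disc is Lipschitz on the disc of half the radius. -/
lemma norm_sub_le_of_bound {h : ℂ → ℂ} {p : ℂ} {ρ M : ℝ} (hρ : 0 < ρ)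
    (hd : DifferentiableOn ℂ h (closedBall p (2 * ρ)))
    (hM : ∀ z ∈ closedBall p (2 * ρ), ‖h z‖ ≤ M) {z w : ℂ} (hz : z ∈ ball p ρ)
    (hw : w ∈ ball p ρ) : ‖h z - h w‖ ≤ M / ρ * ‖z - w‖ := by
  refine Convex.norm_image_sub_le_of_norm_deriv_le (𝕜 := ℂ) (s := ball p ρ) ?_ ?_
    (convex_ball p ρ) hw hz
  · intro u hu; rw [mem_ball_iff_norm] at hu
    refine hd.differentiableAt (mem_of_superset (ball_mem_nhds u hρ) fun y hy => ?_)
    rw [mem_ball_iff_norm] at hy; rw [mem_closedBall_iff_norm]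
    have := norm_sub_le_norm_sub_add_norm_sub y u p; linarith
  · intro u hu; rw [mem_ball_iff_norm] at hu
    have hsub : closedBall u ρ ⊆ closedBall p (2 * ρ) := by
      intro y hy; rw [mem_closedBall_iff_norm] at hy ⊢
      have := norm_sub_le_norm_sub_add_norm_sub y u p; linarith
    grind [norm_deriv_le_of_forall_mem_sphere_norm_le, DifferentiableOn.diffContOnCl, closure_ball, DifferentiableOn.mono, sphere_subset_closedBall]

/-- The difference of the kernel shifted in its two variables. -/
def shiftedKernel (χ : ℂ → ℝ) (m : ℂ → ℂ → ℂ) (n l k : ℂ) : ℂ :=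
  χ l * (m (l - n) k / (l - n - k)) - χ k * (m l (k + n) / (l - (k + n)))

/-- The indicator function of a disc. -/
def discIndicator (p : ℂ) (ρ : ℝ) (z : ℂ) : ℝ := (ball p ρ).indicator (fun _ => 1) z

lemma discIndicator_nonneg (p : ℂ) (ρ : ℝ) (z : ℂ) : 0 ≤ discIndicator p ρ z :=
  indicator_nonneg (fun _ _ => zero_le_one) z

lemma measurable_discIndicator (p : ℂ) (ρ : ℝ) : Measurable (discIndicator p ρ) :=
  measurable_const.indicator measurableSet_ball

namespace TwoPointKernel
variable {C : Contour} {U : Set ℂ} {X0 : Set C.Param} {b : C.Param → ℝ} {m : ℂ → ℂ → ℂ}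

lemma pt_mem (h : TwoPointKernel C U X0 b m) {x : C.Param} (hx : x ∈ X0) : C.pt x ∈ U :=
  h.carrier_subset (C.pt_mem_carrier (C.regularParams_subset (h.regular hx)))

/-- Both terms have the denominator l - k - n. The numerator splits into an increment of χ and two
increments of m, each at most a multiple of |l - k| + |n|, which is comparable with the denominator
off the tangent. -/
lemma norm_near_le (h : TwoPointKernel C U X0 b m) {p : ℂ} {ρ M : ℝ} (hρ : 0 < ρ)
    (hU : closedBall p (2 * ρ) ⊆ U) (hM0 : 0 ≤ M)
    (hM : ∀ z ∈ closedBall p (2 * ρ), ∀ w ∈ closedBall p (2 * ρ), ‖m z w‖ ≤ M)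
    {χ : ℂ → ℝ} {L : NNReal} (hL : LipschitzWith L χ) {B : ℝ} (hB : ∀ z, |χ z| ≤ B) {n : ℂ}
    (hn0 : 0 < ‖n‖) (hn : ‖n‖ < ρ / 8) {l k : ℂ} (hl : l ∈ ball p (ρ / 2))
    (hk : k ∈ ball p (ρ / 2)) (h1 : ‖l - k‖ ≤ 2 * ‖l - k - n‖)
    (h2 : ‖n‖ ≤ 2 * ‖l - k - n‖) :
    ‖shiftedKernel χ m n l k‖ ≤ 2 * L * M + 4 * B * (M / ρ) := by
  set d := ‖l - k - n‖ with hd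
  have hball : ∀ z ∈ ball p ρ, z ∈ closedBall p (2 * ρ) := fun z hz =>
    ball_subset_closedBall (ball_subset_ball (by linarith) hz)
  have hl1 : l ∈ ball p ρ := ball_subset_ball (by linarith) hl
  have hk1 : k ∈ ball p ρ := ball_subset_ball (by linarith) hk
  have hl2 : l - n ∈ ball p ρ := by grind [mem_ball_iff_norm, norm_sub_le, sub_right_comm]
  have hk2 : k + n ∈ ball p ρ := by
    rw [mem_ball_iff_norm] at hk ⊢; have := norm_add_le (k - p) n; rw [sub_add_eq_add_sub] at this
    linarith
  have e1 : ‖m (l - n) k - m l k‖ ≤ M / ρ * ‖n‖ := by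
    have := norm_sub_le_of_bound (h := fun z => m z k) hρ
      ((h.diff_left k (hU (hball k hk1))).mono hU) (fun z hz => hM z hz k (hball k hk1)) hl2 hl1
    simp_all
  have e2 : ‖m l k - m l (k + n)‖ ≤ M / ρ * ‖n‖ := by
    have := norm_sub_le_of_bound (h := fun z => m l z) hρ
      ((h.diff_right l (hU (hball l hl1))).mono hU) (fun z hz => hM l (hball l hl1) z hz) hk1 hk2
    simp_all
  have e4 : |χ l - χ k| ≤ L * ‖l - k‖ := by
    have := hL.dist_le_mul l k; rwa [Real.dist_eq, dist_eq_norm] at this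
  have e5 : shiftedKernel χ m n l k = (((χ l - χ k : ℝ) : ℂ) * m (l - n) k +
      χ k * ((m (l - n) k - m l k) + (m l k - m l (k + n)))) / (l - k - n) := by
    rw [shiftedKernel, sub_right_comm l n k, sub_add_eq_sub_sub]; push_cast; ring
  rw [e5, norm_div, div_le_iff₀ (by linarith)]
  calc _ ≤ ‖((χ l - χ k : ℝ) : ℂ) * m (l - n) k‖ +
        ‖(χ k : ℂ) * ((m (l - n) k - m l k) + (m l k - m l (k + n)))‖ := norm_add_le _ _
    _ ≤ L * (2 * d) * M + B * (M / ρ * (2 * d) + M / ρ * (2 * d)) := by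
        rw [norm_mul, norm_mul, norm_real, norm_real, norm_eq_abs, norm_eq_abs]
        refine add_le_add ?_ ?_
        · exact mul_le_mul (e4.trans (by gcongr)) (by grind) (norm_nonneg _) (by positivity)
        · refine mul_le_mul (hB k) ((norm_add_le _ _).trans (add_le_add (e1.trans ?_)
            (e2.trans ?_))) (norm_nonneg _) (by grind) <;> gcongr
    _ = _ := by ring

/-- A majorant independent of the shift n, as dominated convergence requires. If both points are
near p, `norm_near_le` applies; if one is in the support of χ and the other away from p, the
denominator is at least ρ/8 and the one-sided bounds of m suffice. -/
lemma exists_norm_shifted_le (h : TwoPointKernel C U X0 b m) {p : ℂ} {ρ : ℝ} (hρ : 0 < ρ)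
    (hU : closedBall p (2 * ρ) ⊆ U) {χ : ℂ → ℝ} {L : NNReal} (hL : LipschitzWith L χ)
    (hsupp : ∀ z ∉ ball p (ρ / 4), χ z = 0) {B : ℝ} (hB : ∀ z, |χ z| ≤ B) :
    ∃ c : ℝ, 0 ≤ c ∧ ∀ n : ℂ, 0 < ‖n‖ → ‖n‖ < ρ / 8 → ∀ x ∈ X0, ∀ y ∈ X0,
      (C.pt x ∈ ball p ρ → C.pt y ∈ ball p ρ →
        ‖C.pt x - C.pt y‖ ≤ 2 * ‖C.pt x - C.pt y - n‖ ∧ ‖n‖ ≤ 2 * ‖C.pt x - C.pt y - n‖) →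
      ‖shiftedKernel χ m n (C.pt x) (C.pt y)‖ ≤
        c * (discIndicator p (ρ / 2) (C.pt x) * discIndicator p (ρ / 2) (C.pt y) +
          discIndicator p (ρ / 2) (C.pt x) * b y + b x * discIndicator p (ρ / 2) (C.pt y)) := by
  have hA := isCompact_closedBall p (2 * ρ); obtain ⟨M0, hM₀, hm0⟩ := h.local_bound _ hA hU
  obtain ⟨M1, hM1, hm1⟩ := h.left_bound _ hA hU; obtain ⟨M2, hM2, hm2⟩ := h.right_bound _ hA hU
  have hB0 : 0 ≤ B := (abs_nonneg _).trans (hB 0); set c0 := 2 * L * M0 + 4 * B * (M0 / ρ)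
  have hc₀ : 0 ≤ c0 := by positivity
  set c₁ := B * (M1 / (ρ / 8)); have hc1 : 0 ≤ c₁ := by positivity
  set c₂ := B * (M2 / (ρ / 8)); have hc2 : 0 ≤ c₂ := by positivity
  refine ⟨c0 + c₁ + c₂, by positivity, fun n hn0 hn x hx y hy hgeo => ?_⟩
  have hbx := h.nonneg x; have hby := h.nonneg y
  have hsub : ball p (ρ / 2) ⊆ ball p ρ := ball_subset_ball (by linarith)
  have hsub' : ball p (ρ / 4) ⊆ ball p (ρ / 2) := ball_subset_ball (by linarith)
  by_cases hxN : C.pt x ∈ ball p (ρ / 2)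
  · by_cases hyN : C.pt y ∈ ball p (ρ / 2)
    · obtain ⟨h1, h2⟩ := hgeo (hsub hxN) (hsub hyN)
      refine (h.norm_near_le hρ hU hM₀ hm0 hL hB hn0 hn hxN hyN h1 h2).trans ?_
      simp [discIndicator, indicator_of_mem hxN, indicator_of_mem hyN]; nlinarith
    · simp [discIndicator, indicator_of_mem hxN, indicator_of_notMem hyN]
      rw [shiftedKernel, hsupp _ (fun hy' => hyN (hsub' hy')), ofReal_zero, zero_mul, sub_zero]
      by_cases hxs : C.pt x ∈ ball p (ρ / 4)
      · rw [mem_ball_iff_norm] at hxs hyN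
        have e1 : C.pt x - n ∈ closedBall p (2 * ρ) := by
          grind [mem_closedBall_iff_norm, norm_sub_le, sub_right_comm]
        have e2 : ρ / 8 ≤ ‖C.pt x - n - C.pt y‖ := by
          have h1 := norm_sub_le (C.pt x - p) n
          have h2 := norm_sub_le (C.pt x - p - n) (C.pt x - n - C.pt y)
          have h3 : C.pt x - p - n - (C.pt x - n - C.pt y) = C.pt y - p := by ring
          grind
        have e3 : ‖(χ (C.pt x) : ℂ) * (m (C.pt x - n) (C.pt y) / (C.pt x - n - C.pt y))‖ ≤
            B * (M1 * b y / (ρ / 8)) := by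
          rw [norm_mul, norm_div, norm_real, norm_eq_abs]; bound
        refine e3.trans ?_; have e4 : B * (M1 * b y / (ρ / 8)) = c₁ * b y := by ring
        rw [e4]; bound
      · rw [hsupp _ hxs, ofReal_zero, zero_mul, norm_zero]; positivity
  · simp [discIndicator, indicator_of_notMem hxN]
    rw [shiftedKernel, hsupp _ (fun hx' => hxN (hsub' hx')), ofReal_zero, zero_mul,
      zero_sub, norm_neg]
    by_cases hys : C.pt y ∈ ball p (ρ / 4)
    · rw [indicator_of_mem (hsub' hys), mul_one]; rw [mem_ball_iff_norm] at hys hxN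
      have e1 : C.pt y + n ∈ closedBall p (2 * ρ) := by
        rw [mem_closedBall_iff_norm]; have := norm_add_le (C.pt y - p) n; grind [sub_add_eq_add_sub]
      have e2 : ρ / 8 ≤ ‖C.pt x - (C.pt y + n)‖ := by
        have h1 := norm_add_le (C.pt y - p) n
        have h2 := norm_add_le (C.pt y - p + n) (C.pt x - (C.pt y + n))
        have h3 : C.pt y - p + n + (C.pt x - (C.pt y + n)) = C.pt x - p := by ring
        grind
      have e3 : ‖(χ (C.pt y) : ℂ) * (m (C.pt x) (C.pt y + n) / (C.pt x - (C.pt y + n)))‖ ≤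
          B * (M2 * b x / (ρ / 8)) := by
        rw [norm_mul, norm_div, norm_real, norm_eq_abs]; bound
      refine e3.trans ?_; have e4 : B * (M2 * b x / (ρ / 8)) = c₂ * b x := by ring
      rw [e4]; bound
    · rw [hsupp _ hys, ofReal_zero, zero_mul, norm_zero]
      have := discIndicator_nonneg p (ρ / 2) (C.pt y); positivity

end TwoPointKernel

/-- The integral of `m(z, μ) / (z - μ)` over the contour. -/
def firstTransform (C : Contour) (m : ℂ → ℂ → ℂ) (z : ℂ) : ℂ :=
  ∫ y, m z (C.pt y) / (z - C.pt y) * C.vel y ∂Cᵐ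

/-- The integral of `m(λ, w) / (λ - w)` over the contour. -/
def secondTransform (C : Contour) (m : ℂ → ℂ → ℂ) (w : ℂ) : ℂ :=
  ∫ x, m (C.pt x) w / (C.pt x - w) * C.vel x ∂Cᵐ

/-- The kernel of the commutator with multiplication by `χ`. -/
def commutatorKernel (C : Contour) (χ : ℂ → ℝ) (m : ℂ → ℂ → ℂ) (q : C.Param × C.Param) : ℂ :=
  ((χ (C.pt q.1) - χ (C.pt q.2) : ℝ) : ℂ) * (m (C.pt q.1) (C.pt q.2) / (C.pt q.1 - C.pt q.2)) *
    (C.vel q.1 * C.vel q.2)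

/-- Bounded Lipschitz functions. -/
def IsCutoff (χ : ℂ → ℝ) : Prop := (∃ L, LipschitzWith L χ) ∧ ∃ B : ℝ, ∀ z, |χ z| ≤ B

lemma IsCutoff.measurable {χ : ℂ → ℝ} (h : IsCutoff χ) : Measurable χ := by
  obtain ⟨⟨L, hL⟩, -⟩ := h; exact hL.continuous.measurable

lemma measurable_mul_of_support {χ : ℂ → ℝ} (hχ : Measurable χ) {s : Set ℂ} (hs : IsOpen s)
    (hsupp : ∀ z ∉ s, χ z = 0) {e : ℂ → ℂ} (he : ContinuousOn e s) :
    Measurable fun z => (χ z : ℂ) * e z := by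
  classical
  have h1 : Measurable (s.piecewise e fun _ => 0) :=
    he.measurable_piecewise continuousOn_const hs.measurableSet
  convert (Complex.measurable_ofReal.comp hχ).mul h1 using 1; ext z; by_cases hz : z ∈ s
  · simp [hz]
  simp_all

lemma Contour.integrable_discIndicator_mul_vel {C : Contour} (p : ℂ) (ρ : ℝ) :
    Integrable (fun x => discIndicator p ρ (C.pt x) * ‖C.vel x‖) Cᵐ := by
  have h1 := (C.integrableOn_norm_vel (‖p‖ + |ρ|)).integrable_indicator₀
    (C.nullMeasurableSet_norm_le _)
  refine h1.mono' (((measurable_discIndicator p ρ).comp_aemeasurable C.aemeasurable_pt).mul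
    C.measurable_vel.norm.aemeasurable).aestronglyMeasurable (ae_of_all _ fun x => ?_)
  rw [norm_mul, norm_norm, norm_of_nonneg (discIndicator_nonneg _ _ _)]
  by_cases hx : C.pt x ∈ ball p ρ
  · rw [indicator_of_mem, discIndicator, indicator_of_mem hx, one_mul]; rw [mem_ball_iff_norm] at hx
    have h2 := norm_le_norm_add_norm_sub' (C.pt x) p; grind
  · rw [discIndicator, indicator_of_notMem hx, zero_mul]; grind [indicator_nonneg]

namespace TwoPointKernel
variable {C : Contour} {U : Set ℂ} {X0 : Set C.Param} {b : C.Param → ℝ} {m : ℂ → ℂ → ℂ}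

lemma aestronglyMeasurable_prod (h : TwoPointKernel C U X0 b m) {g : ℂ × ℂ → ℂ}
    (hg : Measurable g) : AEStronglyMeasurable
      (fun q : C.Param × C.Param => g (C.pt q.1, C.pt q.2) * (C.vel q.1 * C.vel q.2))
      (Cᵐ.prod Cᵐ) := by
  have h1 : AEMeasurable (fun q : C.Param × C.Param => (C.pt q.1, C.pt q.2)) (Cᵐ.prod Cᵐ) :=
    (C.aemeasurable_pt.comp_quasiMeasurePreserving quasiMeasurePreserving_fst).prodMk
      (C.aemeasurable_pt.comp_quasiMeasurePreserving quasiMeasurePreserving_snd)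
  exact ((hg.comp_aemeasurable h1).mul ((C.measurable_vel.comp measurable_fst).mul
    (C.measurable_vel.comp measurable_snd)).aemeasurable).aestronglyMeasurable

lemma measurable_first (h : TwoPointKernel C U X0 b m) {χ : ℂ → ℝ} (hχ : Measurable χ) (n : ℂ) :
    Measurable fun q : ℂ × ℂ => (χ q.1 : ℂ) * (m (q.1 - n) q.2 / (q.1 - n - q.2)) := by
  have h1 : Measurable fun q : ℂ × ℂ => m (q.1 - n) q.2 :=
    h.measurable.comp ((measurable_fst.sub_const n).prodMk measurable_snd)
  exact (Complex.measurable_ofReal.comp (hχ.comp measurable_fst)).mul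
    (h1.div ((measurable_fst.sub_const n).sub measurable_snd))

lemma measurable_second (h : TwoPointKernel C U X0 b m) {χ : ℂ → ℝ} (hχ : Measurable χ) (n : ℂ) :
    Measurable fun q : ℂ × ℂ => (χ q.2 : ℂ) * (m q.1 (q.2 + n) / (q.1 - (q.2 + n))) := by
  have h1 : Measurable fun q : ℂ × ℂ => m q.1 (q.2 + n) :=
    h.measurable.comp (measurable_fst.prodMk (measurable_snd.add_const n))
  exact (Complex.measurable_ofReal.comp (hχ.comp measurable_snd)).mul
    (h1.div (measurable_fst.sub (measurable_snd.add_const n)))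

lemma le_norm_translate {p n l k : ℂ} {ρ : ℝ} (hn : ‖n‖ < ρ / 8) (hl : l ∈ ball p (ρ / 4))
    (hgeo : k ∈ ball p ρ → ‖n‖ ≤ 2 * ‖l - n - k‖) : ‖n‖ / 2 ≤ ‖l - n - k‖ := by
  by_cases hk : k ∈ ball p ρ
  · linarith [hgeo hk]
  · rw [mem_ball_iff_norm] at hl hk; have h1 := norm_sub_le (l - p) n
    have h2 := norm_sub_le (l - p - n) (l - n - k)
    have h3 : l - p - n - (l - n - k) = k - p := by ring
    rw [h3] at h2; linarith [norm_nonneg n]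

/-- The integral of the shifted kernel. -/
lemma integral_shiftedKernel (h : TwoPointKernel C U X0 b m) {p : ℂ} {ρ : ℝ} (hρ : 0 < ρ)
    (hU : closedBall p (2 * ρ) ⊆ U) {χ : ℂ → ℝ} (hχ : IsCutoff χ)
    (hsupp : ∀ z ∉ ball p (ρ / 4), χ z = 0) {n : ℂ} (hn0 : 0 < ‖n‖) (hn : ‖n‖ < ρ / 8)
    (hgeo : ∀ x ∈ X0, C.pt x ∈ ball p ρ → ∀ y ∈ X0, C.pt y ∈ ball p ρ →
      ‖n‖ ≤ 2 * ‖C.pt x - C.pt y - n‖) :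
    ∫ q, shiftedKernel χ m n (C.pt q.1) (C.pt q.2) * (C.vel q.1 * C.vel q.2) ∂Cᵐ.prod Cᵐ =
      (∫ x, χ (C.pt x) * firstTransform C m (C.pt x - n) * C.vel x ∂Cᵐ) -
        ∫ y, χ (C.pt y) * secondTransform C m (C.pt y + n) * C.vel y ∂Cᵐ := by
  obtain ⟨B, hB⟩ := hχ.2; have hB0 : 0 ≤ B := (abs_nonneg _).trans (hB 0)
  have hA := isCompact_closedBall p (2 * ρ); obtain ⟨M1, hM1, hm1⟩ := h.left_bound _ hA hU
  obtain ⟨M2, hM2, hm2⟩ := h.right_bound _ hA hU; have hX : ∀ᵐ q ∂Cᵐ.prod Cᵐ, q.1 ∈ X0 ∧ q.2 ∈ X0 :=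
    (C.ae_prod_ne h.measurableSet h.regular h.ae_mem).mono fun q hq => ⟨hq.1, hq.2.1⟩
  have hdisc := C.integrable_discIndicator_mul_vel p (ρ / 4)
  have hsub : ball p (ρ / 4) ⊆ ball p ρ := ball_subset_ball (by linarith)
  -- For fixed n the denominator is at least |n|/2 on the support of χ, so each of the two terms is
  -- integrable separately and Fubini applies.
  have hI1 : Integrable (fun q : C.Param × C.Param =>
      (χ (C.pt q.1) : ℂ) * (m (C.pt q.1 - n) (C.pt q.2) / (C.pt q.1 - n - C.pt q.2)) *
        (C.vel q.1 * C.vel q.2)) (Cᵐ.prod Cᵐ) := by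
    refine ((hdisc.mul_prod h.integrable).const_mul (B * (M1 / (‖n‖ / 2)))).mono'
      (h.aestronglyMeasurable_prod (h.measurable_first hχ.measurable n)) ?_
    filter_upwards [hX] with q hq; have hb := h.nonneg q.2; by_cases hx : C.pt q.1 ∈ ball p (ρ / 4)
    · have e0 : C.pt q.1 - n ∈ closedBall p (2 * ρ) := by
        grind [mem_closedBall_iff_norm, norm_sub_le, mem_ball_iff_norm, sub_right_comm]
      have e1 : ‖n‖ / 2 ≤ ‖C.pt q.1 - n - C.pt q.2‖ := by grind [le_norm_translate, sub_right_comm]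
      rw [discIndicator, indicator_of_mem hx, norm_mul, norm_mul, norm_div, norm_mul,
        norm_real, norm_eq_abs, one_mul]
      calc _ ≤ B * (M1 * b q.2 / (‖n‖ / 2)) * (‖C.vel q.1‖ * ‖C.vel q.2‖) := by
            bound
        _ = _ := by ring
    · rw [hsupp _ hx, ofReal_zero, zero_mul, zero_mul, norm_zero]
      have := discIndicator_nonneg p (ρ / 4) (C.pt q.1); positivity
  have hI2 : Integrable (fun q : C.Param × C.Param =>
      (χ (C.pt q.2) : ℂ) * (m (C.pt q.1) (C.pt q.2 + n) / (C.pt q.1 - (C.pt q.2 + n))) *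
        (C.vel q.1 * C.vel q.2)) (Cᵐ.prod Cᵐ) := by
    refine ((h.integrable.mul_prod hdisc).const_mul (B * (M2 / (‖n‖ / 2)))).mono'
      (h.aestronglyMeasurable_prod (h.measurable_second hχ.measurable n)) ?_
    filter_upwards [hX] with q hq; have hb := h.nonneg q.1; by_cases hy : C.pt q.2 ∈ ball p (ρ / 4)
    · have e0 : C.pt q.2 + n ∈ closedBall p (2 * ρ) := by
        rw [mem_ball_iff_norm] at hy; rw [mem_closedBall_iff_norm]
        have := norm_add_le (C.pt q.2 - p) n; grind [sub_add_eq_add_sub]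
      have e1 : ‖n‖ / 2 ≤ ‖C.pt q.1 - (C.pt q.2 + n)‖ := by
        have := le_norm_translate (n := -n) (k := C.pt q.1) (by rwa [norm_neg]) hy fun hx => by
          grind [norm_neg, sub_neg_eq_add, norm_sub_rev, sub_sub]
        grind [norm_sub_rev, sub_neg_eq_add, norm_neg]
      rw [discIndicator, indicator_of_mem hy, norm_mul, norm_mul, norm_div, norm_mul,
        norm_real, norm_eq_abs, one_mul]
      calc _ ≤ B * (M2 * b q.1 / (‖n‖ / 2)) * (‖C.vel q.1‖ * ‖C.vel q.2‖) := by
            bound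
        _ = _ := by ring
    · rw [hsupp _ hy, ofReal_zero, zero_mul, zero_mul, norm_zero]
      have := discIndicator_nonneg p (ρ / 4) (C.pt q.2); positivity
  simp [shiftedKernel, sub_mul]
  rw [integral_sub hI1 hI2, integral_prod _ hI1, integral_prod_symm _ hI2]; congr 1
  · refine integral_congr_ae (ae_of_all _ fun x => ?_); simp [firstTransform]
    rw [← integral_const_mul, ← integral_mul_const]; grind
  · refine integral_congr_ae (ae_of_all _ fun x => ?_); simp [secondTransform]
    rw [← integral_const_mul, ← integral_mul_const]; grind

lemma tendsto_shiftedKernel (h : TwoPointKernel C U X0 b m) {ν l k : ℂ} (χ : ℂ → ℝ) (hl : l ∈ U)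
    (hk : k ∈ U) (hlk : l ≠ k) :
    Tendsto (fun ε : ℝ => shiftedKernel χ m (ε * ν) l k) (𝓝[>] 0)
      (𝓝 (((χ l - χ k : ℝ) : ℂ) * (m l k / (l - k)))) := by
  have hε : Tendsto (fun ε : ℝ => (ε : ℂ) * ν) (𝓝[>] 0) (𝓝 0) := by
    have : Continuous fun ε : ℝ => (ε : ℂ) * ν := by fun_prop
    have h1 := this.tendsto 0; simp at h1; exact h1.mono_left nhdsWithin_le_nhds
  have h1 : Tendsto (fun ε : ℝ => l - ε * ν) (𝓝[>] 0) (𝓝 l) := by simpa using hε.const_sub l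
  have h2 : Tendsto (fun ε : ℝ => k + ε * ν) (𝓝[>] 0) (𝓝 k) := by simpa using hε.const_add k
  have c1 : ContinuousAt (fun z => m z k) l :=
    ((h.diff_left k hk).differentiableAt (h.isOpen.mem_nhds hl)).continuousAt
  have c2 : ContinuousAt (m l) k :=
    ((h.diff_right l hl).differentiableAt (h.isOpen.mem_nhds hk)).continuousAt
  have h3 := ((c1.tendsto.comp h1).div (h1.sub_const k) (sub_ne_zero.2 hlk)).const_mul (χ l : ℂ)
  have h4 := ((c2.tendsto.comp h2).div (h2.const_sub l) (sub_ne_zero.2 hlk)).const_mul (χ k : ℂ)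
  have h5 := h3.sub h4; rw [← sub_mul, ← ofReal_sub] at h5; exact h5

/-- Used with ν for the boundary values from the left and with -ν for those from the right. -/
lemma tendsto_integral_boundary {χ : ℂ → ℝ} (hχ : IsCutoff χ) {p : ℂ} {ρ : ℝ} (hρ : 0 < ρ)
    (hsupp : ∀ z ∉ ball p (ρ / 4), χ z = 0) {e : ℂ → ℂ}
    (he : ContinuousOn e (closedBall p (2 * ρ))) (ν : ℂ) {T : ℝ → ℂ → ℂ}
    (hT : ∀ᶠ ε : ℝ in 𝓝[>] 0, ∀ x ∈ C.params, C.pt x ∈ ball p ρ →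
      T ε (C.pt x) = e (C.pt x + ε * ν)) :
    Tendsto (fun ε : ℝ => ∫ x, χ (C.pt x) * T ε (C.pt x) * C.vel x ∂Cᵐ) (𝓝[>] 0)
      (𝓝 (∫ x, χ (C.pt x) * e (C.pt x) * C.vel x ∂Cᵐ)) := by
  obtain ⟨B, hB⟩ := hχ.2; have hB0 : 0 ≤ B := (abs_nonneg _).trans (hB 0)
  obtain ⟨E, hE⟩ := (isCompact_closedBall p (2 * ρ)).exists_bound_of_continuousOn he
  have hε : Tendsto (fun ε : ℝ => (ε : ℂ) * ν) (𝓝[>] 0) (𝓝 0) := by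
    have : Continuous fun ε : ℝ => (ε : ℂ) * ν := by fun_prop
    have h1 := this.tendsto 0; simp at h1; exact h1.mono_left nhdsWithin_le_nhds
  have hsmall : ∀ᶠ ε : ℝ in 𝓝[>] 0, ‖(ε : ℂ) * ν‖ < ρ := by
    have := hε.norm; rw [norm_zero] at this; exact this.eventually_lt_const hρ
  have hmem : ∀ z ∈ ball p (ρ / 4), ∀ n : ℂ, ‖n‖ < ρ → z + n ∈ ball p (2 * ρ) := by
    intro z hz n hn; rw [mem_ball_iff_norm] at hz ⊢; have := norm_add_le (z - p) n
    rw [sub_add_eq_add_sub] at this; linarith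
  have hcongr : ∀ᶠ ε : ℝ in 𝓝[>] 0, ∫ x, χ (C.pt x) * e (C.pt x + ε * ν) * C.vel x ∂Cᵐ =
      ∫ x, χ (C.pt x) * T ε (C.pt x) * C.vel x ∂Cᵐ := by
    filter_upwards [hT] with ε hεT; refine integral_congr_ae ?_
    filter_upwards [C.ae_mem_params] with x hx; by_cases hxp : C.pt x ∈ ball p (ρ / 4)
    · rw [hεT x hx (ball_subset_ball (by linarith) hxp)]
    grind [ofReal_zero]
  refine Tendsto.congr' hcongr ?_; refine tendsto_integral_filter_of_dominated_convergence
    (fun x => B * E * (discIndicator p (ρ / 4) (C.pt x) * ‖C.vel x‖)) ?_ ?_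
    ((C.integrable_discIndicator_mul_vel p (ρ / 4)).const_mul _) ?_
  · filter_upwards [hsmall] with ε hε; have h1 : Measurable fun z => (χ z : ℂ) * e (z + ε * ν) :=
      measurable_mul_of_support hχ.measurable isOpen_ball hsupp
        (he.comp (by fun_prop) fun z hz => ball_subset_closedBall (hmem z hz _ hε))
    exact ((h1.comp_aemeasurable C.aemeasurable_pt).mul
      C.measurable_vel.aemeasurable).aestronglyMeasurable
  · filter_upwards [hsmall] with ε hε; refine ae_of_all _ fun x => ?_
    by_cases hxp : C.pt x ∈ ball p (ρ / 4)
    · rw [norm_mul, norm_mul, discIndicator, indicator_of_mem hxp, one_mul, norm_real, norm_eq_abs]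
      gcongr
      · exact hB _
      grind [ball_subset_closedBall]
    · rw [hsupp _ hxp, ofReal_zero, zero_mul, zero_mul, norm_zero, discIndicator,
        indicator_of_notMem hxp]
      simp
  · refine ae_of_all _ fun x => ?_; refine Tendsto.mul_const _ ?_
    by_cases hxp : C.pt x ∈ ball p (ρ / 4)
    · refine Tendsto.const_mul _ ?_
      have h2 : ContinuousAt e (C.pt x) := he.continuousAt (mem_of_superset
        (Metric.isOpen_ball.mem_nhds (by simpa using hmem _ hxp 0 (by simpa using hρ)))
        ball_subset_closedBall)
      exact h2.tendsto.comp (by simpa using hε.const_add (C.pt x))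
    · simp [hsupp _ hxp]

/-- The commutator formula for cutoffs supported near a regular point. -/
theorem local_commutator (h : TwoPointKernel C U X0 b m) {j : Fin C.n} {t0 : ℝ}
    (ht0 : t0 ∈ C.regular j) {W : Set ℂ} (hW : W ∈ 𝓝 (C.γ j t0)) {e₁ e₂ : ℂ → ℂ}
    (he1 : ContinuousOn e₁ W) (he2 : ContinuousOn e₂ W)
    (h₁ : ∀ᶠ z in C.rightNhds (j, t0), firstTransform C m z = e₁ z)
    (h₂ : ∀ᶠ z in C.leftNhds (j, t0), secondTransform C m z = e₂ z) :
    ∃ ρ > 0, ball (C.γ j t0) ρ ⊆ W ∧ ∀ χ, IsCutoff χ → (∀ z ∉ ball (C.γ j t0) ρ, χ z = 0) →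
      Integrable (commutatorKernel C χ m) (Cᵐ.prod Cᵐ) ∧
      (∫ x, χ (C.pt x) * e₁ (C.pt x) * C.vel x ∂Cᵐ) - ∫ x, χ (C.pt x) * e₂ (C.pt x) * C.vel x ∂Cᵐ =
      ∫ q, commutatorKernel C χ m q ∂Cᵐ.prod Cᵐ := by
  have hpU : U ∈ 𝓝 (C.γ j t0) :=
    h.isOpen.mem_nhds (h.carrier_subset (C.mem_carrier (C.regular_subset_dom j ht0)))
  obtain ⟨ν, ρ, ε0, hρ, hε₀, hball, hgeo⟩ :=
    C.exists_normal_translation ht0 h₁ h₂ (inter_mem hW hpU)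
  set p := C.γ j t0; have hballU : closedBall p (2 * ρ) ⊆ U := by grind
  have hballW : closedBall p (2 * ρ) ⊆ W := by grind
  refine ⟨ρ / 4, by positivity, (Metric.ball_subset_closedBall.trans
    (closedBall_subset_closedBall (by linarith))).trans hballW, fun χ hχ hsupp => ?_⟩
  obtain ⟨L, hL⟩ := hχ.1; obtain ⟨B, hB⟩ := hχ.2
  obtain ⟨c, hc0, hc⟩ := h.exists_norm_shifted_le hρ hballU hL hsupp hB
  have hpar : ∀ x ∈ X0, x ∈ C.params := fun x hx => C.regularParams_subset (h.regular hx)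
  have hev : ∀ᶠ ε : ℝ in 𝓝[>] 0, 0 < ε ∧ ε < ε0 := Ioo_mem_nhdsGT hε₀
  set Q : C.Param × C.Param → ℝ := fun q =>
    c * ((discIndicator p (ρ / 2) (C.pt q.1) * ‖C.vel q.1‖) *
        (discIndicator p (ρ / 2) (C.pt q.2) * ‖C.vel q.2‖) +
      (discIndicator p (ρ / 2) (C.pt q.1) * ‖C.vel q.1‖) * (b q.2 * ‖C.vel q.2‖) +
      (b q.1 * ‖C.vel q.1‖) * (discIndicator p (ρ / 2) (C.pt q.2) * ‖C.vel q.2‖)) with hQ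
  have hdisc := C.integrable_discIndicator_mul_vel p (ρ / 2)
  have hQi : Integrable Q (Cᵐ.prod Cᵐ) :=
    (((hdisc.mul_prod hdisc).add (hdisc.mul_prod h.integrable)).add
      (h.integrable.mul_prod hdisc)).const_mul c
  have hne := C.ae_prod_ne h.measurableSet h.regular h.ae_mem
  have hbound : ∀ᶠ ε : ℝ in 𝓝[>] 0, ∀ᵐ q ∂Cᵐ.prod Cᵐ,
      ‖shiftedKernel χ m (ε * ν) (C.pt q.1) (C.pt q.2) * (C.vel q.1 * C.vel q.2)‖ ≤ Q q := by
    filter_upwards [hev] with ε hε; obtain ⟨g1, g2, -, g4⟩ := hgeo ε hε.1 hε.2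
    filter_upwards [hne] with q hq
    have h1 := hc _ g1 g2 q.1 hq.1 q.2 hq.2.1 fun hx hy =>
      g4 q.1 (hpar _ hq.1) hx q.2 (hpar _ hq.2.1) hy
    rw [norm_mul, norm_mul, hQ]
    refine (mul_le_mul_of_nonneg_right h1 (by positivity)).trans (le_of_eq ?_)
    ring
  have hlim : ∀ᵐ q ∂Cᵐ.prod Cᵐ, Tendsto (fun ε : ℝ =>
      shiftedKernel χ m (ε * ν) (C.pt q.1) (C.pt q.2) * (C.vel q.1 * C.vel q.2)) (𝓝[>] 0)
      (𝓝 (commutatorKernel C χ m q)) := by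
    filter_upwards [hne] with q hq
    exact (h.tendsto_shiftedKernel χ (h.pt_mem hq.1) (h.pt_mem hq.2.1) hq.2.2).mul_const _
  have hmeas : ∀ ε : ℝ, AEStronglyMeasurable (fun q : C.Param × C.Param =>
      shiftedKernel χ m (ε * ν) (C.pt q.1) (C.pt q.2) * (C.vel q.1 * C.vel q.2))
      (Cᵐ.prod Cᵐ) := fun ε =>
    h.aestronglyMeasurable_prod (g := fun w => shiftedKernel χ m (ε * ν) w.1 w.2)
      ((h.measurable_first hχ.measurable _).sub (h.measurable_second hχ.measurable _))
  -- The double integral tends to the integral of the commutator. By Fubini it is also the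
  -- difference of two single integrals, whose limits are those of the boundary values.
  have hconv := tendsto_integral_filter_of_dominated_convergence Q
    (Eventually.of_forall hmeas) hbound hQi hlim
  refine ⟨?_, ?_⟩
  · refine hQi.mono' (aestronglyMeasurable_of_tendsto_ae _ hmeas hlim) ?_
    -- The exceptional null set of the bound depends on ε; a sequence of values of ε leaves only
    -- countably many null sets to discard.
    obtain ⟨u, hu⟩ := exists_seq_tendsto (𝓝[>] (0 : ℝ))
    have hb' := ae_all_iff.2 fun k : ℕ => (by
      simp : ∀ᵐ q ∂Cᵐ.prod Cᵐ, (∀ᵐ q ∂Cᵐ.prod Cᵐ,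
        ‖shiftedKernel χ m ((u k : ℝ) * ν) (C.pt q.1) (C.pt q.2) * (C.vel q.1 * C.vel q.2)‖ ≤ Q q) →
        ‖shiftedKernel χ m ((u k : ℝ) * ν) (C.pt q.1) (C.pt q.2) * (C.vel q.1 * C.vel q.2)‖ ≤ Q q)
    filter_upwards [hb', hlim] with q hq1 hq2; refine le_of_tendsto (hq2.comp hu).norm ?_
    filter_upwards [hu.eventually hbound] with k hk; exact hq1 k hk
  · refine tendsto_nhds_unique ?_ hconv
    have t1 := tendsto_integral_boundary (C := C) hχ hρ hsupp (he1.mono hballW) (-ν)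
      (T := fun ε z => firstTransform C m (z - ε * ν)) (by
        filter_upwards [hev] with ε hε x hx hxp; grind [mul_neg, sub_eq_add_neg])
    have t2 := tendsto_integral_boundary (C := C) hχ hρ hsupp (he2.mono hballW) ν
      (T := fun ε z => secondTransform C m (z + ε * ν)) (by
        filter_upwards [hev] with ε hε x hx hxp; grind)
    refine (t1.sub t2).congr' ?_; filter_upwards [hev] with ε hε
    obtain ⟨g1, g2, -, g4⟩ := hgeo ε hε.1 hε.2
    exact (h.integral_shiftedKernel hρ hballU hχ hsupp g1 g2 fun x hx hxp y hy hyp =>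
      (g4 x (hpar x hx) hxp y (hpar y hy) hyp).2).symm

end TwoPointKernel

/-! ### Lipschitz cutoffs -/

namespace IsCutoff
variable {χ χ' : ℂ → ℝ}

lemma const (c : ℝ) : IsCutoff fun _ => c := ⟨⟨0, LipschitzWith.const c⟩, |c|, fun _ => le_rfl⟩

lemma add (h : IsCutoff χ) (h' : IsCutoff χ') : IsCutoff fun z => χ z + χ' z := by
  obtain ⟨⟨L, hL⟩, B, hB⟩ := h; obtain ⟨⟨L', hL'⟩, B', hB'⟩ := h'
  exact ⟨⟨_, hL.add hL'⟩, B + B', fun z => (abs_add_le _ _).trans (add_le_add (hB z) (hB' z))⟩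

lemma mul (h : IsCutoff χ) (h' : IsCutoff χ') : IsCutoff fun z => χ z * χ' z := by
  obtain ⟨⟨L, hL⟩, B, hB⟩ := h; obtain ⟨⟨L', hL'⟩, B', hB'⟩ := h'
  have hB0 : 0 ≤ B := (abs_nonneg _).trans (hB 0)
  have hB0' : 0 ≤ B' := (abs_nonneg _).trans (hB' 0)
  refine ⟨⟨⟨B * L' + L * B', by positivity⟩, LipschitzWith.of_dist_le_mul fun z w => ?_⟩, B * B',
    fun z => ?_⟩
  · have h1 := hL.dist_le_mul z w; have h2 := hL'.dist_le_mul z w; rw [Real.dist_eq] at *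
    have e : χ z * χ' z - χ w * χ' w = χ z * (χ' z - χ' w) + (χ z - χ w) * χ' w := by ring
    rw [e]
    calc _ ≤ |χ z| * |χ' z - χ' w| + |χ z - χ w| * |χ' w| := by
          grind [abs_add_le]
      _ ≤ B * (L' * dist z w) + (L * dist z w) * B' := by bound
      _ = (B * L' + L * B') * dist z w := by ring
  · rw [abs_mul]; bound

lemma one_sub (h : IsCutoff χ) : IsCutoff fun z => 1 - χ z := by
  have := (const 1).add ((const (-1)).mul h); grind

lemma prod {ι : Type*} (s : Finset ι) {χ : ι → ℂ → ℝ} (h : ∀ i, IsCutoff (χ i)) :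
    IsCutoff fun z => ∏ i ∈ s, χ i z := by
  classical
  induction s using Finset.induction_on with
  | empty => simpa using const 1
  | insert i s hi ih =>
    simp_all [mul]

end IsCutoff

/-- The Lipschitz function that is one on the disc of radius `ρ` and zero off the disc of radius
`2ρ`. -/
def hat (p : ℂ) (ρ : ℝ) (z : ℂ) : ℝ := max 0 (min 1 (2 - ‖z - p‖ / ρ))

lemma hat_nonneg (p : ℂ) (ρ : ℝ) (z : ℂ) : 0 ≤ hat p ρ z := le_max_left _ _

lemma hat_le_one (p : ℂ) (ρ : ℝ) (z : ℂ) : hat p ρ z ≤ 1 := max_le zero_le_one (min_le_left _ _)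

lemma hat_eq_one {p : ℂ} {ρ : ℝ} (hρ : 0 < ρ) {z : ℂ} (hz : ‖z - p‖ ≤ ρ) : hat p ρ z = 1 := by
  have : ‖z - p‖ / ρ ≤ 1 := (div_le_one hρ).2 hz
  rw [hat, min_eq_left (by linarith), max_eq_right zero_le_one]

lemma hat_eq_zero {p : ℂ} {ρ : ℝ} (hρ : 0 < ρ) {z : ℂ} (hz : 2 * ρ ≤ ‖z - p‖) : hat p ρ z = 0 := by
  have : 2 ≤ ‖z - p‖ / ρ := (le_div_iff₀ hρ).2 hz; rw [hat, max_eq_left]; grind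

lemma abs_max_min_sub_le (x y : ℝ) :
    |max 0 (min 1 (2 - x)) - max 0 (min 1 (2 - y))| ≤ |x - y| := by
  grind

lemma abs_hat_sub_le {p : ℂ} {ρ : ℝ} (hρ : 0 < ρ) (z w : ℂ) :
    |hat p ρ z - hat p ρ w| ≤ |‖z - p‖ - ‖w - p‖| / ρ := by
  refine (abs_max_min_sub_le _ _).trans (le_of_eq ?_); rw [← sub_div, abs_div, abs_of_pos hρ]

lemma abs_hat_sub_le_norm {p : ℂ} {ρ : ℝ} (hρ : 0 < ρ) (z w : ℂ) :
    |hat p ρ z - hat p ρ w| ≤ ‖z - w‖ / ρ := by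
  refine (abs_hat_sub_le hρ z w).trans (div_le_div_of_nonneg_right ?_ hρ.le)
  have := abs_norm_sub_norm_le (z - p) (w - p); simp_all

lemma isCutoff_hat {p : ℂ} {ρ : ℝ} (hρ : 0 < ρ) : IsCutoff (hat p ρ) := by
  refine ⟨⟨⟨ρ⁻¹, by positivity⟩, LipschitzWith.of_dist_le_mul fun z w => ?_⟩, 1, fun z => ?_⟩
  · rw [Real.dist_eq, dist_eq_norm]; refine (abs_hat_sub_le_norm hρ z w).trans (le_of_eq ?_)
    rw [div_eq_inv_mul]; rfl
  grind [hat_nonneg, hat_le_one]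

/-- The scale invariant bound for the oscillation of `hat`. -/
lemma abs_hat_sub_le_rpow {p : ℂ} {ρ : ℝ} (hρ : 0 < ρ) {z w : ℂ} (hz : z ≠ p) (hw : w ≠ p) :
    |hat p ρ z - hat p ρ w| ≤
      4 * ‖z - w‖ * (‖z - p‖ ^ (-(1 / 2) : ℝ) * ‖w - p‖ ^ (-(1 / 2) : ℝ)) := by
  -- Bound with the larger of the two distances, which dominates their geometric mean. If it is at
  -- most 4ρ, the slope 1/ρ suffices. Otherwise the outer value is zero, and a non-zero inner value
  -- forces |z - p| < 2ρ, so |z - w| is at least half the larger distance.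
  have key : ∀ z w : ℂ, z ≠ p → w ≠ p → ‖z - p‖ ≤ ‖w - p‖ →
      |hat p ρ z - hat p ρ w| * ‖w - p‖ ≤ 4 * ‖z - w‖ := by
    intro z w hz hw hle
    have htri : ‖w - p‖ - ‖z - p‖ ≤ ‖z - w‖ := by
      grind [norm_sub_norm_le, norm_sub_rev, sub_sub_sub_cancel_right]
    by_cases h4 : ‖w - p‖ ≤ 4 * ρ
    · have h1 := abs_hat_sub_le hρ z w (p := p)
      rw [abs_sub_comm (‖z - p‖), abs_of_nonneg (sub_nonneg.2 hle)] at h1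
      calc _ ≤ (‖w - p‖ - ‖z - p‖) / ρ * (4 * ρ) :=
            mul_le_mul h1 h4 (norm_nonneg _) (div_nonneg (sub_nonneg.2 hle) hρ.le)
        _ = 4 * (‖w - p‖ - ‖z - p‖) := by field_simp
        _ ≤ _ := by linarith
    · rw [hat_eq_zero hρ (z := w) (by linarith), sub_zero, abs_of_nonneg (hat_nonneg _ _ _)]
      by_cases h2 : 2 * ρ ≤ ‖z - p‖
      · simp_all [hat_eq_zero]
      · have := mul_le_mul_of_nonneg_right (hat_le_one p ρ z) (norm_nonneg (w - p)); linarith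
  have hz0 : 0 < ‖z - p‖ := norm_pos_iff.2 (sub_ne_zero.2 hz)
  have hw0 : 0 < ‖w - p‖ := norm_pos_iff.2 (sub_ne_zero.2 hw)
  have hprod : ‖z - p‖ ^ (-(1 / 2) : ℝ) * ‖w - p‖ ^ (-(1 / 2) : ℝ) =
      (‖z - p‖ ^ (1 / 2 : ℝ) * ‖w - p‖ ^ (1 / 2 : ℝ))⁻¹ := by
    grind [rpow_neg]
  have hhalf : ∀ u : ℝ, 0 < u → u ^ (1 / 2 : ℝ) * u ^ (1 / 2 : ℝ) = u := fun u hu => by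
    rw [← rpow_add hu]; norm_num
  rw [hprod, ← div_eq_mul_inv, le_div_iff₀ (by positivity)]
  rcases le_total ‖z - p‖ ‖w - p‖ with hle | hle
  · refine le_trans ?_ (key z w hz hw hle); refine mul_le_mul_of_nonneg_left ?_ (abs_nonneg _)
    calc _ ≤ ‖w - p‖ ^ (1 / 2 : ℝ) * ‖w - p‖ ^ (1 / 2 : ℝ) := by gcongr
      _ = _ := hhalf _ hw0
  · have h1 := key w z hw hz hle; rw [abs_sub_comm, norm_sub_rev w z] at h1; refine le_trans ?_ h1
    refine mul_le_mul_of_nonneg_left ?_ (abs_nonneg _)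
    calc _ ≤ ‖z - p‖ ^ (1 / 2 : ℝ) * ‖z - p‖ ^ (1 / 2 : ℝ) := by gcongr
      _ = _ := hhalf _ hz0

lemma abs_prod_sub_prod_le {ι : Type*} (s : Finset ι) (u v : ι → ℝ) (hu : ∀ i, 0 ≤ u i ∧ u i ≤ 1)
    (hv : ∀ i, 0 ≤ v i ∧ v i ≤ 1) : |∏ i ∈ s, u i - ∏ i ∈ s, v i| ≤ ∑ i ∈ s, |u i - v i| := by
  classical
  induction s using Finset.induction_on with
  | empty => simp
  | insert i s hi ih =>
    rw [Finset.prod_insert hi, Finset.prod_insert hi, sum_insert hi]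
    have e : u i * ∏ k ∈ s, u k - v i * ∏ k ∈ s, v k =
        (u i - v i) * ∏ k ∈ s, u k + v i * (∏ k ∈ s, u k - ∏ k ∈ s, v k) := by ring
    rw [e]; refine (abs_add_le _ _).trans (add_le_add ?_ ?_)
    · grind [prod_nonneg, mul_le_of_le_one_right, prod_le_one]
    grind [LE.le.trans, mul_le_of_le_one_left, abs_nonneg]

/-! ### Commutators with cutoffs -/

namespace TwoPointKernel
variable {C : Contour} {U : Set ℂ} {X0 : Set C.Param} {b : C.Param → ℝ} {m : ℂ → ℂ → ℂ}
  {Ψ : C.Param → ℂ} {χ χ' : ℂ → ℝ}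

/-- The commutator formula with the cutoff `χ`. -/
def HasCommutator (C : Contour) (m : ℂ → ℂ → ℂ) (Ψ : C.Param → ℂ) (χ : ℂ → ℝ) : Prop :=
  Integrable (commutatorKernel C χ m) (Cᵐ.prod Cᵐ) ∧ ∫ x, χ (C.pt x) * (Ψ x * C.vel x) ∂Cᵐ =
      -∫ q, commutatorKernel C χ m q ∂Cᵐ.prod Cᵐ

/-- The boundary values of the two transforms of `m` differ by `Ψ`. -/
def HasBoundaryDifference (C : Contour) (X0 : Set C.Param) (m : ℂ → ℂ → ℂ)
    (Ψ : C.Param → ℂ) : Prop :=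
  ∀ j, ∀ t ∈ C.regular j, ∃ W ∈ 𝓝 (C.γ j t), ∃ e₁ e₂ : ℂ → ℂ,
    ContinuousOn e₁ W ∧ ContinuousOn e₂ W ∧
    (∀ᶠ z in C.rightNhds (j, t), firstTransform C m z = e₁ z) ∧
    (∀ᶠ z in C.leftNhds (j, t), secondTransform C m z = e₂ z) ∧
    ∀ x ∈ X0, C.pt x ∈ W → Ψ x = e₂ (C.pt x) - e₁ (C.pt x)

lemma integrable_cutoff_mul (hΨ : Integrable (fun x => Ψ x * C.vel x) Cᵐ)
    (hχ : IsCutoff χ) : Integrable (fun x => (χ (C.pt x) : ℂ) * (Ψ x * C.vel x)) Cᵐ := by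
  obtain ⟨B, hB⟩ := hχ.2; refine hΨ.bdd_mul (c := B) ((Complex.measurable_ofReal.comp
    hχ.measurable).comp_aemeasurable C.aemeasurable_pt).aestronglyMeasurable
    (ae_of_all _ fun x => ?_)
  simp_all

lemma HasCommutator.add (hΨ : Integrable (fun x => Ψ x * C.vel x) Cᵐ)
    (hχ : IsCutoff χ) (hχ' : IsCutoff χ') (h : HasCommutator C m Ψ χ)
    (h' : HasCommutator C m Ψ χ') : HasCommutator C m Ψ fun z => χ z + χ' z := by
  have e : ∀ q, commutatorKernel C (fun z => χ z + χ' z) m q =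
      commutatorKernel C χ m q + commutatorKernel C χ' m q := fun q => by
    simp [commutatorKernel]; push_cast; ring
  refine ⟨(h.1.add h'.1).congr (ae_of_all _ fun q => (e q).symm), ?_⟩; simp [e]
  rw [integral_add h.1 h'.1, neg_add, ← h.2, ← h'.2,
    ← integral_add (integrable_cutoff_mul hΨ hχ) (integrable_cutoff_mul hΨ hχ')]
  grind [ae_of_all]

lemma hasCommutator_of_eq_zero (hχ : ∀ z ∈ C.carrier, χ z = 0) : HasCommutator C m Ψ χ := by
  have h0 : ∀ᵐ x ∂Cᵐ, χ (C.pt x) = 0 := C.ae_mem_params.mono fun x hx => hχ _ (C.pt_mem_carrier hx)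
  have h1 : commutatorKernel C χ m =ᵐ[Cᵐ.prod Cᵐ] 0 := by
    filter_upwards [Measure.quasiMeasurePreserving_fst.ae h0,
      Measure.quasiMeasurePreserving_snd.ae h0] with q h1 h2
    simp [commutatorKernel, h1, h2]
  refine ⟨(integrable_zero _ _ _).congr h1.symm, ?_⟩; rw [integral_congr_ae h1]; simp
  refine integral_eq_zero_of_ae ?_; filter_upwards [h0] with x hx; simp [hx]

lemma integrable_cutoff_mul_continuousOn (hχ : IsCutoff χ) {p : ℂ} {ρ : ℝ}
    (hsupp : ∀ z ∉ ball p (ρ / 2), χ z = 0) {e : ℂ → ℂ}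
    (he : ContinuousOn e (closedBall p (ρ / 2))) :
    Integrable (fun x => χ (C.pt x) * e (C.pt x) * C.vel x) Cᵐ := by
  obtain ⟨B, hB⟩ := hχ.2
  obtain ⟨E, hE⟩ := (isCompact_closedBall p (ρ / 2)).exists_bound_of_continuousOn he
  have hB0 : 0 ≤ B := (abs_nonneg _).trans (hB 0)
  refine ((C.integrable_discIndicator_mul_vel p (ρ / 2)).const_mul (B * E)).mono'
    (((measurable_mul_of_support hχ.measurable isOpen_ball hsupp
      (he.mono ball_subset_closedBall)).comp_aemeasurable C.aemeasurable_pt).mul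
      C.measurable_vel.aemeasurable).aestronglyMeasurable (ae_of_all _ fun x => ?_)
  by_cases hx : C.pt x ∈ ball p (ρ / 2)
  · rw [norm_mul, norm_mul, discIndicator, indicator_of_mem hx, one_mul, norm_real, norm_eq_abs]
    gcongr
    · exact hB _
    · exact hE _ (ball_subset_closedBall hx)
  · rw [hsupp _ hx, discIndicator, indicator_of_notMem hx]; simp

lemma exists_hasCommutator_of_regular (h : TwoPointKernel C U X0 b m)
    (hloc : HasBoundaryDifference C X0 m Ψ) {j : Fin C.n} {t : ℝ} (ht : t ∈ C.regular j) :
    ∃ ρ > 0, ∀ χ, IsCutoff χ → (∀ z ∉ ball (C.γ j t) ρ, χ z = 0) → HasCommutator C m Ψ χ := by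
  obtain ⟨W, hW, e₁, e₂, he1, he2, h₁, h₂, hΨ⟩ := hloc j t ht
  obtain ⟨ρ, hρ, hρW, hcom⟩ := h.local_commutator ht hW he1 he2 h₁ h₂
  have hsub : closedBall (C.γ j t) (ρ / 2) ⊆ W := (closedBall_subset_ball (by linarith)).trans hρW
  refine ⟨ρ / 2, by positivity, fun χ hχ hsupp => ?_⟩
  obtain ⟨hI, hE⟩ := hcom χ hχ fun z hz =>
    hsupp z fun hz' => hz (ball_subset_ball (by linarith) hz')
  refine ⟨hI, ?_⟩
  rw [← hE, neg_sub, ← integral_sub (integrable_cutoff_mul_continuousOn hχ hsupp (he2.mono hsub))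
    (integrable_cutoff_mul_continuousOn hχ hsupp (he1.mono hsub))]
  refine integral_congr_ae ?_; filter_upwards [h.ae_mem] with x hx
  by_cases hxp : C.pt x ∈ ball (C.γ j t) (ρ / 2)
  · grind [ball_subset_closedBall]
  · rw [hsupp _ hxp]; simp

/-- The commutator formula for cutoffs that vanish near the exceptional points. -/
lemma hasCommutator_of_vanish (h : TwoPointKernel C U X0 b m)
    (hΨ : Integrable (fun x => Ψ x * C.vel x) Cᵐ)
    (hloc : HasBoundaryDifference C X0 m Ψ) (hχ : IsCutoff χ) {R : ℝ}
    (hR : ∀ z, R ≤ ‖z‖ → χ z = 0)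
    (hexc : ∀ p ∈ C.exceptional, ∃ δ > 0, ∀ z ∈ ball p δ, χ z = 0) :
    HasCommutator C m Ψ χ := by
  classical
  have hpt : ∀ z : ℂ, ∃ ρ > 0, ∀ θ, IsCutoff θ → (∀ w ∉ ball z ρ, θ w = 0) →
      HasCommutator C m Ψ fun w => χ w * θ w := by
    intro z; by_cases hz : z ∈ C.carrier
    · by_cases hze : z ∈ C.exceptional
      · obtain ⟨δ, hδ, h0⟩ := hexc z hze
        refine ⟨δ, hδ, fun θ hθ hsupp => hasCommutator_of_eq_zero fun w _ => ?_⟩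
        by_cases hw : w ∈ ball z δ
        · rw [h0 w hw, zero_mul]
        grind
      · obtain ⟨j, t, ht, rfl⟩ := Set.mem_iUnion.1 hz
        have htr : t ∈ C.regular j := by
          by_contra hc; exact hze (Set.mem_iUnion.2 ⟨j, t, ⟨ht, hc⟩, rfl⟩)
        obtain ⟨ρ, hρ, hg⟩ := h.exists_hasCommutator_of_regular hloc htr
        exact ⟨ρ, hρ, fun θ hθ hsupp => hg _ (hχ.mul hθ) fun w hw => by grind⟩
    · obtain ⟨ρ, hρ, hball⟩ := Metric.isOpen_iff.1 C.isClosed_carrier.isOpen_compl z hz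
      grind [hasCommutator_of_eq_zero]
  choose ρ hρ hg using hpt
  have hθ : ∀ z, IsCutoff (hat z (ρ z / 2)) := fun z => isCutoff_hat (half_pos (hρ z))
  obtain ⟨s, -, hs⟩ := (isCompact_closedBall (0 : ℂ) R).elim_nhds_subcover
    (fun z => ball z (ρ z / 2)) fun z _ => ball_mem_nhds z (half_pos (hρ z))
  have hone : ∀ s : Finset ℂ, IsCutoff fun w => ∏ z ∈ s, (1 - hat z (ρ z / 2) w) := fun s =>
    IsCutoff.prod s fun z => (hθ z).one_sub
  -- Subordinate partition of unity by telescoping: adding a point i to s adds the summand χ · ∏(1 -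
  -- hat) · hatᵢ, supported where the local formula at i holds. On the covered disc one of the
  -- factors 1 - hat vanishes, so the full product leaves χ.
  have hind : ∀ s : Finset ℂ, HasCommutator C m Ψ
      fun w => χ w * (1 - ∏ z ∈ s, (1 - hat z (ρ z / 2) w)) := by
    intro s
    induction s using Finset.induction_on with
    | empty => grind [hasCommutator_of_eq_zero]
    | insert i s hi ih =>
      have h1 := hg i (fun w => (∏ z ∈ s, (1 - hat z (ρ z / 2) w)) * hat i (ρ i / 2) w)
        ((hone s).mul (hθ i)) fun w hw => by grind [hat_eq_zero, mem_ball_iff_norm]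
      have h2 := HasCommutator.add hΨ (hχ.mul (hone s).one_sub) (hχ.mul ((hone s).mul (hθ i))) ih h1
      grind
  convert hind s using 2 with w; by_cases hw : ‖w‖ < R
  · obtain ⟨z, hz, hwz⟩ := Set.mem_iUnion₂.1 (hs (mem_closedBall_zero_iff.2 hw.le))
    grind [prod_eq_zero, hat_eq_one, mem_ball_iff_norm]
  grind

end TwoPointKernel

/-! ### Removal of the exceptional points and of infinity -/

/-- The cutoff that vanishes near the points of `s` and far away. -/
def puncturedHat (s : Finset ℂ) (T δ : ℝ) (z : ℂ) : ℝ := hat 0 T z * ∏ p ∈ s, (1 - hat p δ z)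

/-- The function `|z - p|^(-1/2)` on the disc of radius `3T`. -/
def localPower (T : ℝ) (p z : ℂ) : ℝ :=
  {z : ℂ | ‖z‖ ≤ 3 * T}.indicator (fun z => ‖z - p‖ ^ (-(1 / 2) : ℝ)) z

lemma localPower_nonneg (T : ℝ) (p z : ℂ) : 0 ≤ localPower T p z :=
  indicator_nonneg (fun _ _ => by positivity) z

lemma one_sub_hat_mem (p : ℂ) (δ : ℝ) (z : ℂ) : 0 ≤ 1 - hat p δ z ∧ 1 - hat p δ z ≤ 1 :=
  ⟨sub_nonneg.2 (hat_le_one p δ z), sub_le_self _ (hat_nonneg p δ z)⟩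

lemma abs_puncturedHat_le_one (s : Finset ℂ) (T δ : ℝ) (z : ℂ) : |puncturedHat s T δ z| ≤ 1 := by
  have h1 := prod_nonneg fun p (_ : p ∈ s) => (one_sub_hat_mem p δ z).1
  have h2 := prod_le_one (fun p (_ : p ∈ s) => (one_sub_hat_mem p δ z).1)
    fun p _ => (one_sub_hat_mem p δ z).2
  rw [puncturedHat, abs_of_nonneg (mul_nonneg (hat_nonneg _ _ _) h1)]
  exact mul_le_one₀ (hat_le_one _ _ _) h1 h2

lemma isCutoff_puncturedHat (s : Finset ℂ) {T δ : ℝ} (hT : 0 < T) (hδ : 0 < δ) :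
    IsCutoff (puncturedHat s T δ) :=
  (isCutoff_hat hT).mul (IsCutoff.prod s fun p => (isCutoff_hat hδ).one_sub)

/-- The bound does not depend on δ, thanks to the scale invariant estimate for each removed point.
The radius 3T enters as follows: the outer cutoff lives in the disc of radius 2T, so a pair with one
point there and the other beyond 3T is more than T apart, and the trivial bound by 1 suffices. -/
lemma abs_puncturedHat_sub_le (s : Finset ℂ) {T δ : ℝ} (hT : 0 < T) (hδ : 0 < δ) {l k : ℂ}
    (hl : l ∉ s) (hk : k ∉ s) : |puncturedHat s T δ l - puncturedHat s T δ k| ≤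
      ‖l - k‖ * (2 / T + 4 * ∑ p ∈ s, localPower T p l * localPower T p k) := by
  set η : ℂ → ℝ := fun z => ∏ p ∈ s, (1 - hat p δ z) with hη
  have hη0 : ∀ z, 0 ≤ η z := fun z => prod_nonneg fun p _ => (one_sub_hat_mem p δ z).1
  have hη1 : ∀ z, η z ≤ 1 := fun z => prod_le_one (fun p _ => (one_sub_hat_mem p δ z).1)
    fun p _ => (one_sub_hat_mem p δ z).2
  have hS : 0 ≤ ∑ p ∈ s, localPower T p l * localPower T p k := sum_nonneg fun p _ =>
    mul_nonneg (localPower_nonneg _ _ _) (localPower_nonneg _ _ _)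
  have e : puncturedHat s T δ l - puncturedHat s T δ k =
      (hat 0 T l - hat 0 T k) * η l + hat 0 T k * (η l - η k) := by
    simp [puncturedHat, hη]; ring
  have h1 : |(hat 0 T l - hat 0 T k) * η l| ≤ ‖l - k‖ * (1 / T) := by
    rw [abs_mul, abs_of_nonneg (hη0 l)]
    refine (mul_le_of_le_one_right (abs_nonneg _) (hη1 l)).trans ?_; grind [abs_hat_sub_le_norm]
  have h2 : |hat 0 T k * (η l - η k)| ≤
      ‖l - k‖ * (1 / T + 4 * ∑ p ∈ s, localPower T p l * localPower T p k) := by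
    rw [abs_mul, abs_of_nonneg (hat_nonneg _ _ _)]; by_cases hkT : 2 * T ≤ ‖k‖
    · rw [hat_eq_zero hT (by simpa using hkT), zero_mul]
      positivity
    · refine (mul_le_of_le_one_left (abs_nonneg _) (hat_le_one _ _ _)).trans ?_
      by_cases hlT : ‖l‖ ≤ 3 * T
      · have h3 := abs_prod_sub_prod_le s (fun p => 1 - hat p δ l) (fun p => 1 - hat p δ k)
          (fun p => one_sub_hat_mem p δ l) (fun p => one_sub_hat_mem p δ k)
        have h4 : ∑ p ∈ s, |1 - hat p δ l - (1 - hat p δ k)| ≤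
            ∑ p ∈ s, 4 * ‖l - k‖ * (localPower T p l * localPower T p k) := by
          refine sum_le_sum fun p hp => ?_; rw [sub_sub_sub_cancel_left, abs_sub_comm]
          have hl' : l ∈ {z : ℂ | ‖z‖ ≤ 3 * T} := hlT
          rw [localPower, localPower, indicator_of_mem hl', indicator_of_mem (by grind)]
          exact abs_hat_sub_le_rpow hδ (fun he => hl (he ▸ hp)) fun he => hk (he ▸ hp)
        refine (h3.trans h4).trans ?_; rw [← mul_sum, mul_add]; grind
      · have h3 : |η l - η k| ≤ 1 := by
          rw [abs_le]
          constructor <;> linarith [hη0 l, hη1 l, hη0 k, hη1 k]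
        have h5 : 1 ≤ ‖l - k‖ * (1 / T) := by
          rw [mul_one_div]; exact (one_le_div hT).2 (by linarith [norm_sub_norm_le l k])
        have : 0 ≤ ‖l - k‖ * (4 * ∑ p ∈ s, localPower T p l * localPower T p k) := by positivity
        linarith
  grind

lemma tendsto_puncturedHat (s : Finset ℂ) {T : ℝ} {z : ℂ} (hz : z ∉ s) :
    Tendsto (fun δ => puncturedHat s T δ z) (𝓝[>] 0) (𝓝 (hat 0 T z)) := by
  have h1 : ∀ p ∈ s, Tendsto (fun δ => 1 - hat p δ z) (𝓝[>] 0) (𝓝 1) := by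
    intro p hp; have hpos : 0 < ‖z - p‖ := norm_pos_iff.2 (sub_ne_zero.2 fun he => hz (he ▸ hp))
    refine tendsto_const_nhds.congr' ?_
    have : Set.Ioo (0 : ℝ) (‖z - p‖ / 2) ∈ 𝓝[>] (0 : ℝ) := Ioo_mem_nhdsGT (half_pos hpos)
    filter_upwards [this] with δ hδ; grind [hat_eq_zero]
  have h2 := (tendsto_finsetProd s h1).const_mul (hat 0 T z); aesop

namespace TwoPointKernel
variable {C : Contour} {U : Set ℂ} {X0 : Set C.Param} {b : C.Param → ℝ} {m : ℂ → ℂ → ℂ}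
  {Ψ : C.Param → ℂ}

lemma aestronglyMeasurable_commutatorKernel (h : TwoPointKernel C U X0 b m) {χ : ℂ → ℝ}
    (hχ : Measurable χ) : AEStronglyMeasurable (commutatorKernel C χ m) (Cᵐ.prod Cᵐ) :=
  h.aestronglyMeasurable_prod (g := fun w : ℂ × ℂ => ((χ w.1 - χ w.2 : ℝ) : ℂ) *
    (m w.1 w.2 / (w.1 - w.2))) ((Complex.measurable_ofReal.comp ((hχ.comp measurable_fst).sub
      (hχ.comp measurable_snd))).mul (h.measurable.div (measurable_fst.sub measurable_snd)))

lemma norm_commutatorKernel_le {χ : ℂ → ℝ} {q : C.Param × C.Param} {B : ℝ}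
    (hne : C.pt q.1 ≠ C.pt q.2)
    (hB : |χ (C.pt q.1) - χ (C.pt q.2)| ≤ ‖C.pt q.1 - C.pt q.2‖ * B) :
    ‖commutatorKernel C χ m q‖ ≤ B * (‖m (C.pt q.1) (C.pt q.2)‖ * (‖C.vel q.1‖ * ‖C.vel q.2‖)) := by
  have e : ‖commutatorKernel C χ m q‖ = |χ (C.pt q.1) - χ (C.pt q.2)| *
      (‖m (C.pt q.1) (C.pt q.2)‖ / ‖C.pt q.1 - C.pt q.2‖) * (‖C.vel q.1‖ * ‖C.vel q.2‖) := by
    rw [commutatorKernel, norm_mul, norm_mul, norm_mul, norm_div, norm_real, norm_eq_abs]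
  rw [e, ← mul_assoc B]; refine mul_le_mul_of_nonneg_right ?_ (by positivity)
  rw [mul_div_assoc', div_le_iff₀ (norm_pos_iff.2 (sub_ne_zero.2 hne))]
  calc _ ≤ ‖C.pt q.1 - C.pt q.2‖ * B * ‖m (C.pt q.1) (C.pt q.2)‖ := by gcongr
    _ = _ := by ring

lemma integrable_localPower (T : ℝ) (p : ℂ) :
    Integrable (fun x => localPower T p (C.pt x) * ‖C.vel x‖) Cᵐ := by
  refine ((C.integrableOn_vel_mul_rpow p (3 * T)).integrable_indicator₀
    (C.nullMeasurableSet_norm_le _)).congr (ae_of_all _ fun x => ?_)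
  by_cases hx : ‖C.pt x‖ ≤ 3 * T
  · have h1 : C.pt x ∈ {z : ℂ | ‖z‖ ≤ 3 * T} := hx; have h2 : x ∈ {x | ‖C.pt x‖ ≤ 3 * T} := hx
    simp [localPower]; grind [indicator_of_mem]
  · simp [localPower]; simp_all

/-- A majorant of the commutators with all `puncturedHat`s of given outer radius. -/
lemma exists_majorant (h : TwoPointKernel C U X0 b m) (s : Finset ℂ) {T : ℝ} (hT : 0 < T) :
    ∃ Q : C.Param × C.Param → ℝ, Integrable Q (Cᵐ.prod Cᵐ) ∧ ∀ δ > 0, ∀ᵐ q ∂Cᵐ.prod Cᵐ,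
        ‖commutatorKernel C (puncturedHat s T δ) m q‖ ≤ Q q := by
  obtain ⟨M, hM0, hM⟩ := h.bound
  obtain ⟨M', hM'0, hM'⟩ := h.local_bound (C.carrier ∩ closedBall 0 (3 * T))
    ((isCompact_closedBall _ _).inter_left C.isClosed_carrier)
    (Set.inter_subset_left.trans h.carrier_subset)
  -- The outer cutoff is controlled by the global bound b(x)b(y) of m. For the inner ones the local
  -- powers confine both points to the disc of radius 3T, where m is bounded and |λ - p|^(-1/2) is
  -- integrable.
  refine ⟨fun q => 2 / T * M * ((b q.1 * ‖C.vel q.1‖) * (b q.2 * ‖C.vel q.2‖)) +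
    4 * M' * ∑ p ∈ s, (localPower T p (C.pt q.1) * ‖C.vel q.1‖) *
      (localPower T p (C.pt q.2) * ‖C.vel q.2‖), ?_, fun δ hδ => ?_⟩
  · exact ((h.integrable.mul_prod h.integrable).const_mul _).add ((integrable_finsetSum _ fun p _ =>
        (integrable_localPower T p).mul_prod (integrable_localPower T p)).const_mul _)
  · have hs : ∀ᵐ x ∂Cᵐ, C.pt x ∉ s := by
      have := (ae_ball_iff s.countable_toSet).2 fun p _ => C.ae_pt_ne p; grind
    filter_upwards [C.ae_prod_ne h.measurableSet h.regular h.ae_mem,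
      Measure.quasiMeasurePreserving_fst.ae hs, Measure.quasiMeasurePreserving_snd.ae hs]
      with q hq h1 h2
    refine (norm_commutatorKernel_le hq.2.2 (abs_puncturedHat_sub_le s hT hδ h1 h2)).trans ?_
    rw [add_mul]; refine add_le_add ?_ ?_
    · calc _ ≤ 2 / T * (M * (b q.1 * b q.2) * (‖C.vel q.1‖ * ‖C.vel q.2‖)) := by
            bound
        _ = _ := by ring
    · rw [mul_assoc, mul_assoc 4 M', mul_sum, sum_mul]
      refine mul_le_mul_of_nonneg_left (sum_le_sum fun p _ => ?_) (by norm_num)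
      by_cases hb : ‖C.pt q.1‖ ≤ 3 * T ∧ ‖C.pt q.2‖ ≤ 3 * T
      · have hmem : ∀ x ∈ X0, ‖C.pt x‖ ≤ 3 * T →
            C.pt x ∈ C.carrier ∩ closedBall 0 (3 * T) := fun x hx hxT =>
          ⟨C.pt_mem_carrier (C.regularParams_subset (h.regular hx)), mem_closedBall_zero_iff.2 hxT⟩
        have h3 := hM' _ (hmem _ hq.1 hb.1) _ (hmem _ hq.2.1 hb.2)
        have n1 := localPower_nonneg T p (C.pt q.1); have n2 := localPower_nonneg T p (C.pt q.2)
        calc _ ≤ localPower T p (C.pt q.1) * localPower T p (C.pt q.2) *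
              (M' * (‖C.vel q.1‖ * ‖C.vel q.2‖)) := by gcongr
          _ = _ := by ring
      · have h0 : localPower T p (C.pt q.1) * localPower T p (C.pt q.2) = 0 := by
          rw [not_and_or] at hb; rcases hb with hb | hb
          · rw [localPower, indicator_of_notMem (by exact hb), zero_mul]
          · rw [mul_comm, localPower, indicator_of_notMem (by exact hb), zero_mul]
        rw [h0, zero_mul]; have n1 := localPower_nonneg T p (C.pt q.1)
        have n2 := localPower_nonneg T p (C.pt q.2); positivity

/-- The formula holds for the punctured cutoffs; letting δ tend to 0 is justified by a majorant
independent of δ. Corners and endpoints therefore leave no contribution. -/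
lemma integral_hat_eq (h : TwoPointKernel C U X0 b m) (hΨ : Integrable (fun x => Ψ x * C.vel x) Cᵐ)
    (hloc : HasBoundaryDifference C X0 m Ψ) {T : ℝ} (hT : 0 < T) :
    ∫ x, hat 0 T (C.pt x) * (Ψ x * C.vel x) ∂Cᵐ =
      -∫ q, commutatorKernel C (hat 0 T) m q ∂Cᵐ.prod Cᵐ := by
  set s := (C.finite_exceptional_inter (2 * T)).toFinset with hs
  have hgood : ∀ δ > 0, HasCommutator C m Ψ (puncturedHat s T δ) := by
    intro δ hδ
    refine h.hasCommutator_of_vanish hΨ hloc (isCutoff_puncturedHat s hT hδ) (R := 2 * T)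
      (fun z hz => ?_) fun p hp => ?_
    · rw [puncturedHat, hat_eq_zero hT (by simpa using hz), zero_mul]
    · by_cases hpT : ‖p‖ ≤ 2 * T
      · have hps : p ∈ s := by simp_all
        refine ⟨δ, hδ, fun z hz => ?_⟩; rw [mem_ball_iff_norm] at hz
        rw [puncturedHat, prod_eq_zero hps (by rw [hat_eq_one hδ hz.le, sub_self]), mul_zero]
      · refine ⟨‖p‖ - 2 * T, by linarith, fun z hz => ?_⟩
        rw [mem_ball_iff_norm, norm_sub_rev] at hz; have := norm_sub_norm_le p z
        rw [puncturedHat, hat_eq_zero hT (by rw [sub_zero]; linarith), zero_mul]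
  have hsne : ∀ᵐ x ∂Cᵐ, C.pt x ∉ s := by
    have := (ae_ball_iff s.countable_toSet).2 fun p _ => C.ae_pt_ne p; grind
  obtain ⟨Q, hQ, hQb⟩ := h.exists_majorant s hT
  have hpos : ∀ᶠ δ : ℝ in 𝓝[>] 0, 0 < δ := self_mem_nhdsWithin
  have t1 : Tendsto (fun δ => ∫ q, commutatorKernel C (puncturedHat s T δ) m q ∂Cᵐ.prod Cᵐ) (𝓝[>] 0)
      (𝓝 (∫ q, commutatorKernel C (hat 0 T) m q ∂Cᵐ.prod Cᵐ)) := by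
    refine tendsto_integral_filter_of_dominated_convergence Q ?_ (hpos.mono hQb) hQ ?_
    · grind [Eventually.mono, aestronglyMeasurable_commutatorKernel, IsCutoff.measurable, isCutoff_puncturedHat]
    · filter_upwards [Measure.quasiMeasurePreserving_fst.ae hsne,
        Measure.quasiMeasurePreserving_snd.ae hsne] with q h1 h2
      have h3 := (tendsto_puncturedHat s (T := T) h1).sub (tendsto_puncturedHat s (T := T) h2)
      exact (((Complex.continuous_ofReal.tendsto _).comp h3).mul_const _).mul_const _
  have t2 : Tendsto (fun δ => ∫ x, puncturedHat s T δ (C.pt x) * (Ψ x * C.vel x) ∂Cᵐ)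
      (𝓝[>] 0) (𝓝 (∫ x, hat 0 T (C.pt x) * (Ψ x * C.vel x) ∂Cᵐ)) := by
    refine tendsto_integral_filter_of_dominated_convergence (fun x => ‖Ψ x * C.vel x‖) ?_ ?_
      hΨ.norm ?_
    · exact hpos.mono fun δ hδ =>
        (integrable_cutoff_mul hΨ (isCutoff_puncturedHat s hT hδ)).aestronglyMeasurable
    · grind [Eventually.of_forall, norm_mul, norm_real, norm_eq_abs, mul_le_of_le_one_left, abs_puncturedHat_le_one]
    · filter_upwards [hsne] with x hx
      exact ((Complex.continuous_ofReal.tendsto _).comp (tendsto_puncturedHat s hx)).mul_const _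
  refine tendsto_nhds_unique t2 (t1.neg.congr' ?_); filter_upwards [hpos] with δ hδ
  exact (hgood δ hδ).2.symm

/-- If the boundary values of the two transforms of a two-point kernel differ by an integrable
function, then the integral of this function is zero. -/
theorem integral_eq_zero (h : TwoPointKernel C U X0 b m)
    (hΨ : Integrable (fun x => Ψ x * C.vel x) Cᵐ)
    (hloc : HasBoundaryDifference C X0 m Ψ) : ∫ x, Ψ x * C.vel x ∂Cᵐ = 0 := by
  obtain ⟨M, hM0, hM⟩ := h.bound; set A := ∫ q, M * ((b q.1 * ‖C.vel q.1‖) * (b q.2 * ‖C.vel q.2‖))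
    ∂Cᵐ.prod Cᵐ
  -- The cutoff has Lipschitz constant 1/T, which cancels the denominator of the commutator and
  -- leaves T⁻¹ times a fixed integral.
  have hle : ∀ T : ℝ, 0 < T → ‖∫ x, hat 0 T (C.pt x) * (Ψ x * C.vel x) ∂Cᵐ‖ ≤ T⁻¹ * A := by
    intro T hT; rw [h.integral_hat_eq hΨ hloc hT, norm_neg, ← integral_const_mul]
    refine norm_integral_le_of_norm_le (((h.integrable.mul_prod h.integrable).const_mul M).const_mul
      _) ?_
    filter_upwards [C.ae_prod_ne h.measurableSet h.regular h.ae_mem] with q hq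
    refine (norm_commutatorKernel_le hq.2.2 (B := T⁻¹) ?_).trans ?_
    · exact abs_hat_sub_le_norm hT _ _
    · calc _ ≤ T⁻¹ * (M * (b q.1 * b q.2) * (‖C.vel q.1‖ * ‖C.vel q.2‖)) := by
            bound
        _ = _ := by ring
  have t1 : Tendsto (fun T : ℝ => ∫ x, hat 0 T (C.pt x) * (Ψ x * C.vel x) ∂Cᵐ) atTop (𝓝 0) := by
    refine squeeze_zero_norm' (a := fun T : ℝ => T⁻¹ * A) ?_ ?_
    · filter_upwards [eventually_gt_atTop 0] with T hT using hle T hT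
    · simpa using tendsto_inv_atTop_zero.mul_const A
  have t2 : Tendsto (fun T : ℝ => ∫ x, hat 0 T (C.pt x) * (Ψ x * C.vel x) ∂Cᵐ) atTop
      (𝓝 (∫ x, Ψ x * C.vel x ∂Cᵐ)) := by
    refine tendsto_integral_filter_of_dominated_convergence (fun x => ‖Ψ x * C.vel x‖) ?_ ?_
      hΨ.norm ?_
    · filter_upwards [eventually_gt_atTop 0] with T hT
      exact (integrable_cutoff_mul hΨ (isCutoff_hat hT)).aestronglyMeasurable
    · grind [Eventually.of_forall, norm_mul, norm_real, norm_of_nonneg, hat_nonneg, mul_le_of_le_one_left, hat_le_one]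
    · refine ae_of_all _ fun x => tendsto_const_nhds.congr' ?_
      filter_upwards [eventually_gt_atTop 0, eventually_ge_atTop ‖C.pt x‖] with T hT hxT
      simp_all [hat_eq_one]
  exact tendsto_nhds_unique t2 t1

end TwoPointKernel

/-! ### Boundary values from the two sides of a regular point -/

namespace Contour
variable {C : Contour} {j : Fin C.n} {t0 : ℝ}

lemma IsChart.isOpen_image {η : ℝ} (h : C.IsChart j t0 η) {S : Set ℂ} (hS : IsOpen S)
    (hsub : S ⊆ square t0 η) : IsOpen (C.straighten j t0 '' S) := by
  rw [isOpen_iff_mem_nhds]; rintro _ ⟨w, hw, rfl⟩; rw [← h.map_nhds (hsub hw).1]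
  exact image_mem_map (hS.mem_nhds hw)

lemma isOpen_im_pos : IsOpen {w : ℂ | 0 < w.im} := isOpen_lt continuous_const continuous_im

lemma isOpen_im_neg : IsOpen {w : ℂ | w.im < 0} := isOpen_lt continuous_im continuous_const

/-- Holomorphic functions on the right and on the left of the contour which have the same boundary
values are restrictions of one holomorphic function. -/
lemma exists_two_sided_extension (ht : t0 ∈ C.regular j) {V : Set ℂ} (hV : IsOpen V)
    (hmem : C.γ j t0 ∈ V) {φ1 φ2 : ℂ → ℂ} (h₁ : DifferentiableOn ℂ φ1 (V \ C.carrier))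
    (h₂ : DifferentiableOn ℂ φ2 (V \ C.carrier))
    (hlim : ∀ᶠ t in 𝓝 t0, ∃ l, Tendsto φ2 (C.leftNhds (j, t)) (𝓝 l) ∧
      Tendsto φ1 (C.rightNhds (j, t)) (𝓝 l)) :
    ∃ (W : Set ℂ) (H : ℂ → ℂ), IsOpen W ∧ C.γ j t0 ∈ W ∧ W ⊆ V ∧ DifferentiableOn ℂ H W ∧
      (∀ᶠ z in C.rightNhds (j, t0), φ1 z = H z) ∧ ∀ᶠ z in C.leftNhds (j, t0), φ2 z = H z := by
  classical
  obtain ⟨η, hη, hch⟩ := exists_isChart ht; have h := hch η hη le_rfl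
  set Θ := C.straighten j t0 with hΘ; set L := Θ '' (square t0 η ∩ {w | 0 < w.im})
  set R := Θ '' (square t0 η ∩ {w | w.im < 0})
  -- The two functions are glued along the contour inside a chart, and the Morera extension is
  -- applied to the result.
  set φ : ℂ → ℂ := fun z => if z ∈ L then φ2 z else φ1 z
  have hL : IsOpen L := h.isOpen_image ((isOpen_square t0 η).inter isOpen_im_pos)
    Set.inter_subset_left
  have hR : IsOpen R := h.isOpen_image ((isOpen_square t0 η).inter isOpen_im_neg)
    Set.inter_subset_left
  have eL : EqOn φ φ2 L := fun z hz => if_pos hz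
  have eR : EqOn φ φ1 R := by
    rintro _ ⟨w, hw, rfl⟩; refine if_neg ?_; rintro ⟨w', hw', he⟩
    have := h.injOn hw'.1.1.le hw.1.1.le he; grind
  have hO : IsOpen (Θ '' square t0 η) := h.isOpen_image (isOpen_square t0 η) subset_rfl
  have hmem' : C.γ j t0 ∈ V ∩ Θ '' square t0 η :=
    ⟨hmem, t0, ofReal_mem_square (by simpa using hη), C.straighten_ofReal j t0 t0⟩
  obtain ⟨W, H, hW, hW0, hWV, hH, he⟩ := exists_holomorphic_extension (φ := φ) ht (hV.inter hO) hmem'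
    (by
      rintro z ⟨⟨hzV, w, hw, rfl⟩, hzC⟩
      have hVC := (hV.sdiff C.isClosed_carrier).mem_nhds ⟨hzV, hzC⟩
      rcases lt_trichotomy w.im 0 with him | him | him
      · exact (((h₁.differentiableAt hVC).congr_of_eventuallyEq
          (eR.eventuallyEq_of_mem (hR.mem_nhds ⟨w, ⟨hw, him⟩, rfl⟩)))).differentiableWithinAt
      · exact absurd ((h.mem_carrier_iff hw.1.le hw.2.le).2 him) hzC
      · exact (((h₂.differentiableAt hVC).congr_of_eventuallyEq
          (eL.eventuallyEq_of_mem (hL.mem_nhds ⟨w, ⟨hw, him⟩, rfl⟩)))).differentiableWithinAt)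
    (by
      filter_upwards [hlim, ball_mem_nhds t0 hη] with u ⟨l, hl, hr⟩ hu
      have hsq := (isOpen_square t0 η).mem_nhds (ofReal_mem_square hu)
      refine ⟨l, (hl.comp (h.tendsto_left hu)).congr' ?_, (hr.comp (h.tendsto_right hu)).congr' ?_⟩
      · filter_upwards [nhdsWithin_le_nhds hsq, self_mem_nhdsWithin] with w hw him; grind
      · filter_upwards [nhdsWithin_le_nhds hsq, self_mem_nhdsWithin] with w hw him
        exact (eR ⟨w, ⟨hw, him⟩, rfl⟩).symm)
  have hWn := hW.mem_nhds hW0; have hsq := square_mem_nhds (t0 := t0) hη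
  refine ⟨W, H, hW, hW0, hWV.trans Set.inter_subset_left, hH, ?_, ?_⟩
  · have hRn : R ∈ C.rightNhds (j, t0) := by
      rw [rightNhds_eq]
      exact image_mem_map (inter_mem (nhdsWithin_le_nhds hsq) self_mem_nhdsWithin)
    filter_upwards [hRn, rightNhds_le ht (nhdsWithin_le_nhds hWn),
      rightNhds_le ht self_mem_nhdsWithin] with z hz hzW hzC
    rw [← eR hz, he ⟨hzW, hzC⟩]
  · have hLn : L ∈ C.leftNhds (j, t0) := by
      rw [leftNhds_eq]; exact image_mem_map (inter_mem (nhdsWithin_le_nhds hsq) self_mem_nhdsWithin)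
    filter_upwards [hLn, leftNhds_le ht (nhdsWithin_le_nhds hWn),
      leftNhds_le ht self_mem_nhdsWithin] with z hz hzW hzC
    rw [← eL hz, he ⟨hzW, hzC⟩]

/-- A half-neighbourhood is open off the contour, so an identity valid on one side holds near each
of its points and may be differentiated. -/
lemma eventually_eventually_side (ht : t0 ∈ C.regular j) {S : Set ℂ} (hS : IsOpen S) {P : ℂ → Prop}
    (hP : ∀ᶠ z in map (C.straighten j t0) (𝓝[S] (t0 : ℂ)), P z) :
    ∀ᶠ z in map (C.straighten j t0) (𝓝[S] (t0 : ℂ)), ∀ᶠ w in 𝓝 z, P w := by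
  obtain ⟨η, hη, hch⟩ := exists_isChart ht; rw [eventually_map] at hP ⊢
  filter_upwards [eventually_eventually_nhdsWithin.2 hP, self_mem_nhdsWithin,
    nhdsWithin_le_nhds (square_mem_nhds hη)] with w hw hwS hsq
  rw [hS.nhdsWithin_eq hwS] at hw; rwa [← (hch η hη le_rfl).map_nhds hsq.1, eventually_map]

lemma eventually_eventually_right (ht : t0 ∈ C.regular j) {P : ℂ → Prop}
    (hP : ∀ᶠ z in C.rightNhds (j, t0), P z) : ∀ᶠ z in C.rightNhds (j, t0), ∀ᶠ w in 𝓝 z, P w := by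
  grind [rightNhds_eq, eventually_eventually_side, isOpen_im_neg]

lemma eventually_eventually_left (ht : t0 ∈ C.regular j) {P : ℂ → Prop}
    (hP : ∀ᶠ z in C.leftNhds (j, t0), P z) : ∀ᶠ z in C.leftNhds (j, t0), ∀ᶠ w in 𝓝 z, P w := by
  grind [leftNhds_eq, eventually_eventually_side, isOpen_im_pos]

/-- Continuous extensions of two functions from the two sides take the boundary values. -/
lemma exists_nhds_boundary_values (ht : t0 ∈ C.regular j) {W : Set ℂ} (hW : IsOpen W)
    (hmem : C.γ j t0 ∈ W) {e₁ e₂ T1 T2 : ℂ → ℂ} (he1 : ContinuousOn e₁ W) (he2 : ContinuousOn e₂ W)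
    (h₁ : ∀ᶠ z in C.rightNhds (j, t0), T1 z = e₁ z)
    (h₂ : ∀ᶠ z in C.leftNhds (j, t0), T2 z = e₂ z) :
    ∃ W' ∈ 𝓝 (C.γ j t0), W' ⊆ W ∧ ∀ x ∈ C.params, C.pt x ∈ W' → ∀ a b,
      Tendsto T1 (C.rightNhds x) (𝓝 a) → Tendsto T2 (C.leftNhds x) (𝓝 b) →
      e₁ (C.pt x) = a ∧ e₂ (C.pt x) = b := by
  obtain ⟨η, hη, hch⟩ := exists_isChart ht; have hb := hch η hη le_rfl
  rw [rightNhds_eq, eventually_map, eventually_nhdsWithin_iff] at h₁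
  rw [leftNhds_eq, eventually_map, eventually_nhdsWithin_iff] at h₂
  obtain ⟨S, hS, hSo, hS0⟩ := _root_.eventually_nhds_iff.1 (h₁.and h₂)
  refine ⟨W ∩ C.straighten j t0 '' (S ∩ square t0 η), inter_mem (hW.mem_nhds hmem)
    ((hb.isOpen_image (hSo.inter (isOpen_square t0 η)) Set.inter_subset_right).mem_nhds ⟨t0, ⟨hS0,
      ofReal_mem_square (by simpa using hη)⟩, C.straighten_ofReal j t0 t0⟩), Set.inter_subset_left,
    ?_⟩
  rintro ⟨k, u⟩ hx ⟨hxW, w, hw, he⟩ a b ha hb'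
  obtain ⟨rfl, rfl⟩ := hb.sep k u hx w hw.2.1.le hw.2.2.le he.symm
  have hu : |u - t0| < η := by simpa using hw.2.1
  have hΘ : Tendsto (C.straighten k t0) (𝓝 (u : ℂ)) (𝓝 (C.γ k u)) := by
    have := (hb.continuousAt (w := (u : ℂ)) (by simpa using hu)).tendsto
    simp_all
  have hWn : W ∈ 𝓝 (C.γ k u) := hW.mem_nhds hxW
  have n₁ : (𝓝[{w : ℂ | w.im < 0}] (u : ℂ)).NeBot := by
    have : (C.rightNhds (k, u)).NeBot := inferInstance; grind [NeBot.of_map, rightNhds_eq]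
  have n₂ : (𝓝[{w : ℂ | 0 < w.im}] (u : ℂ)).NeBot := by
    have : (C.leftNhds (k, u)).NeBot := inferInstance; grind [NeBot.of_map, leftNhds_eq]
  constructor
  · refine tendsto_nhds_unique (((he1.continuousAt hWn).tendsto.comp hΘ).mono_left
      nhdsWithin_le_nhds) ((ha.comp (hb.tendsto_right hu)).congr' ?_)
    filter_upwards [nhdsWithin_le_nhds (hSo.mem_nhds hw.1), self_mem_nhdsWithin] with v hv him
    exact (hS v hv).1 him
  · refine tendsto_nhds_unique (((he2.continuousAt hWn).tendsto.comp hΘ).mono_left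
      nhdsWithin_le_nhds) ((hb'.comp (hb.tendsto_left hu)).congr' ?_)
    filter_upwards [nhdsWithin_le_nhds (hSo.mem_nhds hw.1), self_mem_nhdsWithin] with v hv him
    exact (hS v hv).2 him

end Contour

/-! ### The two-point kernel and the pairing of a dressed pair -/

variable {C : Contour} {r : ℕ} {U : Set ℂ} {f g F G : ℂ → Fin r → ℂ} {X0 : Set C.Param}
  {a : C.Param → ℝ} {Γ : ℂ → Matrix (Fin r) (Fin r) ℂ} {B : ℝ}

lemma IsDressing.hasDerivAt (h : IsDressing C U f g X0 a Γ F B) {z : ℂ} (hz : z ∉ C.carrier)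
    (i k : Fin r) :
    Integrable (fun x => -(F (C.pt x) i * g (C.pt x) k * C.vel x / (z - C.pt x) ^ 2)) Cᵐ ∧
    HasDerivAt (fun z => Γ z i k)
      (∫ x, -(F (C.pt x) i * g (C.pt x) k * C.vel x / (z - C.pt x) ^ 2) ∂Cᵐ) z := by
  obtain ⟨h1, h2⟩ := C.hasDerivAt_cauchyTransform_off (h.integrable i k) hz
  refine ⟨h1, (h2.const_add ((1 : Matrix (Fin r) (Fin r) ℂ) i k)).congr_of_eventuallyEq ?_⟩
  filter_upwards [C.isClosed_carrier.isOpen_compl.mem_nhds hz] with w hw using h.cauchy w hw i k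

lemma dotProduct_mulVec_eq_sum (u v : Fin r → ℂ) (A : Matrix (Fin r) (Fin r) ℂ) :
    u ⬝ᵥ A *ᵥ v = ∑ i, ∑ k, u i * v k * A i k := by
  simp [dotProduct, mulVec, mul_sum]; grind

/-- The derivative of a dressing matrix as a bilinear form. -/
lemma IsDressing.integral_eq (h : IsDressing C U f g X0 a Γ F B) {z : ℂ} (hz : z ∉ C.carrier)
    (u v : Fin r → ℂ) :
    Integrable (fun x => -((u ⬝ᵥ F (C.pt x)) * (v ⬝ᵥ g (C.pt x)) * C.vel x / (z - C.pt x) ^ 2)) Cᵐ ∧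
    ∫ x, -((u ⬝ᵥ F (C.pt x)) * (v ⬝ᵥ g (C.pt x)) * C.vel x / (z - C.pt x) ^ 2) ∂Cᵐ =
      u ⬝ᵥ matrixDeriv Γ z *ᵥ v := by
  have e : ∀ x, -((u ⬝ᵥ F (C.pt x)) * (v ⬝ᵥ g (C.pt x)) * C.vel x / (z - C.pt x) ^ 2) =
      ∑ i, ∑ k, u i * v k * -(F (C.pt x) i * g (C.pt x) k * C.vel x / (z - C.pt x) ^ 2) := by
    intro x; simp [dotProduct, sum_mul, mul_sum, sum_div, ← sum_neg_distrib]; rw [Finset.sum_comm]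
    grind
  have hi := fun i k => ((h.hasDerivAt hz i k).1.const_mul (u i * v k)); simp only [e]
  refine ⟨integrable_finsetSum _ fun i _ => integrable_finsetSum _ fun k _ => hi i k, ?_⟩
  rw [integral_finsetSum _ fun i _ => integrable_finsetSum _ fun k _ => hi i k,
    dotProduct_mulVec_eq_sum]
  refine Finset.sum_congr rfl fun i _ => ?_; rw [integral_finsetSum _ fun k _ => hi i k]
  refine Finset.sum_congr rfl fun k _ => ?_
  rw [integral_const_mul, matrixDeriv, of_apply, (h.hasDerivAt hz i k).2.deriv]

lemma integrableKernel_indicator (hU : IsOpen U) {w z : ℂ} (hw : w ∈ U) (hz : z ∈ U) :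
    integrableKernel (U.indicator F) (U.indicator G) w z = integrableKernel F G w z := by
  have h1 : deriv (U.indicator F) w = deriv F w :=
    ((eqOn_indicator (f := F)).eventuallyEq_of_mem (hU.mem_nhds hw)).deriv_eq
  simp [integrableKernel, h1, indicator_of_mem hw, indicator_of_mem hz]

lemma measurable_indicator_of_isOpen (hU : IsOpen U) (hF : DifferentiableOn ℂ F U) :
    Measurable (U.indicator F) := by
  classical
  exact hF.continuousOn.measurable_piecewise continuousOn_const hU.measurableSet

lemma measurable_integrableKernel (hF : Measurable F) (hG : Measurable G) :
    Measurable (Function.uncurry (integrableKernel F G)) := by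
  classical
  refine Measurable.ite (measurableSet_eq_fun measurable_fst measurable_snd)
    (measurable_dotProduct ((measurable_deriv F).comp measurable_fst) (hG.comp measurable_fst))
    ((measurable_dotProduct (hF.comp measurable_fst) (hG.comp measurable_snd)).div
      (measurable_fst.sub measurable_snd))

/-- The two-point kernel `-(fᵀ(z) h(w)) K_{FG}(w, z)`, truncated outside `U`. -/
def dressedTwoPoint (U : Set ℂ) (f e F G : ℂ → Fin r → ℂ) (z w : ℂ) : ℂ :=
  -(U.indicator f z ⬝ᵥ U.indicator e w) * integrableKernel (U.indicator F) (U.indicator G) w z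

lemma dressedTwoPoint_eq (hU : IsOpen U) {e : ℂ → Fin r → ℂ} {z w : ℂ} (hz : z ∈ U) (hw : w ∈ U) :
    dressedTwoPoint U f e F G z w = -(f z ⬝ᵥ e w) * integrableKernel F G w z := by
  rw [dressedTwoPoint, integrableKernel_indicator hU hw hz, indicator_of_mem hz,
    indicator_of_mem hw]

lemma norm_neg_dotProduct_mul_le {u v : Fin r → ℂ} {k : ℂ} {c₁ c₂ c₃ : ℝ} (h₁ : ‖u‖ ≤ c₁)
    (h₂ : ‖v‖ ≤ c₂) (h₃ : ‖k‖ ≤ c₃) : ‖-(u ⬝ᵥ v) * k‖ ≤ r * c₁ * c₂ * c₃ := by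
  have n₁ := (norm_nonneg u).trans h₁; rw [norm_mul, norm_neg]
  grind [mul_le_mul, LE.le.trans, norm_dotProduct_le, mul_nonneg]

namespace IsDressedPair

lemma kernel_swap (h : IsDressedPair C U f g X0 a Γ F G B) (w : ℂ) {z : ℂ} (hz : z ∈ U) :
    integrableKernel G (-F) z w = integrableKernel F G w z :=
  integrableKernel_swap h.data.isOpen h.left.differentiableOn h.right.differentiableOn
    h.dressedData.orth hz

lemma differentiableOn_kernel_right (h : IsDressedPair C U f g X0 a Γ F G B) {w : ℂ} (hw : w ∈ U) :
    DifferentiableOn ℂ (fun z => integrableKernel F G w z) U :=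
  (differentiableOn_integrableKernel h.data.isOpen h.right.differentiableOn hw
    (h.dressedData.swap.orth w hw)).congr fun z hz => (h.kernel_swap w hz).symm

/-- Bounds of the dressed kernel when one of the variables is in a compact set. -/
lemma exists_norm_kernel_le_of_isCompact (h : IsDressedPair C U f g X0 a Γ F G B) {A : Set ℂ}
    (hA : IsCompact A) (hAU : A ⊆ U) : ∃ M : ℝ, 0 ≤ M ∧ ∀ z ∈ A, ∀ w ∈ U,
      ‖integrableKernel F G w z‖ ≤ M * ‖F w‖ ∧ ‖integrableKernel F G z w‖ ≤ M * ‖G w‖ := by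
  have D := h.dressedData
  obtain ⟨M1, h₁, hM1⟩ := exists_norm_integrableKernel_le (g := -F) D.isOpen D.diff_right hA hAU
  obtain ⟨M2, h₂, hM2⟩ := exists_norm_integrableKernel_le (g := G) D.isOpen D.diff_left hA hAU
  refine ⟨max M1 M2, le_max_of_le_left h₁, fun z hz w hw => ⟨?_, ?_⟩⟩
  · rw [← h.kernel_swap w (hAU hz)]; refine (hM1 w hw (D.swap.orth w hw) z hz).trans ?_; bound
  · refine (hM2 w hw (D.orth w hw) z hz).trans ?_; bound

lemma twoPointKernel (h : IsDressedPair C U f g X0 a Γ F G B) (hK : KernelBound C f g X0 a)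
    {e : ℂ → Fin r → ℂ} (he : DifferentiableOn ℂ e U) (hea : ∀ x ∈ X0, ‖e (C.pt x)‖ ≤ a x) :
    TwoPointKernel C U X0 (fun x => a x * a x) (dressedTwoPoint U f e F G) := by
  have D := h.data; have hU := D.isOpen; have hB : 0 ≤ B := h.left.nonneg
  have ha := D.weight_nonneg; have hmf := measurable_indicator_of_isOpen hU D.diff_left
  have hme := measurable_indicator_of_isOpen hU he
  have hmF := measurable_indicator_of_isOpen hU h.left.differentiableOn
  have hmG := measurable_indicator_of_isOpen hU h.right.differentiableOn
  refine ⟨hU, D.carrier_subset, D.measurableSet, D.regular, D.ae_mem, ?_, ?_, ?_, ?_, ?_, ?_, ?_,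
    fun x => mul_nonneg (ha x) (ha x), by grind [IntegrableData.weight_integrable]⟩
  · exact (measurable_dotProduct (hmf.comp measurable_fst) (hme.comp measurable_snd)).neg.mul
      ((measurable_integrableKernel hmF hmG).comp measurable_swap)
  · exact fun w hw => ((D.diff_left.dotProduct (differentiableOn_const (e w))).neg.mul
      (h.differentiableOn_kernel_right hw)).congr fun z hz => dressedTwoPoint_eq hU hz hw
  · exact fun z hz => (((differentiableOn_const (f z)).dotProduct he).neg.mul
      (h.differentiableOn_kernel hz)).congr fun w hw => dressedTwoPoint_eq hU hz hw
  · intro A hA hAU; obtain ⟨M, hM0, hM⟩ := h.exists_norm_kernel_le_of_isCompact hA hAU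
    obtain ⟨b₁, hb1⟩ := hA.exists_bound_of_continuousOn (D.diff_left.continuousOn.mono hAU)
    obtain ⟨b₂, hb2⟩ := hA.exists_bound_of_continuousOn (he.continuousOn.mono hAU)
    obtain ⟨b3, hb3⟩ :=
      hA.exists_bound_of_continuousOn (h.left.differentiableOn.continuousOn.mono hAU)
    refine ⟨|r * b₁ * b₂ * (M * b3)|, abs_nonneg _, fun z hz w hw => ?_⟩
    rw [dressedTwoPoint_eq hU (hAU hz) (hAU hw)]
    exact (norm_neg_dotProduct_mul_le (hb1 z hz) (hb2 w hw) ((hM z hz w (hAU hw)).1.trans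
      (mul_le_mul_of_nonneg_left (hb3 w hw) hM0))).trans (le_abs_self _)
  · intro A hA hAU; obtain ⟨M, hM0, hM⟩ := h.exists_norm_kernel_le_of_isCompact hA hAU
    obtain ⟨b₁, hb1⟩ := hA.exists_bound_of_continuousOn (D.diff_left.continuousOn.mono hAU)
    refine ⟨r * |b₁| * M * B, by positivity, fun z hz y hy => ?_⟩
    rw [dressedTwoPoint_eq hU (hAU hz) (D.mem_U hy)]
    exact (norm_neg_dotProduct_mul_le ((hb1 z hz).trans (le_abs_self _)) (hea y hy)
      ((hM z hz _ (D.mem_U hy)).1.trans (mul_le_mul_of_nonneg_left (h.left.bound y hy) hM0))).trans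
      (le_of_eq (by ring))
  · intro A hA hAU; obtain ⟨M, hM0, hM⟩ := h.exists_norm_kernel_le_of_isCompact hA hAU
    obtain ⟨b₂, hb2⟩ := hA.exists_bound_of_continuousOn (he.continuousOn.mono hAU)
    refine ⟨r * |b₂| * M * B, by positivity, fun w hw x hx => ?_⟩
    rw [dressedTwoPoint_eq hU (D.mem_U hx) (hAU hw)]
    exact (norm_neg_dotProduct_mul_le (D.left_le x hx) ((hb2 w hw).trans (le_abs_self _))
      ((hM w hw _ (D.mem_U hx)).2.trans (mul_le_mul_of_nonneg_left (h.right.bound x hx) hM0))).trans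
      (le_of_eq (by ring))
  -- Near the diagonal the bounds of F and G alone do not control the quotient. The bound of the
  -- dressed kernel comes from that of the resolvent, in which the speed stands on both sides and
  -- cancels, being non-zero at regular parameters.
  · obtain ⟨c, hc0, hc⟩ := Fredholm.exists_norm_resolvent_le D.isWeight (D.isDominated hK)
    refine ⟨r * c, by positivity, fun x hx y hy => ?_⟩
    rw [dressedTwoPoint_eq hU (D.mem_U hx) (D.mem_U hy)]; have h1 := hc y x
    rw [h.resolvent_eq hK hy hx, indicator_of_mem hy, indicator_of_mem hx, norm_mul,
      ← mul_assoc, ← mul_assoc, mul_le_mul_iff_left₀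
        (norm_pos_iff.2 (C.vel_ne_zero (D.regular hx)))] at h1
    exact (norm_neg_dotProduct_mul_le (D.left_le x hx) (hea y hy) h1).trans (le_of_eq (by ring))

/-- The pairing of another integrable kernel with the dressed one. -/
def pairing (C : Contour) {n : ℕ} (p q : ℂ → Fin n → ℂ) (F G : ℂ → Fin r → ℂ) (z : ℂ) : ℂ :=
  ∫ y, integrableKernel p q z (C.pt y) * integrableKernel F G (C.pt y) z * C.vel y ∂Cᵐ

/-- One kernel is taken at (z, y) and the other at (y, z). Both are holomorphic in z and locally
bounded by multiples of a(y), so the pairing has no jump across the contour. -/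
lemma pairing_spec (h : IsDressedPair C U f g X0 a Γ F G B) {n : ℕ} {p q : ℂ → Fin n → ℂ}
    (D : IntegrableData C U p q X0 a) {z0 : ℂ} (hz₀ : z0 ∈ U) :
    Integrable (fun y => integrableKernel p q z0 (C.pt y) * integrableKernel F G (C.pt y) z0 *
      C.vel y) Cᵐ ∧ DifferentiableAt ℂ (pairing C p q F G) z0 := by
  obtain ⟨ρ, hρ, hρU⟩ := Metric.nhds_basis_closedBall.mem_iff.1 (D.isOpen.mem_nhds hz₀)
  obtain ⟨M, hM0, hM⟩ := h.exists_norm_kernel_le_of_isCompact (isCompact_closedBall z0 ρ) hρU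
  obtain ⟨M', hM'0, hM'⟩ := exists_norm_integrableKernel_le (g := q) D.isOpen D.diff_left
    (isCompact_closedBall z0 ρ) hρU
  have hmeas : ∀ z ∈ ball z0 ρ, AEStronglyMeasurable (fun y =>
      integrableKernel p q z (C.pt y) * integrableKernel F G (C.pt y) z * C.vel y)
      Cᵐ := by
    intro z hz; have hzU := hρU (ball_subset_closedBall hz)
    have h1 := (h.differentiableOn_kernel hzU).continuousOn.mono D.carrier_subset
    have h2 : ContinuousOn (fun w => integrableKernel p q z w) C.carrier :=
      ((differentiableOn_integrableKernel D.isOpen D.diff_right hzU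
        (D.swap.orth z hzU)).continuousOn.mono D.carrier_subset).congr fun w hw =>
        (integrableKernel_swap D.isOpen D.diff_left D.diff_right D.orth (D.carrier_subset hw)).symm
    exact ((C.aemeasurable_comp_pt (h2.mul h1)).mul
      C.measurable_vel.aemeasurable).aestronglyMeasurable
  have hb : ∀ᵐ y ∂Cᵐ, ∀ z ∈ ball z0 ρ,
      ‖integrableKernel p q z (C.pt y) * integrableKernel F G (C.pt y) z * C.vel y‖ ≤
        M' * (M * B) * (a y * (a y * ‖C.vel y‖)) := by
    filter_upwards [D.ae_mem] with y hy z hz; have hz' := ball_subset_closedBall hz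
    have h1 := (hM' _ (D.mem_U hy) (D.orth _ (D.mem_U hy)) z hz').trans
      (mul_le_mul_of_nonneg_left (D.right_le y hy) hM'0)
    have h2 := (hM z hz' _ (D.mem_U hy)).1.trans (mul_le_mul_of_nonneg_left (h.left.bound y hy) hM0)
    rw [norm_mul, norm_mul]; refine (mul_le_mul_of_nonneg_right (mul_le_mul h1 h2 (norm_nonneg _)
      ((norm_nonneg _).trans h1)) (norm_nonneg _)).trans (le_of_eq (by ring))
  have hbi := D.weight_integrable.const_mul (M' * (M * B))
  refine ⟨hbi.mono' (hmeas z0 (mem_ball_self hρ)) (hb.mono fun y hy => hy z0 (mem_ball_self hρ)),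
    differentiableAt_integral_of_bound hρ hmeas ?_ hb hbi⟩
  filter_upwards [D.ae_mem] with y hy; have hy' := D.mem_U hy
  exact (((differentiableOn_integrableKernel D.isOpen D.diff_left hy' (D.orth _ hy')).mul
    (h.differentiableOn_kernel_right hy')).mul_const _).mono
    (Metric.ball_subset_closedBall.trans hρU)

end IsDressedPair

variable {C : Contour} {r : ℕ} {U : Set ℂ} {f g F G u v : ℂ → Fin r → ℂ}
  {X0 : Set C.Param} {a : C.Param → ℝ} {Γ : ℂ → Matrix (Fin r) (Fin r) ℂ} {B : ℝ}

/-! ### Differentiation of matrix functions -/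

lemma hasDerivAt_mulVec {A : ℂ → Matrix (Fin r) (Fin r) ℂ} {w : ℂ → Fin r → ℂ} {p : ℂ}
    (hA : ∀ i k, DifferentiableAt ℂ (fun z => A z i k) p) (hw : DifferentiableAt ℂ w p) :
    HasDerivAt (fun z => A z *ᵥ w z) (matrixDeriv A p *ᵥ w p + A p *ᵥ deriv w p) p := by
  refine hasDerivAt_pi.2 fun i => ?_
  have h := HasDerivAt.fun_sum (u := Finset.univ) fun k _ =>
    (hA i k).hasDerivAt.mul (hasDerivAt_pi.1 hw.hasDerivAt k)
  rw [sum_add_distrib] at h; exact h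

lemma DifferentiableOn.mulVec {A : ℂ → Matrix (Fin r) (Fin r) ℂ} {w : ℂ → Fin r → ℂ} {W : Set ℂ}
    (hA : ∀ i k, DifferentiableOn ℂ (fun z => A z i k) W) (hw : DifferentiableOn ℂ w W) :
    DifferentiableOn ℂ (fun z => A z *ᵥ w z) W :=
  differentiableOn_pi.2 fun i => DifferentiableOn.fun_sum (u := Finset.univ) fun k _ =>
    (hA i k).fun_mul (differentiableOn_pi.1 hw k)

lemma DifferentiableOn.matrix_mul {A A' : ℂ → Matrix (Fin r) (Fin r) ℂ} {W : Set ℂ}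
    (hA : ∀ i k, DifferentiableOn ℂ (fun z => A z i k) W)
    (hA' : ∀ i k, DifferentiableOn ℂ (fun z => A' z i k) W) (i k : Fin r) :
    DifferentiableOn ℂ (fun z => (A z * A' z) i k) W :=
  DifferentiableOn.fun_sum (u := Finset.univ) fun l _ => (hA i l).fun_mul (hA' l k)

lemma differentiableOn_integrableJump {W : Set ℂ} (hf : DifferentiableOn ℂ f W)
    (hg : DifferentiableOn ℂ g W) (i k : Fin r) :
    DifferentiableOn ℂ (fun z => integrableJump f g z i k) W :=
  (((differentiableOn_pi.1 hf i).mul (differentiableOn_pi.1 hg k)).const_mul _).const_sub _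

lemma matrixDeriv_congr {A A' : ℂ → Matrix (Fin r) (Fin r) ℂ} {z : ℂ} (h : A =ᶠ[𝓝 z] A') :
    matrixDeriv A z = matrixDeriv A' z := by
  ext i k; exact (h.fun_comp fun N => N i k).deriv_eq

lemma integrableJump_neg_mulVec (l : ℂ) (w : Fin r → ℂ) :
    integrableJump f (-g) l *ᵥ w = w + (2 * π * I * (g l ⬝ᵥ w)) • f l := by
  rw [integrableJump, Pi.neg_apply, vecMulVec_neg, smul_neg, sub_neg_eq_add, add_mulVec,
    one_mulVec, smul_mulVec, vecMulVec_mulVec, op_smul_eq_smul, smul_smul]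

/-- The left boundary value of `(Γ⁻¹)'`, expressed by the right boundary values. -/
lemma dotProduct_matrixDeriv_mulVec_eq {H H₂ : ℂ → Matrix (Fin r) (Fin r) ℂ} {p : ℂ}
    (hH : ∀ i k, DifferentiableAt ℂ (fun z => H z i k) p)
    (hQ : ∀ i k, DifferentiableAt ℂ (fun z => (H₂ z * integrableJump g (-f) z) i k) p)
    (hf : DifferentiableAt ℂ f p) (hF : ∀ᶠ z in 𝓝 p, F z = H z *ᵥ f z)
    (hinv : ∀ᶠ z in 𝓝 p, (H₂ z)ᵀ * H z = 1) (horth : ∀ᶠ z in 𝓝 p, f z ⬝ᵥ g z = 0)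
    (e : Fin r → ℂ) :
    F p ⬝ᵥ matrixDeriv (fun z => H₂ z * integrableJump g (-f) z) p *ᵥ e =
      -(e ⬝ᵥ ((H₂ p)ᵀ * matrixDeriv H p) *ᵥ f p) - 2 * π * I * (e ⬝ᵥ f p) *
        (g p ⬝ᵥ ((H₂ p)ᵀ * matrixDeriv H p) *ᵥ f p + g p ⬝ᵥ deriv f p) := by
  set Q := fun z => H₂ z * integrableJump g (-f) z with hQdef
  have hQt : ∀ z w, (Q z)ᵀ *ᵥ w = (H₂ z)ᵀ *ᵥ w +
      (2 * π * I * (g z ⬝ᵥ (H₂ z)ᵀ *ᵥ w)) • f z := fun z w => by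
    rw [hQdef, transpose_mul, ← transpose_integrableJump, transpose_transpose,
      ← mulVec_mulVec, integrableJump_neg_mulVec]
  have hF' : HasDerivAt F (matrixDeriv H p *ᵥ f p + H p *ᵥ deriv f p) p :=
    (hasDerivAt_mulVec hH hf).congr_of_eventuallyEq hF
  -- Q continues the left values of Γ⁻ᵀ and F = Γ₋f, so QᵀF = Mf = f by orthogonality.
  -- Differentiating this identity expresses Q'ᵀF by F', that is, by the right values alone.
  have h1 : (fun z => (Q z)ᵀ *ᵥ F z) =ᶠ[𝓝 p] f := by
    filter_upwards [hF, hinv, horth] with z h1 h2 h3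
    grind [mulVec_mulVec, one_mulVec, dotProduct_comm, zero_smul]
  have h2 := hasDerivAt_mulVec (A := fun z => (Q z)ᵀ) (fun i k => hQ k i) hF'.differentiableAt
  have h3 := h2.unique (hf.hasDerivAt.congr_of_eventuallyEq h1)
  have h4 : matrixDeriv (fun z => (Q z)ᵀ) p = (matrixDeriv Q p)ᵀ := rfl
  rw [h4, hF'.deriv, hQt, mulVec_add, mulVec_mulVec, mulVec_mulVec,
    hinv.self_of_nhds, one_mulVec] at h3
  have h5 := congrArg (fun w => e ⬝ᵥ w) h3; simp at h5
  grind [dotProduct_mulVec, dotProduct_comm, mulVec_transpose]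

/-- The Malgrange trace of a variation of the jump matrix. -/
lemma trace_mul_integrableJump (A : Matrix (Fin r) (Fin r) ℂ) {p : ℂ} (horth : f p ⬝ᵥ g p = 0)
    (d e : Fin r → ℂ) :
    (A * ((-(2 * π * I)) • (vecMulVec d (g p) + vecMulVec (f p) e) *
      integrableJump f (-g) p)).trace / (2 * π * I) =
    -(g p ⬝ᵥ A *ᵥ d + e ⬝ᵥ A *ᵥ f p + 2 * π * I * (e ⬝ᵥ f p) * (g p ⬝ᵥ A *ᵥ f p)) := by
  have h1 : g p ⬝ᵥ f p = 0 := by rw [dotProduct_comm, horth]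
  have h2 : (vecMulVec d (g p) + vecMulVec (f p) e) * integrableJump f (-g) p =
      vecMulVec d (g p) + vecMulVec (f p) e + (2 * π * I * (e ⬝ᵥ f p)) • vecMulVec (f p) (g p) := by
    rw [integrableJump, Pi.neg_apply, vecMulVec_neg, smul_neg, sub_neg_eq_add, mul_add,
      mul_one, Matrix.mul_smul, add_mul, vecMulVec_mul_vecMulVec,
      vecMulVec_mul_vecMulVec, h1, zero_smul, vecMulVec_zero, zero_add,
      vecMulVec_smul, smul_smul]
  rw [smul_mul, h2, Matrix.mul_smul, trace_smul, Matrix.mul_add, Matrix.mul_add,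
    Matrix.mul_smul, trace_add, trace_add, trace_smul, mul_vecMulVec,
    mul_vecMulVec, mul_vecMulVec, trace_vecMulVec, trace_vecMulVec,
    trace_vecMulVec, smul_eq_mul, smul_eq_mul, dotProduct_comm _ (g p),
    dotProduct_comm _ (g p), dotProduct_comm _ e]
  field_simp

/-! ### Extension of the solution across the contour -/

/-- The identity theorem: the right side accumulates at the point. -/
lemma eventually_eq_zero_of_right {j : Fin C.n} {t : ℝ} (ht : t ∈ C.regular j) {W : Set ℂ}
    (hW : IsOpen W) (hmem : C.γ j t ∈ W) {φ : ℂ → ℂ} (hφ : DifferentiableOn ℂ φ W)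
    (h0 : ∀ᶠ z in C.rightNhds (j, t), φ z = 0) : ∀ᶠ z in 𝓝 (C.γ j t), φ z = 0 := by
  refine (hφ.analyticAt (hW.mem_nhds hmem)).frequently_zero_iff_eventually_zero.1
    (h0.frequently.filter_mono ((C.rightNhds_le ht).trans (nhdsWithin_mono _ ?_)))
  rintro z hz rfl; exact hz (Set.mem_iUnion.2 ⟨j, t, C.regular_subset_dom j ht, rfl⟩)

/-- The jump matrix is analytic near the contour, so ΓM⁻¹ is analytic on the left and has the same
boundary values as Γ on the right; together they continue Γ₋ analytically. -/
lemma IntegrableData.exists_extension (D : IntegrableData C U f g X0 a)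
    (hΓ : IsWeakRHSolution C (integrableJump f g) Γ) {j : Fin C.n} {t : ℝ} (ht : t ∈ C.regular j) :
    ∃ (W : Set ℂ) (H : ℂ → Matrix (Fin r) (Fin r) ℂ), IsOpen W ∧ C.γ j t ∈ W ∧ W ⊆ U ∧
      (∀ i k, DifferentiableOn ℂ (fun z => H z i k) W) ∧ (∀ᶠ z in C.rightNhds (j, t), Γ z = H z) ∧
      ∀ᶠ z in C.leftNhds (j, t), Γ z = H z * integrableJump f g z := by
  have hcarr : ∀ u ∈ C.regular j, C.γ j u ∈ C.carrier := fun u hu =>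
    Set.mem_iUnion.2 ⟨j, u, C.regular_subset_dom j hu, rfl⟩
  have hUt := D.carrier_subset (hcarr t ht)
  have hΓd : ∀ i k, DifferentiableOn ℂ (fun z => Γ z i k) (U \ C.carrier) := fun i k =>
    (hΓ.analytic i k).mono fun z hz => hz.2
  have hN := fun i k => (differentiableOn_integrableJump D.diff_left D.diff_right.neg i k).mono
    (Set.sdiff_subset (s := U) (t := C.carrier))
  have key : ∀ i k, _ := fun i k => C.exists_two_sided_extension ht D.isOpen hUt
    (φ1 := fun z => Γ z i k) (φ2 := fun z => (Γ z * integrableJump f (-g) z) i k) (hΓd i k)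
    (DifferentiableOn.matrix_mul hΓd hN i k) (by
      filter_upwards [(C.isOpen_regular j).mem_nhds ht] with u hu
      obtain ⟨P, Q, hP, hQ, rfl⟩ := hΓ.jump j u hu; have hu' := hcarr u hu
      have hNl : Tendsto (integrableJump f (-g)) (C.leftNhds (j, u))
          (𝓝 (integrableJump f (-g) (C.γ j u))) :=
        tendsto_pi_nhds.2 fun i => tendsto_pi_nhds.2 fun k =>
          ((differentiableOn_integrableJump D.diff_left D.diff_right.neg i k).continuousOn.continuousAt
            (D.isOpen.mem_nhds (D.carrier_subset hu'))).tendsto.mono_left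
            ((C.leftNhds_le hu).trans nhdsWithin_le_nhds)
      have h1 := hP.mul hNl
      rw [mul_assoc, integrableJump_mul (D.orth _ (D.carrier_subset hu')), mul_one] at h1
      exact ⟨Q i k, tendsto_pi_nhds.1 (tendsto_pi_nhds.1 h1 i) k,
        tendsto_pi_nhds.1 (tendsto_pi_nhds.1 hQ i) k⟩)
  choose W H hW hWt hWU hH hR hL using key; have hU' : ∀ᶠ z in C.leftNhds (j, t), z ∈ U :=
    C.leftNhds_le ht (nhdsWithin_le_nhds (D.isOpen.mem_nhds hUt))
  refine ⟨U ∩ ⋂ i, ⋂ k, W i k, fun z => of fun i k => H i k z,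
    D.isOpen.inter (isOpen_iInter_of_finite fun i => isOpen_iInter_of_finite fun k => hW i k),
    ⟨hUt, Set.mem_iInter₂.2 hWt⟩, Set.inter_subset_left,
    fun i k => (hH i k).mono fun z hz => Set.mem_iInter₂.1 hz.2 i k, ?_, ?_⟩
  · filter_upwards [eventually_all.2 fun i => eventually_all.2 fun k => hR i k] with z hz; bound
  · filter_upwards [eventually_all.2 fun i => eventually_all.2 fun k => hL i k, hU'] with z hz hzU
    have h1 : Γ z * integrableJump f (-g) z = of fun i k => H i k z := by bound
    grind [mul_eq_one_comm, integrableJump_mul, IntegrableData.orth]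

/-! ### The trace formula -/

variable {C : Contour} {r : ℕ} {U : Set ℂ} {f g F G d e : ℂ → Fin r → ℂ}
  {X0 : Set C.Param} {a : C.Param → ℝ} {Γ : ℂ → Matrix (Fin r) (Fin r) ℂ} {B : ℝ}

/-- Two vector functions as one. -/
def stack (u v : ℂ → Fin r → ℂ) (z : ℂ) : Fin (r + r) → ℂ := Fin.append (u z) (v z)

lemma stack_dotProduct (u u' v v' : ℂ → Fin r → ℂ) (z w : ℂ) :
    stack u v z ⬝ᵥ stack u' v' w = u z ⬝ᵥ u' w + v z ⬝ᵥ v' w := by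
  simp only [stack, dotProduct, Fin.sum_univ_add, Fin.append_left, Fin.append_right]

/-- The integrand of the Malgrange form for the variations `d`, `e` of `f`, `g`. -/
def malgrangeTrace (C : Contour) (f g d e : ℂ → Fin r → ℂ) (Γ : ℂ → Matrix (Fin r) (Fin r) ℂ)
    (x : C.Param) : ℂ :=
  ((minusValue C Γ x)⁻¹ * minusValue C (matrixDeriv Γ) x *
    ((-(2 * π * I)) • (vecMulVec (d (C.pt x)) (g (C.pt x)) +
      vecMulVec (f (C.pt x)) (e (C.pt x))) * (integrableJump f g (C.pt x))⁻¹)).trace /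
    (2 * π * I)

/-- The integrand of the correction term for the variation `e` of `g`. -/
def correctionTerm (f g e : ℂ → Fin r → ℂ) (z : ℂ) : ℂ :=
  2 * π * I * ((g z ⬝ᵥ deriv f z) * (e z ⬝ᵥ f z))

namespace IsDressedPair

/-- The product fᵀ(z)e(y) is that of the stacked vectors minus dᵀ(z)g(y). The stacked part is the
pairing; the other has a double pole and is the differentiated Cauchy representation of Γ. -/
lemma firstTransform_eq (h : IsDressedPair C U f g X0 a Γ F G B)
    (D : IntegrableData C U (stack d f) (stack g e) X0 a) {z : ℂ} (hz : z ∉ C.carrier)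
    (hzU : z ∈ U) : firstTransform C (dressedTwoPoint U f e F G) z =
      G z ⬝ᵥ matrixDeriv Γ z *ᵥ d z - pairing C (stack d f) (stack g e) F G z := by
  obtain ⟨h1, h2⟩ := h.left.integral_eq hz (G z) (d z)
  rw [← h2, pairing, ← integral_sub h1 (h.pairing_spec D hzU).1]; refine integral_congr_ae ?_
  filter_upwards [C.ae_mem_params] with y hy; have hyC := C.pt_mem_carrier hy
  have hne : z ≠ C.pt y := by grind
  rw [dressedTwoPoint_eq D.isOpen hzU (D.carrier_subset hyC), integrableKernel_of_ne hne.symm,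
    integrableKernel_of_ne hne, stack_dotProduct, dotProduct_comm (G z), ← neg_sub z (C.pt y)]
  field_simp; ring

/-- The differentiated Cauchy representation of Γ⁻ᵀ, which is the dressing matrix of the pair (g,
-f). -/
lemma secondTransform_eq (h : IsDressedPair C U f g X0 a Γ F G B) {w : ℂ} (hw : w ∉ C.carrier)
    (hwU : w ∈ U) : secondTransform C (dressedTwoPoint U f e F G) w =
      F w ⬝ᵥ matrixDeriv (fun z => (Γ z).adjugateᵀ) w *ᵥ e w := by
  rw [← (h.right.integral_eq hw (F w) (e w)).2]; refine integral_congr_ae ?_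
  filter_upwards [C.ae_mem_params] with x hx; have hxC := C.pt_mem_carrier hx
  have hne : w ≠ C.pt x := by grind
  rw [dressedTwoPoint_eq h.data.isOpen (h.data.carrier_subset hxC) hwU, integrableKernel_of_ne hne,
    Pi.neg_apply, dotProduct_neg, dotProduct_comm (e w), ← neg_sub w (C.pt x)]
  field_simp

/-- The boundary values of the two transforms. -/
lemma exists_boundary_values (h : IsDressedPair C U f g X0 a Γ F G B) (hd : DifferentiableOn ℂ d U)
    (he : DifferentiableOn ℂ e U) (D : IntegrableData C U (stack d f) (stack g e) X0 a)
    {j : Fin C.n} {t : ℝ} (ht : t ∈ C.regular j) :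
    ∃ (W : Set ℂ) (e₁ e₂ : ℂ → ℂ), IsOpen W ∧ C.γ j t ∈ W ∧ ContinuousOn e₁ W ∧ ContinuousOn e₂ W ∧
      (∀ᶠ z in C.rightNhds (j, t), firstTransform C (dressedTwoPoint U f e F G) z = e₁ z) ∧
      (∀ᶠ z in C.leftNhds (j, t), secondTransform C (dressedTwoPoint U f e F G) z = e₂ z) ∧
      malgrangeTrace C f g d e Γ (j, t) - correctionTerm f g e (C.γ j t) +
        pairing C (stack d f) (stack g e) F G (C.γ j t) = e₂ (C.γ j t) - e₁ (C.γ j t) := by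
  have D0 := h.data; obtain ⟨W1, H, hW1, hp1, hWU, hH, hR, -⟩ := D0.exists_extension h.weak ht
  obtain ⟨W2, H₂, hW2, hp2, -, hH2, hR2, hL2⟩ := D0.swap.exists_extension
    (h.weak.swap fun l hl => D0.orth l (D0.carrier_subset hl)) ht
  set p := C.γ j t; set W := W1 ∩ W2; have hW : IsOpen W := hW1.inter hW2
  have hp : p ∈ W := ⟨hp1, hp2⟩; have hWn := hW.mem_nhds hp
  replace hWU : W ⊆ U := Set.inter_subset_left.trans hWU
  replace hH := fun i k => (hH i k).mono (Set.inter_subset_left (t := W2))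
  replace hH2 := fun i k => (hH2 i k).mono (Set.inter_subset_right (s := W1))
  have hQ := DifferentiableOn.matrix_mul hH2 fun i k =>
    (differentiableOn_integrableJump D0.diff_right D0.diff_left.neg i k).mono hWU
  have hfW := D0.diff_left.mono hWU; have hFW := h.left.differentiableOn.mono hWU
  have hGW := h.right.differentiableOn.mono hWU; have hr := C.rightNhds_le ht
  have hl := C.leftNhds_le ht
  have hoffR : ∀ᶠ z in C.rightNhds (j, t), z ∉ C.carrier := hr self_mem_nhdsWithin
  have hoffL : ∀ᶠ z in C.leftNhds (j, t), z ∉ C.carrier := hl self_mem_nhdsWithin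
  have hWR : ∀ᶠ z in C.rightNhds (j, t), z ∈ W := hr (nhdsWithin_le_nhds hWn)
  have hWL : ∀ᶠ z in C.leftNhds (j, t), z ∈ W := hl (nhdsWithin_le_nhds hWn)
  -- identities that continue from the right to a neighbourhood
  have id1 : ∀ᶠ z in 𝓝 p, F z = H z *ᵥ f z := by
    have h1 : ∀ i, ∀ᶠ z in 𝓝 p, F z i - (H z *ᵥ f z) i = 0 := fun i =>
      eventually_eq_zero_of_right ht hW hp ((differentiableOn_pi.1 hFW i).fun_sub
        (differentiableOn_pi.1 (DifferentiableOn.mulVec hH hfW) i)) (by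
        filter_upwards [hR, hoffR] with z hz hzC; rw [h.left.eq_off z hzC, hz, sub_self])
    filter_upwards [eventually_all.2 h1] with z hz using funext fun i => sub_eq_zero.1 (hz i)
  have id2 : ∀ᶠ z in 𝓝 p, G z = H₂ z *ᵥ g z := by
    have h1 : ∀ i, ∀ᶠ z in 𝓝 p, G z i - (H₂ z *ᵥ g z) i = 0 := fun i =>
      eventually_eq_zero_of_right ht hW hp ((differentiableOn_pi.1 hGW i).fun_sub
        (differentiableOn_pi.1 (DifferentiableOn.mulVec hH2 (D0.diff_right.mono hWU)) i)) (by
        filter_upwards [hR2, hoffR] with z hz hzC; rw [h.right.eq_off z hzC, hz, sub_self])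
    filter_upwards [eventually_all.2 h1] with z hz using funext fun i => sub_eq_zero.1 (hz i)
  have id3 : ∀ᶠ z in 𝓝 p, (H₂ z)ᵀ * H z = 1 := by
    have h1 : ∀ i k, ∀ᶠ z in 𝓝 p,
        ((H₂ z)ᵀ * H z) i k - (1 : Matrix (Fin r) (Fin r) ℂ) i k = 0 := fun i k =>
      eventually_eq_zero_of_right ht hW hp ((DifferentiableOn.matrix_mul (A := fun z => (H₂ z)ᵀ)
        (fun i k => hH2 k i) hH i k).sub_const _) (by
        filter_upwards [hR, hR2, hoffR] with z hz hz2 hzC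
        rw [← hz, ← hz2, transpose_transpose, adjugate_mul, h.det_eq_one hzC, one_smul, sub_self])
    filter_upwards [eventually_all.2 fun i => eventually_all.2 fun k => h1 i k] with z hz; ext i k
    grind
  set Q := fun z => H₂ z * integrableJump g (-f) z
  have hpair : DifferentiableOn ℂ (pairing C (stack d f) (stack g e) F G) W := fun z hz =>
    (h.pairing_spec D (hWU hz)).2.differentiableWithinAt
  refine ⟨W, fun z => G z ⬝ᵥ matrixDeriv H z *ᵥ d z - pairing C (stack d f) (stack g e) F G z,
    fun z => F z ⬝ᵥ matrixDeriv Q z *ᵥ e z, hW, hp,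
    ((hGW.dotProduct (DifferentiableOn.mulVec (fun i k => (hH i k).deriv hW)
      (hd.mono hWU))).fun_sub hpair).continuousOn,
    (hFW.dotProduct (DifferentiableOn.mulVec (fun i k => (hQ i k).deriv hW)
      (he.mono hWU))).continuousOn, ?_, ?_, ?_⟩
  · filter_upwards [C.eventually_eventually_right ht hR, hoffR, hWR] with z hz hzC hzW
    rw [h.firstTransform_eq D hzC (hWU hzW), matrixDeriv_congr hz]
  · filter_upwards [C.eventually_eventually_left ht hL2, hoffL, hWL] with z hz hzC hzW
    rw [h.secondTransform_eq hzC (hWU hzW), matrixDeriv_congr hz]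
  · have hHat := fun i k => (hH i k).differentiableAt hWn
    have horth : ∀ᶠ z in 𝓝 p, f z ⬝ᵥ g z = 0 := by
      filter_upwards [hWn] with z hz using D0.orth z (hWU hz)
    have m1 : minusValue C Γ (j, t) = H p := by
      refine Tendsto.limUnder_eq (Tendsto.congr' (hR.mono fun _ hz => hz.symm)
        (tendsto_pi_nhds.2 fun i => tendsto_pi_nhds.2 fun k =>
          (hHat i k).continuousAt.tendsto.mono_left (hr.trans nhdsWithin_le_nhds)))
    have m2 : minusValue C (matrixDeriv Γ) (j, t) = matrixDeriv H p := by
      refine Tendsto.limUnder_eq (Tendsto.congr' ((C.eventually_eventually_right ht hR).mono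
        fun z hz => (matrixDeriv_congr hz).symm)
        (tendsto_pi_nhds.2 fun i => tendsto_pi_nhds.2 fun k =>
          ((((hH i k).deriv hW).differentiableAt hWn).continuousAt).tendsto.mono_left
            (hr.trans nhdsWithin_le_nhds)))
    have i₁ : (H p)⁻¹ = (H₂ p)ᵀ := inv_eq_left_inv id3.self_of_nhds
    have i₂ : (integrableJump f g p)⁻¹ = integrableJump f (-g) p :=
      inv_eq_right_inv (integrableJump_mul horth.self_of_nhds)
    -- With A = Γ₋⁻¹Γ₋', all terms are bilinear in A. The value `k1` of the second transform minus
    -- `k3` contains exactly the terms of the Malgrange trace `k2` together with -2πi (eᵀf)(gᵀf'),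
    -- the correction term with its sign.
    have k1 := dotProduct_matrixDeriv_mulVec_eq hHat (fun i k => (hQ i k).differentiableAt hWn)
      (hfW.differentiableAt hWn) id1 id3 horth (e p)
    have k2 := trace_mul_integrableJump ((H₂ p)ᵀ * matrixDeriv H p) horth.self_of_nhds (d p) (e p)
    have k3 : G p ⬝ᵥ matrixDeriv H p *ᵥ d p = g p ⬝ᵥ ((H₂ p)ᵀ * matrixDeriv H p) *ᵥ d p := by
      rw [id2.self_of_nhds, ← mulVec_mulVec, dotProduct_mulVec (g p), vecMul_transpose]
    have hpt : C.pt (j, t) = p := rfl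
    change _ = F p ⬝ᵥ matrixDeriv (fun z => H₂ z * integrableJump g (-f) z) p *ᵥ e p -
      (G p ⬝ᵥ matrixDeriv H p *ᵥ d p - pairing C (stack d f) (stack g e) F G p)
    rw [malgrangeTrace, m1, m2, hpt, i₁, i₂, k2, k1, k3, correctionTerm]; ring

/-- The trace formula for the resolvent of an integrable kernel. -/
theorem integral_pairing_eq (h : IsDressedPair C U f g X0 a Γ F G B) (hK : KernelBound C f g X0 a)
    (hd : DifferentiableOn ℂ d U) (he : DifferentiableOn ℂ e U)
    (hea : ∀ x ∈ X0, ‖e (C.pt x)‖ ≤ a x) (D : IntegrableData C U (stack d f) (stack g e) X0 a)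
    (hω : C.IntegrableOn (malgrangeTrace C f g d e Γ))
    (hc : C.IntegrableOn fun x => correctionTerm f g e (C.pt x))
    (hI : C.IntegrableOn fun x => pairing C (stack d f) (stack g e) F G (C.pt x)) :
    C.integral (fun x => pairing C (stack d f) (stack g e) F G (C.pt x)) =
      C.integral (fun x => correctionTerm f g e (C.pt x)) -
        C.integral (malgrangeTrace C f g d e Γ) := by
  have hsum : ∀ x, (malgrangeTrace C f g d e Γ x - correctionTerm f g e (C.pt x) +
      pairing C (stack d f) (stack g e) F G (C.pt x)) * C.vel x =
      malgrangeTrace C f g d e Γ x * C.vel x - correctionTerm f g e (C.pt x) * C.vel x +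
      pairing C (stack d f) (stack g e) F G (C.pt x) * C.vel x := fun x => by ring
  have h0 := (h.twoPointKernel hK he hea).integral_eq_zero
    (Ψ := fun x => malgrangeTrace C f g d e Γ x - correctionTerm f g e (C.pt x) +
      pairing C (stack d f) (stack g e) F G (C.pt x))
    (((hω.sub hc).add hI).congr (ae_of_all _ fun x => (hsum x).symm)) (by
      intro j t ht
      obtain ⟨W, e₁, e₂, hW, hp, he1, he2, h₁, h₂, -⟩ := h.exists_boundary_values hd he D ht
      obtain ⟨W', hW', hsub, hval⟩ := C.exists_nhds_boundary_values ht hW hp he1 he2 h₁ h₂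
      refine ⟨W', hW', e₁, e₂, he1.mono hsub, he2.mono hsub, h₁, h₂, ?_⟩; rintro ⟨k, u⟩ hx hxW
      have hu : u ∈ C.regular k := D.regular hx
      obtain ⟨V, φ1, φ2, hV, hq, hφ1, hφ2, h1', h₂', hΨ⟩ := h.exists_boundary_values hd he D hu
      have hVn := hV.mem_nhds hq
      -- The extensions constructed at γ(t) take at a nearby point the same boundary values as those
      -- constructed at that point, so the pointwise identity holds throughout a neighbourhood.
      have h3 := hval (k, u) (C.regularParams_subset (D.regular hx)) hxW _ _
        (Tendsto.congr' (h1'.mono fun _ h => h.symm) ((hφ1.continuousAt hVn).tendsto.mono_left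
          ((C.rightNhds_le hu).trans nhdsWithin_le_nhds)))
        (Tendsto.congr' (h₂'.mono fun _ h => h.symm) ((hφ2.continuousAt hVn).tendsto.mono_left
          ((C.leftNhds_le hu).trans nhdsWithin_le_nhds)))
      rw [h3.1, h3.2]; exact hΨ)
  simp [hsum] at h0
  have h1 := (integral_add (hω.sub hc) hI).trans (congrArg (· + _) (integral_sub hω hc))
  simp [Contour.integral]; linear_combination (h1.symm.trans h0)

end IsDressedPair

/-! ### Dependence on the parameters -/

variable {E : Type*} [NormedAddCommGroup E] [NormedSpace ℝ E] {S : Set E} {U : Set ℂ}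

/-- The derivative in a parameter. -/
def paramDeriv {V : Type*} [NormedAddCommGroup V] [NormedSpace ℝ V] (f : E → ℂ → V) (s v : E)
    (l : ℂ) : V := lineDeriv ℝ (fun q => f q l) s v

section Holomorphic
variable {V : Type*} [NormedAddCommGroup V] [NormedSpace ℂ V] {f : E → ℂ → V} {s : E}

lemma hasDerivAt_param (hS : IsOpen S) (hU : IsOpen U)
    (hf : ContDiffOn ℝ 1 (fun p : E × ℂ => f p.1 p.2) (S ×ˢ U)) (v : E) {t : ℝ}
    (ht : s + t • v ∈ S) {l : ℂ} (hl : l ∈ U) :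
    HasDerivAt (fun t : ℝ => f (s + t • v) l)
      (fderiv ℝ (fun p : E × ℂ => f p.1 p.2) (s + t • v, l) (v, 0)) t := by
  have h1 := ((hf.contDiffAt ((hS.prod hU).mem_nhds (mk_mem_prod ht hl))).differentiableAt
    one_ne_zero).hasFDerivAt
  have h2 : HasDerivAt (fun t : ℝ => (s + t • v, l)) (v, (0 : ℂ)) t := by
    simpa using (((hasDerivAt_id t).smul_const v).const_add s).prodMk (hasDerivAt_const t l)
  exact h1.comp_hasDerivAt t h2

lemma paramDeriv_eq (hS : IsOpen S) (hU : IsOpen U)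
    (hf : ContDiffOn ℝ 1 (fun p : E × ℂ => f p.1 p.2) (S ×ˢ U)) (v : E) (hs : s ∈ S) {l : ℂ}
    (hl : l ∈ U) : HasLineDerivAt ℝ (fun q => f q l) (paramDeriv f s v l) s v ∧
      paramDeriv f s v l = fderiv ℝ (fun p : E × ℂ => f p.1 p.2) (s, l) (v, 0) := by
  have h := hasDerivAt_param hS hU hf v (s := s) (t := 0) (by simpa using hs) hl
  simp at h; have h' : HasLineDerivAt ℝ (fun q => f q l) _ s v := h
  have e : paramDeriv f s v l = _ := h'.lineDeriv; exact ⟨e ▸ h', e⟩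

lemma eventually_add_smul_mem (hS : IsOpen S) (hs : s ∈ S) (v : E) :
    ∀ᶠ t : ℝ in 𝓝 0, s + t • v ∈ S := by
  have : Tendsto (fun t : ℝ => s + t • v) (𝓝 0) (𝓝 s) :=
    Continuous.tendsto' (by fun_prop) _ _ (by simp)
  exact this (hS.mem_nhds hs)

/-- Joint continuity of the derivative at (s, z₀) and the mean value inequality in t give uniformity
in the spectral variable. Locally uniform limits preserve holomorphy and commute with the complex
derivative. -/
lemma tendstoLocallyUniformlyOn_quotient (hS : IsOpen S) (hU : IsOpen U)
    (hf : ContDiffOn ℝ 1 (fun p : E × ℂ => f p.1 p.2) (S ×ˢ U)) (hs : s ∈ S) (v : E) :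
    TendstoLocallyUniformlyOn (fun (t : ℝ) l => t⁻¹ • (f (s + t • v) l - f s l))
      (paramDeriv f s v) (𝓝[≠] 0) U := by
  rw [tendstoLocallyUniformlyOn_iff]; intro ε hε z0 hz₀
  have hcd := (hf.contDiffAt ((hS.prod hU).mem_nhds (mk_mem_prod hs hz₀))).continuousAt_fderiv one_ne_zero
  have hcont : ContinuousAt (fun p : ℝ × ℂ =>
      fderiv ℝ (fun p : E × ℂ => f p.1 p.2) (s + p.1 • v, p.2) (v, 0)) (0, z0) :=
    (ContinuousAt.comp (f := fun p : ℝ × ℂ => (s + p.1 • v, p.2)) (by simpa using hcd)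
      (by fun_prop)).clm_apply continuousAt_const
  have h1 := Metric.tendsto_nhds.1 hcont.tendsto (ε / 3) (by positivity)
  have h2 : ∀ᶠ p : ℝ × ℂ in 𝓝 (0, z0), s + p.1 • v ∈ S ∧ p.2 ∈ U :=
    ((eventually_add_smul_mem hS hs v).prod_inl_nhds z0).and
      (Eventually.prod_inr_nhds (hU.mem_nhds hz₀) 0)
  obtain ⟨ρ, hρ, hb⟩ := Metric.eventually_nhds_iff_ball.1 (h1.and h2)
  simp only [zero_smul, add_zero, ← ball_prod_same, mem_prod] at hb
  set D := fderiv ℝ (fun p : E × ℂ => f p.1 p.2) (s, z0) (v, 0)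
  refine ⟨_, mem_nhdsWithin_of_mem_nhds (ball_mem_nhds z0 hρ), ?_⟩
  filter_upwards [mem_nhdsWithin_of_mem_nhds (ball_mem_nhds (0 : ℝ) hρ),
    self_mem_nhdsWithin] with t ht ht0 l hl
  have h0 := hb (0, l) ⟨mem_ball_self hρ, hl⟩; simp at h0
  rw [(paramDeriv_eq hS hU hf v hs h0.2.2).2]
  have hmv := (convex_ball (0 : ℝ) ρ).norm_image_sub_le_of_norm_hasDerivWithin_le
    (f := fun τ : ℝ => f (s + τ • v) l - τ • D) (C := ε / 3)
    (fun τ hτ => ((hasDerivAt_param hS hU hf v (hb (τ, l) ⟨hτ, hl⟩).2.1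
      h0.2.2).sub ((hasDerivAt_id τ).smul_const D)).hasDerivWithinAt)
    (fun τ hτ => by simp_all [LT.lt.le, dist_eq_norm]) (mem_ball_self hρ) ht
  have ht' : 0 < ‖t‖ := norm_pos_iff.2 ht0; have e : t⁻¹ • (f (s + t • v) l - f s l) - D =
      t⁻¹ • (f (s + t • v) l - t • D - (f (s + (0 : ℝ) • v) l - (0 : ℝ) • D)) := by
    grind [zero_smul, smul_sub, smul_smul, inv_mul_cancel₀, one_smul]
  have h3 : ‖t⁻¹ • (f (s + t • v) l - f s l) - D‖ ≤ ε / 3 := by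
    grind [norm_smul, norm_inv, inv_mul_le_iff₀]
  have h4 := h0.1; rw [dist_eq_norm] at h4 ⊢; have h5 := norm_sub_le_norm_sub_add_norm_sub
    (fderiv ℝ (fun p : E × ℂ => f p.1 p.2) (s, l) (v, 0)) D (t⁻¹ • (f (s + t • v) l - f s l))
  rw [norm_sub_rev D] at h5; linarith

variable [CompleteSpace V]

/-- The derivative in a parameter of a holomorphic function is holomorphic, and commutes with the
complex derivative. -/
lemma differentiableOn_paramDeriv (hS : IsOpen S) (hU : IsOpen U)
    (hf : ContDiffOn ℝ 1 (fun p : E × ℂ => f p.1 p.2) (S ×ˢ U))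
    (hfan : ∀ q ∈ S, DifferentiableOn ℂ (f q) U) (hs : s ∈ S) (v : E) :
    DifferentiableOn ℂ (paramDeriv f s v) U ∧ ∀ l ∈ U,
      HasLineDerivAt ℝ (fun q => deriv (f q) l) (deriv (paramDeriv f s v) l) s v := by
  have h := tendstoLocallyUniformlyOn_quotient hS hU hf hs v; have hd : ∀ᶠ t : ℝ in 𝓝[≠] 0,
      DifferentiableOn ℂ (fun l => t⁻¹ • (f (s + t • v) l - f s l)) U := by
    filter_upwards [nhdsWithin_le_nhds (eventually_add_smul_mem hS hs v)] with t ht; fun_prop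
  refine ⟨h.differentiableOn hd hU, fun l hl => ?_⟩
  rw [HasLineDerivAt, hasDerivAt_iff_tendsto_slope_zero]
  refine ((h.deriv hd hU).tendsto_at hl).congr' ?_
  filter_upwards [nhdsWithin_le_nhds (eventually_add_smul_mem hS hs v)] with t ht
  have hUl := hU.mem_nhds hl; have h2 := ((((hfan _ ht).differentiableAt hUl).hasDerivAt.sub
    ((hfan s hs).differentiableAt hUl).hasDerivAt).const_smul t⁻¹).deriv
  aesop

end Holomorphic

variable {r : ℕ}

lemma HasDerivAt.dotProduct {u w : ℝ → Fin r → ℂ} {u' w' : Fin r → ℂ} {t : ℝ}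
    (hu : HasDerivAt u u' t) (hw : HasDerivAt w w' t) :
    HasDerivAt (fun t => u t ⬝ᵥ w t) (u' ⬝ᵥ w t + u t ⬝ᵥ w') t := by
  have h := HasDerivAt.fun_sum (u := Finset.univ) fun k _ =>
    (hasDerivAt_pi.1 hu k).mul (hasDerivAt_pi.1 hw k)
  rw [sum_add_distrib] at h; exact h

lemma hasDerivAt_stack {u w : ℂ → Fin r → ℂ} {z : ℂ} (hu : DifferentiableAt ℂ u z)
    (hw : DifferentiableAt ℂ w z) :
    HasDerivAt (stack u w) (Fin.append (deriv u z) (deriv w z)) z := by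
  refine hasDerivAt_pi.2 fun i => ?_; refine Fin.addCases (fun i => ?_) (fun i => ?_) i
  · simpa only [stack, Fin.append_left, Fin.append_right] using hasDerivAt_pi.1 hu.hasDerivAt i
  · simpa only [stack, Fin.append_left, Fin.append_right] using hasDerivAt_pi.1 hw.hasDerivAt i

lemma norm_stack_le {u w : ℂ → Fin r → ℂ} {z : ℂ} {c : ℝ} (hu : ‖u z‖ ≤ c) (hw : ‖w z‖ ≤ c) :
    ‖stack u w z‖ ≤ c := by
  refine (pi_norm_le_iff_of_nonneg ((norm_nonneg _).trans hu)).2 fun i => ?_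
  refine Fin.addCases (fun i => ?_) (fun i => ?_) i
  · simpa only [stack, Fin.append_left, Fin.append_right] using (norm_le_pi_norm (u z) i).trans hu
  · simpa only [stack, Fin.append_left, Fin.append_right] using (norm_le_pi_norm (w z) i).trans hw

lemma integrableKernel_stack_self {f g d e : ℂ → Fin r → ℂ} {l : ℂ} (hd : DifferentiableAt ℂ d l)
    (hf : DifferentiableAt ℂ f l) : integrableKernel (stack d f) (stack g e) l l =
      deriv d l ⬝ᵥ g l + deriv f l ⬝ᵥ e l := by
  rw [integrableKernel_self, (hasDerivAt_stack hd hf).deriv]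
  simp only [stack, dotProduct, Fin.sum_univ_add, Fin.append_left, Fin.append_right]

/-- Smooth families of vectors which define an integrable kernel. -/
structure IsFamily (C : Contour) (S : Set E) (U : Set ℂ) (f g : E → ℂ → Fin r → ℂ) : Prop where
  isOpen_left : IsOpen S
  isOpen_right : IsOpen U
  carrier_subset : C.carrier ⊆ U
  smooth_left : ContDiffOn ℝ 1 (fun p : E × ℂ => f p.1 p.2) (S ×ˢ U)
  smooth_right : ContDiffOn ℝ 1 (fun p : E × ℂ => g p.1 p.2) (S ×ˢ U)
  diff_left : ∀ s ∈ S, DifferentiableOn ℂ (f s) U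
  diff_right : ∀ s ∈ S, DifferentiableOn ℂ (g s) U
  orth : ∀ s ∈ S, ∀ l ∈ C.carrier, f s l ⬝ᵥ g s l = 0

/-- The kernel obtained by differentiation in a parameter. -/
def derivKernel (f g : E → ℂ → Fin r → ℂ) (s v : E) : ℂ → ℂ → ℂ :=
  integrableKernel (stack (paramDeriv f s v) (f s)) (stack (g s) (paramDeriv g s v))

namespace IsFamily
variable {C : Contour} {f g : E → ℂ → Fin r → ℂ} {s : E}

/-- By the product rule ∂(fᵀg) is the product of the stacked vectors; on the diagonal the parameter
derivative also has to be exchanged with the spectral one. -/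
lemma hasLineDerivAt_kernel (h : IsFamily C S U f g) (hs : s ∈ S) (v : E) {l m : ℂ} (hl : l ∈ U)
    (hm : m ∈ U) : HasLineDerivAt ℝ (fun q => integrableKernel (f q) (g q) l m)
      (derivKernel f g s v l m) s v := by
  have hg := fun {z : ℂ} (hz : z ∈ U) =>
    (paramDeriv_eq h.isOpen_left h.isOpen_right h.smooth_right v hs hz).1
  have hf := (paramDeriv_eq h.isOpen_left h.isOpen_right h.smooth_left v hs hl).1
  obtain ⟨hd, hf'⟩ :=
    differentiableOn_paramDeriv h.isOpen_left h.isOpen_right h.smooth_left h.diff_left hs v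
  by_cases hlm : l = m
  · subst hlm; have hUl := h.isOpen_right.mem_nhds hl
    have h1 := HasDerivAt.dotProduct (hf' l hl) (hg hl)
    rw [derivKernel, integrableKernel_stack_self (hd.differentiableAt hUl)
      ((h.diff_left s hs).differentiableAt hUl)]
    simpa only [integrableKernel_self, HasLineDerivAt, zero_smul, add_zero] using h1
  · have h1 := (HasDerivAt.dotProduct hf (hg hm)).div_const (l - m)
    rw [derivKernel, integrableKernel_of_ne hlm, stack_dotProduct]
    simpa only [integrableKernel_of_ne hlm, HasLineDerivAt, zero_smul, add_zero] using h1

lemma orth_paramDeriv (h : IsFamily C S U f g) (hs : s ∈ S) (v : E) {l : ℂ}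
    (hl : l ∈ C.carrier) : paramDeriv f s v l ⬝ᵥ g s l + f s l ⬝ᵥ paramDeriv g s v l = 0 := by
  have hlU := h.carrier_subset hl; have h1 := HasDerivAt.dotProduct
    (paramDeriv_eq h.isOpen_left h.isOpen_right h.smooth_left v hs hlU).1
    (paramDeriv_eq h.isOpen_left h.isOpen_right h.smooth_right v hs hlU).1
  simp at h1; refine h1.unique ((hasDerivAt_const (0 : ℝ) (0 : ℂ)).congr_of_eventuallyEq ?_)
  filter_upwards [eventually_add_smul_mem h.isOpen_left hs v] with t ht using h.orth _ ht l hl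

end IsFamily

/-- A holomorphic function that vanishes on the contour vanishes near it. -/
lemma Contour.eventually_eq_zero (C : Contour) (hU : IsOpen U) (hC : C.carrier ⊆ U) {φ : ℂ → ℂ}
    (hφ : DifferentiableOn ℂ φ U) (h0 : ∀ l ∈ C.carrier, φ l = 0) {p : ℂ} (hp : p ∈ C.carrier) :
    ∀ᶠ z in 𝓝 p, φ z = 0 := by
  obtain ⟨j, t, ht, rfl⟩ := Set.mem_iUnion.1 hp
  refine (hφ.analyticAt (hU.mem_nhds (hC hp))).eventually_eq_zero_or_eventually_ne_zero.resolve_right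
    fun hne => ?_
  -- If the zero were isolated, the curve, on which the function vanishes, would be constant near t.
  have hγ : ∀ᶠ u in 𝓝[C.dom j] t, C.γ j u = C.γ j t := by
    have h1 := (C.continuousOn j t ht).eventually (eventually_nhdsWithin_iff.1 hne)
    filter_upwards [h1, self_mem_nhdsWithin] with u hu hud; by_contra hcon
    exact hu hcon (h0 _ (Set.mem_iUnion.2 ⟨j, u, hud, rfl⟩))
  obtain ⟨ε, hε, hb⟩ := Metric.eventually_nhds_iff.1 (eventually_nhdsWithin_iff.1 hγ)
  obtain ⟨u, ⟨hu, hud⟩, hut⟩ := (accPt_iff_nhds.1 ((C.dom_ordConnected j).isPreconnected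
    |>.preperfect_of_nontrivial (C.dom_nontrivial j) t ht)) _ (ball_mem_nhds t hε)
  rw [mem_ball, Real.dist_eq] at hu
  -- The midpoint avoids the one permitted coincidence: u and t may be the two ends of the interval,
  -- the midpoint and t cannot.
  have hm : (u + t) / 2 ∈ Set.uIcc u t := by grind [Set.uIcc_of_le, Set.uIcc_of_ge]
  have hmd := (C.dom_ordConnected j).uIcc_subset hud ht hm
  have hγm : C.γ j ((u + t) / 2) = C.γ j t := hb (y := (u + t) / 2) (by grind [Real.dist_eq]) hmd
  rcases lt_or_gt_of_ne hut with h | h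
  · have := C.simple j _ hmd t ht (by linarith) hγm
    grind
  · have := C.simple j t ht _ hmd (by linarith) hγm.symm
    grind

/-! ### From dominated families to integrable data -/

variable {E : Type*} [NormedAddCommGroup E] [NormedSpace ℝ E] {S : Set E} {U : Set ℂ} {C : Contour}
  {r : ℕ} {f g : E → ℂ → Fin r → ℂ} {s : E} {X0 : Set C.Param} {w : C.Param → ℝ}
  {a : ℂ → ℝ}

/-- A measurable majorant `w` of a square integrable function `a`, on a set `X0` of regular
parameters of full measure. -/
structure IsArcWeight (C : Contour) (a : ℂ → ℝ) (X0 : Set C.Param) (w : C.Param → ℝ) : Prop where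
  measurableSet : MeasurableSet X0
  regular : X0 ⊆ C.regularParams
  ae_mem : ∀ᵐ x ∂Cᵐ, x ∈ X0
  measurable : Measurable w
  nonneg : ∀ x, 0 ≤ w x
  integrable : Integrable (fun x => w x * (w x * ‖C.vel x‖)) Cᵐ
  le : ∀ x ∈ X0, a (C.pt x) ≤ w x

/-- The given majorant is only almost everywhere measurable, and only for arc length. At regular
parameters the velocity is non-zero, so it agrees with a measurable representative almost everywhere
for dt; one measurable set of full measure is kept where all this holds. -/
lemma Contour.exists_isArcWeight (ha : MemLp (fun x => a (C.pt x)) 2 C.arcMeasure) :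
    ∃ X0 w, IsArcWeight C a X0 w := by
  have hvm : Measurable fun x => ‖C.vel x‖ₑ := C.measurable_vel.enorm; set A := ha.1.mk
  have hAm : Measurable A := by fun_prop
  have h1 : ∀ᵐ x ∂Cᵐ, x ∈ C.regularParams ∧ a (C.pt x) = A x := by
    filter_upwards [C.ae_regular, (ae_withDensity_iff hvm).1 ha.1.ae_eq_mk] with x hx hxA
    grind [enorm_ne_zero, Contour.vel_ne_zero]
  obtain ⟨X0, hX, hXm, hsub⟩ := h1.exists_measurable_mem
  have h2 : Integrable (fun x => A x ^ 2) (Cᵐ.withDensity fun x => ‖C.vel x‖ₑ) :=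
    ((memLp_congr_ae ha.1.ae_eq_mk).1 ha).integrable_sq
  rw [integrable_withDensity_iff hvm (ae_of_all _ fun x => enorm_lt_top)] at h2
  refine ⟨X0, fun x => |A x|, hXm, fun x hx => (hsub x hx).1, hX, hAm.norm, fun x => abs_nonneg _,
    h2.congr (ae_of_all _ fun x => ?_), fun x hx => (hsub x hx).2.trans_le (le_abs_self _)⟩
  simp; grind

/-- The Fredholm determinant in terms of the kernel in the parameters. -/
lemma fredholmDet_eq (hX : ∀ᵐ x ∂Cᵐ, x ∈ X0) (f g : ℂ → Fin r → ℂ) :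
    fredholmDet C (integrableKernel f g) = Fredholm.det Cᵐ (paramKernel C f g X0) := by
  refine tsum_congr fun k => ?_; congr 1; refine integral_congr_ae ?_
  filter_upwards [eventually_all.2 fun i => (quasiMeasurePreserving_eval _ i).ae hX] with x hx
  rw [mul_comm, ← det_mul_row]; congr 1; ext i j
  simp [paramKernel, indicator_of_mem (hx i), indicator_of_mem (hx j)]; ring

namespace IsFamily

/-- Orthogonality and its parameter derivative are known on the contour only. By the identity
principle both hold on a neighbourhood of it, to which U is shrunk; this is needed for the kernels
to be holomorphic in each variable. -/
lemma exists_integrableData (h : IsFamily C S U f g) (hs : s ∈ S) (v : E)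
    (hw : IsArcWeight C a X0 w) (hb : ∀ l ∈ C.carrier, ‖f s l‖ ≤ a l ∧ ‖g s l‖ ≤ a l ∧
      ‖paramDeriv f s v l‖ ≤ a l ∧ ‖paramDeriv g s v l‖ ≤ a l) :
    ∃ U', U' ⊆ U ∧ IntegrableData C U' (f s) (g s) X0 w ∧
      IntegrableData C U' (stack (paramDeriv f s v) (f s)) (stack (g s) (paramDeriv g s v)) X0 w := by
  have hU := h.isOpen_right; have hC := h.carrier_subset; have hf := h.diff_left s hs
  have hg := h.diff_right s hs
  have hd := (differentiableOn_paramDeriv h.isOpen_left hU h.smooth_left h.diff_left hs v).1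
  have he := (differentiableOn_paramDeriv h.isOpen_left hU h.smooth_right h.diff_right hs v).1
  set U' := interior {z | z ∈ U ∧ f s z ⬝ᵥ g s z = 0 ∧
    paramDeriv f s v z ⬝ᵥ g s z + f s z ⬝ᵥ paramDeriv g s v z = 0}
  have hsub : U' ⊆ U := fun z hz => (interior_subset hz).1
  have hCU : C.carrier ⊆ U' := fun l hl => mem_interior_iff_mem_nhds.2 <| by
    filter_upwards [hU.mem_nhds (hC hl), C.eventually_eq_zero hU hC (hf.dotProduct hg) (h.orth s hs) hl,
      C.eventually_eq_zero hU hC ((hd.dotProduct hg).fun_add (hf.dotProduct he))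
        (fun l hl => h.orth_paramDeriv hs v hl) hl] with z h1 h2 h3 using ⟨h1, h2, h3⟩
  have hpt : ∀ x ∈ X0, C.pt x ∈ C.carrier := fun x hx =>
    C.pt_mem_carrier (C.regularParams_subset (hw.regular hx))
  have hst : ∀ {u v : ℂ → Fin r → ℂ}, DifferentiableOn ℂ u U → DifferentiableOn ℂ v U →
      DifferentiableOn ℂ (stack u v) U' := fun hu hv z hz =>
    (hasDerivAt_stack (hu.differentiableAt (hU.mem_nhds (hsub hz)))
      (hv.differentiableAt (hU.mem_nhds (hsub hz)))).differentiableAt.differentiableWithinAt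
  refine ⟨U', hsub, ⟨isOpen_interior, hCU, hf.mono hsub, hg.mono hsub,
    fun z hz => (interior_subset hz).2.1, hw.measurableSet, hw.regular, hw.ae_mem, hw.measurable,
    hw.nonneg, hw.integrable, fun x hx => (hb _ (hpt x hx)).1.trans (hw.le x hx),
    fun x hx => (hb _ (hpt x hx)).2.1.trans (hw.le x hx)⟩, ⟨isOpen_interior, hCU, hst hd hf,
    hst hg he, fun z hz => (stack_dotProduct _ _ _ _ z z).trans (interior_subset hz).2.2,
    hw.measurableSet, hw.regular, hw.ae_mem, hw.measurable, hw.nonneg, hw.integrable,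
    fun x hx => (norm_stack_le (hb _ (hpt x hx)).2.2.1 (hb _ (hpt x hx)).1).trans (hw.le x hx),
    fun x hx => (norm_stack_le (hb _ (hpt x hx)).2.1 (hb _ (hpt x hx)).2.2.2).trans (hw.le x hx)⟩⟩

lemma hasDerivAt_paramKernel (h : IsFamily C S U f g) (v : E) (hX : X0 ⊆ C.regularParams) {t : ℝ}
    (ht : s + t • v ∈ S) (x y : C.Param) :
    HasDerivAt (fun t : ℝ => paramKernel C (f (s + t • v)) (g (s + t • v)) X0 x y)
      (paramKernel C (stack (paramDeriv f (s + t • v) v) (f (s + t • v)))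
        (stack (g (s + t • v)) (paramDeriv g (s + t • v) v)) X0 x y) t := by
  unfold paramKernel; by_cases hx : x ∈ X0
  · by_cases hy : y ∈ X0
    · simp [indicator_of_mem hx, indicator_of_mem hy]
      have hpt : ∀ x ∈ X0, C.pt x ∈ U := fun x hx =>
        h.carrier_subset (C.pt_mem_carrier (C.regularParams_subset (hX hx)))
      have h1 := h.hasLineDerivAt_kernel ht v (hpt x hx) (hpt y hy); rw [HasLineDerivAt] at h1
      have h2 : HasDerivAt (fun τ : ℝ => integrableKernel (f (s + τ • v)) (g (s + τ • v)) (C.pt x)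
          (C.pt y)) (derivKernel f g (s + t • v) v (C.pt x) (C.pt y)) t := by
        have h3 := HasDerivAt.comp_sub_const (f := fun τ : ℝ => integrableKernel
          (f (s + t • v + τ • v)) (g (s + t • v + τ • v)) (C.pt x) (C.pt y)) t t
          (by simpa only [sub_self] using h1)
        simpa only [add_assoc, ← add_smul, add_sub_cancel] using h3
      exact h2.mul_const _
    simp_all [hasDerivAt_const]
  simp_all [hasDerivAt_const]

/-- The derivative of the jump matrix in a parameter. -/
lemma matrixParamDeriv_integrableJump (h : IsFamily C S U f g) (hs : s ∈ S) (v : E) {l : ℂ}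
    (hl : l ∈ U) : matrixParamDeriv (fun q => integrableJump (f q) (g q)) s v l =
      (-(2 * π * I)) • (vecMulVec (paramDeriv f s v l) (g s l) +
        vecMulVec (f s l) (paramDeriv g s v l)) := by
  ext i k; have hf := hasDerivAt_pi.1
    (paramDeriv_eq h.isOpen_left h.isOpen_right h.smooth_left v hs hl).1 i
  have hg := hasDerivAt_pi.1 (paramDeriv_eq h.isOpen_left h.isOpen_right h.smooth_right v hs hl).1 k
  have h1 := ((hf.mul hg).const_mul (2 * π * I)).const_sub ((1 : Matrix (Fin r) (Fin r) ℂ) i k)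
  have h2 : HasLineDerivAt ℝ (fun q => integrableJump (f q) (g q) l i k) _ s v := h1
  rw [matrixParamDeriv, of_apply, h2.lineDeriv]; simp [vecMulVec_apply]

end IsFamily

end

/-! ### Proof of the theorem -/

theorem theorem2p1 {E : Type*} [NormedAddCommGroup E] [NormedSpace ℝ E]
    (C : Contour) (r : ℕ)
    -- parameter space, a neighbourhood of the contour, and the two vectors
    (S : Set E) (hS : IsOpen S) (U : Set ℂ) (hU : IsOpen U) (hCU : C.carrier ⊆ U)
    (f g : E → ℂ → Fin r → ℂ)
    (hf : ContDiffOn ℝ 1 (fun p : E × ℂ => f p.1 p.2) (S ×ˢ U))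
    (hg : ContDiffOn ℝ 1 (fun p : E × ℂ => g p.1 p.2) (S ×ˢ U))
    (hfan : ∀ s ∈ S, DifferentiableOn ℂ (f s) U)
    (hgan : ∀ s ∈ S, DifferentiableOn ℂ (g s) U)
    (hfg : ∀ s ∈ S, ∀ l ∈ C.carrier, f s l ⬝ᵥ g s l = 0)
    -- a vector field on the parameter space, a point, and the solution of the problem there
    (X : E → E) (s : E) (hs : s ∈ S)
    (hdom : IsDominatedNear C f g s (X s))
    (Γ : ℂ → Matrix (Fin r) (Fin r) ℂ)
    (hΓ : IsRHSolution C (integrableJump (f s) (g s)) Γ)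
    -- the integrals in the formula converge
    (hω : C.IntegrableOn
      (malgrangeIntegrand C (fun s' => integrableJump (f s') (g s')) Γ s (X s)))
    (hH : C.IntegrableOn (fun x => correctionIntegrand₂ f g s (X s) (C.pt x))) :
    fredholmDet C (integrableKernel (f s) (g s)) ≠ 0 ∧
    LineDifferentiableAt ℝ (fun s' => fredholmDet C (integrableKernel (f s') (g s'))) s (X s) ∧
    malgrangeForm C (fun s' => integrableJump (f s') (g s')) Γ s (X s) =
      lineDeriv ℝ (fun s' => fredholmDet C (integrableKernel (f s') (g s'))) s (X s) /
          fredholmDet C (integrableKernel (f s) (g s)) -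
        correction C f g s (X s) := by
  have hfam : IsFamily C S U f g := ⟨hS, hU, hCU, hf, hg, hfan, hgan, hfg⟩; set v := X s
  obtain ⟨a, ha, hbd⟩ := hdom; obtain ⟨X0, w, hw⟩ := C.exists_isArcWeight ha
  have hpt : ∀ x ∈ X0, C.pt x ∈ C.carrier := fun x hx =>
    C.pt_mem_carrier (C.regularParams_subset (hw.regular hx))
  have hmul : ∀ x ∈ X0, ∀ y ∈ X0, a (C.pt x) * a (C.pt y) ≤ w x * w y := fun x hx y hy => by
    have h0 := fun z hz => (norm_nonneg _).trans (hbd.self_of_nhds z hz).1.1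
    exact mul_le_mul (hw.le x hx) (hw.le y hy) (h0 _ (hpt y hy)) (hw.nonneg x)
  have hev := (eventually_add_smul_mem hS hs v).and
    (((continuous_const.add (continuous_id.smul continuous_const)).tendsto' (0 : ℝ) s
      (by simp : s + (0 : ℝ) • v = s)).eventually hbd)
  obtain ⟨δ, hδ, hball⟩ := Metric.eventually_nhds_iff_ball.1 hev
  have hdata : ∀ q ∈ S, (∀ l ∈ C.carrier, _) → _ := fun q hq hb =>
    hfam.exists_integrableData hq v hw (a := a) hb
  have hK : ∀ t ∈ Metric.ball (0 : ℝ) δ, ∀ x ∈ X0, ∀ y ∈ X0,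
      ‖integrableKernel (f (s + t • v)) (g (s + t • v)) (C.pt x) (C.pt y)‖ ≤ w x * w y :=
    fun t ht x hx y hy => (((hball t ht).2 _ (hpt x hx)).2 _ (hpt y hy)).1.trans (hmul x hx y hy)
  have hL : ∀ t ∈ Metric.ball (0 : ℝ) δ, ∀ x ∈ X0, ∀ y ∈ X0,
      ‖derivKernel f g (s + t • v) v (C.pt x) (C.pt y)‖ ≤ w x * w y := fun t ht x hx y hy => by
    have h1 := (((hball t ht).2 _ (hpt x hx)).2 _ (hpt y hy)).2
    have h2 := (hfam.hasLineDerivAt_kernel (hball t ht).1 v (hCU (hpt x hx))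
      (hCU (hpt y hy))).lineDeriv
    exact (h2 ▸ h1).trans (hmul x hx y hy)
  have h0 : (0 : ℝ) ∈ Metric.ball (0 : ℝ) δ := Metric.mem_ball_self hδ
  have hs0 : s + (0 : ℝ) • v = s := by simp
  obtain ⟨U', hU', D, D2⟩ := hdata s hs fun l hl => (hbd.self_of_nhds l hl).1; have hK0 := hK 0 h0
  have hL0 := hL 0 h0; rw [hs0] at hK0 hL0; have hdomK := D.isDominated hK0
  have hdet := Fredholm.det_ne_zero D.isWeight hdomK (D.isInjective hΓ.weak)
  obtain ⟨F, G, B, hp⟩ := D.exists_isDressedPair hΓ.weak hK0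
  -- Jacobi's formula along the segment s + t·v, whose kernels and their derivatives share the
  -- weights for all small t.
  have hder := Fredholm.hasDerivAt_fredholm_det hδ D.isWeight
    (Kp := fun t => paramKernel C (f (s + t • v)) (g (s + t • v)) X0)
    (Lp := fun t => paramKernel C (stack (paramDeriv f (s + t • v) v) (f (s + t • v)))
      (stack (g (s + t • v)) (paramDeriv g (s + t • v) v)) X0)
    (fun t ht => by
      obtain ⟨_, -, Dt, -⟩ := hdata _ (hball t ht).1 fun l hl => ((hball t ht).2 l hl).1
      exact Dt.isDominated (hK t ht))
    (fun t ht => by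
      obtain ⟨_, -, -, Dt⟩ := hdata _ (hball t ht).1 fun l hl => ((hball t ht).2 l hl).1
      exact Dt.isDominated (hL t ht))
    (fun t ht x y => hfam.hasDerivAt_paramKernel v hw.regular (hball t ht).1 x y)
    (by simpa only [hs0] using hdet)
  simp only [hs0] at hder; set d := paramDeriv f s v; set e := paramDeriv g s v
  -- The diagonal of the derivative kernel is ∂f'ᵀg + f'ᵀ∂g, minus the integrand of the first part
  -- of H(M).
  have hdiag : ∫ x, paramKernel C (stack d (f s)) (stack (g s) e) X0 x x ∂Cᵐ =
      -C.integral fun x => correctionIntegrand₁ f g s v (C.pt x) := by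
    rw [Contour.integral, ← integral_neg]; refine integral_congr_ae ?_
    filter_upwards [hw.ae_mem] with x hx; have hxU := hCU (hpt x hx)
    obtain ⟨hd, hd'⟩ := differentiableOn_paramDeriv hS hU hf hfan hs v; have hUx := hU.mem_nhds hxU
    simp only [paramKernel, Set.indicator_of_mem hx]
    rw [integrableKernel_stack_self (hd.differentiableAt hUx) ((hfan s hs).differentiableAt hUx),
      correctionIntegrand₁, (hd' _ hxU).lineDeriv]
    simp only [e, paramDeriv]; ring
  have hpair : ∀ x ∈ X0, ∫ y, paramKernel C (stack d (f s)) (stack (g s) e) X0 x y *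
      Fredholm.resolvent Cᵐ (paramKernel C (f s) (g s) X0) y x ∂Cᵐ =
      IsDressedPair.pairing C (stack d (f s)) (stack (g s) e) F G (C.pt x) * C.vel x := by
    intro x hx; rw [IsDressedPair.pairing, ← integral_mul_const]; refine integral_congr_ae ?_
    filter_upwards [hw.ae_mem] with y hy; rw [hp.resolvent_eq hK0 hy hx]
    simp only [paramKernel, Set.indicator_of_mem hx, Set.indicator_of_mem hy]; ring
  have hpair' := hw.ae_mem.mono hpair
  have hIint : C.IntegrableOn fun x =>
      IsDressedPair.pairing C (stack d (f s)) (stack (g s) e) F G (C.pt x) :=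
    (Fredholm.integrable_mul_resolvent D.isWeight (D2.isDominated hL0)
      hdomK).integral_prod_left.congr hpair'
  have hωe : ∀ᵐ x ∂Cᵐ,
      malgrangeIntegrand C (fun s' => integrableJump (f s') (g s')) Γ s v x * C.vel x =
        malgrangeTrace C (f s) (g s) d e Γ x * C.vel x := by
    filter_upwards [hw.ae_mem] with x hx; rw [malgrangeIntegrand, malgrangeTrace,
      hfam.matrixParamDeriv_integrableJump hs v (hCU (hpt x hx))]
  -- The double integral in Jacobi's formula equals the second part of H(M) minus the Malgrange
  -- form.
  have key := hp.integral_pairing_eq hK0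
    ((differentiableOn_paramDeriv hS hU hf hfan hs v).1.mono hU')
    ((differentiableOn_paramDeriv hS hU hg hgan hs v).1.mono hU')
    (fun x hx => (hbd.self_of_nhds _ (hpt x hx)).1.2.2.2.trans (hw.le x hx)) D2
    (Integrable.congr hω hωe) hH hIint
  rw [integral_congr_ae hpair', hdiag] at hder
  have hline := HasLineDerivAt.lineDifferentiableAt (𝕜 := ℝ) (f := fun q =>
    Fredholm.det Cᵐ (paramKernel C (f q) (g q) X0)) hder
  simp only [fun q => fredholmDet_eq hw.ae_mem (f q) (g q)]; refine ⟨hdet, hline, ?_⟩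
  have hform : malgrangeForm C (fun s' => integrableJump (f s') (g s')) Γ s v =
      C.integral (malgrangeTrace C (f s) (g s) d e Γ) := integral_congr_ae hωe
  have hcorr : correction C f g s v = C.integral (fun x => correctionIntegrand₁ f g s v (C.pt x)) -
      C.integral (fun x => correctionTerm (f s) (g s) e (C.pt x)) := rfl
  rw [HasLineDerivAt.lineDeriv (𝕜 := ℝ) (f := fun q => Fredholm.det Cᵐ
    (paramKernel C (f q) (g q) X0)) hder, hform, hcorr, neg_mul, neg_div, mul_div_cancel_left₀ _ hdet]
  have key' : ∫ x, IsDressedPair.pairing C (stack d (f s)) (stack (g s) e) F G (C.pt x) * C.vel x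
    ∂Cᵐ = _ := key
  rw [key']; ring
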